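/- **Setting.** Let $L\ge 1$. Let $(\Sigma,\nu)$ be a probability space and, for $\sigma\in\Sigma$ and $\lambda\in[0,\lambda_0]$ with $\lambda_0>0$, let $V_\sigma(\lambda)$ be real symmetric and $T_\sigma(\lambda)$ real symmetric positive definite $L\times L$ matrices, measurable in $\sigma$, such that $$V_\sigma(\lambda)=V+\lambda v_\sigma+O(\lambda^2),\qquad T_\sigma(\lambda)=T+\lambda t_\sigma+O(\lambda^2),$$ where $V$ is real symmetric and $T$ is real symmetric positive definite (entries $V(\mathbf 1+\lambda v'_\sigma+O(\lambda^2))$ and $T(\mathbf 1+\lambda t'_\sigma+O(\lambda^2))$ are the case $v_\sigma=Vv'_\sigma$, $t_\sigma=Tt'_\sigma$). Let $K$ bound $\|V\|,\|T\|,\|T^{-1}\|,\|v_\sigma\|,\|t_\sigma\|$ for all $\sigma$, and let the two remainders have operator norm at most $K\lambda^2$ for all $\sigma$ and all $\lambda\in[0,\lambda_0]$. Let $\sigma_1,\sigma_2,\dots$ be i.i.d. with law $\nu$, let $\mathbf E$ be the expectation, and let $H^N(\lambda)$ be the $N\times N$ block Jacobi matrix with diagonal blocks $V_{\sigma_n}(\lambda)$,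 $1\le n\le N$, and with $T_{\sigma_n}(\lambda)$, $2\le n\le N$, as the blocks in the positions $(n-1,n)$ and $(n,n-1)$. The transfer matrix of entries $(V,T)$ at $E\in\mathbb R$ is $$\mathcal T^E=\begin{pmatrix}(E\mathbf 1-V)T^{-1}&-T\\ T^{-1}&\mathbf 0\end{pmatrix},$$ and $\mathcal T^E_n(\lambda)$ is the transfer matrix of $(V_{\sigma_n}(\lambda),T_{\sigma_n}(\lambda))$. Put $$\mathcal N_\lambda(E)=\lim_{N\to\infty}\frac1{NL}\mathbf E\,\#\{\text{eigenvalues of }H^N(\lambda)\le E\},\qquad \gamma_\lambda(E)=\lim_{N\to\infty}\frac1{NL}\mathbf E\log\bigl\|\Lambda^L\bigl(\mathcal T^E_N(\lambda)\cdots\mathcal T^E_1(\lambda)\bigr)\bigr\|,$$ with eigenvalues counted with multiplicity and the operator norm on $\Lambda^L\mathbb C^{2L}$, and let $\mathcal N_{\lambda,\sigma}(E)$, $\gamma_{\lambda,\sigma}(E)$ be the same quantities when $\sigma_n=\sigma$ for all $n$. A *symplectic normal form* of $\mathcal T^E$ consists of a splitting of the $L$ channels into $L_h$ hyperbolic and $L_e$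 elliptic ones and a real symplectic matrix $\mathcal M$ such that, in the corresponding block decomposition, $$\mathcal M\mathcal T^E\mathcal M^{-1}=\begin{pmatrix}Se^{\kappa}&0&0&0\\0&\cos\eta&0&\sin\eta\\0&0&Se^{-\kappa}&0\\0&-\sin\eta&0&\cos\eta\end{pmatrix},$$ with $\kappa=\mathrm{diag}(\kappa_1,\dots,\kappa_{L_h})$, $\kappa_l>0$, $\eta=\mathrm{diag}(\eta_1,\dots,\eta_{L_e})$ real, and $S\in O(L_h)$ commuting with $e^\kappa$. Put $$g_h=\min_{l}(1-e^{-\kappa_l}),\qquad g_e=\min_{l,k}\bigl|1-e^{i(\eta_l+\eta_k)}\bigr|,$$ where a minimum over the empty set is read as $1$. **Theorem.** For every $K$ there are $C,c>0$, depending on $K$ only (in particular not on $L$), such that the following holds in the above setting for every $E\in\mathbb R$ with $|E|\le K$ for which $\mathcal T^E$ is diagonalizable over $\mathbb C$. A symplectic normal form of $\mathcal T^E$ exists. If, for some symplectic normal form with $\|\mathcal M\|\le K$, one has $g_h>0$ and $g_e>0$, then for all $\lambda\in[0,\lambda_0]$ with $\lambda\le c\,g_h^2$ the limits $\mathcal N_\lambda(E)$,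 $\gamma_\lambda(E)$, $\mathcal N_{\lambda,\sigma}(E)$, $\gamma_{\lambda,\sigma}(E)$ exist, the last two are $\nu$-integrable in $\sigma$, and $$\Bigl|\mathcal N_\lambda(E)-\int\mathcal N_{\lambda,\sigma}(E)\,d\nu(\sigma)\Bigr|\le C\Bigl(\frac{\lambda^2}{g_e}+\frac{\lambda^2}{g_h^3}\Bigr),\qquad \Bigl|\gamma_\lambda(E)-\int\gamma_{\lambda,\sigma}(E)\,d\nu(\sigma)\Bigr|\le C\Bigl(\frac{\lambda^2}{g_e}+\frac{\lambda^2}{g_h^3}\Bigr).$$ In particular, for a fixed model and energy, $\mathcal N_\lambda(E)=\mathbf E_\sigma(\mathcal N_{\lambda,\sigma}(E))+O(\lambda^2)$ and $\gamma_\lambda(E)=\mathbf E_\sigma(\gamma_{\lambda,\sigma}(E))+O(\lambda^2)$ as $\lambda\to0$. -/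

import Mathlib

open scoped Matrix.Norms.L2Operator
open Filter Topology MeasureTheory ProbabilityTheory

namespace BlockJacobi

noncomputable section

/-- The block Jacobi matrix `H^N`: site `i : Fin N` carries the diagonal block `V i`, and the
blocks coupling site `i` with site `i + 1` (above and below the diagonal) are `T (i + 1)`.
Sites are numbered from `0`, so `T 0` does not enter. -/
def hamiltonian {L : ℕ} (V T : ℕ → Matrix (Fin L) (Fin L) ℝ) (N : ℕ) :
    Matrix (Fin N × Fin L) (Fin N × Fin L) ℝ :=
  fun x y =>
    if x.1 = y.1 then V x.1 x.2 y.2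
    else if (x.1 : ℕ) + 1 = y.1 then T y.1 x.2 y.2
    else if (y.1 : ℕ) + 1 = x.1 then T x.1 x.2 y.2
    else 0

/-- The number of real eigenvalues `≤ E` of a matrix, counted with (algebraic) multiplicity. -/
def eigCount {n : Type*} [Fintype n] [DecidableEq n] (H : Matrix n n ℝ) (E : ℝ) : ℕ :=
  H.charpoly.roots.countP (fun x => x ≤ E)

/-- The transfer matrix at energy `E` of a site with entries `V`, `T`. -/
def transfer {L : ℕ} (V T : Matrix (Fin L) (Fin L) ℝ) (E : ℝ) :
    Matrix (Fin L ⊕ Fin L) (Fin L ⊕ Fin L) ℝ :=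
  Matrix.fromBlocks ((E • (1 : Matrix (Fin L) (Fin L) ℝ) - V) * T⁻¹) (-T) T⁻¹ 0

/-- The ordered product of the first `N` transfer matrices, later sites to the left. -/
def transferProd {L : ℕ} (V T : ℕ → Matrix (Fin L) (Fin L) ℝ) (E : ℝ) :
    ℕ → Matrix (Fin L ⊕ Fin L) (Fin L ⊕ Fin L) ℝ
  | 0 => 1
  | n + 1 => transfer (V n) (T n) E * transferProd V T E n

/-- The matrix of `Λ^L A` acting on `Λ^L ℂ^{2L}`, in the basis of the vectors
`e_{i_1} ∧ … ∧ e_{i_L}` with `i_1 < … < i_L`, which is orthonormal in the Fock space. -/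
def extPower {L : ℕ} (A : Matrix (Fin L ⊕ Fin L) (Fin L ⊕ Fin L) ℝ) :
    Matrix (Set.powersetCard (Fin (L + L)) L) (Set.powersetCard (Fin (L + L)) L) ℂ :=
  LinearMap.toMatrix
    ((Pi.basisFun ℂ (Fin (L + L))).exteriorPower L) ((Pi.basisFun ℂ (Fin (L + L))).exteriorPower L)
    (exteriorPower.map L
      (Matrix.toLin' ((Matrix.reindex finSumFinEquiv finSumFinEquiv A).map Complex.ofReal)))

section Ergodic

variable {L : ℕ} {Ω : Type*} [MeasurableSpace Ω]

/-- `𝒩` is the integrated density of states at `E` of the random block Jacobi matrices with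
entries `V n ω`, `T n ω`: the limit of the expected number of eigenvalues `≤ E` of `H^N` divided
by `N L`. -/
def HasIDS (P : Measure Ω) (V T : ℕ → Ω → Matrix (Fin L) (Fin L) ℝ) (E 𝒩 : ℝ) : Prop :=
  Tendsto (fun N : ℕ =>
      (∫ ω, (eigCount (hamiltonian (fun n => V n ω) (fun n => T n ω) N) E : ℝ) ∂P)
        / ((N : ℝ) * (L : ℝ)))
    atTop (𝓝 𝒩)

/-- `γ` is the averaged sum of the positive Lyapunov exponents at `E`: the limit of
`(N L)⁻¹ 𝔼 log ‖Λ^L (𝒯_N ⋯ 𝒯_1)‖`. -/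
def HasLyapunov (P : Measure Ω) (V T : ℕ → Ω → Matrix (Fin L) (Fin L) ℝ) (E γ : ℝ) : Prop :=
  Tendsto (fun N : ℕ =>
      (∫ ω, Real.log ‖extPower (transferProd (fun n => V n ω) (fun n => T n ω) E N)‖ ∂P)
        / ((N : ℝ) * (L : ℝ)))
    atTop (𝓝 γ)

end Ergodic

/-- A bounded ensemble, indexed by `σ ∈ S` and by a coupling constant `lam ∈ [0, lam0]`, of
single-site entries `V lam σ = V₀ + lam • v σ + O(lam²)` and `T lam σ = T₀ + lam • t σ + O(lam²)`
(the multiplicative form `V₀ (1 + lam v' + O(lam²))` is the case `v = V₀ v'`). The number `K`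
bounds all the data, including the remainders, in operator norm. -/
structure Ensemble (L : ℕ) (S : Type*) [MeasurableSpace S] (K : ℝ) where
  /-- unperturbed diagonal block -/
  V₀ : Matrix (Fin L) (Fin L) ℝ
  /-- unperturbed off-diagonal block -/
  T₀ : Matrix (Fin L) (Fin L) ℝ
  /-- first-order coefficient of the diagonal block -/
  v : S → Matrix (Fin L) (Fin L) ℝ
  /-- first-order coefficient of the off-diagonal block -/
  t : S → Matrix (Fin L) (Fin L) ℝ
  /-- end of the interval of coupling constants -/
  lam0 : ℝ
  /-- diagonal block at coupling `lam` -/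
  V : ℝ → S → Matrix (Fin L) (Fin L) ℝ
  /-- off-diagonal block at coupling `lam` -/
  T : ℝ → S → Matrix (Fin L) (Fin L) ℝ
  lam0_pos : 0 < lam0
  V₀_symm : V₀.IsSymm
  T₀_posDef : T₀.PosDef
  V_symm : ∀ lam ∈ Set.Icc 0 lam0, ∀ σ, (V lam σ).IsSymm
  T_posDef : ∀ lam ∈ Set.Icc 0 lam0, ∀ σ, (T lam σ).PosDef
  V_meas : ∀ lam ∈ Set.Icc 0 lam0, ∀ i j, Measurable fun σ => V lam σ i j
  T_meas : ∀ lam ∈ Set.Icc 0 lam0, ∀ i j, Measurable fun σ => T lam σ i j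
  V₀_bound : ‖V₀‖ ≤ K
  T₀_bound : ‖T₀‖ ≤ K
  T₀_inv_bound : ‖T₀⁻¹‖ ≤ K
  v_bound : ∀ σ, ‖v σ‖ ≤ K
  t_bound : ∀ σ, ‖t σ‖ ≤ K
  V_expansion : ∀ lam ∈ Set.Icc 0 lam0, ∀ σ, ‖V lam σ - (V₀ + lam • v σ)‖ ≤ K * lam ^ 2
  T_expansion : ∀ lam ∈ Set.Icc 0 lam0, ∀ σ, ‖T lam σ - (T₀ + lam • t σ)‖ ≤ K * lam ^ 2

/-- Diagonalizability over `ℂ` of a real matrix. -/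
def IsDiagonalizable {n : Type*} [Fintype n] [DecidableEq n] (A : Matrix n n ℝ) : Prop :=
  ∃ (Q : Matrix n n ℂ) (d : n → ℂ), IsUnit Q ∧ A.map Complex.ofReal = Q * Matrix.diagonal d * Q⁻¹

/-- The block matrix
`[[S e^κ, 0, 0, 0], [0, cos η, 0, sin η], [0, 0, S e^{-κ}, 0], [0, -sin η, 0, cos η]]`. -/
def normalMatrix {Lh Le : ℕ} (κ : Fin Lh → ℝ) (η : Fin Le → ℝ) (S : Matrix (Fin Lh) (Fin Lh) ℝ) :
    Matrix ((Fin Lh ⊕ Fin Le) ⊕ (Fin Lh ⊕ Fin Le)) ((Fin Lh ⊕ Fin Le) ⊕ (Fin Lh ⊕ Fin Le)) ℝ :=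
  Matrix.fromBlocks
    (Matrix.fromBlocks (S * Matrix.diagonal fun l => Real.exp (κ l)) 0
      0 (Matrix.diagonal fun l => Real.cos (η l)))
    (Matrix.fromBlocks 0 0 0 (Matrix.diagonal fun l => Real.sin (η l)))
    (Matrix.fromBlocks 0 0 0 (-Matrix.diagonal fun l => Real.sin (η l)))
    (Matrix.fromBlocks (S * Matrix.diagonal fun l => Real.exp (-κ l)) 0
      0 (Matrix.diagonal fun l => Real.cos (η l)))

/-- A real symplectic diagonalization `M 𝒯 M⁻¹ = R` of a `2L × 2L` matrix `𝒯` into `Lh` hyperbolic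
channels with expansion factors `κ_l > 0` and `Le` elliptic channels with rotation phases `η_l`.
The orthogonal matrix `S`, commuting with `e^κ`, carries the signs and phases of the hyperbolic
eigenvalues; `chan` splits the `L` channels into hyperbolic and elliptic ones. -/
structure NormalForm {L : ℕ} (𝒯 : Matrix (Fin L ⊕ Fin L) (Fin L ⊕ Fin L) ℝ) where
  /-- number of hyperbolic channels -/
  Lh : ℕ
  /-- number of elliptic channels -/
  Le : ℕ
  /-- labelling of the channels -/
  chan : Fin Lh ⊕ Fin Le ≃ Fin L
  /-- expansion factors -/
  κ : Fin Lh → ℝ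
  /-- rotation phases -/
  η : Fin Le → ℝ
  /-- orthogonal part of the hyperbolic channels -/
  S : Matrix (Fin Lh) (Fin Lh) ℝ
  /-- symplectic basis change -/
  M : Matrix (Fin L ⊕ Fin L) (Fin L ⊕ Fin L) ℝ
  κ_pos : ∀ l, 0 < κ l
  S_orthogonal : S ∈ Matrix.orthogonalGroup (Fin Lh) ℝ
  S_comm : Commute S (Matrix.diagonal fun l => Real.exp (κ l))
  M_symplectic : M ∈ Matrix.symplecticGroup (Fin L) ℝ
  conj : M * 𝒯 * M⁻¹ =
    Matrix.reindex (Equiv.sumCongr chan chan) (Equiv.sumCongr chan chan) (normalMatrix κ η S)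

variable {L : ℕ} {𝒯 : Matrix (Fin L ⊕ Fin L) (Fin L ⊕ Fin L) ℝ}

/-- `g_h = min_l (1 - e^{-κ_l})`, set to `1` if there are no hyperbolic channels. -/
def NormalForm.gh (F : NormalForm 𝒯) : ℝ :=
  if F.Lh = 0 then 1 else ⨅ l : Fin F.Lh, (1 - Real.exp (-F.κ l))

/-- `g_e = min_{l,k} |1 - e^{i(η_l + η_k)}|`, set to `1` if there are no elliptic channels. -/
def NormalForm.ge (F : NormalForm 𝒯) : ℝ :=
  if F.Le = 0 then 1
  else ⨅ p : Fin F.Le × Fin F.Le, ‖1 - Complex.exp (Complex.I * ((F.η p.1 + F.η p.2 : ℝ) : ℂ))‖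

end

end BlockJacobi

/-! The frame `(1; i)`, transported by `M⁻¹`, is pushed through the transfer matrices. In a chart
that keeps the hyperbolic channels and diagonalises the elliptic rotations, the unperturbed transfer
matrix becomes `diag(Ra, Rd)`, and the frame becomes `(x_k; y_k)` with slope `W_k = y_k x_k⁻¹`. One
site multiplies `x_k` by `Ra (1 + X_k)`, where `X_k = D11 + D12 W_k` and the blocks `D` are the
perturbation of that site, of size `δ = O(lam)`. Hence `det x_N = (det Ra)^N · ∏ det (1 + X_k) · det
x_0`. The modulus of this determinant governs the Lyapunov exponents and its argument counts
eigenvalues, both up to errors that stay bounded in `N`. To first order `log det (1 + X_k)` is `tr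
X_k`, with error `O(L δ²)`.

It remains to average `tr X_k = tr D11 + tr (D12 W_k)`. The slope `W_k` depends only on the sites
before `k`, so it is independent of the `D12` at site `k`, and only sums `∑ tr (B W_k)` with a fixed
`B` matter. They are `O(L ‖B‖ (1 + δ N) (1/g_h + 1/g_e))` (`norm_sum_trace_le`): hyperbolic rows and
columns of `W` contract by `1 - g_h`, while an entry between two elliptic channels is multiplied at
each step by a phase `ζ_i ζ_j`, so that its sum is a telescoping sum divided by `1 - ζ_i ζ_j`. As
`‖B‖ ≤ δ`, the slope contributes only `O(δ² (1/g_h + 1/g_e))` per site and channel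
(`norm_integral_growth_sub_le`).

What is left, a constant plus the mean of `tr D11`, is affine in the law of a site. The same formula
holds for the constant environments, seen as i.i.d. with a Dirac law, and integrating it over `ν`
gives back the first-order term of the random chain. This cancellation is the theorem
(`exists_lyapunov_comparison`, `exists_ids_comparison`).

Uniformity in `L` comes from bounding `W` in operator norm (`norm_ell_le`, `invariant`) and traces
by operator or Frobenius norms; this costs exactly one factor `L`, which the normalisation absorbs.

For the growth, `norm_extPower_le` and `norm_det_x_le` trap `‖Λ^L(𝒯_N ⋯ 𝒯_1)‖` between multiples of
`|det x_N|`. For the count, `det_dissipative_mul_det` expresses the frame through the determinant of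
`E - H^N` with a dissipative boundary term, whose argument counts eigenvalues up to `π L`; the
branch of the argument is fixed by deforming the chain to the unperturbed one, along which `phase`
is continuous with constant exponential. The limits exist by almost-subadditivity and stationarity.

The normal form is built separately: a diagonalizable symplectic matrix is normal for some inner
product compatible with the symplectic form, and for a normal symplectic `N` the eigenvectors of `Nᵀ
N` with eigenvalue above `1`, together with the eigenvectors of `N` on the unit circle of positive
Krein sign, supply a Lagrangian frame. -/

namespace BlockJacobi

/-! ### The branch of `log det` given by the principal logarithms of the eigenvalues -/

section LogDet

open unitInterval

variable {n : Type*} [Fintype n] [DecidableEq n]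

/-- The sum of the principal logarithms of the eigenvalues. -/
noncomputable def logDet (Y : Matrix n n ℂ) : ℂ := (Y.charpoly.roots.map Complex.log).sum

/-- All eigenvalues lie in the slit plane. -/
def SlitSpec (Y : Matrix n n ℂ) : Prop := ∀ μ ∈ Y.charpoly.roots, μ ∈ Complex.slitPlane

lemma card_roots_charpoly (Y : Matrix n n ℂ) :
    Multiset.card Y.charpoly.roots = Fintype.card n := by
  rw [← (IsAlgClosed.splits Y.charpoly).natDegree_eq_card_roots, Matrix.charpoly_natDegree_eq_dim]

lemma det_scalar_sub_eq_prod (Y : Matrix n n ℂ) (s : ℂ) :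
    (s • (1 : Matrix n n ℂ) - Y).det = (Y.charpoly.roots.map (fun y => s - y)).prod := by
  have h := Matrix.eval_charpoly Y s
  have h2 := (IsAlgClosed.splits Y.charpoly).eq_prod_roots_of_monic Y.charpoly_monic
  rw [h2] at h
  rw [Polynomial.eval_multiset_prod] at h
  rw [Matrix.smul_one_eq_diagonal, ← Matrix.scalar_apply, ← h]
  simp [Multiset.map_map]

lemma det_segment_eq_prod (Y : Matrix n n ℂ) (t : ℂ) :
    (1 + t • (Y - 1)).det = (Y.charpoly.roots.map (fun y => 1 + t * (y - 1))).prod := by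
  by_cases ht : t = 0
  · subst ht; simp
  have h1 : (1 + t • (Y - 1) : Matrix n n ℂ) = (-t) • (((t - 1) / t) • (1 : Matrix n n ℂ) - Y) := by
    have : -t * ((t - 1) / t) = 1 - t := by field_simp; ring
    rw [smul_sub (-t), smul_smul, this]
    module
  rw [h1, Matrix.det_smul, det_scalar_sub_eq_prod, ← card_roots_charpoly Y]
  rw [← Multiset.prod_replicate, ← Multiset.map_const', ← Multiset.prod_map_mul]
  congr 1
  apply Multiset.map_congr rfl
  intro y _
  field_simp
  ring

lemma exists_eigenvector {Y : Matrix n n ℂ} {μ : ℂ} (h : μ ∈ Y.charpoly.roots) :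
    ∃ v : n → ℂ, v ≠ 0 ∧ Y.mulVec v = μ • v := by
  have h0 : (μ • (1 : Matrix n n ℂ) - Y).det = 0 := by
    rw [det_scalar_sub_eq_prod]
    apply Multiset.prod_eq_zero
    rw [Multiset.mem_map]
    exact ⟨μ, h, by simp⟩
  obtain ⟨v, hv, hv0⟩ := Matrix.exists_mulVec_eq_zero_iff.mpr h0
  refine ⟨v, hv, ?_⟩
  rw [Matrix.sub_mulVec, Matrix.smul_mulVec, Matrix.one_mulVec, sub_eq_zero] at hv0
  exact hv0.symm

lemma exp_logDet {Y : Matrix n n ℂ} (h : SlitSpec Y) : Complex.exp (logDet Y) = Y.det := by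
  rw [logDet, Complex.exp_multiset_sum, Matrix.det_eq_prod_roots_charpoly, Multiset.map_map]
  conv_rhs => rw [← Multiset.map_id Y.charpoly.roots]
  congr 1
  apply Multiset.map_congr rfl
  intro y hy
  exact Complex.exp_log (Complex.slitPlane_ne_zero (h y hy))

lemma SlitSpec.det_ne_zero {Y : Matrix n n ℂ} (h : SlitSpec Y) : Y.det ≠ 0 := by
  rw [← exp_logDet h]
  exact Complex.exp_ne_zero _

lemma multiset_abs_im_sum_le {s : Multiset ℂ} {c : ℝ} (h : ∀ x ∈ s, |x.im| ≤ c) :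
    |s.sum.im| ≤ c * Multiset.card s := by
  induction s using Multiset.induction with
  | empty => simp
  | cons a s ih =>
    have h1 := h a (Multiset.mem_cons_self a s)
    have h2 := ih (fun x hx => h x (Multiset.mem_cons_of_mem hx))
    simp only [Multiset.sum_cons, Complex.add_im, Multiset.card_cons]
    push_cast
    calc _ ≤ |a.im| + |s.sum.im| := abs_add_le _ _
      _ ≤ _ := by linarith

lemma multiset_norm_sum_le {s : Multiset ℂ} {c : ℝ} (h : ∀ x ∈ s, ‖x‖ ≤ c) :
    ‖s.sum‖ ≤ c * Multiset.card s := by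
  induction s using Multiset.induction with
  | empty => simp
  | cons a s ih =>
    have h1 := h a (Multiset.mem_cons_self a s)
    have h2 := ih (fun x hx => h x (Multiset.mem_cons_of_mem hx))
    simp only [Multiset.sum_cons, Multiset.card_cons]
    push_cast
    calc _ ≤ ‖a‖ + ‖s.sum‖ := norm_add_le _ _
      _ ≤ _ := by linarith

lemma abs_im_logDet_le (Y : Matrix n n ℂ) :
    |(logDet Y).im| ≤ Real.pi * Fintype.card n := by
  have := multiset_abs_im_sum_le (s := Y.charpoly.roots.map Complex.log) (c := Real.pi) (by
    intro x hx
    obtain ⟨y, _, rfl⟩ := Multiset.mem_map.mp hx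
    rw [Complex.log_im]
    exact Complex.abs_arg_le_pi y)
  rwa [Multiset.card_map, card_roots_charpoly] at this

lemma logDet_one : logDet (1 : Matrix n n ℂ) = 0 := by
  rw [logDet]
  apply Multiset.sum_eq_zero
  intro x hx
  obtain ⟨y, hy, rfl⟩ := Multiset.mem_map.mp hx
  obtain ⟨v, hv, hv2⟩ := exists_eigenvector hy
  rw [Matrix.one_mulVec] at hv2
  have : (1 - y) • v = 0 := by rw [sub_smul, one_smul, ← hv2, sub_self]
  rcases smul_eq_zero.mp this with h | h
  · rw [← sub_eq_zero.mp h, Complex.log_one]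
  · exact absurd h hv

lemma norm_eigenvalue_le {Y : Matrix n n ℂ} {μ : ℂ} (h : μ ∈ Y.charpoly.roots) : ‖μ‖ ≤ ‖Y‖ := by
  obtain ⟨v, hv, hv2⟩ := exists_eigenvector h
  have h1 := Matrix.l2_opNorm_mulVec Y (WithLp.toLp 2 v)
  simp only [hv2] at h1
  have h2 : ‖(EuclideanSpace.equiv n ℂ).symm (μ • v)‖ = ‖μ‖ * ‖WithLp.toLp 2 v‖ := by
    rw [map_smul, norm_smul]; rfl
  have h3 : 0 < ‖WithLp.toLp 2 v‖ := by
    rw [norm_pos_iff]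
    intro h; apply hv
    exact congrArg WithLp.ofLp h
  have h4 : ‖μ‖ * ‖WithLp.toLp 2 v‖ ≤ ‖Y‖ * ‖WithLp.toLp 2 v‖ := by
    rw [← h2]; exact h1
  exact le_of_mul_le_mul_right h4 h3

lemma norm_eigenvalue_sub_one_le {X : Matrix n n ℂ} {μ : ℂ} (h : μ ∈ (1 + X).charpoly.roots) :
    ‖μ - 1‖ ≤ ‖X‖ := by
  obtain ⟨v, hv, hv2⟩ := exists_eigenvector h
  rw [Matrix.add_mulVec, Matrix.one_mulVec] at hv2
  apply norm_eigenvalue_le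
  have : X.mulVec v = (μ - 1) • v := by rw [sub_smul, one_smul, ← hv2]; simp
  rw [Polynomial.mem_roots X.charpoly_monic.ne_zero, ← Matrix.mem_spectrum_iff_isRoot_charpoly,
    Matrix.mem_spectrum_iff_isRoot_charpoly, Polynomial.IsRoot, Matrix.eval_charpoly]
  apply Matrix.exists_mulVec_eq_zero_iff.mp
  refine ⟨v, hv, ?_⟩
  rw [Matrix.sub_mulVec, this, Matrix.scalar_apply, ← Matrix.smul_one_eq_diagonal,
    Matrix.smul_mulVec, Matrix.one_mulVec, sub_self]

/-- Every eigenvalue of `1 + X` is within `‖X‖` of `1`, and `|log (1 + z) - z| ≤ |z|²` for `|z| ≤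
1/2`; summing over the eigenvalues costs only one factor of the dimension. Non-normality of `X`
plays no role. -/
lemma norm_logDet_one_add_sub_trace_le {X : Matrix n n ℂ} (hX : ‖X‖ ≤ 1 / 2) :
    ‖logDet (1 + X) - X.trace‖ ≤ Fintype.card n * ‖X‖ ^ 2 := by
  have ht : X.trace = ((1 + X).charpoly.roots.map (fun y => y - 1)).sum := by
    have h1 := Matrix.trace_eq_sum_roots_charpoly (1 + X)
    rw [Matrix.trace_add, Matrix.trace_one] at h1
    rw [Multiset.sum_map_sub, Multiset.map_id', ← h1, Multiset.map_const', Multiset.sum_replicate,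
      card_roots_charpoly]
    simp
  rw [ht, logDet, ← Multiset.sum_map_sub]
  have := multiset_norm_sum_le
    (s := (1 + X).charpoly.roots.map (fun y => Complex.log y - (y - 1))) (c := ‖X‖ ^ 2) (by
    intro x hx
    obtain ⟨y, hy, rfl⟩ := Multiset.mem_map.mp hx
    have h1 := norm_eigenvalue_sub_one_le hy
    have h2 : ‖y - 1‖ < 1 := by linarith
    have h3 := Complex.norm_log_one_add_sub_self_le h2
    rw [add_sub_cancel] at h3
    refine h3.trans ?_
    have h4 : (1 - ‖y - 1‖)⁻¹ ≤ 2 := by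
      rw [inv_le_comm₀ (by linarith) (by norm_num)]; linarith
    have h5 : ‖y - 1‖ ^ 2 ≤ ‖X‖ ^ 2 := by gcongr
    have h6 : ‖y - 1‖ ^ 2 * (1 - ‖y - 1‖)⁻¹ ≤ ‖y - 1‖ ^ 2 * 2 := by gcongr
    linarith)
  rw [Multiset.card_map, card_roots_charpoly] at this
  linarith

/-- An eigenvalue `y ≤ 0` would make the determinant vanish at `t = 1 / (1 - y)`, which lies in `(0,
1]`. -/
lemma slitSpec_of_segment {Y : Matrix n n ℂ}
    (h : ∀ t ∈ Set.Icc (0 : ℝ) 1, (1 + (t : ℂ) • (Y - 1)).det ≠ 0) : SlitSpec Y := by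
  intro y hy
  by_contra hs
  rw [Complex.mem_slitPlane_iff, not_or, not_lt, not_not] at hs
  have hd : 0 < 1 - y.re := by linarith [hs.1]
  have hy2 : y = (y.re : ℂ) := by apply Complex.ext <;> simp [hs.2]
  apply h (1 / (1 - y.re)) ⟨by positivity, by rw [div_le_one hd]; linarith [hs.1]⟩
  rw [det_segment_eq_prod]
  apply Multiset.prod_eq_zero
  rw [Multiset.mem_map]
  refine ⟨y, hy, ?_⟩
  rw [hy2]
  have : (1 : ℂ) - (y.re : ℂ) ≠ 0 := by exact_mod_cast hd.ne'
  push_cast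
  simp only [Complex.ofReal_re]
  field_simp
  ring

-- The numerical range, hence the spectrum, lies in the closed right half plane; removing `0` from
-- it leaves a subset of the slit plane.
open scoped ComplexOrder in
lemma slitSpec_of_re_nonneg {Y : Matrix n n ℂ}
    (h : ∀ v : n → ℂ, 0 ≤ (star v ⬝ᵥ Y.mulVec v).re) (hd : Y.det ≠ 0) : SlitSpec Y := by
  intro y hy
  obtain ⟨v, hv, hv2⟩ := exists_eigenvector hy
  have h1 := h v
  rw [hv2, dotProduct_smul, smul_eq_mul] at h1
  have hpos : 0 < star v ⬝ᵥ v := by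
    exact Matrix.dotProduct_star_self_pos_iff.mpr hv
  have him : (star v ⬝ᵥ v).im = 0 := (Complex.le_def.mp hpos.le).2.symm
  have hre : 0 < (star v ⬝ᵥ v).re := (Complex.lt_def.mp hpos).1
  rw [Complex.mul_re, him, mul_zero, sub_zero] at h1
  have hy0 : 0 ≤ y.re := nonneg_of_mul_nonneg_left h1 hre
  have hne : y ≠ 0 := by
    rintro rfl
    apply hd
    apply Matrix.exists_mulVec_eq_zero_iff.mp
    exact ⟨v, hv, by simpa using hv2⟩
  rw [Complex.mem_slitPlane_iff]
  rcases hy0.lt_or_eq with h2 | h2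
  · exact Or.inl h2
  · right
    intro h3
    exact hne (Complex.ext h2.symm h3)

lemma det_ne_zero_of_re_pos {Y : Matrix n n ℂ}
    (h : ∀ v : n → ℂ, v ≠ 0 → 0 < (star v ⬝ᵥ Y.mulVec v).re) : Y.det ≠ 0 := by
  intro hd
  obtain ⟨v, hv, hv0⟩ := Matrix.exists_mulVec_eq_zero_iff.mpr hd
  have := h v hv
  rw [hv0] at this
  simp at this

lemma slitSpec_of_re_pos {Y : Matrix n n ℂ}
    (h : ∀ v : n → ℂ, v ≠ 0 → 0 < (star v ⬝ᵥ Y.mulVec v).re) : SlitSpec Y := by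
  apply slitSpec_of_re_nonneg _ (det_ne_zero_of_re_pos h)
  intro v
  by_cases hv : v = 0
  · simp [hv]
  · exact (h v hv).le

lemma slitSpec_one_add {X : Matrix n n ℂ} (hX : ‖X‖ < 1) : SlitSpec (1 + X) := by
  intro y hy
  have h1 := norm_eigenvalue_sub_one_le hy
  have h2 := (Complex.abs_re_le_norm (y - 1))
  rw [abs_le] at h2
  simp only [Complex.sub_re, Complex.one_re] at h2
  exact Or.inl (by linarith)

lemma det_one_add_ne_zero {X : Matrix n n ℂ} (hX : ‖X‖ < 1) : (1 + X).det ≠ 0 := by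
  exact (slitSpec_one_add hX).det_ne_zero

lemma one_add_mul_sub_one_mem_slitPlane {y : ℂ} (hy : y ∈ Complex.slitPlane) {t : ℝ}
    (ht : t ∈ Set.Icc (0 : ℝ) 1) : 1 + (t : ℂ) * (y - 1) ∈ Complex.slitPlane := by
  have := Complex.starConvex_one_slitPlane
  have h2 := this hy (a := 1 - t) (b := t) (by linarith [ht.2]) ht.1 (by ring)
  convert h2 using 1
  simp only [Complex.real_smul]
  push_cast
  ring

lemma continuous_multiset_sum_log (s : Multiset ℂ) (hs : ∀ y ∈ s, y ∈ Complex.slitPlane) :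
    Continuous fun t : I => (s.map (fun y => Complex.log (1 + ((t : ℝ) : ℂ) * (y - 1)))).sum := by
  apply continuous_multiset_sum
  intro y hy
  apply Continuous.clog
  · fun_prop
  · intro t
    exact one_add_mul_sub_one_mem_slitPlane (hs y hy) t.2

/-- `logDet` is continuous along continuous families with spectrum in the slit plane. -/
lemma continuous_logDet {A : Type*} [TopologicalSpace A] {Y : A → Matrix n n ℂ}
    (hY : Continuous Y) (hs : ∀ a, SlitSpec (Y a)) : Continuous fun a => logDet (Y a) := by
  -- Eigenvalues cannot be followed continuously one by one, but `g` is a lift through `exp` of the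
  -- jointly continuous map `(t, a) ↦ det (1 + t (Y a - 1))`. It is constant in `a` at `t = 0` and
  -- continuous in `t` for each `a`, which forces joint continuity; `t = 1` is the claim.
  let g : I × A → ℂ := fun p =>
    ((Y p.2).charpoly.roots.map (fun y => Complex.log (1 + ((p.1 : ℝ) : ℂ) * (y - 1)))).sum
  let f : I × A → {z : ℂ // z ≠ 0} := fun p => ⟨Complex.exp (g p), Complex.exp_ne_zero _⟩
  have hexp : ∀ p, Complex.exp (g p) = (1 + ((p.1 : ℝ) : ℂ) • (Y p.2 - 1)).det := by
    intro p
    rw [Complex.exp_multiset_sum, det_segment_eq_prod, Multiset.map_map]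
    congr 1
    apply Multiset.map_congr rfl
    intro y hy
    exact Complex.exp_log (Complex.slitPlane_ne_zero
      (one_add_mul_sub_one_mem_slitPlane (hs p.2 y hy) p.1.2))
  have hf : Continuous f := by
    apply Continuous.subtype_mk
    simp_rw [hexp]
    apply Continuous.matrix_det
    fun_prop
  have hg : Continuous g := by
    refine Complex.isCoveringMap_exp.isLocalHomeomorph.continuous_lift
      Complex.isCoveringMap_exp.isSeparatedMap ⟨f, hf⟩ (g := g) rfl ?_ ?_
    · simp [g]
      exact continuous_const
    · intro a
      exact continuous_multiset_sum_log _ (hs a)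
  have : (fun a => logDet (Y a)) = fun a => g (1, a) := by
    funext a
    simp [g, logDet]
  rw [this]
  fun_prop

/-- A continuous function on a preconnected space with constant exponential is constant. -/
lemma eq_of_exp_eq {A : Type*} [TopologicalSpace A] [PreconnectedSpace A] {f : A → ℂ}
    (hf : Continuous f) (h : ∀ a b, Complex.exp (f a) = Complex.exp (f b)) (a b : A) :
    f a = f b := by
  have := Complex.isCoveringMap_exp.isSeparatedMap.eq_of_comp_eq
    Complex.isCoveringMap_exp.isLocalHomeomorph.isLocallyInjective hf
    (continuous_const (y := f b)) (by
      funext x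
      apply Subtype.ext
      exact h x b) b rfl
  exact congrFun this a

/-- A perturbation of rank `k` changes the imaginary part of `logDet` by at most `π k`. -/
lemma abs_im_logDet_add_mul_sub_le {k : Type*} [Fintype k] [DecidableEq k] {A : Matrix n n ℂ}
    {U : Matrix n k ℂ} {V : Matrix k n ℂ}
    (h : ∀ t ∈ Set.Icc (0 : ℝ) 1, SlitSpec (A + (t : ℂ) • (U * V))) :
    |(logDet (A + U * V)).im - (logDet A).im| ≤ Real.pi * Fintype.card k := by
  have hA : SlitSpec A := by simpa using h 0 (by simp)
  have hu : IsUnit A.det := isUnit_iff_ne_zero.mpr hA.det_ne_zero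
  -- Sylvester's identity moves the `t`-dependence into a `k × k` determinant. The two `logDet`s
  -- then differ by a continuous function with constant exponential, hence by a constant, and the `k
  -- × k` one has imaginary part at most `π k`.
  have hfac : ∀ t : ℂ, (A + t • (U * V)).det
      = A.det * (1 + t • ((1 + V * (A⁻¹ * U)) - 1)).det := by
    intro t
    have : A + t • (U * V) = A * (1 + (A⁻¹ * U) * (t • V)) := by
      rw [Matrix.mul_add, Matrix.mul_one, ← Matrix.mul_assoc, ← Matrix.mul_assoc,
        Matrix.mul_nonsing_inv A hu, Matrix.one_mul, Matrix.mul_smul]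
    rw [this, Matrix.det_mul, Matrix.det_one_add_mul_comm, add_sub_cancel_left, Matrix.smul_mul]
  -- The segment from `1` to the small matrix at parameter `t` consists of the small matrices at the
  -- parameters `s t`, all nonsingular by the factorisation.
  have hB : ∀ t ∈ Set.Icc (0 : ℝ) 1, SlitSpec (1 + (t : ℂ) • (V * (A⁻¹ * U))) := by
    intro t ht
    apply slitSpec_of_segment
    intro s hs h0
    have hts : s * t ∈ Set.Icc (0 : ℝ) 1 :=
      ⟨mul_nonneg hs.1 ht.1, mul_le_one₀ hs.2 ht.1 ht.2⟩
    apply (h _ hts).det_ne_zero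
    rw [hfac]
    rw [add_sub_cancel_left, smul_smul] at h0
    rw [add_sub_cancel_left]
    push_cast
    rw [h0, mul_zero]
  have hcont : Continuous fun t : I => logDet (A + ((t : ℝ) : ℂ) • (U * V))
      - logDet (1 + ((t : ℝ) : ℂ) • (V * (A⁻¹ * U))) := by
    apply Continuous.sub
    · exact continuous_logDet (by fun_prop) (fun t => h t t.2)
    · exact continuous_logDet (by fun_prop) (fun t => hB t t.2)
  have hval : ∀ t : I, Complex.exp (logDet (A + ((t : ℝ) : ℂ) • (U * V))
      - logDet (1 + ((t : ℝ) : ℂ) • (V * (A⁻¹ * U)))) = A.det := by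
    intro t
    rw [Complex.exp_sub, exp_logDet (h t t.2), exp_logDet (hB t t.2), hfac, add_sub_cancel_left,
      mul_div_assoc, div_self (hB t t.2).det_ne_zero, mul_one]
  have heq := eq_of_exp_eq hcont (fun a b => by rw [hval, hval]) 1 0
  simp only [Set.Icc.coe_one, Set.Icc.coe_zero, Complex.ofReal_one, Complex.ofReal_zero, one_smul,
    zero_smul, add_zero, logDet_one, sub_zero] at heq
  have h2 : logDet (A + U * V) - logDet A = logDet (1 + V * (A⁻¹ * U)) := by
    rw [← heq]; ring
  rw [← Complex.sub_im, h2]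
  exact abs_im_logDet_le _

lemma norm_det_le (Y : Matrix n n ℂ) : ‖Y.det‖ ≤ ‖Y‖ ^ Fintype.card n := by
  rw [Matrix.det_eq_prod_roots_charpoly, ← card_roots_charpoly Y]
  have : ∀ s : Multiset ℂ, (∀ x ∈ s, ‖x‖ ≤ ‖Y‖) → ‖s.prod‖ ≤ ‖Y‖ ^ (Multiset.card s) := by
    intro s
    induction s using Multiset.induction with
    | empty => simp
    | cons a s ih =>
      intro h
      rw [Multiset.prod_cons, norm_mul, Multiset.card_cons, pow_succ']
      exact mul_le_mul (h a (Multiset.mem_cons_self a s))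
        (ih fun x hx => h x (Multiset.mem_cons_of_mem hx)) (norm_nonneg _) (norm_nonneg _)
  exact this _ (fun x hx => norm_eigenvalue_le hx)

end LogDet

end BlockJacobi

namespace BlockJacobi

/-! ### Complexification of real matrices -/

section Complexification

variable {l m n : Type*}

/-- A real matrix, regarded as a complex one. -/
def cx (A : Matrix m n ℝ) : Matrix m n ℂ := A.map Complex.ofReal

@[simp] lemma cx_apply (A : Matrix m n ℝ) (i : m) (j : n) : cx A i j = (A i j : ℂ) := rfl

lemma cx_mul [Fintype n] (A : Matrix m n ℝ) (B : Matrix n l ℝ) : cx (A * B) = cx A * cx B := by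
  ext i j
  simp [Matrix.mul_apply]

lemma cx_add (A B : Matrix m n ℝ) : cx (A + B) = cx A + cx B := by
  ext i j
  simp

lemma cx_sub (A B : Matrix m n ℝ) : cx (A - B) = cx A - cx B := by
  ext i j
  simp

lemma cx_neg (A : Matrix m n ℝ) : cx (-A) = -cx A := by
  ext i j
  simp

lemma cx_smul (t : ℝ) (A : Matrix m n ℝ) : cx (t • A) = (t : ℂ) • cx A := by
  ext i j
  simp

@[simp] lemma cx_zero : cx (0 : Matrix m n ℝ) = 0 := by
  ext i j
  simp

@[simp] lemma cx_one [DecidableEq n] : cx (1 : Matrix n n ℝ) = 1 := by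
  ext i j
  by_cases h : i = j <;> simp [h, Matrix.one_apply]

lemma cx_diagonal [DecidableEq n] (d : n → ℝ) :
    cx (Matrix.diagonal d) = Matrix.diagonal (fun i => (d i : ℂ)) := by
  ext i j
  by_cases h : i = j <;> simp [h]

lemma cx_transpose (A : Matrix m n ℝ) : cx A.transpose = (cx A).transpose := rfl

lemma cx_conjTranspose (A : Matrix m n ℝ) : (cx A).conjTranspose = cx A.transpose := by
  ext i j
  simp [Matrix.conjTranspose_apply]

lemma cx_det [Fintype n] [DecidableEq n] (A : Matrix n n ℝ) : (cx A).det = (A.det : ℂ) := by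
  rw [cx]
  exact (RingHom.map_det Complex.ofRealHom A).symm

lemma cx_inv [Fintype n] [DecidableEq n] {A : Matrix n n ℝ} (hA : IsUnit A.det) :
    cx A⁻¹ = (cx A)⁻¹ := by
  symm
  apply Matrix.inv_eq_left_inv
  rw [← cx_mul, Matrix.nonsing_inv_mul A hA, cx_one]

lemma cx_fromBlocks {o : Type*} (A : Matrix m n ℝ) (B : Matrix m l ℝ) (C : Matrix o n ℝ)
    (D : Matrix o l ℝ) :
    cx (Matrix.fromBlocks A B C D) = Matrix.fromBlocks (cx A) (cx B) (cx C) (cx D) :=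
  Matrix.fromBlocks_map _ _ _ _ _

lemma continuous_cx : Continuous (cx : Matrix m n ℝ → Matrix m n ℂ) := by
  apply continuous_matrix
  intro i j
  simp only [cx_apply]
  exact Complex.continuous_ofReal.comp (by fun_prop)

end Complexification

/-! ### Counting eigenvalues with `logDet` -/

section Counting

variable {n : Type*} [Fintype n] [DecidableEq n]

lemma exists_orthogonal_diagonalization {H : Matrix n n ℝ} (hH : H.IsSymm) :
    ∃ (Q : Matrix n n ℝ) (μ : n → ℝ), Q.transpose * Q = 1 ∧ Q * Q.transpose = 1 ∧
      H = Q * Matrix.diagonal μ * Q.transpose ∧ H.charpoly.roots = Finset.univ.val.map μ := by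
  have hh : H.IsHermitian := by
    rw [Matrix.IsHermitian, Matrix.conjTranspose_eq_transpose_of_trivial]
    exact hH
  refine ⟨hh.eigenvectorUnitary, hh.eigenvalues, ?_, ?_, ?_, ?_⟩
  · have := Unitary.coe_star_mul_self hh.eigenvectorUnitary
    rwa [Matrix.star_eq_conjTranspose, Matrix.conjTranspose_eq_transpose_of_trivial] at this
  · have := Unitary.coe_mul_star_self hh.eigenvectorUnitary
    rwa [Unitary.coe_star, Matrix.star_eq_conjTranspose, Matrix.conjTranspose_eq_transpose_of_trivial] at this
  · have := hh.spectral_theorem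
    rw [Unitary.conjStarAlgAut_apply, Matrix.star_eq_conjTranspose,
      Matrix.conjTranspose_eq_transpose_of_trivial] at this
    exact this
  · exact hh.roots_charpoly_eq_eigenvalues

lemma logDet_conj_diagonal {U V : Matrix n n ℂ} (d : n → ℂ) (hVU : V * U = 1) :
    logDet (U * Matrix.diagonal d * V) = ∑ i, Complex.log (d i) := by
  have h : (U * Matrix.diagonal d * V).charpoly.roots = Finset.univ.val.map d := by
    rw [Matrix.charpoly_mul_comm, ← Matrix.mul_assoc, hVU, Matrix.one_mul,
      Matrix.charpoly_diagonal, Polynomial.roots_prod]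
    · simp
    · simp [Finset.prod_ne_zero_iff, Polynomial.X_sub_C_ne_zero]
  rw [logDet, h, Multiset.map_map]
  rfl

/-- The matrix `δ + i (E + √δ - H)`. -/
noncomputable def countMatrix (H : Matrix n n ℝ) (E δ : ℝ) : Matrix n n ℂ :=
  ((δ : ℂ) + Complex.I * ((E + √δ : ℝ) : ℂ)) • (1 : Matrix n n ℂ)
    - Complex.I • cx H

lemma re_star_dotProduct_smul_I_symm {n : Type*} [Fintype n] {H : Matrix n n ℝ} (hH : H.IsSymm) (v : n → ℂ) :
    (star v ⬝ᵥ (Complex.I • cx H).mulVec v).re = 0 := by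
  have hh : (cx H).IsHermitian := by
    rw [Matrix.IsHermitian]
    ext i j
    simp [Matrix.conjTranspose_apply, hH.apply i j]
  have h1 : star (star v ⬝ᵥ (cx H).mulVec v)
      = star v ⬝ᵥ (cx H).mulVec v := by
    rw [← Matrix.star_dotProduct_star, star_star, Matrix.star_mulVec, hh.eq,
      ← Matrix.dotProduct_mulVec]
  have h2 : (star v ⬝ᵥ (cx H).mulVec v).im = 0 := by
    have := congrArg Complex.im h1
    simp only [RCLike.star_def, Complex.conj_im] at this
    linarith
  rw [Matrix.smul_mulVec, dotProduct_smul, smul_eq_mul, Complex.mul_re, h2]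
  simp

open scoped ComplexOrder in
lemma re_star_dotProduct_self_pos {n : Type*} [Fintype n] {v : n → ℂ} (hv : v ≠ 0) :
    0 < (star v ⬝ᵥ v).re ∧ (star v ⬝ᵥ v).im = 0 := by
  have hpos : 0 < star v ⬝ᵥ v := Matrix.dotProduct_star_self_pos_iff.mpr hv
  exact ⟨(Complex.lt_def.mp hpos).1, (Complex.le_def.mp hpos.le).2.symm⟩

lemma re_countMatrix {H : Matrix n n ℝ} (hH : H.IsSymm) (E δ : ℝ) (v : n → ℂ) :
    (star v ⬝ᵥ (countMatrix H E δ).mulVec v).re = δ * (star v ⬝ᵥ v).re := by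
  rw [countMatrix, Matrix.sub_mulVec, dotProduct_sub, Complex.sub_re,
    re_star_dotProduct_smul_I_symm hH, Matrix.smul_mulVec, Matrix.one_mulVec, dotProduct_smul,
    smul_eq_mul, Complex.mul_re]
  have him : (star v ⬝ᵥ v).im = 0 := by
    by_cases hv : v = 0
    · simp [hv]
    · exact (re_star_dotProduct_self_pos hv).2
  rw [him]
  simp

lemma slitSpec_countMatrix {H : Matrix n n ℝ} (hH : H.IsSymm) (E : ℝ) {δ : ℝ} (hδ : 0 < δ) :
    SlitSpec (countMatrix H E δ) := by
  apply slitSpec_of_re_pos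
  intro v hv
  rw [re_countMatrix hH]
  exact mul_pos hδ (re_star_dotProduct_self_pos hv).1

lemma tendsto_sqrt_nhdsGT_zero : Tendsto (fun δ : ℝ => √δ) (𝓝[>] 0) (𝓝 0) := by
  have := (Real.continuous_sqrt.tendsto 0).mono_left (nhdsWithin_le_nhds (s := Set.Ioi 0))
  simpa using this

lemma arg_ofReal_mul_I_of_pos {x : ℝ} (hx : 0 < x) :
    Complex.arg ((x : ℂ) * Complex.I) = Real.pi / 2 := by
  rw [Complex.arg_real_mul _ hx, Complex.arg_I]

lemma arg_ofReal_mul_I_of_neg {x : ℝ} (hx : x < 0) :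
    Complex.arg ((x : ℂ) * Complex.I) = -(Real.pi / 2) := by
  have : (x : ℂ) * Complex.I = ((-x : ℝ) : ℂ) * (-Complex.I) := by push_cast; ring
  rw [this, Complex.arg_real_mul _ (by linarith), Complex.arg_neg_I]

/-- An eigenvalue contributes the argument of a point near the positive or the negative imaginary
axis. The shift `√δ` breaks the tie `μ = E`: since `√δ` dominates `δ`, the point `δ + i √δ` also
turns to `+i`, which is why the count includes `E` itself. -/
lemma tendsto_im_log_count (E μ : ℝ) :
    Tendsto (fun δ : ℝ => (Complex.log ((δ : ℂ) + Complex.I * ((E + √δ : ℝ) : ℂ)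
      - Complex.I * (μ : ℂ))).im) (𝓝[>] 0)
      (𝓝 (if μ ≤ E then Real.pi / 2 else -(Real.pi / 2))) := by
  have hid : Tendsto (fun δ : ℝ => (δ : ℂ)) (𝓝[>] 0) (𝓝 0) := by
    have := (Complex.continuous_ofReal.tendsto 0).mono_left (nhdsWithin_le_nhds (s := Set.Ioi 0))
    simpa using this
  have hsq : Tendsto (fun δ : ℝ => ((√δ : ℝ) : ℂ)) (𝓝[>] 0) (𝓝 0) := by
    have := (Complex.continuous_ofReal.tendsto 0).comp tendsto_sqrt_nhdsGT_zero
    simpa [Function.comp_def] using this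
  have key : Tendsto (fun δ : ℝ => (δ : ℂ) + Complex.I * ((E + √δ : ℝ) : ℂ)
      - Complex.I * (μ : ℂ)) (𝓝[>] 0) (𝓝 (((E - μ : ℝ) : ℂ) * Complex.I)) := by
    have : Tendsto (fun δ : ℝ => (δ : ℂ) + Complex.I * ((E : ℂ) + ((√δ : ℝ) : ℂ))
      - Complex.I * (μ : ℂ)) (𝓝[>] 0) (𝓝 (0 + Complex.I * ((E : ℂ) + 0) - Complex.I * (μ : ℂ))) :=
      (hid.add ((tendsto_const_nhds.add hsq).const_mul _)).sub tendsto_const_nhds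
    convert this using 2
    · push_cast; ring
    · push_cast; ring
  rcases lt_trichotomy μ E with h | h | h
  · rw [if_pos h.le]
    have hs : (((E - μ : ℝ) : ℂ) * Complex.I) ∈ Complex.slitPlane := by
      right; simp; linarith
    have := (Complex.continuous_im.tendsto _).comp (key.clog hs)
    rw [Complex.log_im, arg_ofReal_mul_I_of_pos (by linarith : 0 < E - μ)] at this
    exact this
  · subst h
    rw [if_pos le_rfl]
    have h1 : Tendsto (fun δ : ℝ => (Complex.log (((√δ : ℝ) : ℂ) + Complex.I)).im) (𝓝[>] 0)
        (𝓝 (Real.pi / 2)) := by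
      have h2 : Tendsto (fun δ : ℝ => ((√δ : ℝ) : ℂ) + Complex.I) (𝓝[>] 0) (𝓝 (0 + Complex.I)) :=
        hsq.add tendsto_const_nhds
      rw [zero_add] at h2
      have := (Complex.continuous_im.tendsto _).comp
        (h2.clog (by right; simp))
      rw [Complex.log_im, Complex.arg_I] at this
      exact this
    refine h1.congr' ?_
    filter_upwards [self_mem_nhdsWithin] with δ hδ
    have hδ' : 0 < √δ := Real.sqrt_pos.mpr hδ
    rw [Complex.log_im, Complex.log_im]
    rw [← Complex.arg_real_mul _ hδ']
    congr 1
    have : (δ : ℂ) = ((√δ : ℝ) : ℂ) * ((√δ : ℝ) : ℂ) := by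
      rw [← Complex.ofReal_mul, Real.mul_self_sqrt (le_of_lt hδ)]
    push_cast
    rw [this]
    ring
  · rw [if_neg (not_le.mpr h)]
    have hs : (((E - μ : ℝ) : ℂ) * Complex.I) ∈ Complex.slitPlane := by
      right; simp; linarith
    have := (Complex.continuous_im.tendsto _).comp (key.clog hs)
    rw [Complex.log_im, arg_ofReal_mul_I_of_neg (by linarith : E - μ < 0)] at this
    exact this

/-- Turns the integer count into an argument, `π/2` for each eigenvalue up to `E` and `-π/2` for
each one above. Rank estimates for `logDet` thereby become estimates for counts. -/
lemma tendsto_im_logDet_countMatrix {H : Matrix n n ℝ} (hH : H.IsSymm) (E : ℝ) :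
    Tendsto (fun δ : ℝ => (logDet (countMatrix H E δ)).im) (𝓝[>] 0)
      (𝓝 (Real.pi * eigCount H E - Fintype.card n * (Real.pi / 2))) := by
  obtain ⟨Q, μ, hQ1, hQ2, hHQ, hroots⟩ := exists_orthogonal_diagonalization hH
  have hc : ∀ δ : ℝ, (logDet (countMatrix H E δ)).im
      = ∑ i, (Complex.log ((δ : ℂ) + Complex.I * ((E + √δ : ℝ) : ℂ)
          - Complex.I * (μ i : ℂ))).im := by
    intro δ
    have hm1 : (cx Q) * (cx Q.transpose) = 1 := by
      rw [← cx_mul, hQ2, cx_one]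
    have hm2 : (cx Q.transpose) * (cx Q) = 1 := by
      rw [← cx_mul, hQ1, cx_one]
    have hm3 : cx H = (cx Q)
        * Matrix.diagonal (fun i => (μ i : ℂ)) * (cx Q.transpose) := by
      rw [hHQ, cx_mul, cx_mul, cx_diagonal]
    have : countMatrix H E δ = (cx Q)
        * Matrix.diagonal (fun i => (δ : ℂ) + Complex.I * ((E + √δ : ℝ) : ℂ)
          - Complex.I * (μ i : ℂ)) * (cx Q.transpose) := by
      rw [countMatrix, hm3]
      conv_lhs => rw [← hm1]
      have hd : Matrix.diagonal (fun i => (δ : ℂ) + Complex.I * ((E + √δ : ℝ) : ℂ)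
          - Complex.I * (μ i : ℂ)) = ((δ : ℂ) + Complex.I * ((E + √δ : ℝ) : ℂ)) • 1
            - Complex.I • Matrix.diagonal (fun i => (μ i : ℂ)) := by
        ext i j
        by_cases hij : i = j
        · subst hij; simp
        · simp [hij]
      rw [hd, Matrix.mul_sub, Matrix.sub_mul]
      simp only [Matrix.mul_smul, Matrix.smul_mul, Matrix.mul_one]
    rw [this, logDet_conj_diagonal _ hm2, Complex.im_sum]
  simp_rw [hc]
  have hlim := tendsto_finsetSum Finset.univ (fun i _ => tendsto_im_log_count E (μ i))
  convert hlim using 2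
  have hcount : (eigCount H E : ℝ) = ∑ i, if μ i ≤ E then (1 : ℝ) else 0 := by
    rw [eigCount, hroots, Multiset.countP_map, Finset.sum_boole]
    rfl
  rw [hcount, Finset.mul_sum]
  have : (Fintype.card n : ℝ) * (Real.pi / 2) = ∑ _i : n, Real.pi / 2 := by simp
  rw [this, ← Finset.sum_sub_distrib]
  apply Finset.sum_congr rfl
  intro i _
  split_ifs <;> ring

/-- Two symmetric matrices that differ by a matrix of rank `k` have eigenvalue counts that differ
by at most `k`. -/
lemma abs_eigCount_sub_le {k : Type*} [Fintype k] [DecidableEq k] {H H' : Matrix n n ℝ}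
    (hH : H.IsSymm) (hH' : H'.IsSymm) (U : Matrix n k ℝ) (V : Matrix k n ℝ) (h : H' = H + U * V)
    (E : ℝ) : |(eigCount H' E : ℝ) - eigCount H E| ≤ Fintype.card k := by
  have hmap : cx H' = cx H
      + cx U * cx V := by
    rw [h, cx_add, cx_mul]
  have hc : ∀ δ, countMatrix H' E δ = countMatrix H E δ
      + ((-Complex.I) • cx U) * cx V := by
    intro δ
    rw [countMatrix, hmap, countMatrix, smul_add, Matrix.smul_mul, neg_smul]
    abel
  have hb : ∀ᶠ δ in 𝓝[>] (0 : ℝ), |(logDet (countMatrix H' E δ)).im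
      - (logDet (countMatrix H E δ)).im| ≤ Real.pi * Fintype.card k := by
    filter_upwards [self_mem_nhdsWithin] with δ hδ
    rw [hc]
    apply abs_im_logDet_add_mul_sub_le
    intro t ht
    have hs : (H + t • (U * V)).IsSymm := by
      have : H + t • (U * V) = (1 - t) • H + t • H' := by rw [h]; module
      rw [this]
      exact (hH.smul _).add (hH'.smul _)
    have := slitSpec_countMatrix hs E hδ
    convert this using 1
    have hm : cx (H + t • (U * V)) = cx H
        + (t : ℂ) • (cx U * cx V) := by
      rw [cx_add, cx_smul, cx_mul]
    rw [countMatrix, countMatrix, hm, smul_add, Matrix.smul_mul, neg_smul, smul_neg, smul_comm]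
    abel
  have hl := ((tendsto_im_logDet_countMatrix hH' E).sub (tendsto_im_logDet_countMatrix hH E)).abs
  have := le_of_tendsto hl hb
  have h3 : (Real.pi * eigCount H' E - Fintype.card n * (Real.pi / 2)
      - (Real.pi * eigCount H E - Fintype.card n * (Real.pi / 2)))
      = Real.pi * ((eigCount H' E : ℝ) - eigCount H E) := by ring
  rw [h3, abs_mul, abs_of_pos Real.pi_pos] at this
  exact le_of_mul_le_mul_left this Real.pi_pos

/-- The eigenvalue count is the argument of a determinant with a dissipative perturbation of
rank `k`, up to `π k`. -/
lemma abs_im_logDet_sub_eigCount_le {k : Type*} [Fintype k] [DecidableEq k] {H : Matrix n n ℝ}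
    (hH : H.IsSymm) (U : Matrix n k ℂ) (V : Matrix k n ℂ) (E : ℝ)
    (hdiss : ∀ v : n → ℂ, 0 ≤ (star v ⬝ᵥ (U * V).mulVec v).re)
    (hdet : (Complex.I • ((E : ℂ) • 1 - cx H) + U * V).det ≠ 0) :
    |(logDet (Complex.I • ((E : ℂ) • 1 - cx H) + U * V)).im
      - (Real.pi * eigCount H E - Fintype.card n * (Real.pi / 2))|
      ≤ Real.pi * Fintype.card k := by
  have hform : ∀ δ t : ℝ, 0 ≤ δ → 0 ≤ t → ∀ v : n → ℂ, δ * (star v ⬝ᵥ v).re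
      ≤ (star v ⬝ᵥ (countMatrix H E δ + (t : ℂ) • (U * V)).mulVec v).re := by
    intro δ t _ ht v
    rw [Matrix.add_mulVec, dotProduct_add, Complex.add_re, re_countMatrix hH, Matrix.smul_mulVec,
      dotProduct_smul, smul_eq_mul, Complex.re_ofReal_mul]
    nlinarith [mul_nonneg ht (hdiss v)]
  have hslit : ∀ δ t : ℝ, 0 < δ → 0 ≤ t → SlitSpec (countMatrix H E δ + (t : ℂ) • (U * V)) := by
    intro δ t hδ ht
    apply slitSpec_of_re_pos
    intro v hv
    exact (mul_pos hδ (re_star_dotProduct_self_pos hv).1).trans_le (hform δ t hδ.le ht v)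
  have hb : ∀ᶠ δ in 𝓝[>] (0 : ℝ), |(logDet (countMatrix H E δ + U * V)).im
      - (logDet (countMatrix H E δ)).im| ≤ Real.pi * Fintype.card k := by
    filter_upwards [self_mem_nhdsWithin] with δ hδ
    exact abs_im_logDet_add_mul_sub_le (fun t ht => hslit δ t hδ ht.1)
  have h0 : countMatrix H E 0 + U * V
      = Complex.I • ((E : ℂ) • 1 - cx H) + U * V := by
    simp only [countMatrix, smul_sub, smul_smul, Real.sqrt_zero, add_zero, Complex.ofReal_zero,
      zero_add]
  -- With the dissipative term present, `δ = 0` may be included: the form is still nonnegative and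
  -- the matrix is nonsingular, so the spectrum stays in the slit plane up to the boundary.
  have hcont : Continuous fun δ : Set.Ici (0 : ℝ) =>
      logDet (countMatrix H E (δ : ℝ) + U * V) := by
    apply continuous_logDet
    · unfold countMatrix
      fun_prop
    · intro δ
      rcases (show (0 : ℝ) ≤ δ from δ.2).eq_or_lt with h | h
      · apply slitSpec_of_re_nonneg
        · intro v
          have := hform δ 1 δ.2 zero_le_one v
          rw [← h] at this ⊢
          simpa using this
        · rw [← h, h0]; exact hdet
      · simpa using hslit δ 1 h zero_le_one
  have hl1 : Tendsto (fun δ : ℝ => (logDet (countMatrix H E δ + U * V)).im) (𝓝[>] 0)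
      (𝓝 (logDet (Complex.I • ((E : ℂ) • 1 - cx H) + U * V)).im) := by
    have hco : ContinuousOn (fun δ : ℝ => (logDet (countMatrix H E δ + U * V)).im)
        (Set.Ici 0) := by
      rw [continuousOn_iff_continuous_domRestrict]
      exact Complex.continuous_im.comp hcont
    have := (hco 0 (by simp)).mono_left (nhdsWithin_mono 0 Set.Ioi_subset_Ici_self)
    simpa only [h0] using this
  exact le_of_tendsto (hl1.sub (tendsto_im_logDet_countMatrix hH E)).abs hb

/-- The count is a pointwise limit, along `δ = 1 / (m + 1)`, of functions that are continuous on
symmetric matrices. -/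
lemma measurable_eigCount {Ω : Type*} [MeasurableSpace Ω] {H : Ω → Matrix n n ℝ}
    (hsym : ∀ ω, (H ω).IsSymm) (hm : ∀ i j, Measurable fun ω => H ω i j) (E : ℝ) :
    Measurable fun ω => (eigCount (H ω) E : ℝ) := by
  let d : ℕ → ℝ := fun m => 1 / ((m : ℝ) + 1)
  have hdpos : ∀ m, 0 < d m := fun m => Nat.one_div_pos_of_nat
  have hd : Tendsto d atTop (𝓝[>] 0) := by
    apply tendsto_nhdsWithin_of_tendsto_nhds_of_eventually_within
    · exact tendsto_one_div_add_atTop_nhds_zero_nat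
    · filter_upwards with m
      exact hdpos m
  have hcont : ∀ m, Continuous fun f : {f : n → n → ℝ // (Matrix.of f).IsSymm} => (logDet (countMatrix (Matrix.of f.1) E (d m))).im := by
    intro m
    apply Complex.continuous_im.comp
    apply continuous_logDet
    · unfold countMatrix
      refine continuous_const.sub ?_
      have : Continuous fun f : {f : n → n → ℝ // (Matrix.of f).IsSymm} => cx (Matrix.of f.1) :=
        continuous_cx.comp (continuous_matrix fun i j => by
          simp only [Matrix.of_apply]
          exact (continuous_apply j).comp ((continuous_apply i).comp continuous_subtype_val))
      fun_prop
    · intro f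
      exact slitSpec_countMatrix f.2 E (hdpos m)
  have hmeas : ∀ m, Measurable fun ω => (logDet (countMatrix (H ω) E (d m))).im := by
    intro m
    have hA : Measurable fun ω => (⟨fun i j => H ω i j, hsym ω⟩ :
        {f : n → n → ℝ // (Matrix.of f).IsSymm}) := by
      apply Measurable.subtype_mk
      exact measurable_pi_lambda _ fun i => measurable_pi_lambda _ fun j => hm i j
    have e : ∀ ω, H ω = Matrix.of (fun i j => H ω i j) := fun _ => rfl
    have := (hcont m).measurable.comp hA
    simp only [Function.comp_def] at this
    simpa only [← e] using this
  have hlim : Measurable fun ω => Real.pi * (eigCount (H ω) E : ℝ)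
      - Fintype.card n * (Real.pi / 2) := by
    refine measurable_of_tendsto_metrizable hmeas ?_
    rw [tendsto_pi_nhds]
    intro ω
    exact (tendsto_im_logDet_countMatrix (hsym ω) E).comp hd
  have : (fun ω => (eigCount (H ω) E : ℝ)) = fun ω => ((Real.pi * (eigCount (H ω) E : ℝ)
      - Fintype.card n * (Real.pi / 2)) + Fintype.card n * (Real.pi / 2)) / Real.pi := by
    funext ω
    have := Real.pi_ne_zero
    field_simp
    ring
  rw [this]
  exact (hlim.add_const _).div_const _

lemma eigCount_le_card {H : Matrix n n ℝ} (hH : H.IsSymm) (E : ℝ) :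
    eigCount H E ≤ Fintype.card n := by
  obtain ⟨Q, μ, _, _, _, hroots⟩ := exists_orthogonal_diagonalization hH
  refine (Multiset.countP_le_card _ _).trans ?_
  rw [hroots]
  simp

end Counting

end BlockJacobi

namespace BlockJacobi

/-! ### Exterior powers of matrices -/

section OperatorNorm

variable {m n : Type*} [Fintype m] [Fintype n] [DecidableEq n] {𝕜 : Type*} [RCLike 𝕜]

lemma norm_mulVec_le (A : Matrix m n 𝕜) (v : n → 𝕜) :
    ‖WithLp.toLp 2 (A.mulVec v)‖ ≤ ‖A‖ * ‖WithLp.toLp 2 v‖ :=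
  Matrix.l2_opNorm_mulVec A (WithLp.toLp 2 v)

lemma opNorm_le_bound (A : Matrix m n 𝕜) {c : ℝ} (hc : 0 ≤ c)
    (h : ∀ v : n → 𝕜, ‖WithLp.toLp 2 (A.mulVec v)‖ ≤ c * ‖WithLp.toLp 2 v‖) : ‖A‖ ≤ c := by
  rw [Matrix.l2_opNorm_def]
  apply ContinuousLinearMap.opNorm_le_bound _ hc
  intro x
  exact h x.ofLp

lemma norm_entry_le (A : Matrix m n 𝕜) (i : m) (j : n) : ‖A i j‖ ≤ ‖A‖ := by
  have h1 := norm_mulVec_le A (Pi.single j 1)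
  have h2 : ‖WithLp.toLp 2 (Pi.single j (1 : 𝕜) : n → 𝕜)‖ = 1 := by
    simp
  rw [h2, mul_one] at h1
  have h3 := EuclideanSpace.norm_sq_eq (WithLp.toLp 2 (A.mulVec (Pi.single j 1)))
  have h4 : ‖A i j‖ ^ 2 ≤ ‖WithLp.toLp 2 (A.mulVec (Pi.single j 1))‖ ^ 2 := by
    rw [h3]
    have := Finset.single_le_sum (f := fun i => ‖(WithLp.toLp 2 (A.mulVec (Pi.single j 1))) i‖ ^ 2)
      (fun _ _ => by positivity) (Finset.mem_univ i)
    simpa using this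
  have h5 := abs_le_of_sq_le_sq h4 (norm_nonneg _)
  rw [abs_of_nonneg (norm_nonneg _)] at h5
  exact h5.trans h1

lemma norm_le_one_of_conjTranspose_mul_self_eq_one {A : Matrix m n 𝕜}
    (h : A.conjTranspose * A = 1) : ‖A‖ ≤ 1 := by
  have h1 := Matrix.l2_opNorm_conjTranspose_mul_self A
  have h2 : ‖(1 : Matrix n n 𝕜)‖ ≤ 1 := by
    rw [← Matrix.diagonal_one, Matrix.l2_opNorm_diagonal]
    rw [pi_norm_le_iff_of_nonneg zero_le_one]
    simp
  rw [h] at h1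
  nlinarith [norm_nonneg A]

lemma norm_mul_mul_conjTranspose_le [DecidableEq m] {U : Matrix m n 𝕜} (hU : ‖U‖ ≤ 1)
    (D : Matrix n n 𝕜) : ‖U * D * U.conjTranspose‖ ≤ ‖D‖ := by
  have h1 := Matrix.l2_opNorm_mul (U * D) U.conjTranspose
  rw [Matrix.l2_opNorm_conjTranspose] at h1
  have h2 := Matrix.l2_opNorm_mul U D
  nlinarith [norm_nonneg U, norm_nonneg D, norm_nonneg (U * D)]

end OperatorNorm

section ExteriorPower

variable {N k : ℕ}

/-- The matrix of `Λ^k B` in the basis of ordered wedge products. -/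
noncomputable def wedge (k : ℕ) (B : Matrix (Fin N) (Fin N) ℂ) :
    Matrix (Set.powersetCard (Fin N) k) (Set.powersetCard (Fin N) k) ℂ :=
  LinearMap.toMatrix
    ((Pi.basisFun ℂ (Fin N)).exteriorPower k) ((Pi.basisFun ℂ (Fin N)).exteriorPower k)
    (exteriorPower.map k (Matrix.toLin' B))

lemma wedge_mul (A B : Matrix (Fin N) (Fin N) ℂ) : wedge k (A * B) = wedge k A * wedge k B := by
  rw [wedge, Matrix.toLin'_mul, exteriorPower.map_comp, LinearMap.toMatrix_comp _
    ((Pi.basisFun ℂ (Fin N)).exteriorPower k)]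
  rfl

lemma wedge_one : wedge k (1 : Matrix (Fin N) (Fin N) ℂ) = 1 := by
  rw [wedge, Matrix.toLin'_one, exteriorPower.map_id, LinearMap.toMatrix_id]

lemma wedge_apply (B : Matrix (Fin N) (Fin N) ℂ) (s t : Set.powersetCard (Fin N) k) :
    wedge k B s t = (Matrix.of fun i j => B (Set.powersetCard.ofFinEmbEquiv.symm s j)
      (Set.powersetCard.ofFinEmbEquiv.symm t i)).det := by
  rw [wedge, LinearMap.toMatrix_apply, exteriorPower.basis_apply, exteriorPower.basis_repr_apply,
    exteriorPower.ιMulti_family, exteriorPower.map_apply_ιMulti,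
    exteriorPower.ιMultiDual_apply_ιMulti]
  congr 1
  ext i j
  simp [Matrix.toLin'_apply, Matrix.mulVec_single]

lemma wedge_conjTranspose (B : Matrix (Fin N) (Fin N) ℂ) :
    wedge k B.conjTranspose = (wedge k B).conjTranspose := by
  ext s t
  rw [Matrix.conjTranspose_apply, wedge_apply, wedge_apply, ← Matrix.det_conjTranspose]
  congr 1

lemma wedge_diagonal (d : Fin N → ℂ) :
    wedge k (Matrix.diagonal d) = Matrix.diagonal fun s => ∏ i ∈ s.val, d i := by
  ext s t
  rw [wedge_apply]
  by_cases hst : s = t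
  · subst hst
    rw [Matrix.diagonal_apply_eq]
    have : (Matrix.of fun i j => Matrix.diagonal d (Set.powersetCard.ofFinEmbEquiv.symm s j)
        (Set.powersetCard.ofFinEmbEquiv.symm s i))
        = Matrix.diagonal fun i => d (Set.powersetCard.ofFinEmbEquiv.symm s i) := by
      ext i j
      by_cases hij : i = j
      · subst hij; simp
      · have h2 : Set.powersetCard.ofFinEmbEquiv.symm s j
            ≠ Set.powersetCard.ofFinEmbEquiv.symm s i := by
          intro h
          exact hij ((Set.powersetCard.ofFinEmbEquiv.symm s).injective h).symm
        simp [hij, Matrix.diagonal_apply_ne _ h2]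
    rw [this, Matrix.det_diagonal]
    symm
    refine (Finset.prod_nbij (fun j => Set.powersetCard.ofFinEmbEquiv.symm s j) ?_ ?_ ?_ ?_).symm
    · intro j _
      exact (Set.powersetCard.mem_range_ofFinEmbEquiv_symm_iff_mem s _).mp ⟨j, rfl⟩
    · intro a _ b _ h
      exact (Set.powersetCard.ofFinEmbEquiv.symm s).injective h
    · intro i hi
      obtain ⟨j, hj⟩ := (Set.powersetCard.mem_range_ofFinEmbEquiv_symm_iff_mem s i).mpr hi
      exact ⟨j, by simp, hj⟩
    · intro j _
      rfl
  · rw [Matrix.diagonal_apply_ne _ hst]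
    obtain ⟨i, his, hit⟩ := (Set.powersetCard.exists_mem_notMem_iff_ne s t).mp hst
    obtain ⟨j, rfl⟩ := (Set.powersetCard.mem_range_ofFinEmbEquiv_symm_iff_mem s i).mpr his
    apply Matrix.det_eq_zero_of_column_eq_zero j
    intro i
    rw [Matrix.of_apply, Matrix.diagonal_apply_ne]
    intro h
    apply hit
    exact (Set.powersetCard.mem_range_ofFinEmbEquiv_symm_iff_mem t _).mp ⟨i, h.symm⟩

variable {L : ℕ}

/-- The `L`-th exterior power of a `2L × 2L` matrix in block form. -/
noncomputable def wedgeBlock (B : Matrix (Fin L ⊕ Fin L) (Fin L ⊕ Fin L) ℂ) :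
    Matrix (Set.powersetCard (Fin (L + L)) L) (Set.powersetCard (Fin (L + L)) L) ℂ :=
  wedge L (Matrix.reindex finSumFinEquiv finSumFinEquiv B)

lemma extPower_eq (A : Matrix (Fin L ⊕ Fin L) (Fin L ⊕ Fin L) ℝ) :
    extPower A = wedgeBlock (cx A) := rfl

lemma wedgeBlock_mul (A B : Matrix (Fin L ⊕ Fin L) (Fin L ⊕ Fin L) ℂ) :
    wedgeBlock (A * B) = wedgeBlock A * wedgeBlock B := by
  rw [wedgeBlock, wedgeBlock, wedgeBlock, ← wedge_mul]
  simp [Matrix.reindex_apply, Matrix.submatrix_mul_equiv]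

lemma extPower_mul (A B : Matrix (Fin L ⊕ Fin L) (Fin L ⊕ Fin L) ℝ) :
    extPower (A * B) = extPower A * extPower B := by
  rw [extPower_eq, extPower_eq, extPower_eq, cx_mul, wedgeBlock_mul]

/-- This determinant is the minor of the first `L` rows and columns, thus a single entry of the
exterior power. -/
lemma norm_det_toBlocks₁₁_le (B : Matrix (Fin L ⊕ Fin L) (Fin L ⊕ Fin L) ℂ) :
    ‖B.toBlocks₁₁.det‖ ≤ ‖wedgeBlock B‖ := by
  let s : Set.powersetCard (Fin (L + L)) L :=
    Set.powersetCard.ofFinEmbEquiv (Fin.castAddOrderEmb L)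
  have h := norm_entry_le (wedgeBlock B) s s
  rw [wedgeBlock, wedge_apply] at h
  refine le_trans (le_of_eq ?_) h
  rw [← Matrix.det_transpose]
  congr 2
  ext i j
  simp [s, Matrix.toBlocks₁₁, Matrix.reindex_apply]

lemma prod_le_prod_one_add {ι : Type*} [Fintype ι] (s : Finset ι) {μ : ι → ℝ}
    (h : ∀ i, 0 ≤ μ i) : ∏ i ∈ s, μ i ≤ ∏ i, (1 + μ i) := by
  calc ∏ i ∈ s, μ i ≤ ∏ i ∈ s, (1 + μ i) :=
        Finset.prod_le_prod (fun i _ => h i) (fun i _ => by linarith)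
    _ ≤ ∏ i, (1 + μ i) :=
        Finset.prod_le_prod_of_subset_of_one_le (Finset.subset_univ s)
          (fun i _ => by linarith [h i]) (fun i _ _ => by linarith [h i])

/-- In an eigenbasis of `Aᵀ A` the exterior power of the Gram matrix is diagonal, with products of
`k` eigenvalues as entries. Each is at most the product of all `1 + μ_i`. The crude bound is chosen
because `det (1 + Aᵀ A)` can be computed exactly for symplectic `A`. -/
lemma norm_wedge_cx_sq_le (A : Matrix (Fin N) (Fin N) ℝ) :
    ‖wedge k (cx A)‖ ^ 2 ≤ (1 + A.transpose * A).det := by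
  have hsym : (A.transpose * A).IsSymm := by
    rw [Matrix.IsSymm, Matrix.transpose_mul, Matrix.transpose_transpose]
  obtain ⟨Q, μ, hQ1, hQ2, hG, -⟩ := exists_orthogonal_diagonalization hsym
  have hμ : ∀ i, 0 ≤ μ i := by
    intro i
    have h1 : Q.transpose * (A.transpose * A) * Q = Matrix.diagonal μ := by
      rw [hG, Matrix.mul_assoc, Matrix.mul_assoc, Matrix.mul_assoc, hQ1, Matrix.mul_one,
        ← Matrix.mul_assoc, hQ1, Matrix.one_mul]
    have h2 : μ i = ((A * Q).transpose * (A * Q)) i i := by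
      rw [Matrix.transpose_mul, ← Matrix.mul_assoc, Matrix.mul_assoc Q.transpose, h1,
        Matrix.diagonal_apply_eq]
    rw [h2, Matrix.mul_apply]
    exact Finset.sum_nonneg fun j _ => by
      rw [Matrix.transpose_apply]; exact mul_self_nonneg _
  have hdet : (1 + A.transpose * A).det = ∏ i, (1 + μ i) := by
    have : 1 + A.transpose * A = Q * Matrix.diagonal (fun i => 1 + μ i) * Q.transpose := by
      have hd : Matrix.diagonal (fun i => 1 + μ i) = 1 + Matrix.diagonal μ := by
        rw [← Matrix.diagonal_one, Matrix.diagonal_add]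
      rw [hd, Matrix.mul_add, Matrix.add_mul, ← hG, Matrix.mul_one, hQ2]
    rw [this, Matrix.det_mul_right_comm, hQ2, Matrix.one_mul, Matrix.det_diagonal]
  have hU : ‖wedge k (cx Q)‖ ≤ 1 := by
    apply norm_le_one_of_conjTranspose_mul_self_eq_one
    rw [← wedge_conjTranspose, cx_conjTranspose, ← wedge_mul, ← cx_mul, hQ1, cx_one, wedge_one]
  have hprod : 0 ≤ ∏ i, (1 + μ i) := Finset.prod_nonneg fun i _ => by linarith [hμ i]
  have hd : ‖wedge k (cx (Matrix.diagonal μ))‖ ≤ ∏ i, (1 + μ i) := by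
    rw [cx_diagonal, wedge_diagonal, Matrix.l2_opNorm_diagonal]
    rw [pi_norm_le_iff_of_nonneg hprod]
    intro s
    rw [← Complex.ofReal_prod, Complex.norm_real, Real.norm_eq_abs,
      abs_of_nonneg (Finset.prod_nonneg fun i _ => hμ i)]
    exact prod_le_prod_one_add _ hμ
  have h1 : ‖wedge k (cx A)‖ ^ 2 = ‖wedge k (cx (A.transpose * A))‖ := by
    rw [sq, ← Matrix.l2_opNorm_conjTranspose_mul_self, ← wedge_conjTranspose, ← wedge_mul,
      cx_conjTranspose, cx_mul]
  rw [h1, hdet, hG, cx_mul, cx_mul, wedge_mul, wedge_mul, ← cx_conjTranspose, wedge_conjTranspose]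
  exact (norm_mul_mul_conjTranspose_le hU _).trans hd

lemma norm_extPower_sq_le (A : Matrix (Fin L ⊕ Fin L) (Fin L ⊕ Fin L) ℝ) :
    ‖extPower A‖ ^ 2 ≤ (1 + A.transpose * A).det := by
  have h := norm_wedge_cx_sq_le (k := L) (Matrix.reindex finSumFinEquiv finSumFinEquiv A)
  refine h.trans (le_of_eq ?_)
  rw [← Matrix.det_reindex_self finSumFinEquiv (1 + A.transpose * A)]
  congr 1
  simp [Matrix.reindex_apply, Matrix.submatrix_add, Matrix.submatrix_mul_equiv]

end ExteriorPower

end BlockJacobi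

namespace BlockJacobi

/-! ### Block structure of the Hamiltonian -/

section Hamiltonian

variable {L : ℕ}

/-- The embedding of one fibre as the first site of a chain of length `N`. -/
def firstSite (L N : ℕ) : Matrix (Fin N × Fin L) (Fin L) ℝ :=
  fun x j => if (x.1 : ℕ) = 0 ∧ x.2 = j then 1 else 0

/-- The embedding of one fibre as the last site of a chain of length `N`. -/
def lastSite (L N : ℕ) : Matrix (Fin N × Fin L) (Fin L) ℝ :=
  fun x j => if (x.1 : ℕ) + 1 = N ∧ x.2 = j then 1 else 0

/-- Splitting a chain of length `m + n` into two chains. -/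
def splitChain (L m n : ℕ) : (Fin m × Fin L) ⊕ (Fin n × Fin L) ≃ Fin (m + n) × Fin L :=
  (Equiv.sumProdDistrib (Fin m) (Fin n) (Fin L)).symm.trans
    (finSumFinEquiv.prodCongr (Equiv.refl (Fin L)))

lemma splitChain_inl (m n : ℕ) (i : Fin m) (a : Fin L) :
    splitChain L m n (Sum.inl (i, a)) = (Fin.castAdd n i, a) := rfl

lemma splitChain_inr (m n : ℕ) (i : Fin n) (a : Fin L) :
    splitChain L m n (Sum.inr (i, a)) = (Fin.natAdd m i, a) := rfl

lemma firstSite_apply {N : ℕ} (x : Fin N × Fin L) (j : Fin L) :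
    firstSite L N x j = if (x.1 : ℕ) = 0 ∧ x.2 = j then 1 else 0 := rfl

lemma lastSite_apply {N : ℕ} (x : Fin N × Fin L) (j : Fin L) :
    lastSite L N x j = if (x.1 : ℕ) + 1 = N ∧ x.2 = j then 1 else 0 := rfl

lemma site_mul_mul_site_apply {m n : ℕ} {R : Type*} [CommRing R] {p : Fin m → Prop}
    {q : Fin n → Prop} [DecidablePred p] [DecidablePred q] {P : Matrix (Fin m × Fin L) (Fin L) R}
    {Q : Matrix (Fin n × Fin L) (Fin L) R} (hP : ∀ x j, P x j = if p x.1 ∧ x.2 = j then 1 else 0)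
    (hQ : ∀ x j, Q x j = if q x.1 ∧ x.2 = j then 1 else 0) (B : Matrix (Fin L) (Fin L) R)
    (x : Fin m × Fin L) (y : Fin n × Fin L) :
    (P * B * Q.transpose) x y = if p x.1 ∧ q y.1 then B x.2 y.2 else 0 := by
  simp only [Matrix.mul_apply, Matrix.transpose_apply, hP, hQ]
  by_cases hp : p x.1 <;> by_cases hq : q y.1 <;> simp [hp, hq]

lemma hamiltonian_isSymm {V T : ℕ → Matrix (Fin L) (Fin L) ℝ} (hV : ∀ n, (V n).IsSymm)
    (hT : ∀ n, (T n).IsSymm) (N : ℕ) : (hamiltonian V T N).IsSymm := by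
  ext x y
  simp only [Matrix.transpose_apply, hamiltonian]
  by_cases h1 : x.1 = y.1
  · rw [if_pos h1.symm, if_pos h1, h1]
    exact (hV _).apply _ _
  · rw [if_neg (Ne.symm h1), if_neg h1]
    by_cases h2 : (x.1 : ℕ) + 1 = y.1
    · rw [if_neg (by omega), if_pos h2, if_pos h2]
      exact (hT _).apply _ _
    · rw [if_neg h2]
      by_cases h3 : (y.1 : ℕ) + 1 = x.1
      · rw [if_pos h3, if_neg h2, if_pos h3]
        exact (hT _).apply _ _
      · rw [if_neg h3, if_neg h2, if_neg h3]

/-- The bond between the two pieces carries `T m`, the block of the first site of the second piece;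
inside that piece this block plays the role of the unused `T 0`. -/
lemma hamiltonian_splitChain (V T : ℕ → Matrix (Fin L) (Fin L) ℝ) (m n : ℕ) :
    (hamiltonian V T (m + n)).submatrix (splitChain L m n) (splitChain L m n)
      = Matrix.fromBlocks (hamiltonian V T m)
        (lastSite L m * T m * (firstSite L n).transpose)
        (firstSite L n * T m * (lastSite L m).transpose)
        (hamiltonian (fun k => V (m + k)) (fun k => T (m + k)) n) := by
  ext x y
  rcases x with ⟨i, a⟩ | ⟨i, a⟩ <;> rcases y with ⟨j, b⟩ | ⟨j, b⟩
  · simp only [Matrix.submatrix_apply, splitChain_inl, Matrix.fromBlocks_apply₁₁, hamiltonian,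
      Fin.val_castAdd, Fin.ext_iff]
    rfl
  · rw [Matrix.submatrix_apply, splitChain_inl, splitChain_inr, Matrix.fromBlocks_apply₁₂,
      site_mul_mul_site_apply (p := fun i => (i : ℕ) + 1 = m) (q := fun i => (i : ℕ) = 0)
        lastSite_apply firstSite_apply]
    simp only [hamiltonian, Fin.val_castAdd, Fin.val_natAdd, Fin.ext_iff]
    have hi := i.2
    rw [if_neg (by omega)]
    by_cases h : (i : ℕ) + 1 = m ∧ (j : ℕ) = 0
    · rw [if_pos h, if_pos (by omega), h.2, add_zero]
    · rw [if_neg h, if_neg (by omega), if_neg (by omega)]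
  · rw [Matrix.submatrix_apply, splitChain_inl, splitChain_inr, Matrix.fromBlocks_apply₂₁,
      site_mul_mul_site_apply (p := fun i => (i : ℕ) = 0) (q := fun i => (i : ℕ) + 1 = m)
        firstSite_apply lastSite_apply]
    simp only [hamiltonian, Fin.val_castAdd, Fin.val_natAdd, Fin.ext_iff]
    have hj := j.2
    rw [if_neg (by omega), if_neg (by omega)]
    by_cases h : (i : ℕ) = 0 ∧ (j : ℕ) + 1 = m
    · rw [if_pos h, if_pos (by omega), h.1, add_zero]
    · rw [if_neg h, if_neg (by omega)]
  · simp only [Matrix.submatrix_apply, splitChain_inr, Matrix.fromBlocks_apply₂₂, hamiltonian,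
      Fin.val_natAdd, Fin.ext_iff, add_right_inj, add_assoc]

lemma eigCount_submatrix {m n : Type*} [Fintype m] [DecidableEq m] [Fintype n] [DecidableEq n]
    (e : m ≃ n) (H : Matrix n n ℝ) (E : ℝ) : eigCount (H.submatrix e e) E = eigCount H E := by
  have := Matrix.charpoly_reindex e.symm H
  rw [Matrix.reindex_apply, Equiv.symm_symm] at this
  rw [eigCount, eigCount, this]

lemma eigCount_fromBlocks_diagonal {m n : Type*} [Fintype m] [DecidableEq m] [Fintype n]
    [DecidableEq n] (A : Matrix m m ℝ) (D : Matrix n n ℝ) (E : ℝ) :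
    eigCount (Matrix.fromBlocks A 0 0 D) E = eigCount A E + eigCount D E := by
  rw [eigCount, Matrix.charpoly_fromBlocks_zero₁₂, Polynomial.roots_mul, Multiset.countP_add]
  · rfl
  · exact mul_ne_zero A.charpoly_monic.ne_zero D.charpoly_monic.ne_zero

/-- Cutting a chain changes the eigenvalue count by at most `2 L`. -/
lemma abs_eigCount_hamiltonian_add_sub_le {V T : ℕ → Matrix (Fin L) (Fin L) ℝ}
    (hV : ∀ n, (V n).IsSymm) (hT : ∀ n, (T n).IsSymm) (m n : ℕ) (E : ℝ) :
    |(eigCount (hamiltonian V T (m + n)) E : ℝ) - (eigCount (hamiltonian V T m) E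
      + eigCount (hamiltonian (fun k => V (m + k)) (fun k => T (m + k)) n) E)| ≤ 2 * L := by
  rw [← eigCount_submatrix (splitChain L m n), ← Nat.cast_add, ← eigCount_fromBlocks_diagonal]
  -- The two bond blocks factor through `Fin L ⊕ Fin L`, so cutting the bond is a perturbation of
  -- rank at most `2 L`.
  have h := abs_eigCount_sub_le (k := Fin L ⊕ Fin L)
    (H := Matrix.fromBlocks (hamiltonian V T m) 0 0
      (hamiltonian (fun k => V (m + k)) (fun k => T (m + k)) n))
    (H' := (hamiltonian V T (m + n)).submatrix (splitChain L m n) (splitChain L m n))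
    (by
      rw [Matrix.isSymm_fromBlocks_iff]
      refine ⟨hamiltonian_isSymm hV hT m, by simp, by simp,
        hamiltonian_isSymm (fun k => hV _) (fun k => hT _) n⟩)
    ((hamiltonian_isSymm hV hT _).submatrix _)
    (Matrix.fromBlocks (lastSite L m * T m) 0 0 (firstSite L n * T m))
    (Matrix.fromBlocks 0 (firstSite L n).transpose (lastSite L m).transpose 0)
    (by
      rw [hamiltonian_splitChain, Matrix.fromBlocks_multiply, Matrix.fromBlocks_add]
      simp) E
  refine h.trans (le_of_eq ?_)
  simp [Fintype.card_sum, two_mul]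

/-- `E - H^N` with the boundary condition `b = Z a` at the left end. -/
noncomputable def dissipative (V T : ℕ → Matrix (Fin L) (Fin L) ℝ) (E : ℝ)
    (Z : Matrix (Fin L) (Fin L) ℂ) (N : ℕ) : Matrix (Fin N × Fin L) (Fin N × Fin L) ℂ :=
  (E : ℂ) • 1 - cx (hamiltonian V T N)
    - cx (firstSite L N) * (cx (T 0) * Z * cx (T 0)) * (cx (firstSite L N)).transpose

lemma cx_firstSite_apply {N : ℕ} (x : Fin N × Fin L) (j : Fin L) :
    cx (firstSite L N) x j = if (x.1 : ℕ) = 0 ∧ x.2 = j then 1 else 0 := by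
  rw [cx_apply, firstSite_apply]
  split_ifs <;> simp

lemma lastSite_one_apply (a b : Fin L) :
    lastSite L 1 (0, a) b = if a = b then 1 else 0 := by
  simp [lastSite_apply]

/-- The equivalence of a fibre with the chain of length one. -/
def oneSite (L : ℕ) : Fin L ≃ Fin 1 × Fin L := (Equiv.uniqueProd (Fin L) (Fin 1)).symm

lemma oneSite_apply (a : Fin L) : oneSite L a = (0, a) := rfl

/-- Isolates the first site, in the shape needed for a Schur complement. -/
lemma dissipative_splitChain (V T : ℕ → Matrix (Fin L) (Fin L) ℝ) (E : ℝ)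
    (Z : Matrix (Fin L) (Fin L) ℂ) (N : ℕ) :
    (dissipative V T E Z (1 + N)).submatrix
      ((Equiv.sumCongr (oneSite L) (Equiv.refl _)).trans (splitChain L 1 N))
      ((Equiv.sumCongr (oneSite L) (Equiv.refl _)).trans (splitChain L 1 N))
      = Matrix.fromBlocks ((E : ℂ) • 1 - cx (V 0) - cx (T 0) * Z * cx (T 0))
        (-(cx (T 1) * (cx (firstSite L N)).transpose)) (-(cx (firstSite L N) * cx (T 1)))
        ((E : ℂ) • 1 - cx (hamiltonian (fun k => V (1 + k)) (fun k => T (1 + k)) N)) := by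
  have hH := fun x y => congrFun (congrFun (hamiltonian_splitChain V T 1 N) x) y
  have hC : ∀ x y, (cx (firstSite L (1 + N)) * (cx (T 0) * Z * cx (T 0))
      * (cx (firstSite L (1 + N))).transpose) x y
      = if (x.1 : ℕ) = 0 ∧ (y.1 : ℕ) = 0 then (cx (T 0) * Z * cx (T 0)) x.2 y.2 else 0 := by
    intro x y
    exact site_mul_mul_site_apply (p := fun i => (i : ℕ) = 0) (q := fun i => (i : ℕ) = 0)
      cx_firstSite_apply cx_firstSite_apply _ _ _
  ext x y
  rw [Matrix.submatrix_apply, dissipative, Matrix.sub_apply, Matrix.sub_apply, Matrix.smul_apply,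
    cx_apply, hC, smul_eq_mul]
  simp only [Matrix.one_apply, EmbeddingLike.apply_eq_iff_eq]
  simp only [Equiv.trans_apply]
  have hH' : ∀ x y, hamiltonian V T (1 + N) (splitChain L 1 N x) (splitChain L 1 N y) = _ := hH
  rw [hH']
  rcases x with a | ⟨i, a⟩ <;> rcases y with b | ⟨j, b⟩
  · simp only [Equiv.sumCongr_apply, Sum.map_inl, Matrix.fromBlocks_apply₁₁, splitChain_inl,
      oneSite_apply, Fin.val_castAdd, Fin.val_zero, and_self, if_true, Matrix.sub_apply,
      Matrix.smul_apply, cx_apply, hamiltonian]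
    simp [Matrix.one_apply]
  · simp only [Equiv.sumCongr_apply, Sum.map_inl, Sum.map_inr, Matrix.fromBlocks_apply₁₂,
      splitChain_inl, splitChain_inr, oneSite_apply, Equiv.refl_apply, Fin.val_natAdd,
      Fin.val_castAdd, Matrix.neg_apply]
    rw [if_neg (by simp), if_neg (by omega), mul_zero, ← cx_apply, cx_mul, cx_mul, Matrix.mul_assoc, Matrix.mul_apply,
      Finset.sum_eq_single a]
    · simp [lastSite_one_apply, cx_transpose]
    · intro c _ hc
      simp [lastSite_one_apply, hc.symm]
    · simp
  · simp only [Equiv.sumCongr_apply, Sum.map_inl, Sum.map_inr, Matrix.fromBlocks_apply₂₁,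
      splitChain_inl, splitChain_inr, oneSite_apply, Equiv.refl_apply, Fin.val_natAdd,
      Fin.val_castAdd, Matrix.neg_apply]
    rw [if_neg (by simp), if_neg (by omega), mul_zero, ← cx_apply, cx_mul, cx_mul, Matrix.mul_apply,
      Finset.sum_eq_single b]
    · simp [lastSite_one_apply]
    · intro c _ hc
      simp [lastSite_one_apply, hc.symm]
    · simp
  · simp only [Equiv.sumCongr_apply, Sum.map_inr, Matrix.fromBlocks_apply₂₂, splitChain_inr,
      Equiv.refl_apply, Fin.val_natAdd, Matrix.sub_apply, Matrix.smul_apply, cx_apply]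
    rw [if_neg (show ¬(1 + (i : ℕ) = 0 ∧ 1 + (j : ℕ) = 0) by omega)]
    simp [Matrix.one_apply]

/-- The determinant of `E - H^N` with a boundary condition at the left end is the determinant of
the solution `a` that satisfies the boundary condition. -/
lemma det_dissipative_mul_det (E : ℝ) (N : ℕ) : ∀ (V T : ℕ → Matrix (Fin L) (Fin L) ℝ)
    (Z : Matrix (Fin L) (Fin L) ℂ) (a b : ℕ → Matrix (Fin L) (Fin L) ℂ),
    (∀ n, IsUnit (T n).det) → (∀ n, IsUnit (a n).det) → b 0 = Z * a 0 →
    (∀ n, a (n + 1) = ((E : ℂ) • 1 - cx (V n)) * (cx (T n))⁻¹ * a n - cx (T n) * b n) →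
    (∀ n, b (n + 1) = (cx (T n))⁻¹ * a n) →
    (dissipative V T E Z N).det * (a 0).det
      = (a N).det * ∏ n ∈ Finset.range N, (cx (T n)).det := by
  induction N with
  | zero => intro V T Z a b _ _ _ _ _; simp
  | succ N ih =>
    intro V T Z a b hT ha hb0 ha1 hb1
    have hTu : ∀ n, IsUnit (cx (T n)).det := fun n => by
      rw [cx_det]; exact (hT n).map Complex.ofRealHom
    -- `G` is the corner block of the first site. Eliminating that site leaves the shifted chain
    -- with the boundary condition `G⁻¹`, and this is the condition satisfied by the propagated
    -- solution: `b 1 = (T 0)⁻¹ a 0 = G⁻¹ a 1`. The induction therefore closes with `Z` generalised.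
    set G : Matrix (Fin L) (Fin L) ℂ := (E : ℂ) • 1 - cx (V 0) - cx (T 0) * Z * cx (T 0) with hG
    have hGa : a 1 = G * ((cx (T 0))⁻¹ * a 0) := by
      have h1 := ha1 0
      rw [zero_add, hb0] at h1
      rw [h1, hG, Matrix.sub_mul _ (cx (T 0) * Z * cx (T 0)), Matrix.mul_assoc (cx (T 0) * Z),
        Matrix.mul_nonsing_inv_cancel_left _ _ (hTu 0)]
      simp only [Matrix.mul_assoc]
    have hdet : (a 1).det * (cx (T 0)).det = G.det * (a 0).det := by
      rw [hGa, Matrix.det_mul, Matrix.det_mul]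
      have : ((cx (T 0))⁻¹).det * (cx (T 0)).det = 1 := Matrix.det_nonsing_inv_mul_det _ (hTu 0)
      linear_combination (G.det * (a 0).det) * this
    have hGu : IsUnit G.det := by
      have h1 : IsUnit ((a 1).det * (cx (T 0)).det) := (ha 1).mul (hTu 0)
      rw [hdet] at h1
      exact isUnit_of_mul_isUnit_left h1
    have hih := ih (fun k => V (1 + k)) (fun k => T (1 + k)) G⁻¹ (fun k => a (1 + k))
      (fun k => b (1 + k)) (fun n => hT _) (fun n => ha _)
      (by
        have := hb1 0
        simp only [add_zero, zero_add] at this ⊢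
        rw [this, hGa, Matrix.nonsing_inv_mul_cancel_left _ _ hGu])
      (fun n => ha1 (1 + n)) (fun n => hb1 (1 + n))
    have hsplit : (dissipative V T E Z (N + 1)).det = G.det
        * (dissipative (fun k => V (1 + k)) (fun k => T (1 + k)) E G⁻¹ N).det := by
      rw [add_comm N 1, ← Matrix.det_submatrix_equiv_self
        ((Equiv.sumCongr (oneSite L) (Equiv.refl _)).trans (splitChain L 1 N)),
        dissipative_splitChain]
      have : Invertible G := Matrix.invertibleOfIsUnitDet G hGu
      rw [← hG, Matrix.det_fromBlocks₁₁, Matrix.invOf_eq_nonsing_inv]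
      congr 2
      rw [dissipative]
      congr 1
      simp only [Matrix.neg_mul, Matrix.mul_neg, neg_neg, add_zero, Matrix.mul_assoc]
    rw [hsplit, Finset.prod_range_succ']
    have e1 : ∀ n, 1 + n = n + 1 := fun n => add_comm 1 n
    simp only [e1, zero_add] at hih
    simp only [e1]
    linear_combination (-(dissipative (fun k => V (k + 1)) (fun k => T (k + 1)) E G⁻¹ N).det) * hdet
      + (cx (T 0)).det * hih

lemma smul_dissipative_eq (V T : ℕ → Matrix (Fin L) (Fin L) ℝ) (E : ℝ)
    (Z : Matrix (Fin L) (Fin L) ℂ) (N : ℕ) :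
    Complex.I • dissipative V T E Z N
      = Complex.I • ((E : ℂ) • 1 - cx (hamiltonian V T N))
        + (cx (firstSite L N) * ((-Complex.I) • (cx (T 0) * Z * cx (T 0))))
          * (cx (firstSite L N)).transpose := by
  rw [dissipative, smul_sub Complex.I (_ - _), Matrix.mul_smul, Matrix.smul_mul, neg_smul,
    sub_eq_add_neg]

/-- The quadratic form of the boundary term at `v` is `-i ⟨w, Z w⟩` with `w` the image under `T` of
the first component of `v`; its real part is `Im ⟨w, Z w⟩`. -/
lemma re_boundary_nonneg {T : Matrix (Fin L) (Fin L) ℝ} (hT : T.IsSymm)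
    {Z : Matrix (Fin L) (Fin L) ℂ} (hZ : ∀ w : Fin L → ℂ, 0 ≤ (star w ⬝ᵥ Z.mulVec w).im) {N : ℕ}
    (v : Fin N × Fin L → ℂ) :
    0 ≤ (star v ⬝ᵥ (cx (firstSite L N) * ((-Complex.I) • (cx T * Z * cx T))
      * (cx (firstSite L N)).transpose).mulVec v).re := by
  set w := (cx T).mulVec ((cx (firstSite L N)).transpose.mulVec v) with hw
  have h1 : star v ⬝ᵥ (cx (firstSite L N) * ((-Complex.I) • (cx T * Z * cx T))
      * (cx (firstSite L N)).transpose).mulVec v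
      = (-Complex.I) * (star w ⬝ᵥ Z.mulVec w) := by
    rw [Matrix.mul_smul, Matrix.smul_mul, Matrix.smul_mulVec, dotProduct_smul, smul_eq_mul]
    congr 1
    have h2 : star w = Matrix.vecMul (Matrix.vecMul (star v) (cx (firstSite L N))) (cx T) := by
      rw [hw, Matrix.star_mulVec, Matrix.star_mulVec, cx_conjTranspose, hT.eq,
        ← cx_transpose, cx_conjTranspose, Matrix.transpose_transpose]
    rw [h2, hw, Matrix.dotProduct_mulVec, Matrix.dotProduct_mulVec]
    simp only [Matrix.vecMul_vecMul, Matrix.dotProduct_mulVec, Matrix.mul_assoc]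
  rw [h1]
  simpa using hZ w

/-- The Sturm oscillation statement: the boundary term is dissipative and lives on one site, so it
has rank at most `L` and disturbs the counting argument by at most `π L`, whatever `N` is. -/
lemma abs_im_logDet_dissipative_sub_le {V T : ℕ → Matrix (Fin L) (Fin L) ℝ}
    (hV : ∀ n, (V n).IsSymm) (hT : ∀ n, (T n).IsSymm) {E : ℝ} {Z : Matrix (Fin L) (Fin L) ℂ}
    (hZ : ∀ w : Fin L → ℂ, 0 ≤ (star w ⬝ᵥ Z.mulVec w).im) {N : ℕ}
    (hdet : (dissipative V T E Z N).det ≠ 0) :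
    |(logDet (Complex.I • dissipative V T E Z N)).im
      - (Real.pi * eigCount (hamiltonian V T N) E - (N * L) * (Real.pi / 2))| ≤ Real.pi * L := by
  have heq := smul_dissipative_eq V T E Z N
  have h := abs_im_logDet_sub_eigCount_le (hamiltonian_isSymm hV hT N)
    (cx (firstSite L N) * ((-Complex.I) • (cx (T 0) * Z * cx (T 0))))
    (cx (firstSite L N)).transpose E (re_boundary_nonneg (hT 0) hZ) ?_
  · rw [← heq] at h
    simpa using h
  · rw [← heq, Matrix.det_smul]
    exact mul_ne_zero (pow_ne_zero _ Complex.I_ne_zero) hdet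

end Hamiltonian

end BlockJacobi

namespace BlockJacobi

/-! ### Trace and Frobenius bounds -/

section TraceBounds

variable {n : Type*} [Fintype n] [DecidableEq n]

lemma norm_trace_le (A : Matrix n n ℂ) : ‖A.trace‖ ≤ Fintype.card n * ‖A‖ := by
  rw [Matrix.trace]
  refine (norm_sum_le _ _).trans ?_
  calc ∑ i, ‖A i i‖ ≤ ∑ _i : n, ‖A‖ := Finset.sum_le_sum fun i _ => norm_entry_le A i i
    _ = _ := by simp

lemma sum_norm_sq_le (A : Matrix n n ℂ) :
    ∑ i, ∑ j, ‖A i j‖ ^ 2 ≤ Fintype.card n * ‖A‖ ^ 2 := by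
  rw [Finset.sum_comm]
  calc ∑ j, ∑ i, ‖A i j‖ ^ 2 ≤ ∑ _j : n, ‖A‖ ^ 2 := by
        apply Finset.sum_le_sum
        intro j _
        have h1 := norm_mulVec_le A (Pi.single j 1)
        have h2 : ‖WithLp.toLp 2 (Pi.single j (1 : ℂ) : n → ℂ)‖ = 1 := by simp
        rw [h2, mul_one] at h1
        have h3 := EuclideanSpace.norm_sq_eq (WithLp.toLp 2 (A.mulVec (Pi.single j 1)))
        have h4 : ∑ i, ‖A i j‖ ^ 2 = ‖WithLp.toLp 2 (A.mulVec (Pi.single j 1))‖ ^ 2 := by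
          rw [h3]
          simp
        rw [h4]
        exact pow_le_pow_left₀ (norm_nonneg _) h1 2
    _ = _ := by simp

/-- A Schur multiplier bound for the trace pairing. -/
lemma norm_sum_mul_mul_le (A B : Matrix n n ℂ) (c : n → n → ℂ) {κ : ℝ} (hκ : 0 ≤ κ)
    (hc : ∀ i j, ‖c i j‖ ≤ κ) :
    ‖∑ i, ∑ j, A j i * (c i j * B i j)‖ ≤ κ * (Fintype.card n * (‖A‖ * ‖B‖)) := by
  have h1 : ‖∑ i, ∑ j, A j i * (c i j * B i j)‖ ≤ ∑ p : n × n, κ * (‖A p.2 p.1‖ * ‖B p.1 p.2‖) := by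
    rw [← Finset.sum_product', Finset.univ_product_univ]
    refine (norm_sum_le _ _).trans (Finset.sum_le_sum fun p _ => ?_)
    rw [norm_mul, norm_mul]
    have := mul_le_mul_of_nonneg_right (hc p.1 p.2)
      (mul_nonneg (norm_nonneg (A p.2 p.1)) (norm_nonneg (B p.1 p.2)))
    linarith
  rw [← Finset.mul_sum] at h1
  refine h1.trans (mul_le_mul_of_nonneg_left ?_ hκ)
  -- Multiplying entries by bounded numbers need not be uniformly bounded in operator norm, but it
  -- is in Frobenius norm. Cauchy–Schwarz with Frobenius norms at most `√n ‖·‖` gives a single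
  -- factor `n`, so no constant depends on the dimension beyond the normalisation.
  have h2 := Finset.sum_mul_sq_le_sq_mul_sq (Finset.univ : Finset (n × n))
    (fun p => ‖A p.2 p.1‖) (fun p => ‖B p.1 p.2‖)
  have hA : ∑ p : n × n, ‖A p.2 p.1‖ ^ 2 ≤ Fintype.card n * ‖A‖ ^ 2 := by
    rw [← Finset.univ_product_univ, Finset.sum_product, Finset.sum_comm]
    exact sum_norm_sq_le A
  have hB : ∑ p : n × n, ‖B p.1 p.2‖ ^ 2 ≤ Fintype.card n * ‖B‖ ^ 2 := by
    rw [← Finset.univ_product_univ, Finset.sum_product]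
    exact sum_norm_sq_le B
  have h3 : (∑ p : n × n, ‖A p.2 p.1‖ * ‖B p.1 p.2‖) ^ 2
      ≤ (Fintype.card n * (‖A‖ * ‖B‖)) ^ 2 := by
    refine h2.trans ?_
    calc _ ≤ (Fintype.card n * ‖A‖ ^ 2) * (Fintype.card n * ‖B‖ ^ 2) :=
          mul_le_mul hA hB (Finset.sum_nonneg fun _ _ => by positivity) (by positivity)
      _ = _ := by ring
  exact (sq_le_sq₀ (Finset.sum_nonneg fun _ _ => by positivity) (by positivity)).mp h3

lemma norm_one_le : ‖(1 : Matrix n n ℂ)‖ ≤ 1 := by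
  apply norm_le_one_of_conjTranspose_mul_self_eq_one
  simp

lemma norm_diagonal_le {d : n → ℂ} {c : ℝ} (hc : 0 ≤ c) (h : ∀ i, ‖d i‖ ≤ c) :
    ‖Matrix.diagonal d‖ ≤ c := by
  rw [Matrix.l2_opNorm_diagonal, pi_norm_le_iff_of_nonneg hc]
  exact h

lemma norm_one_add_inv_le {X : Matrix n n ℂ} (hX : ‖X‖ ≤ 1 / 2) : ‖(1 + X)⁻¹‖ ≤ 2 := by
  have hu : IsUnit (1 + X).det := isUnit_iff_ne_zero.mpr (det_one_add_ne_zero (by linarith))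
  have h1 : (1 + X)⁻¹ = 1 - X * (1 + X)⁻¹ := by
    have := Matrix.mul_nonsing_inv _ hu
    rw [Matrix.add_mul, Matrix.one_mul] at this
    exact eq_sub_of_add_eq this
  have h2 : ‖(1 + X)⁻¹‖ ≤ 1 + 1 / 2 * ‖(1 + X)⁻¹‖ := by
    conv_lhs => rw [h1]
    refine (norm_sub_le _ _).trans ?_
    have h3 := Matrix.l2_opNorm_mul X (1 + X)⁻¹
    have h4 := mul_le_mul_of_nonneg_right hX (norm_nonneg (1 + X)⁻¹)
    have h5 := norm_one_le (n := n)
    linarith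
  linarith

lemma re_star_dotProduct_self_eq_norm_sq (v : n → ℂ) :
    (star v ⬝ᵥ v).re = ‖WithLp.toLp 2 v‖ ^ 2 := by
  rw [EuclideanSpace.norm_sq_eq, dotProduct, Complex.re_sum]
  apply Finset.sum_congr rfl
  intro i _
  simp only [Pi.star_apply, RCLike.star_def]
  rw [← Complex.normSq_eq_conj_mul_self, Complex.ofReal_re, Complex.normSq_eq_norm_sq]

end TraceBounds

/-! ### The Möbius dynamics near a split linear map -/

section Dynamics

variable {n : Type*} [Fintype n] [DecidableEq n]

/-- The projection onto the channels selected by `h`. -/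
def chanProj (h : n → Bool) : Matrix n n ℂ := Matrix.diagonal fun i => if h i then 1 else 0

lemma chanProj_mul_self (h : n → Bool) : chanProj h * chanProj h = chanProj h := by
  rw [chanProj, Matrix.diagonal_mul_diagonal]
  congr 1
  funext i
  split_ifs <;> simp

lemma chanProj_mul_not (h : n → Bool) : chanProj h * chanProj (fun i => !h i) = 0 := by
  rw [chanProj, chanProj, Matrix.diagonal_mul_diagonal, ← Matrix.diagonal_zero]
  congr 1
  funext i
  cases h i <;> simp

lemma chanProj_add_not (h : n → Bool) : chanProj h + chanProj (fun i => !h i) = 1 := by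
  rw [chanProj, chanProj, Matrix.diagonal_add, ← Matrix.diagonal_one]
  congr 1
  funext i
  cases h i <;> simp

lemma chanProj_conjTranspose (h : n → Bool) : (chanProj h).conjTranspose = chanProj h := by
  rw [chanProj, Matrix.diagonal_conjTranspose]
  congr 1
  funext i
  cases hi : h i <;> simp [hi]

lemma norm_chanProj_le (h : n → Bool) : ‖chanProj h‖ ≤ 1 := by
  apply norm_diagonal_le zero_le_one
  intro i
  split_ifs <;> simp

lemma star_dotProduct_chanProj (h : n → Bool) (v : n → ℂ) :
    (star v ⬝ᵥ (chanProj h).mulVec v).re = ‖WithLp.toLp 2 ((chanProj h).mulVec v)‖ ^ 2 := by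
  rw [← re_star_dotProduct_self_eq_norm_sq, Matrix.star_mulVec, chanProj_conjTranspose,
    ← Matrix.dotProduct_mulVec, Matrix.mulVec_mulVec, chanProj_mul_self]

/-- A linear map `diag(Ra, Rd)` that splits into hyperbolic channels, which `Ra` expands and `Rd`
contracts with gap `g`, and elliptic channels, on which `Ra⁻¹` and `Rd` are multiplications by the
same phases `ζ`. -/
structure Splitting (n : Type*) [Fintype n] [DecidableEq n] (g ge : ℝ) where
  /-- the hyperbolic channels -/
  hyp : n → Bool
  /-- the expanding block -/
  Ra : Matrix n n ℂ
  /-- the inverse of the expanding block -/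
  Rai : Matrix n n ℂ
  /-- the contracting block -/
  Rd : Matrix n n ℂ
  /-- the elliptic phases -/
  ζ : n → ℂ
  Ra_mul_Rai : Ra * Rai = 1
  norm_Rai : ‖Rai‖ ≤ 1
  norm_Rd : ‖Rd‖ ≤ 1
  Rd_comm : chanProj hyp * Rd = Rd * chanProj hyp
  Rai_comm : Rai * chanProj hyp = chanProj hyp * Rai
  norm_hyp_Rd : ‖chanProj hyp * Rd‖ ≤ 1 - g
  norm_Rai_hyp : ‖Rai * chanProj hyp‖ ≤ 1 - g
  ell_Rd : chanProj (fun i => !hyp i) * Rd = Matrix.diagonal ζ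
  Rai_ell : Rai * chanProj (fun i => !hyp i) = Matrix.diagonal ζ
  ζ_hyp : ∀ i, hyp i = true → ζ i = 0
  norm_ζ : ∀ i, ‖ζ i‖ ≤ 1
  ge_le : ∀ i j, hyp i = false → hyp j = false → ge ≤ ‖1 - ζ i * ζ j‖

variable {g ge : ℝ}

/-- The Hermitian form `|x_e|² - |y_e|² + 2 Im ⟨x_h, y_h⟩`. -/
def krein (h : n → Bool) (u w : n → ℂ) : ℂ :=
  star u ⬝ᵥ (chanProj fun i => !h i).mulVec u - star w ⬝ᵥ (chanProj fun i => !h i).mulVec w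
    - Complex.I * (star u ⬝ᵥ (chanProj h).mulVec w)
    + Complex.I * (star w ⬝ᵥ (chanProj h).mulVec u)

/-- A trajectory of frames `(x_k; y_k)` under `diag(Ra, Rd) (1 + D_k)` with `‖D_k‖ ≤ δ`, positive
for the Krein form. -/
structure Trajectory (Sp : Splitting n g ge) (δ : ℝ) where
  /-- perturbation blocks -/
  (D11 D12 D21 D22 : ℕ → Matrix n n ℂ)
  /-- upper half of the frame -/
  x : ℕ → Matrix n n ℂ
  /-- lower half of the frame -/
  y : ℕ → Matrix n n ℂ
  norm_D11 : ∀ k, ‖D11 k‖ ≤ δ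
  norm_D12 : ∀ k, ‖D12 k‖ ≤ δ
  norm_D21 : ∀ k, ‖D21 k‖ ≤ δ
  norm_D22 : ∀ k, ‖D22 k‖ ≤ δ
  x_succ : ∀ k, x (k + 1) = Sp.Ra * ((1 + D11 k) * x k + D12 k * y k)
  y_succ : ∀ k, y (k + 1) = Sp.Rd * (D21 k * x k + (1 + D22 k) * y k)
  x_unit : IsUnit (x 0).det
  init_row : ‖chanProj Sp.hyp * (y 0 * (x 0)⁻¹)‖ ≤ 1
  init_col : ‖y 0 * (x 0)⁻¹ * chanProj Sp.hyp‖ ≤ 1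
  pos : ∀ k v, 0 ≤ (krein Sp.hyp ((x k).mulVec v) ((y k).mulVec v)).re

namespace Trajectory

variable {Sp : Splitting n g ge} {δ : ℝ} (τ : Trajectory Sp δ)

/-- The slope `W = y x⁻¹` of the frame. -/
noncomputable def W (k : ℕ) : Matrix n n ℂ := τ.y k * (τ.x k)⁻¹

/-- The growth increment `X = D11 + D12 W`. -/
noncomputable def X (k : ℕ) : Matrix n n ℂ := τ.D11 k + τ.D12 k * τ.W k

/-- The increment of the slope. -/
noncomputable def Δ (k : ℕ) : Matrix n n ℂ :=
  (τ.D21 k + τ.D22 k * τ.W k - τ.W k * τ.X k) * (1 + τ.X k)⁻¹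

/-- On a vector whose upper half is elliptic the Krein form reduces to `|x_e|² - |y_e|²`, and its
positivity says that the elliptic corner of the slope is a contraction. No contraction mechanism
exists in these channels; this conserved form replaces it. -/
lemma norm_ell_le {k : ℕ} (hx : IsUnit (τ.x k).det) :
    ‖chanProj (fun i => !Sp.hyp i) * τ.W k * chanProj (fun i => !Sp.hyp i)‖ ≤ 1 := by
  apply opNorm_le_bound _ zero_le_one
  intro u
  rw [one_mul]
  set Pe := chanProj (fun i => !Sp.hyp i) with hPe
  set a := Pe.mulVec u with ha
  have h1 : (τ.x k).mulVec ((τ.x k)⁻¹.mulVec a) = a := by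
    rw [Matrix.mulVec_mulVec, Matrix.mul_nonsing_inv _ hx, Matrix.one_mulVec]
  have h2 : (τ.y k).mulVec ((τ.x k)⁻¹.mulVec a) = (τ.W k).mulVec a := by
    rw [Matrix.mulVec_mulVec]; rfl
  have hpos := τ.pos k ((τ.x k)⁻¹.mulVec a)
  rw [h1, h2, krein] at hpos
  have hz1 : (chanProj Sp.hyp).mulVec a = 0 := by
    rw [ha, Matrix.mulVec_mulVec, hPe, chanProj_mul_not, Matrix.zero_mulVec]
  have hz2 : star a ⬝ᵥ (chanProj Sp.hyp).mulVec ((τ.W k).mulVec a) = 0 := by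
    rw [Matrix.dotProduct_mulVec]
    have : Matrix.vecMul (star a) (chanProj Sp.hyp) = star ((chanProj Sp.hyp).mulVec a) := by
      conv_rhs => rw [Matrix.star_mulVec, chanProj_conjTranspose]
    rw [this, hz1]
    simp
  rw [hz1, hz2, dotProduct_zero, mul_zero, sub_zero, add_zero, Complex.sub_re,
    star_dotProduct_chanProj, star_dotProduct_chanProj, ← hPe] at hpos
  have h3 : ‖WithLp.toLp 2 (Pe.mulVec ((τ.W k).mulVec a))‖ ≤ ‖WithLp.toLp 2 (Pe.mulVec a)‖ :=
    (sq_le_sq₀ (norm_nonneg _) (norm_nonneg _)).mp (by linarith)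
  have h4 : (Pe * τ.W k * Pe).mulVec u = Pe.mulVec ((τ.W k).mulVec a) := by
    rw [ha, Matrix.mulVec_mulVec, Matrix.mulVec_mulVec, Matrix.mul_assoc]
  have h5 : Pe.mulVec a = a := by rw [ha, Matrix.mulVec_mulVec, hPe, chanProj_mul_self]
  rw [h4]
  refine h3.trans ?_
  rw [h5, ha]
  have h6 := norm_mulVec_le Pe u
  have h7 := norm_chanProj_le (fun i => !Sp.hyp i)
  have h8 := mul_le_mul_of_nonneg_right h7 (norm_nonneg (WithLp.toLp 2 u))
  linarith

/-- Hyperbolic rows, hyperbolic columns of the remaining rows, and the elliptic corner: the three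
pieces obey different mechanisms and are estimated separately. -/
lemma decomposition (h : n → Bool) (A : Matrix n n ℂ) :
    A = chanProj h * A + chanProj (fun i => !h i) * (A * chanProj h)
      + chanProj (fun i => !h i) * A * chanProj (fun i => !h i) := by
  have h1 := chanProj_add_not h
  calc A = (chanProj h + chanProj (fun i => !h i)) * A := by rw [h1, Matrix.one_mul]
    _ = chanProj h * A + chanProj (fun i => !h i) * (A * (chanProj h + chanProj (fun i => !h i))) := by
        rw [Matrix.add_mul, h1, Matrix.mul_one]
    _ = _ := by rw [Matrix.mul_add, Matrix.mul_add, Matrix.mul_assoc _ A, add_assoc]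

lemma norm_le_of_parts (h : n → Bool) {A : Matrix n n ℂ} {a b c : ℝ} (ha : ‖chanProj h * A‖ ≤ a)
    (hb : ‖A * chanProj h‖ ≤ b)
    (hc : ‖chanProj (fun i => !h i) * A * chanProj (fun i => !h i)‖ ≤ c) : ‖A‖ ≤ a + b + c := by
  rw [decomposition h A]
  refine (norm_add₃_le).trans ?_
  have h1 := Matrix.l2_opNorm_mul (chanProj (fun i => !h i)) (A * chanProj h)
  have h2 := mul_le_mul_of_nonneg_right (norm_chanProj_le (fun i => !h i))
    (norm_nonneg (A * chanProj h))
  linarith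

lemma norm_mul_le_mul {A B : Matrix n n ℂ} {a b : ℝ} (ha : ‖A‖ ≤ a) (hb : ‖B‖ ≤ b) :
    ‖A * B‖ ≤ a * b :=
  (Matrix.l2_opNorm_mul A B).trans
    (mul_le_mul ha hb (norm_nonneg _) ((norm_nonneg _).trans ha))

lemma norm_X_le {k : ℕ} (hδ : 0 ≤ δ) (hW : ‖τ.W k‖ ≤ 5) : ‖τ.X k‖ ≤ 6 * δ := by
  have h1 := norm_mul_le_mul (τ.norm_D12 k) hW
  have h2 := norm_add_le (τ.D11 k) (τ.D12 k * τ.W k)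
  have h3 := τ.norm_D11 k
  rw [X]
  linarith

lemma norm_Δ_le {k : ℕ} (hδ : 0 ≤ δ) (hδ2 : δ ≤ 1 / 12) (hW : ‖τ.W k‖ ≤ 5) :
    ‖τ.Δ k‖ ≤ 72 * δ := by
  have hX := τ.norm_X_le hδ hW
  have h1 := norm_mul_le_mul (τ.norm_D22 k) hW
  have h2 := norm_mul_le_mul hW hX
  have h3 : ‖τ.D21 k + τ.D22 k * τ.W k - τ.W k * τ.X k‖ ≤ 36 * δ := by
    have h4 := norm_sub_le (τ.D21 k + τ.D22 k * τ.W k) (τ.W k * τ.X k)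
    have h5 := norm_add_le (τ.D21 k) (τ.D22 k * τ.W k)
    have h6 := τ.norm_D21 k
    linarith
  have h4 := norm_mul_le_mul h3 (norm_one_add_inv_le (X := τ.X k) (by linarith))
  rw [Δ]
  linarith

lemma x_succ_eq {k : ℕ} (hx : IsUnit (τ.x k).det) :
    τ.x (k + 1) = Sp.Ra * (1 + τ.X k) * τ.x k := by
  have h1 : τ.y k = τ.W k * τ.x k := by
    rw [W, Matrix.nonsing_inv_mul_cancel_right _ _ hx]
  rw [τ.x_succ, X, h1, Matrix.mul_assoc Sp.Ra, ← add_assoc, Matrix.add_mul (1 + τ.D11 k),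
    Matrix.mul_assoc]

lemma isUnit_det_Ra : IsUnit (Sp.Ra).det := by
  have := congrArg Matrix.det Sp.Ra_mul_Rai
  rw [Matrix.det_mul, Matrix.det_one] at this
  exact IsUnit.of_mul_eq_one _ this

/-- The increment `Δ` is defined so that `W + Δ = (D21 + (1 + D22) W)(1 + X)⁻¹`, the Möbius action
of `1 + D`. What remains is the unperturbed map `W ↦ Rd W Ra⁻¹`. -/
lemma W_succ_eq {k : ℕ} (hx : IsUnit (τ.x k).det) (hX : IsUnit (1 + τ.X k).det) :
    τ.W (k + 1) = Sp.Rd * (τ.W k + τ.Δ k) * Sp.Rai := by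
  have h1 : τ.y k = τ.W k * τ.x k := by
    rw [W, Matrix.nonsing_inv_mul_cancel_right _ _ hx]
  have hRi : Sp.Rai * Sp.Ra = 1 := mul_eq_one_comm.mp Sp.Ra_mul_Rai
  have hx1 : IsUnit (τ.x (k + 1)).det := by
    rw [τ.x_succ_eq hx, Matrix.det_mul, Matrix.det_mul]
    exact (isUnit_det_Ra.mul hX).mul hx
  have key : τ.y (k + 1) = Sp.Rd * (τ.W k + τ.Δ k) * Sp.Rai * τ.x (k + 1) := by
    rw [τ.x_succ_eq hx, τ.y_succ, h1]
    have h2 : Sp.Rd * (τ.W k + τ.Δ k) * Sp.Rai * (Sp.Ra * (1 + τ.X k) * τ.x k)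
        = Sp.Rd * ((τ.W k + τ.Δ k) * (1 + τ.X k)) * τ.x k := by
      calc _ = Sp.Rd * (τ.W k + τ.Δ k) * (Sp.Rai * Sp.Ra) * ((1 + τ.X k) * τ.x k) := by
            simp only [Matrix.mul_assoc]
        _ = _ := by rw [hRi, Matrix.mul_one]; simp only [Matrix.mul_assoc]
    have h3 : (τ.W k + τ.Δ k) * (1 + τ.X k) = τ.D21 k + (1 + τ.D22 k) * τ.W k := by
      rw [Matrix.add_mul, Δ, Matrix.nonsing_inv_mul_cancel_right _ _ hX, Matrix.mul_add,
        Matrix.mul_one, Matrix.add_mul, Matrix.one_mul]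
      abel
    rw [h2, h3]
    simp only [Matrix.mul_assoc, Matrix.add_mul, Matrix.one_mul]
  rw [W, key, Matrix.mul_nonsing_inv_cancel_right _ _ hx1]

/-- The hyperbolic projection commutes with `Rd`, so hyperbolic rows see only the contracting part
of `Rd` on the left. For columns the contraction comes from `Ra⁻¹` on the right. -/
lemma norm_row_succ_le {k : ℕ} (hg : g ≤ 1) (hx : IsUnit (τ.x k).det)
    (hX : IsUnit (1 + τ.X k).det) :
    ‖chanProj Sp.hyp * τ.W (k + 1)‖ ≤ (1 - g) * (‖chanProj Sp.hyp * τ.W k‖ + ‖τ.Δ k‖) := by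
  set P := chanProj Sp.hyp with hP
  have h1 : P * τ.W (k + 1) = P * Sp.Rd * (P * τ.W k + P * τ.Δ k) * Sp.Rai := by
    rw [τ.W_succ_eq hx hX, ← Matrix.mul_add P]
    have : P * Sp.Rd = P * Sp.Rd * P := by
      rw [Matrix.mul_assoc, ← Sp.Rd_comm, ← Matrix.mul_assoc, hP, chanProj_mul_self]
    conv_lhs => rw [← Matrix.mul_assoc, ← Matrix.mul_assoc, this]
    simp only [Matrix.mul_assoc]
  rw [h1]
  have h2 : ‖P * τ.W k + P * τ.Δ k‖ ≤ ‖P * τ.W k‖ + ‖τ.Δ k‖ := by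
    refine (norm_add_le _ _).trans ?_
    have := norm_mul_le_mul (norm_chanProj_le Sp.hyp) (le_refl ‖τ.Δ k‖)
    rw [← hP] at this
    linarith
  have h3 := norm_mul_le_mul (norm_mul_le_mul Sp.norm_hyp_Rd h2) Sp.norm_Rai
  rw [mul_one] at h3
  exact h3

lemma norm_col_succ_le {k : ℕ} (hg : g ≤ 1) (hx : IsUnit (τ.x k).det)
    (hX : IsUnit (1 + τ.X k).det) :
    ‖τ.W (k + 1) * chanProj Sp.hyp‖ ≤ (1 - g) * (‖τ.W k * chanProj Sp.hyp‖ + ‖τ.Δ k‖) := by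
  set P := chanProj Sp.hyp with hP
  have h1 : τ.W (k + 1) * P = Sp.Rd * (τ.W k * P + τ.Δ k * P) * (Sp.Rai * P) := by
    rw [τ.W_succ_eq hx hX, ← Matrix.add_mul]
    have : Sp.Rai * P = P * (Sp.Rai * P) := by
      rw [← Matrix.mul_assoc, ← Sp.Rai_comm, Matrix.mul_assoc, hP, chanProj_mul_self]
    conv_lhs => rw [Matrix.mul_assoc, this]
    simp only [Matrix.mul_assoc]
  rw [h1]
  have h2 : ‖τ.W k * P + τ.Δ k * P‖ ≤ ‖τ.W k * P‖ + ‖τ.Δ k‖ := by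
    refine (norm_add_le _ _).trans ?_
    have := norm_mul_le_mul (le_refl ‖τ.Δ k‖) (norm_chanProj_le Sp.hyp)
    rw [← hP] at this
    linarith
  have h3 := norm_mul_le_mul (norm_mul_le_mul Sp.norm_Rd h2) Sp.norm_Rai_hyp
  rw [one_mul, mul_comm] at h3
  exact h3

/-- The invariant region. -/
lemma invariant (hg0 : 0 < g) (hg : g ≤ 1) (hδ : 0 ≤ δ) (hδg : 36 * δ ≤ g) (k : ℕ) :
    IsUnit (τ.x k).det ∧ ‖chanProj Sp.hyp * τ.W k‖ ≤ 2 ∧ ‖τ.W k * chanProj Sp.hyp‖ ≤ 2 := by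
  induction k with
  | zero =>
    exact ⟨τ.x_unit, τ.init_row.trans one_le_two, τ.init_col.trans one_le_two⟩
  | succ k ih =>
    obtain ⟨hx, hr, hc⟩ := ih
    have hW : ‖τ.W k‖ ≤ 5 := by
      have := norm_le_of_parts Sp.hyp hr hc (τ.norm_ell_le hx)
      linarith
    have hX := τ.norm_X_le hδ hW
    have hΔ := τ.norm_Δ_le hδ (by linarith) hW
    have hXu : IsUnit (1 + τ.X k).det := isUnit_iff_ne_zero.mpr (det_one_add_ne_zero (by linarith))
    refine ⟨?_, ?_, ?_⟩
    · rw [τ.x_succ_eq hx, Matrix.det_mul, Matrix.det_mul]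
      exact (isUnit_det_Ra.mul hXu).mul hx
    · refine (τ.norm_row_succ_le hg hx hXu).trans ?_
      -- With `36 δ ≤ g` the new bound is at most `(1 - g)(2 + 72 δ) ≤ (1 - g)(2 + 2 g) ≤ 2`. This
      -- fixes the constant `36`; the total `2 + 2 + 1 = 5` is the bound on `‖W‖` used for `Δ`.
      nlinarith [norm_nonneg (chanProj Sp.hyp * τ.W k), norm_nonneg (τ.Δ k)]
    · refine (τ.norm_col_succ_le hg hx hXu).trans ?_
      nlinarith [norm_nonneg (τ.W k * chanProj Sp.hyp), norm_nonneg (τ.Δ k)]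

/-! ### Consequences of the invariant region: the determinant of the frame and time averages of the
slope. -/

section Bounds

lemma isUnit_x (hg0 : 0 < g) (hg : g ≤ 1) (hδ : 0 ≤ δ) (hδg : 36 * δ ≤ g)
    (k : ℕ) : IsUnit (τ.x k).det := (τ.invariant hg0 hg hδ hδg k).1

lemma norm_W_le (hg0 : 0 < g) (hg : g ≤ 1) (hδ : 0 ≤ δ) (hδg : 36 * δ ≤ g)
    (k : ℕ) : ‖τ.W k‖ ≤ 5 := by
  obtain ⟨hx, hr, hc⟩ := τ.invariant hg0 hg hδ hδg k
  have := norm_le_of_parts Sp.hyp hr hc (τ.norm_ell_le hx)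
  linarith

lemma norm_X_le' (hg0 : 0 < g) (hg : g ≤ 1) (hδ : 0 ≤ δ) (hδg : 36 * δ ≤ g)
    (k : ℕ) : ‖τ.X k‖ ≤ 6 * δ := τ.norm_X_le hδ (τ.norm_W_le hg0 hg hδ hδg k)

lemma norm_Δ_le' (hg0 : 0 < g) (hg : g ≤ 1) (hδ : 0 ≤ δ) (hδg : 36 * δ ≤ g)
    (k : ℕ) : ‖τ.Δ k‖ ≤ 72 * δ :=
  τ.norm_Δ_le hδ (by linarith) (τ.norm_W_le hg0 hg hδ hδg k)

lemma isUnit_one_add_X (hg0 : 0 < g) (hg : g ≤ 1) (hδ : 0 ≤ δ) (hδg : 36 * δ ≤ g)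
    (k : ℕ) : IsUnit (1 + τ.X k).det :=
  isUnit_iff_ne_zero.mpr (det_one_add_ne_zero
    ((τ.norm_X_le' hg0 hg hδ hδg k).trans_lt (by linarith)))

lemma det_x (hg0 : 0 < g) (hg : g ≤ 1) (hδ : 0 ≤ δ) (hδg : 36 * δ ≤ g)
    (N : ℕ) : (τ.x N).det
    = Sp.Ra.det ^ N * (∏ k ∈ Finset.range N, (1 + τ.X k).det) * (τ.x 0).det := by
  induction N with
  | zero => simp
  | succ N ih =>
    rw [τ.x_succ_eq (τ.isUnit_x hg0 hg hδ hδg N), Matrix.det_mul, Matrix.det_mul, ih,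
      Finset.prod_range_succ, pow_succ]
    ring

/-- The contraction gives `g r_k ≤ r_k - r_{k+1} + ‖Δ_k‖` for the row norms `r_k`, and this
telescopes. Summing loses one power of `1/g` only. -/
lemma sum_row_le (hg0 : 0 < g) (hg : g ≤ 1) (hδ : 0 ≤ δ) (hδg : 36 * δ ≤ g)
    (N : ℕ) :
    ∑ k ∈ Finset.range N, ‖chanProj Sp.hyp * τ.W k‖ ≤ (1 + 72 * δ * N) / g := by
  rw [le_div_iff₀ hg0]
  have : ∀ N : ℕ, (∑ k ∈ Finset.range N, ‖chanProj Sp.hyp * τ.W k‖) * g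
      + ‖chanProj Sp.hyp * τ.W N‖ ≤ 1 + 72 * δ * N := by
    intro N
    induction N with
    | zero => simpa [W] using τ.init_row
    | succ N ih =>
      have h1 := τ.norm_row_succ_le hg (τ.isUnit_x hg0 hg hδ hδg N)
        (τ.isUnit_one_add_X hg0 hg hδ hδg N)
      have h2 := τ.norm_Δ_le' hg0 hg hδ hδg N
      rw [Finset.sum_range_succ]
      push_cast
      nlinarith [norm_nonneg (τ.Δ N)]
  have h := this N
  linarith [norm_nonneg (chanProj Sp.hyp * τ.W N)]

lemma sum_col_le (hg0 : 0 < g) (hg : g ≤ 1) (hδ : 0 ≤ δ) (hδg : 36 * δ ≤ g)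
    (N : ℕ) :
    ∑ k ∈ Finset.range N, ‖τ.W k * chanProj Sp.hyp‖ ≤ (1 + 72 * δ * N) / g := by
  rw [le_div_iff₀ hg0]
  have : ∀ N : ℕ, (∑ k ∈ Finset.range N, ‖τ.W k * chanProj Sp.hyp‖) * g
      + ‖τ.W N * chanProj Sp.hyp‖ ≤ 1 + 72 * δ * N := by
    intro N
    induction N with
    | zero => simpa [W] using τ.init_col
    | succ N ih =>
      have h1 := τ.norm_col_succ_le hg (τ.isUnit_x hg0 hg hδ hδg N)
        (τ.isUnit_one_add_X hg0 hg hδ hδg N)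
      have h2 := τ.norm_Δ_le' hg0 hg hδ hδg N
      rw [Finset.sum_range_succ]
      push_cast
      nlinarith [norm_nonneg (τ.Δ N)]
  have h := this N
  linarith [norm_nonneg (τ.W N * chanProj Sp.hyp)]

/-- Averaging over the rotation of the elliptic channels. -/
lemma norm_sum_trace_ell_le (hg0 : 0 < g) (hg : g ≤ 1) (hδ : 0 ≤ δ) (hδg : 36 * δ ≤ g)
    (hge : 0 < ge) (B : Matrix n n ℂ) (N : ℕ) :
    ‖∑ k ∈ Finset.range N, (B * (chanProj (fun i => !Sp.hyp i) * τ.W k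
      * chanProj (fun i => !Sp.hyp i))).trace‖
      ≤ Fintype.card n * ‖B‖ * ((2 + 72 * δ * N) / ge) := by
  set Pe := chanProj (fun i => !Sp.hyp i) with hPe
  -- `Y` is what remains after summing the recursion `W_{k+1} = ζ (W_k + Δ_k) ζ` over `k` in the
  -- elliptic corner: boundary terms bounded by `2`, plus the accumulated increments. Its operator
  -- norm is controlled before any division by small denominators.
  set Y : Matrix n n ℂ := Pe * τ.W 0 * Pe - Pe * τ.W N * Pe
    + ∑ k ∈ Finset.range N, Matrix.diagonal Sp.ζ * τ.Δ k * Matrix.diagonal Sp.ζ with hY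
  have hζ : ‖Matrix.diagonal Sp.ζ‖ ≤ 1 := norm_diagonal_le zero_le_one Sp.norm_ζ
  have hYn : ‖Y‖ ≤ 2 + 72 * δ * N := by
    have h1 : ‖∑ k ∈ Finset.range N, Matrix.diagonal Sp.ζ * τ.Δ k * Matrix.diagonal Sp.ζ‖
        ≤ ∑ _k ∈ Finset.range N, 72 * δ := by
      refine (norm_sum_le _ _).trans (Finset.sum_le_sum fun k _ => ?_)
      have := norm_mul_le_mul (norm_mul_le_mul hζ (τ.norm_Δ_le' hg0 hg hδ hδg k)) hζ
      linarith
    rw [Finset.sum_const, Finset.card_range, nsmul_eq_mul] at h1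
    have h2 := τ.norm_ell_le (τ.isUnit_x hg0 hg hδ hδg 0)
    have h3 := τ.norm_ell_le (τ.isUnit_x hg0 hg hδ hδg N)
    have h4 := norm_add_le (Pe * τ.W 0 * Pe - Pe * τ.W N * Pe)
      (∑ k ∈ Finset.range N, Matrix.diagonal Sp.ζ * τ.Δ k * Matrix.diagonal Sp.ζ)
    have h5 := norm_sub_le (Pe * τ.W 0 * Pe) (Pe * τ.W N * Pe)
    rw [← hY] at h4
    linarith
  have hent : ∀ k i j, (Pe * τ.W k * Pe) i j
      = if Sp.hyp i = false ∧ Sp.hyp j = false then τ.W k i j else 0 := by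
    intro k i j
    rw [hPe, chanProj, Matrix.mul_diagonal, Matrix.diagonal_mul]
    cases hi : Sp.hyp i <;> cases hj : Sp.hyp j <;> simp
  have hstep : ∀ k i j, (Pe * τ.W (k + 1) * Pe) i j
      = Sp.ζ i * Sp.ζ j * (Pe * τ.W k * Pe) i j
        + (Matrix.diagonal Sp.ζ * τ.Δ k * Matrix.diagonal Sp.ζ) i j := by
    intro k i j
    have h1 : Pe * τ.W (k + 1) * Pe
        = Matrix.diagonal Sp.ζ * (τ.W k + τ.Δ k) * Matrix.diagonal Sp.ζ := by
      rw [τ.W_succ_eq (τ.isUnit_x hg0 hg hδ hδg k) (τ.isUnit_one_add_X hg0 hg hδ hδg k)]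
      calc _ = (Pe * Sp.Rd) * (τ.W k + τ.Δ k) * (Sp.Rai * Pe) := by simp only [Matrix.mul_assoc]
        _ = _ := by rw [hPe, Sp.ell_Rd, Sp.Rai_ell]
    rw [h1, hent]
    simp only [Matrix.mul_diagonal, Matrix.diagonal_mul, Matrix.add_apply]
    by_cases hi : Sp.hyp i = true
    · simp [Sp.ζ_hyp i hi]
    · by_cases hj : Sp.hyp j = true
      · simp [Sp.ζ_hyp j hj]
      · rw [if_pos ⟨by simpa using hi, by simpa using hj⟩]
        ring
  have htel : ∀ i j, (1 - Sp.ζ i * Sp.ζ j) * ∑ k ∈ Finset.range N, (Pe * τ.W k * Pe) i j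
      = Y i j := by
    intro i j
    have h1 := Finset.sum_range_sub (fun k => (Pe * τ.W k * Pe) i j) N
    simp only [hstep] at h1
    rw [Finset.sum_sub_distrib, Finset.sum_add_distrib, ← Finset.mul_sum] at h1
    rw [hY, Matrix.add_apply, Matrix.sub_apply, Matrix.sum_apply]
    linear_combination -h1
  -- The small denominators enter as an entrywise multiplier bounded by `1 / ge`, so the Frobenius
  -- estimate applies to `Y`.
  set c : n → n → ℂ := fun i j =>
    if Sp.hyp i = false ∧ Sp.hyp j = false then (1 - Sp.ζ i * Sp.ζ j)⁻¹ else 0 with hc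
  have hcn : ∀ i j, ‖c i j‖ ≤ 1 / ge := by
    intro i j
    simp only [hc]
    split_ifs with h
    · rw [norm_inv, one_div]
      exact inv_anti₀ hge (Sp.ge_le i j h.1 h.2)
    · rw [norm_zero]; positivity
  have hsum : ∀ i j, ∑ k ∈ Finset.range N, (Pe * τ.W k * Pe) i j = c i j * Y i j := by
    intro i j
    rw [← htel i j]
    simp only [hc]
    split_ifs with h
    · have h0 : (1 - Sp.ζ i * Sp.ζ j) ≠ 0 := by
        intro h0
        have := Sp.ge_le i j h.1 h.2
        rw [h0, norm_zero] at this
        linarith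
      rw [inv_mul_cancel_left₀ h0]
    · rw [zero_mul]
      apply Finset.sum_eq_zero
      intro k _
      rw [hent, if_neg h]
  have htr : ∑ k ∈ Finset.range N, (B * (Pe * τ.W k * Pe)).trace
      = ∑ i, ∑ j, B j i * (c i j * Y i j) := by
    rw [← Matrix.trace_sum, ← Matrix.mul_sum, Matrix.trace, Finset.sum_comm]
    apply Finset.sum_congr rfl
    intro j _
    rw [Matrix.diag_apply, Matrix.mul_apply]
    apply Finset.sum_congr rfl
    intro i _
    rw [Matrix.sum_apply, hsum]
  rw [htr]
  refine (norm_sum_mul_mul_le B Y c (by positivity) hcn).trans ?_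
  have h1 : ‖B‖ * ‖Y‖ ≤ ‖B‖ * (2 + 72 * δ * N) := by gcongr
  calc _ ≤ 1 / ge * (Fintype.card n * (‖B‖ * (2 + 72 * δ * N))) := by gcongr
    _ = _ := by ring

/-- Although `‖W_k‖` is only of order one, its average over `N` steps is of order `δ (1/g + 1/ge)`
when tested against a fixed matrix. This extra `δ` turns the first-order contribution of the slope
into a second-order one. -/
lemma norm_sum_trace_le (hg0 : 0 < g) (hg : g ≤ 1) (hδ : 0 ≤ δ) (hδg : 36 * δ ≤ g)
    (hge : 0 < ge) (B : Matrix n n ℂ) (N : ℕ) :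
    ‖∑ k ∈ Finset.range N, (B * τ.W k).trace‖
      ≤ Fintype.card n * ‖B‖ * (2 * ((1 + 72 * δ * N) / g) + (2 + 72 * δ * N) / ge) := by
  set P := chanProj Sp.hyp with hP
  set Pe := chanProj (fun i => !Sp.hyp i) with hPe
  have hdec : ∀ k, (B * τ.W k).trace = (B * (P * τ.W k)).trace
      + (B * (Pe * (τ.W k * P))).trace + (B * (Pe * τ.W k * Pe)).trace := by
    intro k
    conv_lhs => rw [decomposition Sp.hyp (τ.W k)]
    rw [Matrix.mul_add, Matrix.mul_add, Matrix.trace_add, Matrix.trace_add]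
  simp only [hdec]
  rw [Finset.sum_add_distrib, Finset.sum_add_distrib]
  refine norm_add₃_le.trans ?_
  have h1 : ‖∑ k ∈ Finset.range N, (B * (P * τ.W k)).trace‖
      ≤ Fintype.card n * ‖B‖ * ((1 + 72 * δ * N) / g) := by
    refine (norm_sum_le _ _).trans ?_
    calc _ ≤ ∑ k ∈ Finset.range N, Fintype.card n * ‖B‖ * ‖P * τ.W k‖ := by
          apply Finset.sum_le_sum
          intro k _
          refine (norm_trace_le _).trans ?_
          rw [mul_assoc]
          gcongr
          exact Matrix.l2_opNorm_mul _ _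
      _ = Fintype.card n * ‖B‖ * ∑ k ∈ Finset.range N, ‖P * τ.W k‖ := by rw [Finset.mul_sum]
      _ ≤ _ := by
          gcongr
          exact τ.sum_row_le hg0 hg hδ hδg N
  have h2 : ‖∑ k ∈ Finset.range N, (B * (Pe * (τ.W k * P))).trace‖
      ≤ Fintype.card n * ‖B‖ * ((1 + 72 * δ * N) / g) := by
    refine (norm_sum_le _ _).trans ?_
    calc _ ≤ ∑ k ∈ Finset.range N, Fintype.card n * ‖B‖ * ‖τ.W k * P‖ := by
          apply Finset.sum_le_sum
          intro k _
          refine (norm_trace_le _).trans ?_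
          rw [mul_assoc]
          gcongr
          have h3 := norm_mul_le_mul (norm_chanProj_le (fun i => !Sp.hyp i))
            (le_refl ‖τ.W k * P‖)
          rw [one_mul] at h3
          exact norm_mul_le_mul (le_refl ‖B‖) h3
      _ = Fintype.card n * ‖B‖ * ∑ k ∈ Finset.range N, ‖τ.W k * P‖ := by rw [Finset.mul_sum]
      _ ≤ _ := by
          gcongr
          exact τ.sum_col_le hg0 hg hδ hδg N
  have h3 := τ.norm_sum_trace_ell_le hg0 hg hδ hδg hge B N
  rw [← hPe] at h3
  calc _ ≤ _ := add_le_add (add_le_add h1 h2) h3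
    _ = _ := by ring

end Bounds

end Trajectory

end Dynamics

end BlockJacobi

namespace BlockJacobi

/-! ### Operator norms of blocks, submatrices and complexifications -/

section BlockNorms

variable {m n p q : Type*} [Fintype m] [Fintype n] [Fintype p] [Fintype q]
  [DecidableEq m] [DecidableEq n] [DecidableEq p] [DecidableEq q] {𝕜 : Type*} [RCLike 𝕜]

/-- Extend the test vector by zero outside the range of `e`, then drop the rows outside the range of
`f`. -/
lemma norm_submatrix_le (A : Matrix m n 𝕜) {f : p → m} {e : q → n} (hf : Function.Injective f)
    (he : Function.Injective e) : ‖A.submatrix f e‖ ≤ ‖A‖ := by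
  apply opNorm_le_bound _ (norm_nonneg _)
  intro v
  set w : n → 𝕜 := Function.extend e v 0 with hw
  have hwe : ∀ j, w (e j) = v j := fun j => he.extend_apply v (0 : n → 𝕜) j
  have hw0 : ∀ i ∉ Set.range e, w i = 0 := fun i hi =>
    Function.extend_apply' v (0 : n → 𝕜) i hi
  have h1 : ‖WithLp.toLp 2 v‖ = ‖WithLp.toLp 2 w‖ := by
    rw [EuclideanSpace.norm_eq, EuclideanSpace.norm_eq]
    congr 1
    apply Fintype.sum_of_injective e he
    · intro i hi
      simp [hw0 i hi]
    · intro j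
      simp [hwe]
  have h2 : ∀ i, (A.submatrix f e).mulVec v i = A.mulVec w (f i) := by
    intro i
    simp only [Matrix.mulVec, dotProduct, Matrix.submatrix_apply]
    apply Fintype.sum_of_injective e he
    · intro j hj
      simp [hw0 j hj]
    · intro j
      rw [hwe]
  rw [h1]
  refine le_trans ?_ (norm_mulVec_le A w)
  rw [EuclideanSpace.norm_eq, EuclideanSpace.norm_eq]
  apply Real.sqrt_le_sqrt
  simp only [h2]
  calc ∑ i, ‖A.mulVec w (f i)‖ ^ 2 = ∑ i ∈ Finset.univ.map ⟨f, hf⟩, ‖A.mulVec w i‖ ^ 2 := by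
        rw [Finset.sum_map]
        rfl
    _ ≤ _ := Finset.sum_le_univ_sum_of_nonneg fun _ => by positivity

lemma norm_toBlocks₁₁_le (A : Matrix (m ⊕ n) (p ⊕ q) 𝕜) : ‖A.toBlocks₁₁‖ ≤ ‖A‖ :=
  norm_submatrix_le A Sum.inl_injective Sum.inl_injective

lemma norm_toBlocks₁₂_le (A : Matrix (m ⊕ n) (p ⊕ q) 𝕜) : ‖A.toBlocks₁₂‖ ≤ ‖A‖ :=
  norm_submatrix_le A Sum.inl_injective Sum.inr_injective

lemma norm_toBlocks₂₁_le (A : Matrix (m ⊕ n) (p ⊕ q) 𝕜) : ‖A.toBlocks₂₁‖ ≤ ‖A‖ :=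
  norm_submatrix_le A Sum.inr_injective Sum.inl_injective

lemma norm_toBlocks₂₂_le (A : Matrix (m ⊕ n) (p ⊕ q) 𝕜) : ‖A.toBlocks₂₂‖ ≤ ‖A‖ :=
  norm_submatrix_le A Sum.inr_injective Sum.inr_injective

lemma norm_toLp_sq_sum (v : m ⊕ n → 𝕜) : ‖WithLp.toLp 2 v‖ ^ 2
    = ‖WithLp.toLp 2 (v ∘ Sum.inl)‖ ^ 2 + ‖WithLp.toLp 2 (v ∘ Sum.inr)‖ ^ 2 := by
  simp [EuclideanSpace.norm_sq_eq, Fintype.sum_sum_type]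

lemma norm_fromBlocks_diag_le {A : Matrix m p 𝕜} {D : Matrix n q 𝕜} {c : ℝ} (hA : ‖A‖ ≤ c)
    (hD : ‖D‖ ≤ c) : ‖Matrix.fromBlocks A 0 0 D‖ ≤ c := by
  have hc : 0 ≤ c := (norm_nonneg _).trans hA
  apply opNorm_le_bound _ hc
  intro v
  have h := Matrix.fromBlocks_mulVec A 0 0 D v
  have h1 := (norm_mulVec_le A (v ∘ Sum.inl)).trans
    (mul_le_mul_of_nonneg_right hA (norm_nonneg _))
  have h2 := (norm_mulVec_le D (v ∘ Sum.inr)).trans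
    (mul_le_mul_of_nonneg_right hD (norm_nonneg _))
  have h3 := pow_le_pow_left₀ (norm_nonneg _) h1 2
  have h4 := pow_le_pow_left₀ (norm_nonneg _) h2 2
  refine (sq_le_sq₀ (norm_nonneg _) (by positivity)).mp ?_
  rw [mul_pow, norm_toLp_sq_sum v, h, norm_toLp_sq_sum]
  simp only [Sum.elim_comp_inl, Sum.elim_comp_inr, Matrix.zero_mulVec, add_zero, zero_add]
  nlinarith

lemma norm_fromBlocks_offDiag_le {B : Matrix m q 𝕜} {C : Matrix n p 𝕜} {c : ℝ} (hB : ‖B‖ ≤ c)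
    (hC : ‖C‖ ≤ c) : ‖Matrix.fromBlocks 0 B C 0‖ ≤ c := by
  have h : Matrix.fromBlocks (0 : Matrix m p 𝕜) B C (0 : Matrix n q 𝕜)
      = (Matrix.fromBlocks B 0 0 C).submatrix id (Equiv.sumComm p q) := by
    ext i j
    rcases i with i | i <;> rcases j with j | j <;> rfl
  rw [h]
  exact (norm_submatrix_le _ Function.injective_id (Equiv.injective _)).trans
    (norm_fromBlocks_diag_le hB hC)

lemma norm_fromBlocks_le (A : Matrix m p 𝕜) (B : Matrix m q 𝕜) (C : Matrix n p 𝕜)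
    (D : Matrix n q 𝕜) : ‖Matrix.fromBlocks A B C D‖ ≤ ‖A‖ + ‖B‖ + ‖C‖ + ‖D‖ := by
  have h : Matrix.fromBlocks A B C D
      = Matrix.fromBlocks A 0 0 D + Matrix.fromBlocks 0 B C 0 := by
    rw [Matrix.fromBlocks_add]
    simp
  rw [h]
  have h1 : ‖Matrix.fromBlocks A 0 0 D‖ ≤ ‖A‖ + ‖D‖ :=
    norm_fromBlocks_diag_le (by linarith [norm_nonneg D]) (by linarith [norm_nonneg A])
  have h2 : ‖Matrix.fromBlocks 0 B C 0‖ ≤ ‖B‖ + ‖C‖ :=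
    norm_fromBlocks_offDiag_le (by linarith [norm_nonneg C]) (by linarith [norm_nonneg B])
  linarith [norm_add_le (Matrix.fromBlocks A 0 0 D) (Matrix.fromBlocks 0 B C 0)]

/-- A real matrix acts separately on real and imaginary parts, whose squared norms add. -/
lemma norm_cx_le (A : Matrix m n ℝ) : ‖cx A‖ ≤ ‖A‖ := by
  apply opNorm_le_bound _ (norm_nonneg _)
  intro v
  have hsq : ∀ {k : Type _} [Fintype k] (u : k → ℂ), ‖WithLp.toLp 2 u‖ ^ 2
      = ‖WithLp.toLp 2 (fun i => (u i).re)‖ ^ 2 + ‖WithLp.toLp 2 (fun i => (u i).im)‖ ^ 2 := by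
    intro k _ u
    simp only [EuclideanSpace.norm_sq_eq, ← Finset.sum_add_distrib]
    apply Finset.sum_congr rfl
    intro i _
    rw [← Complex.normSq_eq_norm_sq, Complex.normSq_apply]
    simp [sq]
  have hre : (fun i => ((cx A).mulVec v i).re) = A.mulVec (fun i => (v i).re) := by
    funext i
    simp [Matrix.mulVec, dotProduct]
  have him : (fun i => ((cx A).mulVec v i).im) = A.mulVec (fun i => (v i).im) := by
    funext i
    simp [Matrix.mulVec, dotProduct]
  refine (sq_le_sq₀ (norm_nonneg _) (by positivity)).mp ?_
  rw [mul_pow, hsq v]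
  have hm : ‖WithLp.toLp 2 ((cx A).mulVec v)‖ ^ 2
      = ‖WithLp.toLp 2 (A.mulVec (fun i => (v i).re))‖ ^ 2
        + ‖WithLp.toLp 2 (A.mulVec (fun i => (v i).im))‖ ^ 2 := by
    rw [← hre, ← him]
    simp only [EuclideanSpace.norm_sq_eq, ← Finset.sum_add_distrib]
    apply Finset.sum_congr rfl
    intro i _
    rw [← Complex.normSq_eq_norm_sq, Complex.normSq_apply]
    simp [sq]
  rw [hm]
  have h1 := pow_le_pow_left₀ (norm_nonneg _) (norm_mulVec_le A (fun i => (v i).re)) 2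
  have h2 := pow_le_pow_left₀ (norm_nonneg _) (norm_mulVec_le A (fun i => (v i).im)) 2
  nlinarith

end BlockNorms

/-! ### Symplectic matrices -/

section Symplectic

variable {l : Type*} [Fintype l] [DecidableEq l]

lemma norm_J_le : ‖Matrix.J l ℝ‖ ≤ 1 := by
  apply norm_le_one_of_conjTranspose_mul_self_eq_one
  rw [Matrix.conjTranspose_eq_transpose_of_trivial, Matrix.J_transpose, Matrix.neg_mul,
    Matrix.J_squared, neg_neg]

lemma norm_transpose_real {m n : Type*} [Fintype m] [Fintype n] [DecidableEq m] [DecidableEq n]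
    (A : Matrix m n ℝ) : ‖A.transpose‖ = ‖A‖ := by
  rw [← Matrix.conjTranspose_eq_transpose_of_trivial, Matrix.l2_opNorm_conjTranspose]

/-- The inverse is `-J Aᵀ J`. Consequently bounds on `M` and on the transfer matrix also bound their
inverses. -/
lemma norm_inv_symplectic_le {A : Matrix (l ⊕ l) (l ⊕ l) ℝ} (hA : A ∈ Matrix.symplecticGroup l ℝ) :
    ‖A⁻¹‖ ≤ ‖A‖ := by
  rw [SymplecticGroup.inv_eq_symplectic_inv A hA]
  have h1 := Matrix.l2_opNorm_mul (-Matrix.J l ℝ * A.transpose) (Matrix.J l ℝ)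
  have h2 := Matrix.l2_opNorm_mul (-Matrix.J l ℝ) A.transpose
  rw [norm_neg, norm_transpose_real] at h2
  have h3 := norm_J_le (l := l)
  nlinarith [norm_nonneg A, norm_nonneg (Matrix.J l ℝ), norm_nonneg (-Matrix.J l ℝ * A.transpose)]

lemma inv_mem_symplectic {A : Matrix (l ⊕ l) (l ⊕ l) ℝ} (hA : A ∈ Matrix.symplecticGroup l ℝ) :
    A⁻¹ ∈ Matrix.symplecticGroup l ℝ := by
  have := (⟨A, hA⟩ : Matrix.symplecticGroup l ℝ)⁻¹.2
  rwa [SymplecticGroup.coe_inv'] at this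

variable {L : ℕ}

lemma transfer_mem_symplectic {V T : Matrix (Fin L) (Fin L) ℝ} (E : ℝ) (hV : V.IsSymm)
    (hT : T.PosDef) : transfer V T E ∈ Matrix.symplecticGroup (Fin L) ℝ := by
  have hTs : T.transpose = T := by
    rw [← Matrix.conjTranspose_eq_transpose_of_trivial]; exact hT.1
  have hu : IsUnit T.det := isUnit_iff_ne_zero.mpr hT.det_pos.ne'
  have hTi : (T⁻¹).transpose = T⁻¹ := by rw [Matrix.transpose_nonsing_inv, hTs]
  have hV' : (E • (1 : Matrix (Fin L) (Fin L) ℝ) - V).transpose = E • 1 - V := by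
    rw [Matrix.transpose_sub, hV, Matrix.transpose_smul, Matrix.transpose_one]
  rw [transfer, SymplecticGroup.fromBlocks_mem_iff]
  refine ⟨?_, ?_, ?_⟩
  · rw [Matrix.transpose_mul, hTi, hV', Matrix.mul_assoc]
  · simp
  · rw [hTi]
    simp [Matrix.nonsing_inv_mul _ hu]

lemma transferProd_mem_symplectic {V T : ℕ → Matrix (Fin L) (Fin L) ℝ} (E : ℝ)
    (hV : ∀ n, (V n).IsSymm) (hT : ∀ n, (T n).PosDef) (N : ℕ) :
    transferProd V T E N ∈ Matrix.symplecticGroup (Fin L) ℝ := by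
  induction N with
  | zero => exact Submonoid.one_mem _
  | succ N ih => exact Submonoid.mul_mem _ (transfer_mem_symplectic E (hV N) (hT N)) ih

end Symplectic

end BlockJacobi

namespace BlockJacobi

/-! ### The chart -/

section Chart

variable {n : Type*} [Fintype n] [DecidableEq n]

/-- The number `1 / √2`. -/
noncomputable def rsqrt : ℂ := ((√2)⁻¹ : ℝ)

lemma rsqrt_mul_self : rsqrt * rsqrt = 1 / 2 := by
  rw [rsqrt, ← Complex.ofReal_mul, ← mul_inv, Real.mul_self_sqrt (by norm_num)]
  norm_num

lemma star_rsqrt : star rsqrt = rsqrt := Complex.conj_ofReal _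

lemma rsqrt_ne_zero : rsqrt ≠ 0 := by
  intro h
  have := rsqrt_mul_self
  rw [h] at this
  norm_num at this

/-- The unitary that keeps the hyperbolic channels and applies the Cayley rotation to the elliptic
ones. -/
noncomputable def chart (h : n → Bool) : Matrix (n ⊕ n) (n ⊕ n) ℂ :=
  Matrix.fromBlocks (Matrix.diagonal fun i => if h i then 1 else rsqrt)
    (Matrix.diagonal fun i => if h i then 0 else -(rsqrt * Complex.I))
    (Matrix.diagonal fun i => if h i then 0 else rsqrt)
    (Matrix.diagonal fun i => if h i then 1 else rsqrt * Complex.I)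

/-- The matrix of the Krein form in the chart. -/
noncomputable def kreinMatrix (h : n → Bool) : Matrix (n ⊕ n) (n ⊕ n) ℂ :=
  Matrix.fromBlocks (chanProj fun i => !h i) (-(Complex.I • chanProj h))
    (Complex.I • chanProj h) (-chanProj fun i => !h i)

lemma chart_mul_conjTranspose (h : n → Bool) : chart h * (chart h).conjTranspose = 1 := by
  rw [chart, Matrix.fromBlocks_conjTranspose, Matrix.fromBlocks_multiply, ← Matrix.fromBlocks_one]
  simp only [Matrix.diagonal_conjTranspose, Matrix.diagonal_mul_diagonal, Matrix.diagonal_add]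
  have hI := Complex.I_mul_I
  have hs := rsqrt_mul_self
  congr 1
  all_goals
    first | rw [← Matrix.diagonal_one] | rw [← Matrix.diagonal_zero]
    congr 1
    funext i
    cases hi : h i <;>
    simp only [Pi.star_apply, hi, if_true, if_false, star_one, star_zero, star_neg, star_mul',
      star_rsqrt, RCLike.star_def, Complex.conj_I, Bool.false_eq_true]
    all_goals first | (ring; done) | linear_combination 2 * hs - rsqrt * rsqrt * hI | linear_combination -rsqrt * rsqrt * hI | linear_combination rsqrt * rsqrt * hI | linear_combination hs - rsqrt * rsqrt * hI

lemma conjTranspose_mul_chart (h : n → Bool) : (chart h).conjTranspose * chart h = 1 :=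
  mul_eq_one_comm.mp (chart_mul_conjTranspose h)

lemma norm_chart_le (h : n → Bool) : ‖chart h‖ ≤ 1 :=
  norm_le_one_of_conjTranspose_mul_self_eq_one (conjTranspose_mul_chart h)

/-- The Hermitian form `i J`, which real symplectic matrices preserve, becomes the Krein form in the
chart: definite of either sign on the two elliptic halves, and still off-diagonal on the hyperbolic
channels. -/
lemma kreinMatrix_mul_chart (h : n → Bool) :
    kreinMatrix h * chart h = chart h * (Complex.I • Matrix.J n ℂ) := by
  rw [kreinMatrix, chart, Matrix.J, Matrix.fromBlocks_smul, Matrix.fromBlocks_multiply,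
    Matrix.fromBlocks_multiply, chanProj, chanProj]
  simp only [smul_zero, Matrix.mul_zero, smul_neg, Matrix.mul_neg, Matrix.mul_smul, Matrix.mul_one,
    Matrix.neg_mul, ← Matrix.diagonal_smul, Matrix.diagonal_mul_diagonal, zero_add, add_zero]
  have hI := Complex.I_mul_I
  congr 1
  all_goals
    ext i j
    rcases eq_or_ne i j with rfl | hij
    · cases hi : h i <;> simp [hi]
      all_goals first
        | exact mul_comm _ _ | linear_combination rsqrt * hI | linear_combination -rsqrt * hI
    · simp [hij]

lemma conjTranspose_mul_kreinMatrix_mul (h : n → Bool) :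
    (chart h).conjTranspose * kreinMatrix h * chart h = Complex.I • Matrix.J n ℂ := by
  rw [Matrix.mul_assoc, kreinMatrix_mul_chart, ← Matrix.mul_assoc, conjTranspose_mul_chart,
    Matrix.one_mul]

lemma krein_eq (h : n → Bool) (z : n ⊕ n → ℂ) :
    krein h (z ∘ Sum.inl) (z ∘ Sum.inr) = star z ⬝ᵥ (kreinMatrix h).mulVec z := by
  have hz : star z = Sum.elim (star (z ∘ Sum.inl)) (star (z ∘ Sum.inr)) := by
    funext i; rcases i with i | i <;> rfl
  rw [kreinMatrix, Matrix.fromBlocks_mulVec, hz, sumElim_dotProduct_sumElim, krein]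
  simp only [Matrix.neg_mulVec, Matrix.smul_mulVec, dotProduct_add, dotProduct_neg,
    dotProduct_smul, smul_eq_mul]
  ring

/-- The isotropic frame `(1; i)`. -/
noncomputable def frame (n : Type*) [DecidableEq n] : Matrix (n ⊕ n) n ℂ :=
  Matrix.fromRows 1 (Complex.I • 1)

lemma frame_form : (frame n).conjTranspose * (Complex.I • Matrix.J n ℂ) * frame n
    = (2 : ℂ) • 1 := by
  rw [frame, Matrix.conjTranspose_fromRows_eq_fromCols_conjTranspose, Matrix.J, Matrix.fromBlocks_smul,
    Matrix.fromCols_mul_fromBlocks, Matrix.fromCols_mul_fromRows]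
  ext i j
  simp [← mul_assoc]
  ring

end Chart

/-! ### The splitting given by a normal form -/

section NormalSplitting

lemma norm_diagonal_real_le {n : Type*} [Fintype n] [DecidableEq n] {d : n → ℝ} {c : ℝ}
    (hc : 0 ≤ c) (h : ∀ i, ‖d i‖ ≤ c) : ‖Matrix.diagonal d‖ ≤ c := by
  rw [Matrix.l2_opNorm_diagonal, pi_norm_le_iff_of_nonneg hc]
  exact h

lemma chanProj_isLeft {p q : Type*} [DecidableEq p] [DecidableEq q] :
    chanProj (fun i : p ⊕ q => i.isLeft) = Matrix.fromBlocks 1 0 0 0 := by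
  rw [chanProj, ← Matrix.diagonal_one, ← Matrix.diagonal_zero (n := q), Matrix.fromBlocks_diagonal]
  congr 1
  funext i
  rcases i with i | i <;> simp

lemma chanProj_not_isLeft {p q : Type*} [DecidableEq p] [DecidableEq q] :
    chanProj (fun i : p ⊕ q => !i.isLeft) = Matrix.fromBlocks 0 0 0 1 := by
  rw [chanProj, ← Matrix.diagonal_one, ← Matrix.diagonal_zero (n := p), Matrix.fromBlocks_diagonal]
  congr 1
  funext i
  rcases i with i | i <;> simp

variable {Lh Le : ℕ}

/-- The splitting given by the expansion factors `κ`, the phases `η` and the orthogonal part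
`S`. -/
noncomputable def normalSplitting (κ : Fin Lh → ℝ) (η : Fin Le → ℝ) (S : Matrix (Fin Lh) (Fin Lh) ℝ)
    {g ge : ℝ} (hS : S ∈ Matrix.orthogonalGroup (Fin Lh) ℝ) (hκ : ∀ l, 0 < κ l) (hg1 : g ≤ 1)
    (hg : ∀ l, g ≤ 1 - Real.exp (-κ l))
    (hge : ∀ l k, ge ≤ ‖1 - Complex.exp (Complex.I * ((η l + η k : ℝ) : ℂ))‖) :
    Splitting (Fin Lh ⊕ Fin Le) g ge := by
  have hSS : S * S.transpose = 1 := (Matrix.mem_orthogonalGroup_iff (Fin Lh) ℝ).mp hS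
  have hSS' : S.transpose * S = 1 := (Matrix.mem_orthogonalGroup_iff' (Fin Lh) ℝ).mp hS
  have hSn : ‖S‖ ≤ 1 := by
    apply norm_le_one_of_conjTranspose_mul_self_eq_one
    rwa [Matrix.conjTranspose_eq_transpose_of_trivial]
  have hSn' : ‖S.transpose‖ ≤ 1 := by rwa [norm_transpose_real]
  have hd : ∀ c : ℝ, 0 ≤ c → (∀ l, Real.exp (-κ l) ≤ c) →
      ‖Matrix.diagonal fun l => Real.exp (-κ l)‖ ≤ c := by
    intro c hc h
    apply norm_diagonal_real_le hc
    intro l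
    rw [Real.norm_eq_abs, abs_of_pos (Real.exp_pos _)]
    exact h l
  have hb : ∀ c : ℝ, 0 ≤ c → (∀ l, Real.exp (-κ l) ≤ c) →
      ‖cx (S * Matrix.diagonal fun l => Real.exp (-κ l))‖ ≤ c := by
    intro c hc h
    refine (norm_cx_le _).trans ((Matrix.l2_opNorm_mul _ _).trans ?_)
    nlinarith [hd c hc h, norm_nonneg S, norm_nonneg (Matrix.diagonal fun l => Real.exp (-κ l))]
  have hb' : ∀ c : ℝ, 0 ≤ c → (∀ l, Real.exp (-κ l) ≤ c) →
      ‖cx ((Matrix.diagonal fun l => Real.exp (-κ l)) * S.transpose)‖ ≤ c := by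
    intro c hc h
    refine (norm_cx_le _).trans ((Matrix.l2_opNorm_mul _ _).trans ?_)
    nlinarith [hd c hc h, norm_nonneg S.transpose,
      norm_nonneg (Matrix.diagonal fun l => Real.exp (-κ l))]
  have he1 : ∀ l, Real.exp (-κ l) ≤ 1 := fun l => by
    rw [Real.exp_le_one_iff]; linarith [hκ l]
  have heg : ∀ l, Real.exp (-κ l) ≤ 1 - g := fun l => by linarith [hg l]
  have hζ : ∀ l : Fin Le, ‖Complex.exp (-(Complex.I * (η l : ℂ)))‖ ≤ 1 := by
    intro l
    rw [Complex.norm_exp]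
    simp
  have hζd : ‖Matrix.diagonal fun l : Fin Le => Complex.exp (-(Complex.I * (η l : ℂ)))‖ ≤ 1 :=
    norm_diagonal_le zero_le_one hζ
  have h0 : ‖(0 : Matrix (Fin Le) (Fin Le) ℂ)‖ ≤ 1 - g := by
    rw [norm_zero]; linarith
  refine
    { hyp := fun i => i.isLeft
      Ra := Matrix.fromBlocks (cx (S * Matrix.diagonal fun l => Real.exp (κ l))) 0 0
        (Matrix.diagonal fun l => Complex.exp (Complex.I * (η l : ℂ)))
      Rai := Matrix.fromBlocks (cx ((Matrix.diagonal fun l => Real.exp (-κ l)) * S.transpose)) 0 0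
        (Matrix.diagonal fun l => Complex.exp (-(Complex.I * (η l : ℂ))))
      Rd := Matrix.fromBlocks (cx (S * Matrix.diagonal fun l => Real.exp (-κ l))) 0 0
        (Matrix.diagonal fun l => Complex.exp (-(Complex.I * (η l : ℂ))))
      ζ := Sum.elim 0 fun l => Complex.exp (-(Complex.I * (η l : ℂ)))
      Ra_mul_Rai := ?_, norm_Rai := norm_fromBlocks_diag_le (hb' 1 zero_le_one he1) hζd
      norm_Rd := norm_fromBlocks_diag_le (hb 1 zero_le_one he1) hζd
      Rd_comm := ?_, Rai_comm := ?_, norm_hyp_Rd := ?_, norm_Rai_hyp := ?_, ell_Rd := ?_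
      Rai_ell := ?_, ζ_hyp := ?_, norm_ζ := ?_, ge_le := ?_ }
  · rw [Matrix.fromBlocks_multiply, ← cx_mul, Matrix.diagonal_mul_diagonal, ← Matrix.fromBlocks_one]
    have h1 : S * (Matrix.diagonal fun l => Real.exp (κ l))
        * ((Matrix.diagonal fun l => Real.exp (-κ l)) * S.transpose) = 1 := by
      rw [Matrix.mul_assoc, ← Matrix.mul_assoc (Matrix.diagonal _), Matrix.diagonal_mul_diagonal]
      simp [← Real.exp_add, hSS]
    rw [h1]
    simp [← Complex.exp_add]
  · rw [chanProj_isLeft, Matrix.fromBlocks_multiply, Matrix.fromBlocks_multiply]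
    simp
  · rw [chanProj_isLeft, Matrix.fromBlocks_multiply, Matrix.fromBlocks_multiply]
    simp
  · rw [chanProj_isLeft, Matrix.fromBlocks_multiply]
    simpa using norm_fromBlocks_diag_le (hb (1 - g) (by linarith) heg) h0
  · rw [chanProj_isLeft, Matrix.fromBlocks_multiply]
    simpa using norm_fromBlocks_diag_le (hb' (1 - g) (by linarith) heg) h0
  · rw [chanProj_not_isLeft, Matrix.fromBlocks_multiply, ← Matrix.fromBlocks_diagonal]
    simp
  · rw [chanProj_not_isLeft, Matrix.fromBlocks_multiply, ← Matrix.fromBlocks_diagonal]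
    simp
  · rintro (i | i) hi
    · rfl
    · simp at hi
  · rintro (i | i)
    · simp
    · exact hζ i
  · rintro (i | i) (j | j) hi hj
    · simp at hi
    · simp at hi
    · simp at hj
    -- The phases of the splitting are `e^{-iη}`, the common value of `Rd` and `Ra⁻¹`; complex
    -- conjugation restores the sign in the gap.
    · refine (hge i j).trans (le_of_eq ?_)
      rw [Sum.elim_inr, Sum.elim_inr, ← Complex.exp_add, ← Complex.norm_conj]
      congr 1
      rw [map_sub, map_one, ← Complex.exp_conj]
      congr 2
      simp
      ring

lemma chanProj_submatrix {m n : Type*} [DecidableEq m] [DecidableEq n] (e : m ≃ n)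
    (h : n → Bool) : (chanProj h).submatrix e e = chanProj fun i => h (e i) := by
  rw [chanProj, Matrix.submatrix_diagonal_equiv]
  rfl

/-- Relabelling of the channels. -/
def Splitting.relabel {m n : Type*} [Fintype m] [Fintype n] [DecidableEq m] [DecidableEq n]
    {g ge : ℝ} (Sp : Splitting n g ge) (e : m ≃ n) : Splitting m g ge where
  hyp i := Sp.hyp (e i)
  Ra := Sp.Ra.submatrix e e
  Rai := Sp.Rai.submatrix e e
  Rd := Sp.Rd.submatrix e e
  ζ i := Sp.ζ (e i)
  Ra_mul_Rai := by
    rw [Matrix.submatrix_mul_equiv, Sp.Ra_mul_Rai, Matrix.submatrix_one_equiv]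
  norm_Rai := (norm_submatrix_le _ e.injective e.injective).trans Sp.norm_Rai
  norm_Rd := (norm_submatrix_le _ e.injective e.injective).trans Sp.norm_Rd
  Rd_comm := by
    rw [← chanProj_submatrix, Matrix.submatrix_mul_equiv, Matrix.submatrix_mul_equiv, Sp.Rd_comm]
  Rai_comm := by
    rw [← chanProj_submatrix, Matrix.submatrix_mul_equiv, Matrix.submatrix_mul_equiv, Sp.Rai_comm]
  norm_hyp_Rd := by
    rw [← chanProj_submatrix, Matrix.submatrix_mul_equiv]
    exact (norm_submatrix_le _ e.injective e.injective).trans Sp.norm_hyp_Rd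
  norm_Rai_hyp := by
    rw [← chanProj_submatrix, Matrix.submatrix_mul_equiv]
    exact (norm_submatrix_le _ e.injective e.injective).trans Sp.norm_Rai_hyp
  ell_Rd := by
    rw [← chanProj_submatrix e (fun i => !Sp.hyp i), Matrix.submatrix_mul_equiv, Sp.ell_Rd,
      Matrix.submatrix_diagonal_equiv]
    rfl
  Rai_ell := by
    rw [← chanProj_submatrix e (fun i => !Sp.hyp i), Matrix.submatrix_mul_equiv, Sp.Rai_ell,
      Matrix.submatrix_diagonal_equiv]
    rfl
  ζ_hyp i := Sp.ζ_hyp (e i)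
  norm_ζ i := Sp.norm_ζ (e i)
  ge_le i j := Sp.ge_le (e i) (e j)

variable {L : ℕ} {𝒯 : Matrix (Fin L ⊕ Fin L) (Fin L ⊕ Fin L) ℝ}

lemma NormalForm.gh_le_one (F : NormalForm 𝒯) : F.gh ≤ 1 := by
  rw [NormalForm.gh]
  split_ifs with h
  · exact le_rfl
  · have l : Fin F.Lh := ⟨0, Nat.pos_of_ne_zero h⟩
    refine (ciInf_le (Set.finite_range _).bddBelow l).trans ?_
    linarith [Real.exp_pos (-F.κ l)]

lemma NormalForm.gh_le (F : NormalForm 𝒯) (l : Fin F.Lh) : F.gh ≤ 1 - Real.exp (-F.κ l) := by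
  rw [NormalForm.gh, if_neg (by have := l.pos; omega)]
  exact ciInf_le (Set.finite_range _).bddBelow l

lemma NormalForm.ge_le (F : NormalForm 𝒯) (l k : Fin F.Le) :
    F.ge ≤ ‖1 - Complex.exp (Complex.I * ((F.η l + F.η k : ℝ) : ℂ))‖ := by
  rw [NormalForm.ge, if_neg (by have := l.pos; omega)]
  exact ciInf_le (f := fun p : Fin F.Le × Fin F.Le =>
    ‖1 - Complex.exp (Complex.I * ((F.η p.1 + F.η p.2 : ℝ) : ℂ))‖)
    (Set.finite_range _).bddBelow (l, k)

/-- The splitting given by a normal form. -/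
noncomputable def NormalForm.splitting (F : NormalForm 𝒯) : Splitting (Fin L) F.gh F.ge :=
  (normalSplitting F.κ F.η F.S F.S_orthogonal F.κ_pos F.gh_le_one F.gh_le F.ge_le).relabel
    F.chan.symm

/-- In each elliptic channel the rows `(1, -i)` and `(1, i)` are left eigenvectors of the rotation,
for `e^{iη}` and `e^{-iη}`; the hyperbolic channels are left untouched. -/
lemma chart_mul_normalMatrix (κ : Fin Lh → ℝ) (η : Fin Le → ℝ) (S : Matrix (Fin Lh) (Fin Lh) ℝ) :
    chart (fun i : Fin Lh ⊕ Fin Le => i.isLeft) * cx (normalMatrix κ η S)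
      = Matrix.fromBlocks
          (Matrix.fromBlocks (cx (S * Matrix.diagonal fun l => Real.exp (κ l))) 0 0
            (Matrix.diagonal fun l => Complex.exp (Complex.I * (η l : ℂ)))) 0 0
          (Matrix.fromBlocks (cx (S * Matrix.diagonal fun l => Real.exp (-κ l))) 0 0
            (Matrix.diagonal fun l => Complex.exp (-(Complex.I * (η l : ℂ)))))
        * chart (fun i : Fin Lh ⊕ Fin Le => i.isLeft) := by
  have hd : ∀ a b : ℂ, (Matrix.diagonal fun i : Fin Lh ⊕ Fin Le => if i.isLeft then a else b)
      = Matrix.fromBlocks (Matrix.diagonal fun _ => a) 0 0 (Matrix.diagonal fun _ => b) := by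
    intro a b
    rw [Matrix.fromBlocks_diagonal]
    congr 1
    funext i
    rcases i with i | i <;> rfl
  have hI := Complex.I_mul_I
  have he : ∀ i, Complex.exp (Complex.I * (η i : ℂ))
      = Complex.cos (η i) + Complex.sin (η i) * Complex.I := by
    intro i
    rw [mul_comm, Complex.exp_mul_I]
  have he' : ∀ i, Complex.exp (-(Complex.I * (η i : ℂ)))
      = Complex.cos (η i) - Complex.sin (η i) * Complex.I := by
    intro i
    rw [mul_comm, ← neg_mul, Complex.exp_mul_I, Complex.cos_neg, Complex.sin_neg]
    ring
  rw [chart, hd, hd, hd, hd, normalMatrix]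
  simp only [cx_fromBlocks, cx_diagonal, cx_neg, cx_zero, Matrix.fromBlocks_multiply,
    Matrix.fromBlocks_add, Matrix.mul_zero, Matrix.zero_mul, add_zero, zero_add,
    Matrix.diagonal_mul_diagonal, Matrix.mul_neg, Matrix.diagonal_one, Matrix.diagonal_zero,
    Matrix.one_mul, Matrix.mul_one, neg_zero, Complex.ofReal_cos, Complex.ofReal_sin]
  congr 2
  all_goals
    ext i j
    rcases eq_or_ne i j with rfl | hij
    · simp only [Matrix.add_apply, Matrix.neg_apply, Matrix.diagonal_apply_eq]
      try rw [he]
      try rw [he']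
      first
      | (ring; done)
      | linear_combination rsqrt * Complex.sin (η i) * hI
      | linear_combination -rsqrt * Complex.sin (η i) * hI
    · simp [hij]

lemma chart_relabel {m n : Type*} [DecidableEq m] [DecidableEq n] (e : m ≃ n) (h : n → Bool) :
    (chart h).submatrix (Equiv.sumCongr e e) (Equiv.sumCongr e e) = chart fun i => h (e i) := by
  ext i j
  rcases i with i | i <;> rcases j with j | j <;> simp [chart, Matrix.diagonal_apply]

lemma NormalForm.chart_mul_conj (F : NormalForm 𝒯) :
    chart F.splitting.hyp * cx (F.M * 𝒯 * F.M⁻¹)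
      = Matrix.fromBlocks F.splitting.Ra 0 0 F.splitting.Rd * chart F.splitting.hyp := by
  have h := congrArg (fun A => Matrix.submatrix A (Equiv.sumCongr F.chan.symm F.chan.symm)
    (Equiv.sumCongr F.chan.symm F.chan.symm)) (chart_mul_normalMatrix F.κ F.η F.S)
  simp only [← Matrix.submatrix_mul_equiv _ _ _ (Equiv.sumCongr F.chan.symm F.chan.symm) _,
    chart_relabel] at h
  rw [F.conj]
  refine Eq.trans ?_ (h.trans ?_)
  · rfl
  · congr 1
    ext i j
    rcases i with i | i <;> rcases j with j | j <;> rfl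

end NormalSplitting

end BlockJacobi

namespace BlockJacobi

/-! ### Perturbed transfer matrices in the chart -/

section Perturbation

variable {L : ℕ}

/-- Bounds on the unperturbed entries. -/
structure Background (V₀ T₀ : Matrix (Fin L) (Fin L) ℝ) (E K : ℝ) : Prop where
  one_le : 1 ≤ K
  V_symm : V₀.IsSymm
  T_posDef : T₀.PosDef
  norm_V : ‖V₀‖ ≤ K
  norm_T : ‖T₀‖ ≤ K
  norm_T_inv : ‖T₀⁻¹‖ ≤ K
  abs_E : |E| ≤ K

/-- Admissible entries within distance `ε` of the unperturbed ones. -/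
structure Near (V₀ T₀ : Matrix (Fin L) (Fin L) ℝ) (ε : ℝ) (V T : Matrix (Fin L) (Fin L) ℝ) :
    Prop where
  V_symm : V.IsSymm
  T_posDef : T.PosDef
  norm_V : ‖V - V₀‖ ≤ ε
  norm_T : ‖T - T₀‖ ≤ ε

variable {V₀ T₀ : Matrix (Fin L) (Fin L) ℝ} {E K ε : ℝ}

lemma isUnit_det_of_posDef {T : Matrix (Fin L) (Fin L) ℝ} (hT : T.PosDef) : IsUnit T.det :=
  isUnit_iff_ne_zero.mpr hT.det_pos.ne'

lemma norm_mul_le_mul_real {n : Type*} [Fintype n] [DecidableEq n] {A B : Matrix n n ℝ} {a b : ℝ}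
    (ha : ‖A‖ ≤ a) (hb : ‖B‖ ≤ b) : ‖A * B‖ ≤ a * b :=
  (Matrix.l2_opNorm_mul A B).trans
    (mul_le_mul ha hb (norm_nonneg _) ((norm_nonneg _).trans ha))

lemma norm_smul_one_le (E : ℝ) : ‖E • (1 : Matrix (Fin L) (Fin L) ℝ)‖ ≤ |E| := by
  rw [← Matrix.diagonal_one, ← Matrix.diagonal_smul]
  apply norm_diagonal_real_le (abs_nonneg _)
  intro i
  simp

/-- By the resolvent identity `T⁻¹ - T₀⁻¹ = -T⁻¹ (T - T₀) T₀⁻¹`. The unknown `‖T⁻¹‖` is first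
bounded by `2 K`, absorbing half of it through `ε K ≤ 1/2`. -/
lemma Near.norm_T_inv_sub (bg : Background V₀ T₀ E K) {V T : Matrix (Fin L) (Fin L) ℝ}
    (h : Near V₀ T₀ ε V T) (hε : ε * K ≤ 1 / 2) : ‖T⁻¹ - T₀⁻¹‖ ≤ 2 * K ^ 2 * ε := by
  have hu := isUnit_det_of_posDef h.T_posDef
  have hu0 := isUnit_det_of_posDef bg.T_posDef
  have hK := bg.one_le
  have hε0 : 0 ≤ ε := (norm_nonneg _).trans h.norm_V
  have key : T⁻¹ - T₀⁻¹ = -(T⁻¹ * (T - T₀) * T₀⁻¹) := by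
    rw [Matrix.mul_sub, Matrix.nonsing_inv_mul _ hu, Matrix.sub_mul, Matrix.one_mul,
      Matrix.mul_nonsing_inv_cancel_right _ _ hu0, neg_sub]
  have h1 : ‖T⁻¹ - T₀⁻¹‖ ≤ ‖T⁻¹‖ * ε * K := by
    rw [key, norm_neg]
    exact norm_mul_le_mul_real (norm_mul_le_mul_real le_rfl h.norm_T) bg.norm_T_inv
  have h2 : ‖T⁻¹‖ ≤ ‖T⁻¹ - T₀⁻¹‖ + ‖T₀⁻¹‖ := by
    have := norm_add_le (T⁻¹ - T₀⁻¹) T₀⁻¹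
    rwa [sub_add_cancel] at this
  have h3 : ‖T⁻¹‖ ≤ 2 * K := by
    nlinarith [norm_nonneg T⁻¹, bg.norm_T_inv]
  refine h1.trans ?_
  have : ‖T⁻¹‖ * (ε * K) ≤ 2 * K * (ε * K) := mul_le_mul_of_nonneg_right h3 (by positivity)
  nlinarith

lemma norm_transfer_le (bg : Background V₀ T₀ E K) : ‖transfer V₀ T₀ E‖ ≤ 4 * K ^ 2 := by
  have hK := bg.one_le
  rw [transfer]
  refine (norm_fromBlocks_le _ _ _ _).trans ?_
  have h1 : ‖E • (1 : Matrix (Fin L) (Fin L) ℝ) - V₀‖ ≤ 2 * K := by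
    refine (norm_sub_le _ _).trans ?_
    linarith [norm_smul_one_le (L := L) E, bg.abs_E, bg.norm_V]
  have h2 := norm_mul_le_mul_real h1 bg.norm_T_inv
  rw [norm_neg, norm_zero]
  nlinarith [bg.norm_T, bg.norm_T_inv]

lemma norm_transfer_sub_le (bg : Background V₀ T₀ E K) {V T : Matrix (Fin L) (Fin L) ℝ}
    (h : Near V₀ T₀ ε V T) (hε : ε * K ≤ 1 / 2) :
    ‖transfer V T E - transfer V₀ T₀ E‖ ≤ 10 * K ^ 3 * ε := by
  have hK := bg.one_le
  have hε0 : 0 ≤ ε := (norm_nonneg _).trans h.norm_V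
  have hε1 : ε ≤ K := by nlinarith
  have hTi := h.norm_T_inv_sub bg hε
  have hb : transfer V T E - transfer V₀ T₀ E
      = Matrix.fromBlocks ((E • 1 - V) * (T⁻¹ - T₀⁻¹) - (V - V₀) * T₀⁻¹) (-(T - T₀))
          (T⁻¹ - T₀⁻¹) 0 := by
    rw [transfer, transfer, sub_eq_add_neg, Matrix.fromBlocks_neg, Matrix.fromBlocks_add]
    congr 1
    · simp only [Matrix.sub_mul, Matrix.mul_sub]
      abel
    · abel
    · simp
  rw [hb]
  refine (norm_fromBlocks_le _ _ _ _).trans ?_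
  have h1 : ‖E • (1 : Matrix (Fin L) (Fin L) ℝ) - V‖ ≤ 3 * K := by
    have h3 : E • (1 : Matrix (Fin L) (Fin L) ℝ) - V = E • 1 - V₀ - (V - V₀) := by abel
    rw [h3]
    refine (norm_sub_le _ _).trans ?_
    have := norm_sub_le (E • (1 : Matrix (Fin L) (Fin L) ℝ)) V₀
    linarith [norm_smul_one_le (L := L) E, bg.abs_E, bg.norm_V, h.norm_V]
  have h2 := norm_mul_le_mul_real h1 hTi
  have h3 := norm_mul_le_mul_real h.norm_V bg.norm_T_inv
  have h4 := norm_sub_le ((E • 1 - V) * (T⁻¹ - T₀⁻¹)) ((V - V₀) * T₀⁻¹)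
  rw [norm_neg, norm_zero]
  have h5 := h.norm_T
  have k1 : K ^ 2 ≤ K ^ 3 := pow_le_pow_right₀ hK (by norm_num)
  have k2 : K ≤ K ^ 3 := le_self_pow₀ hK (by norm_num)
  have k3 : 1 ≤ K ^ 3 := one_le_pow₀ hK
  have m1 := mul_le_mul_of_nonneg_right k1 hε0
  have m2 := mul_le_mul_of_nonneg_right k2 hε0
  have m3 := mul_le_mul_of_nonneg_right k3 hε0
  nlinarith

lemma Background.transfer_mem (bg : Background V₀ T₀ E K) :
    transfer V₀ T₀ E ∈ Matrix.symplecticGroup (Fin L) ℝ :=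
  transfer_mem_symplectic E bg.V_symm bg.T_posDef

variable (F : NormalForm (transfer V₀ T₀ E))

/-- The relative perturbation `M (𝒯₀⁻¹ 𝒯 - 1) M⁻¹`, seen in the chart. -/
noncomputable def NormalForm.pert (V T : Matrix (Fin L) (Fin L) ℝ) :
    Matrix (Fin L ⊕ Fin L) (Fin L ⊕ Fin L) ℂ :=
  chart F.splitting.hyp
    * cx (F.M * ((transfer V₀ T₀ E)⁻¹ * transfer V T E - 1) * F.M⁻¹)
    * (chart F.splitting.hyp).conjTranspose

/-- The constant is `K · (4 K² · 10 K³ ε) · K`: the factor `4 K²` bounds the inverse unperturbed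
transfer matrix, `10 K³ ε` the difference of transfer matrices, the outer two factors bound `M` and
`M⁻¹`, and the chart is unitary. -/
lemma NormalForm.norm_pert_le (bg : Background V₀ T₀ E K) (hM : ‖F.M‖ ≤ K)
    {V T : Matrix (Fin L) (Fin L) ℝ} (h : Near V₀ T₀ ε V T) (hε : ε * K ≤ 1 / 2) :
    ‖F.pert V T‖ ≤ 40 * K ^ 7 * ε := by
  have hK := bg.one_le
  have h1 : (transfer V₀ T₀ E)⁻¹ * transfer V T E - 1
      = (transfer V₀ T₀ E)⁻¹ * (transfer V T E - transfer V₀ T₀ E) := by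
    rw [Matrix.mul_sub, Matrix.nonsing_inv_mul _ (SymplecticGroup.symplectic_det bg.transfer_mem)]
  have h2 := norm_mul_le_mul_real
    ((norm_inv_symplectic_le bg.transfer_mem).trans (norm_transfer_le bg))
    (norm_transfer_sub_le bg h hε)
  rw [← h1] at h2
  have h3 := norm_mul_le_mul_real (norm_mul_le_mul_real hM h2)
    ((norm_inv_symplectic_le F.M_symplectic).trans hM)
  rw [NormalForm.pert]
  refine (norm_mul_mul_conjTranspose_le (norm_chart_le _) _).trans ((norm_cx_le _).trans ?_)
  refine h3.trans (le_of_eq ?_)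
  ring

/-- The frame `C M 𝒯_k ⋯ 𝒯_1 M⁻¹ (1; i)`. -/
noncomputable def NormalForm.chartFrame (V T : ℕ → Matrix (Fin L) (Fin L) ℝ) (k : ℕ) :
    Matrix (Fin L ⊕ Fin L) (Fin L) ℂ :=
  chart F.splitting.hyp * (cx (F.M * transferProd V T E k * F.M⁻¹) * frame (Fin L))

lemma NormalForm.isUnit_det_M : IsUnit F.M.det := SymplecticGroup.symplectic_det F.M_symplectic

/-- The factorisation `𝒯 = 𝒯₀ (1 + (𝒯₀⁻¹ 𝒯 - 1))`, conjugated by `M` and the chart. The perturbation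
stands to the right of the unperturbed map, so the growth increment of a step involves the slope
before that step, which is what independence needs. -/
lemma NormalForm.chartFrame_succ (bg : Background V₀ T₀ E K)
    (V T : ℕ → Matrix (Fin L) (Fin L) ℝ) (k : ℕ) :
    F.chartFrame V T (k + 1) = Matrix.fromBlocks F.splitting.Ra 0 0 F.splitting.Rd
      * ((1 + F.pert (V k) (T k)) * F.chartFrame V T k) := by
  have hu := SymplecticGroup.symplectic_det bg.transfer_mem
  have hM := F.isUnit_det_M
  have h1 : F.M * transferProd V T E (k + 1) * F.M⁻¹
      = (F.M * transfer V₀ T₀ E * F.M⁻¹)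
        * ((1 + F.M * ((transfer V₀ T₀ E)⁻¹ * transfer (V k) (T k) E - 1) * F.M⁻¹)
          * (F.M * transferProd V T E k * F.M⁻¹)) := by
    have h2 : 1 + F.M * ((transfer V₀ T₀ E)⁻¹ * transfer (V k) (T k) E - 1) * F.M⁻¹
        = F.M * ((transfer V₀ T₀ E)⁻¹ * transfer (V k) (T k) E) * F.M⁻¹ := by
      rw [Matrix.mul_sub, Matrix.sub_mul, Matrix.mul_one, Matrix.mul_nonsing_inv _ hM]
      abel
    rw [h2, transferProd]
    simp only [Matrix.mul_assoc, Matrix.nonsing_inv_mul_cancel_left _ _ hM,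
      Matrix.mul_nonsing_inv_cancel_left _ _ hu]
  have h3 : 1 + F.pert (V k) (T k) = chart F.splitting.hyp
      * cx (1 + F.M * ((transfer V₀ T₀ E)⁻¹ * transfer (V k) (T k) E - 1) * F.M⁻¹)
      * (chart F.splitting.hyp).conjTranspose := by
    rw [cx_add, cx_one, Matrix.mul_add, Matrix.add_mul, Matrix.mul_one, chart_mul_conjTranspose]
    rfl
  rw [h3, NormalForm.chartFrame, NormalForm.chartFrame, h1, cx_mul, cx_mul (1 + _),
    Matrix.mul_assoc (cx (F.M * transfer V₀ T₀ E * F.M⁻¹)), ← Matrix.mul_assoc (chart _),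
    F.chart_mul_conj]
  generalize cx ((1 : Matrix (Fin L ⊕ Fin L) (Fin L ⊕ Fin L) ℝ) + _) = a
  generalize cx (F.M * _ * F.M⁻¹) = b
  simp only [Matrix.mul_assoc]
  rw [← Matrix.mul_assoc (chart F.splitting.hyp).conjTranspose, conjTranspose_mul_chart,
    Matrix.one_mul]

lemma conj_symplectic_mem {M A : Matrix (Fin L ⊕ Fin L) (Fin L ⊕ Fin L) ℝ}
    (hM : M ∈ Matrix.symplecticGroup (Fin L) ℝ) (hA : A ∈ Matrix.symplecticGroup (Fin L) ℝ) :
    M * A * M⁻¹ ∈ Matrix.symplecticGroup (Fin L) ℝ :=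
  Submonoid.mul_mem _ (Submonoid.mul_mem _ hM hA) (inv_mem_symplectic hM)

lemma cx_J {n : Type*} [DecidableEq n] : cx (Matrix.J n ℝ) = Matrix.J n ℂ :=
  Matrix.map_J n Complex.ofRealHom

/-- A real symplectic `A` preserves the Hermitian form `i J`, so the frame keeps its positive value
`2` along the whole chain. All positivity statements on slopes come from this. -/
lemma frame_form_of_symplectic {n : Type*} [Fintype n] [DecidableEq n]
    {A : Matrix (n ⊕ n) (n ⊕ n) ℝ} (hA : A ∈ Matrix.symplecticGroup n ℝ) :
    (cx A * frame n).conjTranspose * (Complex.I • Matrix.J n ℂ) * (cx A * frame n)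
      = (2 : ℂ) • 1 := by
  have h := congrArg cx (SymplecticGroup.mem_iff'.mp hA)
  rw [cx_mul, cx_mul, cx_J, ← cx_conjTranspose] at h
  rw [← frame_form, Matrix.conjTranspose_mul]
  calc _ = (frame n).conjTranspose
        * (Complex.I • ((cx A).conjTranspose * Matrix.J n ℂ * cx A)) * frame n := by
        simp only [Matrix.mul_assoc, Matrix.mul_smul, Matrix.smul_mul]
    _ = _ := by rw [h]

lemma NormalForm.chartFrame_form {V T : ℕ → Matrix (Fin L) (Fin L) ℝ}
    (hV : ∀ n, (V n).IsSymm) (hT : ∀ n, (T n).PosDef) (k : ℕ) :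
    (F.chartFrame V T k).conjTranspose * kreinMatrix F.splitting.hyp * F.chartFrame V T k
      = (2 : ℂ) • 1 := by
  have h := frame_form_of_symplectic
    (conj_symplectic_mem F.M_symplectic (transferProd_mem_symplectic E hV hT k))
  rw [← conjTranspose_mul_kreinMatrix_mul F.splitting.hyp] at h
  rw [NormalForm.chartFrame, Matrix.conjTranspose_mul]
  simpa only [Matrix.mul_assoc] using h

/-- In the elliptic channels the Cayley rotation sends `(1; i)` to the centre of the disc, so the
lower half vanishes there. The initial slope is therefore `i` times the hyperbolic projection,
within the invariant region. -/
lemma chart_mul_frame {n : Type*} [Fintype n] [DecidableEq n] (h : n → Bool) :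
    chart h * frame n = Matrix.fromRows (Matrix.diagonal fun i => if h i then 1 else 2 * rsqrt)
      (Complex.I • chanProj h) := by
  rw [chart, frame, Matrix.fromBlocks_mul_fromRows]
  have hI := Complex.I_mul_I
  congr 1
  all_goals
    ext i j
    rcases eq_or_ne i j with rfl | hij
    · cases hi : h i <;> simp [chanProj, hi]
      all_goals first | linear_combination -rsqrt * hI | linear_combination rsqrt * hI
    · simp [chanProj, hij]

lemma NormalForm.chartFrame_zero (V T : ℕ → Matrix (Fin L) (Fin L) ℝ) :
    F.chartFrame V T 0
      = Matrix.fromRows (Matrix.diagonal fun i => if F.splitting.hyp i then 1 else 2 * rsqrt)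
          (Complex.I • chanProj F.splitting.hyp) := by
  rw [NormalForm.chartFrame, transferProd, Matrix.mul_one,
    Matrix.mul_nonsing_inv _ F.isUnit_det_M, cx_one, Matrix.one_mul, chart_mul_frame]

lemma isUnit_det_initial {n : Type*} [Fintype n] [DecidableEq n] (h : n → Bool) :
    IsUnit (Matrix.diagonal fun i => if h i then 1 else 2 * rsqrt : Matrix n n ℂ).det := by
  rw [Matrix.det_diagonal, isUnit_iff_ne_zero, Finset.prod_ne_zero_iff]
  intro i _
  split_ifs
  · exact one_ne_zero
  · exact mul_ne_zero two_ne_zero rsqrt_ne_zero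

lemma initial_slope {n : Type*} [Fintype n] [DecidableEq n] (h : n → Bool) :
    (Complex.I • chanProj h) * (Matrix.diagonal fun i => if h i then 1 else 2 * rsqrt)⁻¹
      = Complex.I • chanProj h := by
  have h1 : Complex.I • chanProj h
      = Complex.I • chanProj h * (Matrix.diagonal fun i => if h i then 1 else 2 * rsqrt) := by
    rw [chanProj, Matrix.smul_mul, Matrix.diagonal_mul_diagonal]
    congr 2
    funext i
    cases h i <;> simp
  conv_lhs => rw [h1]
  exact Matrix.mul_nonsing_inv_cancel_right _ _ (isUnit_det_initial h)

/-- The trajectory of frames generated by a sequence of entries near the unperturbed ones. -/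
noncomputable def NormalForm.trajectory (bg : Background V₀ T₀ E K) (hM : ‖F.M‖ ≤ K)
    {V T : ℕ → Matrix (Fin L) (Fin L) ℝ} (h : ∀ n, Near V₀ T₀ ε (V n) (T n))
    (hε : ε * K ≤ 1 / 2) : Trajectory F.splitting (40 * K ^ 7 * ε) where
  D11 k := (F.pert (V k) (T k)).toBlocks₁₁
  D12 k := (F.pert (V k) (T k)).toBlocks₁₂
  D21 k := (F.pert (V k) (T k)).toBlocks₂₁
  D22 k := (F.pert (V k) (T k)).toBlocks₂₂
  x k := (F.chartFrame V T k).toRows₁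
  y k := (F.chartFrame V T k).toRows₂
  norm_D11 k := (norm_toBlocks₁₁_le _).trans (F.norm_pert_le bg hM (h k) hε)
  norm_D12 k := (norm_toBlocks₁₂_le _).trans (F.norm_pert_le bg hM (h k) hε)
  norm_D21 k := (norm_toBlocks₂₁_le _).trans (F.norm_pert_le bg hM (h k) hε)
  norm_D22 k := (norm_toBlocks₂₂_le _).trans (F.norm_pert_le bg hM (h k) hε)
  x_succ k := by
    rw [F.chartFrame_succ bg]
    conv_lhs => rw [← Matrix.fromBlocks_toBlocks (F.pert (V k) (T k)),
      ← Matrix.fromRows_toRows (F.chartFrame V T k), ← Matrix.fromBlocks_one,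
      Matrix.fromBlocks_add, Matrix.fromBlocks_mul_fromRows, Matrix.fromBlocks_mul_fromRows]
    simp
  y_succ k := by
    rw [F.chartFrame_succ bg]
    conv_lhs => rw [← Matrix.fromBlocks_toBlocks (F.pert (V k) (T k)),
      ← Matrix.fromRows_toRows (F.chartFrame V T k), ← Matrix.fromBlocks_one,
      Matrix.fromBlocks_add, Matrix.fromBlocks_mul_fromRows, Matrix.fromBlocks_mul_fromRows]
    simp
  x_unit := by
    rw [F.chartFrame_zero, Matrix.toRows₁_fromRows]
    exact isUnit_det_initial _
  init_row := by
    rw [F.chartFrame_zero, Matrix.toRows₁_fromRows, Matrix.toRows₂_fromRows, initial_slope,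
      Matrix.mul_smul, chanProj_mul_self, norm_smul, Complex.norm_I, one_mul]
    exact norm_chanProj_le _
  init_col := by
    rw [F.chartFrame_zero, Matrix.toRows₁_fromRows, Matrix.toRows₂_fromRows, initial_slope,
      Matrix.smul_mul, chanProj_mul_self, norm_smul, Complex.norm_I, one_mul]
    exact norm_chanProj_le _
  pos k v := by
    have h1 := F.chartFrame_form (fun n => (h n).V_symm) (fun n => (h n).T_posDef) k
    have h2 := krein_eq F.splitting.hyp ((F.chartFrame V T k).mulVec v)
    have h3 : star ((F.chartFrame V T k).mulVec v) ⬝ᵥ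
        (kreinMatrix F.splitting.hyp).mulVec ((F.chartFrame V T k).mulVec v)
        = 2 * (star v ⬝ᵥ v) := by
      rw [Matrix.star_mulVec, ← Matrix.dotProduct_mulVec, Matrix.mulVec_mulVec,
        Matrix.mulVec_mulVec, h1, Matrix.smul_mulVec, Matrix.one_mulVec, dotProduct_smul,
        smul_eq_mul]
    have h4 : ((F.chartFrame V T k).mulVec v) ∘ Sum.inl = (F.chartFrame V T k).toRows₁.mulVec v :=
      rfl
    have h5 : ((F.chartFrame V T k).mulVec v) ∘ Sum.inr = (F.chartFrame V T k).toRows₂.mulVec v :=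
      rfl
    rw [h4, h5, h3] at h2
    rw [h2, Complex.mul_re]
    have h6 := re_star_dotProduct_self_eq_norm_sq v
    simp only [Complex.re_ofNat, Complex.im_ofNat, zero_mul, sub_zero, h6]
    positivity

end Perturbation

end BlockJacobi

namespace BlockJacobi

/-! ### Growth of the exterior power along a trajectory -/

section Growth

variable {L : ℕ}

/-- A real-linear map commuting with the complex structure splits into its complex-linear part and
the conjugate; two unipotent factors make the block matrix triangular. -/
lemma det_fromBlocks_rotation {n : Type*} [Fintype n] [DecidableEq n] (p q : Matrix n n ℂ) :
    (Matrix.fromBlocks p q (-q) p).det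
      = (p + Complex.I • q).det * (p - Complex.I • q).det := by
  have hI := Complex.I_mul_I
  have h : Matrix.fromBlocks 1 0 (-(Complex.I • 1)) 1 * Matrix.fromBlocks p q (-q) p
      * Matrix.fromBlocks 1 0 (Complex.I • 1) 1
      = Matrix.fromBlocks (p + Complex.I • q) q 0 (p - Complex.I • q) := by
    rw [Matrix.fromBlocks_multiply, Matrix.fromBlocks_multiply]
    congr 1
    · simp
    · simp
    · simp only [Matrix.mul_one, Matrix.one_mul, Matrix.neg_mul, Matrix.smul_mul, Matrix.mul_smul,
        Matrix.add_mul, smul_add, smul_neg, smul_smul, hI]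
      simp
    · simp only [Matrix.mul_zero, zero_add, Matrix.mul_one, Matrix.one_mul, Matrix.neg_mul,
        Matrix.smul_mul]
      abel
  have h2 := congrArg Matrix.det h
  rw [Matrix.det_mul, Matrix.det_mul, Matrix.det_fromBlocks_zero₁₂, Matrix.det_fromBlocks_zero₁₂,
    Matrix.det_fromBlocks_zero₂₁] at h2
  simpa using h2

/-- For symplectic `A` one has `1 + Aᵀ A = Aᵀ (A - J A J)`, and the second factor is of the form
`[[p, q], [-q, p]]`. Its determinant is `|det (p + i q)|²`, and `p + i q` is exactly the compression
of `A` to the frame `(1; i)`. -/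
lemma det_one_add_transpose_mul_self {n : Type*} [Fintype n] [DecidableEq n]
    {A : Matrix (n ⊕ n) (n ⊕ n) ℝ} (hA : A ∈ Matrix.symplecticGroup n ℝ) :
    (1 + A.transpose * A).det = ‖((frame n).conjTranspose * (cx A * frame n)).det‖ ^ 2 := by
  set p := A.toBlocks₁₁ + A.toBlocks₂₂ with hp
  set q := A.toBlocks₁₂ - A.toBlocks₂₁ with hq
  have hJ := SymplecticGroup.mem_iff'.mp hA
  have hd : A.det = 1 := SymplecticGroup.det_eq_one hA
  have hJd : (Matrix.J n ℝ).det = 1 := SymplecticGroup.det_eq_one (SymplecticGroup.J_mem n ℝ)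
  have h1 : A.transpose * (A - Matrix.J n ℝ * A * Matrix.J n ℝ)
      = (1 + A.transpose * A) := by
    have h2 : A.transpose * (Matrix.J n ℝ * A * Matrix.J n ℝ) = -1 := by
      rw [← Matrix.mul_assoc, ← Matrix.mul_assoc, hJ, Matrix.J_squared]
    rw [Matrix.mul_sub, h2]
    abel
  have h2 : A - Matrix.J n ℝ * A * Matrix.J n ℝ = Matrix.fromBlocks p q (-q) p := by
    conv_lhs => rw [← Matrix.fromBlocks_toBlocks A]
    rw [Matrix.J, Matrix.fromBlocks_multiply, Matrix.fromBlocks_multiply, sub_eq_add_neg,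
      Matrix.fromBlocks_neg, Matrix.fromBlocks_add]
    congr 1
    · simp [hp]
    · simp [hq, sub_eq_add_neg]
    · simp [hq]
      abel
    · simp [hp]
      abel
  have h3 : (frame n).conjTranspose * (cx A * frame n) = cx p + Complex.I • cx q := by
    conv_lhs => rw [← Matrix.fromBlocks_toBlocks A]
    rw [frame, cx_fromBlocks, Matrix.fromBlocks_mul_fromRows,
      Matrix.conjTranspose_fromRows_eq_fromCols_conjTranspose, Matrix.fromCols_mul_fromRows, hp, hq,
      cx_add, cx_sub]
    have hI := Complex.I_mul_I
    simp only [Matrix.conjTranspose_smul, Matrix.conjTranspose_one, Matrix.one_mul, Matrix.mul_one,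
      Matrix.mul_smul, Matrix.smul_mul, smul_add, smul_smul, RCLike.star_def, Complex.conj_I,
      neg_mul, hI, neg_neg, one_smul, smul_sub]
    ext i j
    simp
    ring
  have h4 : (cx p - Complex.I • cx q) = (cx p + Complex.I • cx q).map star := by
    ext i j
    simp [sub_eq_add_neg]
  have h5 : (cx p - Complex.I • cx q).det = star (cx p + Complex.I • cx q).det := by
    rw [h4]
    exact (RingHom.map_det (starRingEnd ℂ) (cx p + Complex.I • cx q)).symm
  have h6 : (((1 + A.transpose * A).det : ℝ) : ℂ)
      = ((‖((frame n).conjTranspose * (cx A * frame n)).det‖ ^ 2 : ℝ) : ℂ) := by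
    rw [← h1, Matrix.det_mul, Matrix.det_transpose, hd, one_mul, h2, ← cx_det, cx_fromBlocks,
      cx_neg, det_fromBlocks_rotation, h5, h3, RCLike.star_def, Complex.mul_conj,
      Complex.normSq_eq_norm_sq]
  exact_mod_cast h6

/-- The standing smallness assumptions. -/
structure NormalForm.Regime {V₀ T₀ : Matrix (Fin L) (Fin L) ℝ} {E : ℝ}
    (F : NormalForm (transfer V₀ T₀ E)) (K ε : ℝ) : Prop where
  bg : Background V₀ T₀ E K
  norm_M : ‖F.M‖ ≤ K
  gh_pos : 0 < F.gh
  ge_pos : 0 < F.ge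
  ε_nonneg : 0 ≤ ε
  ε_mul_le : ε * K ≤ 1 / 2
  gap : 36 * (40 * K ^ 7 * ε) ≤ F.gh

variable {V₀ T₀ : Matrix (Fin L) (Fin L) ℝ} {E K ε : ℝ} {F : NormalForm (transfer V₀ T₀ E)}

namespace NormalForm.Regime

variable (H : F.Regime K ε)

lemma δ_nonneg (H : F.Regime K ε) : 0 ≤ 40 * K ^ 7 * ε := by
  have := H.bg.one_le
  have := H.ε_nonneg
  positivity

variable {V T : ℕ → Matrix (Fin L) (Fin L) ℝ}

/-- The trajectory of a sequence of entries. -/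
noncomputable def traj (h : ∀ n, Near V₀ T₀ ε (V n) (T n)) :
    Trajectory F.splitting (40 * K ^ 7 * ε) :=
  F.trajectory H.bg H.norm_M h H.ε_mul_le

lemma norm_W_le (h : ∀ n, Near V₀ T₀ ε (V n) (T n)) (k : ℕ) : ‖(H.traj h).W k‖ ≤ 5 :=
  (H.traj h).norm_W_le H.gh_pos F.gh_le_one H.δ_nonneg H.gap k

lemma norm_X_le (h : ∀ n, Near V₀ T₀ ε (V n) (T n)) (k : ℕ) :
    ‖(H.traj h).X k‖ ≤ 6 * (40 * K ^ 7 * ε) :=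
  (H.traj h).norm_X_le' H.gh_pos F.gh_le_one H.δ_nonneg H.gap k

lemma norm_X_le_sixth (h : ∀ n, Near V₀ T₀ ε (V n) (T n)) (k : ℕ) :
    ‖(H.traj h).X k‖ ≤ 1 / 6 := by
  have h1 := H.norm_X_le h k
  have h2 := H.gap
  have h3 := F.gh_le_one
  linarith

lemma isUnit_x (h : ∀ n, Near V₀ T₀ ε (V n) (T n)) (k : ℕ) : IsUnit ((H.traj h).x k).det :=
  (H.traj h).isUnit_x H.gh_pos F.gh_le_one H.δ_nonneg H.gap k

lemma det_x (h : ∀ n, Near V₀ T₀ ε (V n) (T n)) (N : ℕ) : ((H.traj h).x N).det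
    = F.splitting.Ra.det ^ N * (∏ k ∈ Finset.range N, (1 + (H.traj h).X k).det)
      * ((H.traj h).x 0).det :=
  (H.traj h).det_x H.gh_pos F.gh_le_one H.δ_nonneg H.gap N

lemma norm_logDet_sub_trace_le (h : ∀ n, Near V₀ T₀ ε (V n) (T n)) (k : ℕ) :
    ‖logDet (1 + (H.traj h).X k) - ((H.traj h).X k).trace‖ ≤ L * (36 * (40 * K ^ 7 * ε) ^ 2) := by
  have h1 := norm_logDet_one_add_sub_trace_le (X := (H.traj h).X k)
    ((H.norm_X_le_sixth h k).trans (by norm_num))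
  rw [Fintype.card_fin] at h1
  refine h1.trans (mul_le_mul_of_nonneg_left ?_ (Nat.cast_nonneg L))
  have h2 := pow_le_pow_left₀ (norm_nonneg _) (H.norm_X_le h k) 2
  linarith

lemma norm_sum_logDet_sub_trace_le (h : ∀ n, Near V₀ T₀ ε (V n) (T n)) (N : ℕ) :
    ‖∑ k ∈ Finset.range N, logDet (1 + (H.traj h).X k)
      - ∑ k ∈ Finset.range N, ((H.traj h).X k).trace‖ ≤ N * (L * (36 * (40 * K ^ 7 * ε) ^ 2)) := by
  rw [← Finset.sum_sub_distrib]
  refine (norm_sum_le _ _).trans ?_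
  calc _ ≤ ∑ _k ∈ Finset.range N, (L * (36 * (40 * K ^ 7 * ε) ^ 2)) :=
        Finset.sum_le_sum fun k _ => H.norm_logDet_sub_trace_le h k
    _ = _ := by rw [Finset.sum_const, Finset.card_range, nsmul_eq_mul]

lemma exp_logDet_one_add_X (h : ∀ n, Near V₀ T₀ ε (V n) (T n)) (k : ℕ) :
    Complex.exp (logDet (1 + (H.traj h).X k)) = (1 + (H.traj h).X k).det :=
  exp_logDet (slitSpec_one_add ((H.norm_X_le_sixth h k).trans_lt (by norm_num)))

lemma x_zero (h : ∀ n, Near V₀ T₀ ε (V n) (T n)) : (H.traj h).x 0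
    = Matrix.diagonal fun i => if F.splitting.hyp i then 1 else 2 * rsqrt := by
  change (F.chartFrame V T 0).toRows₁ = _
  rw [F.chartFrame_zero, Matrix.toRows₁_fromRows]

lemma log_norm_det_x (h : ∀ n, Near V₀ T₀ ε (V n) (T n)) (N : ℕ) :
    Real.log ‖((H.traj h).x N).det‖ = N * Real.log ‖F.splitting.Ra.det‖
      + (∑ k ∈ Finset.range N, logDet (1 + (H.traj h).X k)).re
      + Real.log ‖(Matrix.diagonal fun i => if F.splitting.hyp i then 1 else 2 * rsqrt :
          Matrix (Fin L) (Fin L) ℂ).det‖ := by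
  have hRa : F.splitting.Ra.det ≠ 0 := Trajectory.isUnit_det_Ra.ne_zero
  have h0 := (isUnit_det_initial F.splitting.hyp).ne_zero
  rw [H.det_x, H.x_zero, norm_mul, norm_mul, norm_pow]
  simp only [← H.exp_logDet_one_add_X]
  rw [← Complex.exp_sum, Complex.norm_exp, Real.log_mul (by positivity) (by positivity),
    Real.log_mul (by positivity) (by positivity), Real.log_exp, Real.log_pow]

/-- For the conjugated product, `‖Λ^L A‖²` is at most `det (1 + Aᵀ A)`, which is the squared modulus
of the determinant of its compression to the frame. In the chart this compression is `(D* + (i P)*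
W_N) x_N`, and the first factor has norm at most `2 + 5 = 7`. -/
lemma norm_extPower_le (h : ∀ n, Near V₀ T₀ ε (V n) (T n)) (N : ℕ) :
    ‖extPower (transferProd V T E N)‖
      ≤ ‖extPower F.M⁻¹‖ * (7 ^ L * ‖((H.traj h).x N).det‖) * ‖extPower F.M‖ := by
  set A := F.M * transferProd V T E N * F.M⁻¹ with hA
  have hM := F.isUnit_det_M
  have hsym : A ∈ Matrix.symplecticGroup (Fin L) ℝ := conj_symplectic_mem F.M_symplectic
    (transferProd_mem_symplectic E (fun n => (h n).V_symm) (fun n => (h n).T_posDef) N)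
  have h1 : transferProd V T E N = F.M⁻¹ * A * F.M := by
    rw [hA, Matrix.mul_assoc F.M, Matrix.nonsing_inv_mul_cancel_left _ _ hM,
      Matrix.nonsing_inv_mul_cancel_right _ _ hM]
  have h2 : ‖extPower A‖ ≤ ‖((frame (Fin L)).conjTranspose * (cx A * frame (Fin L))).det‖ := by
    refine (sq_le_sq₀ (norm_nonneg _) (norm_nonneg _)).mp ?_
    rw [← det_one_add_transpose_mul_self hsym]
    exact norm_extPower_sq_le A
  set D : Matrix (Fin L) (Fin L) ℂ :=
    Matrix.diagonal fun i => if F.splitting.hyp i then 1 else 2 * rsqrt with hD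
  have h3 : (frame (Fin L)).conjTranspose * (cx A * frame (Fin L))
      = (D.conjTranspose + (Complex.I • chanProj F.splitting.hyp).conjTranspose * (H.traj h).W N)
        * (H.traj h).x N := by
    have h4 : cx A * frame (Fin L)
        = (chart F.splitting.hyp).conjTranspose * F.chartFrame V T N := by
      rw [NormalForm.chartFrame, ← Matrix.mul_assoc, conjTranspose_mul_chart, Matrix.one_mul]
    have h5 : F.chartFrame V T N = Matrix.fromRows ((H.traj h).x N) ((H.traj h).y N) :=
      (Matrix.fromRows_toRows _).symm
    have h6 : (H.traj h).y N = (H.traj h).W N * (H.traj h).x N := by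
      rw [Trajectory.W, Matrix.nonsing_inv_mul_cancel_right _ _ (H.isUnit_x h N)]
    rw [h4, ← Matrix.mul_assoc, ← Matrix.conjTranspose_mul, chart_mul_frame, h5,
      Matrix.conjTranspose_fromRows_eq_fromCols_conjTranspose, Matrix.fromCols_mul_fromRows,
      Matrix.add_mul, Matrix.mul_assoc _ ((H.traj h).W N), ← h6]
  have hDn : ‖D‖ ≤ 2 := by
    apply norm_diagonal_le zero_le_two
    intro i
    split_ifs
    · norm_num
    · have h7 : ‖rsqrt‖ ≤ 1 := by
        have h8 := congrArg norm rsqrt_mul_self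
        rw [norm_mul] at h8
        norm_num at h8
        nlinarith [norm_nonneg rsqrt]
      rw [norm_mul]
      norm_num
      linarith
  have hPn : ‖(Complex.I • chanProj F.splitting.hyp).conjTranspose‖ ≤ 1 := by
    rw [Matrix.l2_opNorm_conjTranspose, norm_smul, Complex.norm_I, one_mul]
    exact norm_chanProj_le _
  have h7 : ‖D.conjTranspose
      + (Complex.I • chanProj F.splitting.hyp).conjTranspose * (H.traj h).W N‖ ≤ 7 := by
    refine (norm_add_le _ _).trans ?_
    have := Trajectory.norm_mul_le_mul hPn (H.norm_W_le h N)
    rw [Matrix.l2_opNorm_conjTranspose]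
    linarith
  have h8 : ‖extPower A‖ ≤ 7 ^ L * ‖((H.traj h).x N).det‖ := by
    refine h2.trans ?_
    rw [h3, Matrix.det_mul, norm_mul]
    gcongr
    refine (norm_det_le _).trans ?_
    rw [Fintype.card_fin]
    gcongr
  rw [h1, extPower_mul, extPower_mul]
  refine (Matrix.l2_opNorm_mul _ _).trans ?_
  gcongr
  refine (Matrix.l2_opNorm_mul _ _).trans ?_
  gcongr

/-- The converse comparison: `x_N` is the upper left block of the product padded with zero columns,
hence its determinant is an entry of an exterior power, which is multiplicative. -/
lemma norm_det_x_le (h : ∀ n, Near V₀ T₀ ε (V n) (T n)) (N : ℕ) :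
    ‖((H.traj h).x N).det‖ ≤ ‖wedgeBlock (chart F.splitting.hyp * cx F.M)‖
      * ‖extPower (transferProd V T E N)‖
      * ‖wedgeBlock (cx F.M⁻¹ * Matrix.fromBlocks 1 0 (Complex.I • 1) 0)‖ := by
  have h1 : (H.traj h).x N = (chart F.splitting.hyp * cx F.M * cx (transferProd V T E N)
      * (cx F.M⁻¹ * Matrix.fromBlocks 1 0 (Complex.I • 1) 0)).toBlocks₁₁ := by
    have h2 : (Matrix.fromBlocks 1 0 (Complex.I • 1) 0 :
        Matrix (Fin L ⊕ Fin L) (Fin L ⊕ Fin L) ℂ) = Matrix.fromCols (frame (Fin L)) 0 := by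
      ext i j
      rcases i with i | i <;> rcases j with j | j <;> rfl
    have h3 : chart F.splitting.hyp * cx F.M * cx (transferProd V T E N)
        * (cx F.M⁻¹ * Matrix.fromBlocks 1 0 (Complex.I • 1) 0)
        = Matrix.fromCols (F.chartFrame V T N) 0 := by
      rw [h2, NormalForm.chartFrame, cx_mul, cx_mul]
      simp only [Matrix.mul_assoc, Matrix.mul_fromCols, Matrix.mul_zero]
    rw [h3]
    change (F.chartFrame V T N).toRows₁ = _
    ext i j
    rfl
  have h2 := norm_det_toBlocks₁₁_le (chart F.splitting.hyp * cx F.M * cx (transferProd V T E N)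
      * (cx F.M⁻¹ * Matrix.fromBlocks 1 0 (Complex.I • 1) 0))
  rw [← h1, wedgeBlock_mul, wedgeBlock_mul (chart F.splitting.hyp * cx F.M), ← extPower_eq] at h2
  exact h2.trans ((Matrix.l2_opNorm_mul _ _).trans
    (mul_le_mul_of_nonneg_right (Matrix.l2_opNorm_mul _ _) (norm_nonneg _)))

end NormalForm.Regime

lemma abs_sub_sub_le_of_comparison {u x r s y p q e n : ℝ} (h₁ : x ≤ p + u) (h₂ : u ≤ q + x)
    (h₃ : x = r + s + e) (h₄ : |s - y| ≤ n) : |u - r - y| ≤ |p| + |q| + |e| + n := by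
  obtain ⟨h5, h6⟩ := abs_le.mp h₄
  have := neg_abs_le p
  have := le_abs_self p
  have := neg_abs_le q
  have := le_abs_self q
  have := neg_abs_le e
  have := le_abs_self e
  rw [abs_le]
  constructor <;> linarith

/-- Along every sequence of entries near the unperturbed ones, `log ‖Λ^L (𝒯_N ⋯ 𝒯_1)‖` is given to
first order by the traces of the growth increments. -/
theorem NormalForm.exists_abs_log_norm_extPower_sub_le (F : NormalForm (transfer V₀ T₀ E)) :
    ∃ c : ℝ, 0 ≤ c ∧ ∀ {K ε : ℝ} (H : F.Regime K ε) {V T : ℕ → Matrix (Fin L) (Fin L) ℝ}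
      (h : ∀ n, Near V₀ T₀ ε (V n) (T n)) (N : ℕ),
      ‖extPower (transferProd V T E N)‖ ≠ 0 ∧
      |Real.log ‖extPower (transferProd V T E N)‖ - N * Real.log ‖F.splitting.Ra.det‖
        - (∑ k ∈ Finset.range N, ((H.traj h).X k).trace).re|
        ≤ c + N * (L * (36 * (40 * K ^ 7 * ε) ^ 2)) := by
  -- The added `1`s only make the constants positive so that logarithms can be taken. These
  -- constants may depend badly on `L`, but not on `N`, and so they vanish in the limit.
  obtain ⟨a, ha⟩ : ∃ a, a = ‖wedgeBlock (chart F.splitting.hyp * cx F.M)‖ + 1 := ⟨_, rfl⟩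
  obtain ⟨b, hb⟩ : ∃ b, b = ‖wedgeBlock (cx F.M⁻¹
    * (Matrix.fromBlocks 1 0 (Complex.I • 1) 0 : Matrix (Fin L ⊕ Fin L) (Fin L ⊕ Fin L) ℂ))‖ + 1 :=
    ⟨_, rfl⟩
  obtain ⟨d, hd⟩ : ∃ d, d = (‖extPower F.M⁻¹‖ + 1) * 7 ^ L * (‖extPower F.M‖ + 1) := ⟨_, rfl⟩
  obtain ⟨e, he⟩ : ∃ e, e = Real.log ‖(Matrix.diagonal fun i =>
    if F.splitting.hyp i then 1 else 2 * rsqrt : Matrix (Fin L) (Fin L) ℂ).det‖ := ⟨_, rfl⟩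
  have ha0 : 0 < a := by rw [ha]; positivity
  have hb0 : 0 < b := by rw [hb]; positivity
  have hd0 : 0 < d := by rw [hd]; positivity
  refine ⟨|Real.log (a * b)| + |Real.log d| + |e|, by positivity, ?_⟩
  intro K ε H V T h N
  have hx0 : 0 < ‖((H.traj h).x N).det‖ := norm_pos_iff.mpr (H.isUnit_x h N).ne_zero
  have h1 : ‖((H.traj h).x N).det‖ ≤ a * b * ‖extPower (transferProd V T E N)‖ := by
    refine (H.norm_det_x_le h N).trans ?_
    rw [mul_right_comm]
    exact mul_le_mul_of_nonneg_right (mul_le_mul (ha ▸ (lt_add_one _).le)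
      (hb ▸ (lt_add_one _).le) (norm_nonneg _) ha0.le) (norm_nonneg _)
  have h2 : ‖extPower (transferProd V T E N)‖ ≤ d * ‖((H.traj h).x N).det‖ := by
    refine (H.norm_extPower_le h N).trans ?_
    have : d * ‖((H.traj h).x N).det‖ = (‖extPower F.M⁻¹‖ + 1)
        * (7 ^ L * ‖((H.traj h).x N).det‖) * (‖extPower F.M‖ + 1) := by
      rw [hd]; ring
    rw [this]
    refine mul_le_mul (mul_le_mul_of_nonneg_right (lt_add_one _).le ?_) (lt_add_one _).le
      (norm_nonneg _) ?_ <;> positivity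
  have hpos : 0 < ‖extPower (transferProd V T E N)‖ := by
    by_contra hn
    have : ‖extPower (transferProd V T E N)‖ = 0 := le_antisymm (not_lt.mp hn) (norm_nonneg _)
    rw [this, mul_zero] at h1
    linarith
  refine ⟨hpos.ne', ?_⟩
  have h3 := Real.log_le_log hx0 h1
  have h4 := Real.log_le_log hpos h2
  rw [Real.log_mul (mul_pos ha0 hb0).ne' hpos.ne'] at h3
  rw [Real.log_mul hd0.ne' hx0.ne'] at h4
  have h5 := H.log_norm_det_x h N
  rw [← he] at h5
  have h6 := (Complex.abs_re_le_norm _).trans (H.norm_sum_logDet_sub_trace_le h N)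
  rw [Complex.sub_re] at h6
  exact abs_sub_sub_le_of_comparison h3 h4 h5 h6

end Growth

end BlockJacobi

namespace BlockJacobi

/-! ### Lagrangian frames and the Siegel half space -/

section Siegel

variable {n : Type*} [Fintype n] [DecidableEq n]

/-- Matrices with positive definite imaginary part. -/
def SiegelPos (Z : Matrix n n ℂ) : Prop := ∀ w : n → ℂ, w ≠ 0 → 0 < (star w ⬝ᵥ Z.mulVec w).im

lemma form_fromRows (a b : n → ℂ) :
    star (Sum.elim a b) ⬝ᵥ (Complex.I • Matrix.J n ℂ).mulVec (Sum.elim a b)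
      = ((2 * (star a ⬝ᵥ b).im : ℝ) : ℂ) := by
  have hz : star (Sum.elim a b) = Sum.elim (star a) (star b) := by
    funext i; rcases i with i | i <;> rfl
  have h1 : star b ⬝ᵥ a = star (star a ⬝ᵥ b) := by
    rw [← Matrix.star_dotProduct]
  rw [Matrix.J, Matrix.fromBlocks_smul, Matrix.fromBlocks_mulVec, hz, sumElim_dotProduct_sumElim]
  simp only [Sum.elim_comp_inl, Sum.elim_comp_inr, smul_zero, Matrix.zero_mulVec, zero_add,
    add_zero, Matrix.smul_mulVec, Matrix.neg_mulVec, Matrix.one_mulVec, dotProduct_smul,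
    dotProduct_neg, smul_eq_mul, h1]
  apply Complex.ext <;> simp
  ring

variable {G : Matrix (n ⊕ n) n ℂ}

lemma mulVec_fromRows_elim (G : Matrix (n ⊕ n) n ℂ) (v : n → ℂ) :
    G.mulVec v = Sum.elim (G.toRows₁.mulVec v) (G.toRows₂.mulVec v) := by
  funext i
  rcases i with i | i <;> rfl

lemma im_toRows_dotProduct
    (hG : G.conjTranspose * (Complex.I • Matrix.J n ℂ) * G = (2 : ℂ) • 1) (v : n → ℂ) :
    (star (G.toRows₁.mulVec v) ⬝ᵥ G.toRows₂.mulVec v).im = (star v ⬝ᵥ v).re := by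
  have h1 : star (G.mulVec v) ⬝ᵥ (Complex.I • Matrix.J n ℂ).mulVec (G.mulVec v)
      = 2 * (star v ⬝ᵥ v) := by
    rw [Matrix.star_mulVec, ← Matrix.dotProduct_mulVec, Matrix.mulVec_mulVec,
      Matrix.mulVec_mulVec, hG, Matrix.smul_mulVec, Matrix.one_mulVec, dotProduct_smul,
      smul_eq_mul]
  rw [mulVec_fromRows_elim, form_fromRows] at h1
  have h2 := congrArg Complex.re h1
  rw [Complex.ofReal_re, Complex.mul_re] at h2
  simp at h2
  exact h2

/-- A vector killed by the upper half would have form value zero, against positivity of the form on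
the frame. Hence the raw solution is invertible at every site, with no smallness assumption. -/
lemma isUnit_det_toRows₁
    (hG : G.conjTranspose * (Complex.I • Matrix.J n ℂ) * G = (2 : ℂ) • 1) :
    IsUnit G.toRows₁.det := by
  rw [isUnit_iff_ne_zero]
  intro h0
  obtain ⟨v, hv, hv0⟩ := Matrix.exists_mulVec_eq_zero_iff.mpr h0
  have h1 := im_toRows_dotProduct hG v
  rw [hv0, star_zero, zero_dotProduct, Complex.zero_im] at h1
  exact (re_star_dotProduct_self_pos hv).1.ne h1

lemma siegelPos_of_form
    (hG : G.conjTranspose * (Complex.I • Matrix.J n ℂ) * G = (2 : ℂ) • 1) :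
    SiegelPos (G.toRows₂ * (G.toRows₁)⁻¹) := by
  intro w hw
  have hu := isUnit_det_toRows₁ hG
  have h1 := im_toRows_dotProduct hG ((G.toRows₁)⁻¹.mulVec w)
  rw [Matrix.mulVec_mulVec, Matrix.mulVec_mulVec, Matrix.mul_nonsing_inv _ hu,
    Matrix.one_mulVec] at h1
  rw [h1]
  refine (re_star_dotProduct_self_pos ?_).1
  intro h0
  apply hw
  have h2 := congrArg (G.toRows₁).mulVec h0
  rwa [Matrix.mulVec_mulVec, Matrix.mul_nonsing_inv _ hu, Matrix.one_mulVec,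
    Matrix.mulVec_zero] at h2

lemma siegelPos_I : SiegelPos (Complex.I • (1 : Matrix n n ℂ)) := by
  intro w hw
  rw [Matrix.smul_mulVec, Matrix.one_mulVec, dotProduct_smul, smul_eq_mul, Complex.I_mul_im]
  exact (re_star_dotProduct_self_pos hw).1

lemma SiegelPos.segment {Z₀ Z₁ : Matrix n n ℂ} (h₀ : SiegelPos Z₀) (h₁ : SiegelPos Z₁) {t : ℝ}
    (ht : t ∈ Set.Icc (0 : ℝ) 1) : SiegelPos (Z₀ + (t : ℂ) • (Z₁ - Z₀)) := by
  intro w hw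
  have e : star w ⬝ᵥ (Z₀ + (t : ℂ) • (Z₁ - Z₀)).mulVec w
      = star w ⬝ᵥ Z₀.mulVec w + (t : ℂ) * (star w ⬝ᵥ Z₁.mulVec w - star w ⬝ᵥ Z₀.mulVec w) := by
    rw [Matrix.add_mulVec, Matrix.smul_mulVec, Matrix.sub_mulVec, dotProduct_add, dotProduct_smul,
      dotProduct_sub, smul_eq_mul]
  rw [e, Complex.add_im, Complex.im_ofReal_mul, Complex.sub_im]
  have a0 := h₀ w hw
  have a1 := h₁ w hw
  rcases eq_or_lt_of_le ht.1 with h | h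
  · rw [← h]; linarith
  · nlinarith [ht.2, mul_pos h a1, mul_nonneg (sub_nonneg.mpr ht.2) a0.le]

/-- The image under a Krein isometry of a point of the Siegel half space is a graph over the first
component. -/
lemma det_mobius_ne_zero (h : n → Bool) {B : Matrix (n ⊕ n) (n ⊕ n) ℂ}
    (hB : B.conjTranspose * kreinMatrix h * B = Complex.I • Matrix.J n ℂ) {Z : Matrix n n ℂ}
    (hZ : SiegelPos Z) : (B.toBlocks₁₁ + B.toBlocks₁₂ * Z).det ≠ 0 := by
  intro h0
  obtain ⟨w, hw, hw0⟩ := Matrix.exists_mulVec_eq_zero_iff.mpr h0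
  set z : n ⊕ n → ℂ := Sum.elim w (Z.mulVec w) with hz
  have h1 : star (B.mulVec z) ⬝ᵥ (kreinMatrix h).mulVec (B.mulVec z)
      = ((2 * (star w ⬝ᵥ Z.mulVec w).im : ℝ) : ℂ) := by
    rw [← form_fromRows, ← hz, Matrix.star_mulVec, ← Matrix.dotProduct_mulVec,
      Matrix.mulVec_mulVec, Matrix.mulVec_mulVec, hB]
  -- A kernel vector would be mapped to a vector with zero upper half. There the Krein form is
  -- `-|y_e|² ≤ 0`, while it is positive on the graph of a point of the Siegel half space.
  have h2 : (B.mulVec z) ∘ Sum.inl = 0 := by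
    rw [← hw0]
    conv_lhs => rw [← Matrix.fromBlocks_toBlocks B]
    rw [Matrix.fromBlocks_mulVec, Sum.elim_comp_inl, hz, Sum.elim_comp_inl, Sum.elim_comp_inr,
      Matrix.mulVec_mulVec, Matrix.add_mulVec]
  rw [← krein_eq, h2, krein] at h1
  have h3 := congrArg Complex.re h1
  have h4 := star_dotProduct_chanProj (fun i => !h i) ((B.mulVec z) ∘ Sum.inr)
  simp only [Matrix.mulVec_zero, dotProduct_zero, star_zero, zero_dotProduct, mul_zero, sub_zero,
    add_zero, zero_sub, Complex.neg_re, h4, Complex.ofReal_re] at h3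
  have h5 := hZ w hw
  nlinarith [sq_nonneg ‖WithLp.toLp 2 ((chanProj fun i => !h i).mulVec ((B.mulVec z) ∘ Sum.inr))‖]

/-- The Siegel half space is convex. The segment from `1` to the quotient consists of the quotients
for the points between `i` and `Z`, all nonsingular. Normalising by the value at `i` is what selects
a branch of the argument. -/
lemma slitSpec_mobius (h : n → Bool) {B : Matrix (n ⊕ n) (n ⊕ n) ℂ}
    (hB : B.conjTranspose * kreinMatrix h * B = Complex.I • Matrix.J n ℂ) {Z : Matrix n n ℂ}
    (hZ : SiegelPos Z) :
    SlitSpec ((B.toBlocks₁₁ + B.toBlocks₁₂ * Z)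
      * (B.toBlocks₁₁ + B.toBlocks₁₂ * (Complex.I • 1))⁻¹) := by
  apply slitSpec_of_segment
  intro t ht
  have hu : IsUnit (B.toBlocks₁₁ + B.toBlocks₁₂ * (Complex.I • 1)).det :=
    isUnit_iff_ne_zero.mpr (det_mobius_ne_zero h hB siegelPos_I)
  set D := B.toBlocks₁₁ + B.toBlocks₁₂ * (Complex.I • 1) with hD
  have e : 1 + (t : ℂ) • ((B.toBlocks₁₁ + B.toBlocks₁₂ * Z) * D⁻¹ - 1)
      = (B.toBlocks₁₁ + B.toBlocks₁₂ * (Complex.I • 1 + (t : ℂ) • (Z - Complex.I • 1))) * D⁻¹ := by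
    have h1 : B.toBlocks₁₁ + B.toBlocks₁₂ * (Complex.I • 1 + (t : ℂ) • (Z - Complex.I • 1))
        = D + (t : ℂ) • ((B.toBlocks₁₁ + B.toBlocks₁₂ * Z) - D) := by
      rw [hD, Matrix.mul_add, Matrix.mul_smul B.toBlocks₁₂ (t : ℂ), Matrix.mul_sub,
        add_sub_add_left_eq_sub, add_assoc]
    rw [h1]
    generalize B.toBlocks₁₁ + B.toBlocks₁₂ * Z = U
    rw [Matrix.add_mul, Matrix.smul_mul, Matrix.sub_mul, Matrix.mul_nonsing_inv _ hu]
  rw [e, Matrix.det_mul]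
  refine mul_ne_zero (det_mobius_ne_zero h hB (siegelPos_I.segment hZ ht)) ?_
  exact (Matrix.isUnit_nonsing_inv_det _ hu).ne_zero

end Siegel

/-! ### Continuity along a segment of entries -/

section Continuity

lemma continuous_matrix_inv {A n 𝕜 : Type*} [TopologicalSpace A] [Fintype n] [DecidableEq n]
    [RCLike 𝕜] {Y : A → Matrix n n 𝕜} (hY : Continuous Y) (h : ∀ a, IsUnit (Y a).det) :
    Continuous fun a => (Y a)⁻¹ := by
  simp only [Matrix.inv_def, Ring.inverse_eq_inv']
  exact (hY.matrix_det.inv₀ fun a => (h a).ne_zero).smul hY.matrix_adjugate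

variable {L : ℕ} {A : Type*} [TopologicalSpace A]

lemma continuous_transfer {V T : A → Matrix (Fin L) (Fin L) ℝ} (hV : Continuous V)
    (hT : Continuous T) (h : ∀ a, IsUnit (T a).det) (E : ℝ) :
    Continuous fun a => transfer (V a) (T a) E :=
  Continuous.matrix_fromBlocks ((continuous_const.sub hV).mul (continuous_matrix_inv hT h))
    hT.neg (continuous_matrix_inv hT h) continuous_const

lemma continuous_transferProd {V T : A → ℕ → Matrix (Fin L) (Fin L) ℝ}
    (hV : ∀ n, Continuous fun a => V a n) (hT : ∀ n, Continuous fun a => T a n)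
    (h : ∀ a n, IsUnit (T a n).det) (E : ℝ) (N : ℕ) :
    Continuous fun a => transferProd (V a) (T a) E N := by
  induction N with
  | zero => exact continuous_const
  | succ N ih => exact (continuous_transfer (hV N) (hT N) (fun a => h a N) E).mul ih

lemma continuous_hamiltonian {V T : A → ℕ → Matrix (Fin L) (Fin L) ℝ}
    (hV : ∀ n, Continuous fun a => V a n) (hT : ∀ n, Continuous fun a => T a n) (N : ℕ) :
    Continuous fun a => hamiltonian (V a) (T a) N := by
  apply continuous_matrix
  intro x y
  simp only [hamiltonian]
  split_ifs
  · exact (hV _).matrix_elem _ _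
  · exact (hT _).matrix_elem _ _
  · exact (hT _).matrix_elem _ _
  · exact continuous_const

end Continuity

end BlockJacobi

namespace BlockJacobi

/-! ### Counting eigenvalues along a trajectory -/

section Counting

variable {L : ℕ} {V₀ T₀ : Matrix (Fin L) (Fin L) ℝ} {E K ε : ℝ}
  {F : NormalForm (transfer V₀ T₀ E)} {V T : ℕ → Matrix (Fin L) (Fin L) ℝ}

/-- The frame `𝒯_k ⋯ 𝒯_1 M⁻¹ (1; i)`. -/
noncomputable def NormalForm.rawFrame (F : NormalForm (transfer V₀ T₀ E))
    (V T : ℕ → Matrix (Fin L) (Fin L) ℝ) (k : ℕ) : Matrix (Fin L ⊕ Fin L) (Fin L) ℂ :=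
  cx (transferProd V T E k * F.M⁻¹) * frame (Fin L)

/-- The basis change followed by the chart. -/
noncomputable def NormalForm.chartM (F : NormalForm (transfer V₀ T₀ E)) :
    Matrix (Fin L ⊕ Fin L) (Fin L ⊕ Fin L) ℂ := chart F.splitting.hyp * cx F.M

lemma NormalForm.chartM_form (F : NormalForm (transfer V₀ T₀ E)) :
    F.chartM.conjTranspose * kreinMatrix F.splitting.hyp * F.chartM
      = Complex.I • Matrix.J (Fin L) ℂ := by
  have h := congrArg cx (SymplecticGroup.mem_iff'.mp F.M_symplectic)
  rw [cx_mul, cx_mul, cx_J, ← cx_conjTranspose] at h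
  rw [NormalForm.chartM, Matrix.conjTranspose_mul]
  calc _ = (cx F.M).conjTranspose * ((chart F.splitting.hyp).conjTranspose
        * kreinMatrix F.splitting.hyp * chart F.splitting.hyp) * cx F.M := by
        simp only [Matrix.mul_assoc]
    _ = _ := by rw [conjTranspose_mul_kreinMatrix_mul, Matrix.mul_smul, Matrix.smul_mul, h]

lemma NormalForm.chartFrame_eq (F : NormalForm (transfer V₀ T₀ E))
    (V T : ℕ → Matrix (Fin L) (Fin L) ℝ) (k : ℕ) :
    F.chartFrame V T k = F.chartM * F.rawFrame V T k := by
  rw [NormalForm.chartFrame, NormalForm.chartM, NormalForm.rawFrame, Matrix.mul_assoc F.M, cx_mul]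
  simp only [Matrix.mul_assoc]

lemma NormalForm.rawFrame_form (F : NormalForm (transfer V₀ T₀ E)) (hV : ∀ n, (V n).IsSymm)
    (hT : ∀ n, (T n).PosDef) (k : ℕ) :
    (F.rawFrame V T k).conjTranspose * (Complex.I • Matrix.J (Fin L) ℂ) * F.rawFrame V T k
      = (2 : ℂ) • 1 :=
  frame_form_of_symplectic (Submonoid.mul_mem _ (transferProd_mem_symplectic E hV hT k)
    (inv_mem_symplectic F.M_symplectic))

lemma NormalForm.rawFrame_succ (F : NormalForm (transfer V₀ T₀ E)) {k : ℕ} (hT : IsUnit (T k).det) :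
    F.rawFrame V T (k + 1) = Matrix.fromRows
      (((E : ℂ) • 1 - cx (V k)) * (cx (T k))⁻¹ * (F.rawFrame V T k).toRows₁
        - cx (T k) * (F.rawFrame V T k).toRows₂)
      ((cx (T k))⁻¹ * (F.rawFrame V T k).toRows₁) := by
  have h1 : F.rawFrame V T (k + 1) = cx (transfer (V k) (T k) E) * F.rawFrame V T k := by
    rw [NormalForm.rawFrame, transferProd, Matrix.mul_assoc, cx_mul, Matrix.mul_assoc]
    rfl
  rw [h1]
  conv_lhs => rw [← Matrix.fromRows_toRows (F.rawFrame V T k)]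
  rw [transfer, cx_fromBlocks, Matrix.fromBlocks_mul_fromRows, cx_mul, cx_inv hT, cx_sub, cx_smul,
    cx_one, cx_neg, cx_zero, Matrix.neg_mul, Matrix.zero_mul, add_zero, ← sub_eq_add_neg]

/-- Symmetry, positive definiteness and the distance bounds are all stable along the segment to the
unperturbed entries; this provides the homotopy for the eigenvalue count. -/
lemma Near.segment {V' T' : Matrix (Fin L) (Fin L) ℝ} (h : Near V₀ T₀ ε V' T') (hV₀ : V₀.IsSymm) (hT₀ : T₀.PosDef) (hε : 0 ≤ ε) {s : ℝ}
    (hs : s ∈ Set.Icc (0 : ℝ) 1) : Near V₀ T₀ ε (V₀ + s • (V' - V₀)) (T₀ + s • (T' - T₀)) where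
  V_symm := hV₀.add ((h.V_symm.sub hV₀).smul s)
  T_posDef := by
    have e : T₀ + s • (T' - T₀) = (1 - s) • T₀ + s • T' := by
      rw [smul_sub, sub_smul, one_smul]; abel
    rw [e]
    rcases eq_or_lt_of_le hs.1 with h0 | h0
    · rw [← h0]; simpa using hT₀
    · exact Matrix.PosDef.posSemidef_add (hT₀.posSemidef.smul (sub_nonneg.mpr hs.2))
        (h.T_posDef.smul h0)
  norm_V := by
    rw [add_sub_cancel_left, norm_smul, Real.norm_eq_abs, abs_of_nonneg hs.1]
    nlinarith [h.norm_V, hs.1, hs.2, norm_nonneg (V' - V₀)]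
  norm_T := by
    rw [add_sub_cancel_left, norm_smul, Real.norm_eq_abs, abs_of_nonneg hs.1]
    nlinarith [h.norm_T, hs.1, hs.2, norm_nonneg (T' - T₀)]

/-- The slope of the initial frame. -/
noncomputable def NormalForm.slope (F : NormalForm (transfer V₀ T₀ E))
    (V T : ℕ → Matrix (Fin L) (Fin L) ℝ) (k : ℕ) : Matrix (Fin L) (Fin L) ℂ :=
  (F.rawFrame V T k).toRows₂ * ((F.rawFrame V T k).toRows₁)⁻¹

lemma re_dissipative_nonneg {Z : Matrix (Fin L) (Fin L) ℂ} (hV : ∀ n, (V n).IsSymm)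
    (hT : ∀ n, (T n).IsSymm) (hZ : SiegelPos Z) {N : ℕ} (v : Fin N × Fin L → ℂ) :
    0 ≤ (star v ⬝ᵥ (Complex.I • dissipative V T E Z N).mulVec v).re := by
  have h1 : (E : ℂ) • 1 - cx (hamiltonian V T N) = cx (E • 1 - hamiltonian V T N) := by
    rw [cx_sub, cx_smul, cx_one]
  have h2 : (E • 1 - hamiltonian V T N).IsSymm :=
    (Matrix.isSymm_one.smul E).sub (hamiltonian_isSymm hV hT N)
  rw [smul_dissipative_eq, Matrix.add_mulVec, dotProduct_add, Complex.add_re, h1,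
    re_star_dotProduct_smul_I_symm h2, zero_add]
  refine re_boundary_nonneg (hT 0) (fun w => ?_) v
  by_cases hw : w = 0
  · simp [hw]
  · exact (hZ w hw).le

lemma NormalForm.det_dissipative (F : NormalForm (transfer V₀ T₀ E)) (hV : ∀ n, (V n).IsSymm)
    (hT : ∀ n, (T n).PosDef) (N : ℕ) :
    (dissipative V T E (F.slope V T 0) N).det * ((F.rawFrame V T 0).toRows₁).det
      = ((F.rawFrame V T N).toRows₁).det * ∏ n ∈ Finset.range N, (cx (T n)).det := by
  have hTu : ∀ n, IsUnit (T n).det := fun n => isUnit_det_of_posDef (hT n)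
  have hu := fun n => isUnit_det_toRows₁ (F.rawFrame_form hV hT n)
  apply det_dissipative_mul_det E N V T _ (fun n => (F.rawFrame V T n).toRows₁)
    (fun n => (F.rawFrame V T n).toRows₂) hTu hu
  · rw [NormalForm.slope, Matrix.nonsing_inv_mul_cancel_right _ _ (hu 0)]
  · intro n
    rw [F.rawFrame_succ (hTu n), Matrix.toRows₁_fromRows]
  · intro n
    rw [F.rawFrame_succ (hTu n), Matrix.toRows₂_fromRows]

/-- Multiplication by `i` makes the self-adjoint part purely imaginary in the quadratic form, so
only the dissipative boundary contributes to the real part. -/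
lemma slitSpec_dissipative {Z : Matrix (Fin L) (Fin L) ℂ} (hV : ∀ n, (V n).IsSymm)
    (hT : ∀ n, (T n).IsSymm) (hZ : SiegelPos Z) {N : ℕ} (hd : (dissipative V T E Z N).det ≠ 0) :
    SlitSpec (Complex.I • dissipative V T E Z N) := by
  apply slitSpec_of_re_nonneg (re_dissipative_nonneg hV hT hZ)
  rw [Matrix.det_smul]
  exact mul_ne_zero (pow_ne_zero _ Complex.I_ne_zero) hd

/-- The quotient of the first components of the chart images of `(1; Z)` and `(1; i)`. -/
noncomputable def NormalForm.mobius (F : NormalForm (transfer V₀ T₀ E))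
    (Z : Matrix (Fin L) (Fin L) ℂ) : Matrix (Fin L) (Fin L) ℂ :=
  (F.chartM.toBlocks₁₁ + F.chartM.toBlocks₁₂ * Z)
    * (F.chartM.toBlocks₁₁ + F.chartM.toBlocks₁₂ * (Complex.I • 1))⁻¹

lemma isSymm_of_posDef {T : Matrix (Fin L) (Fin L) ℝ} (hT : T.PosDef) : T.IsSymm := by
  rw [Matrix.IsSymm, ← Matrix.conjTranspose_eq_transpose_of_trivial]
  exact hT.1

namespace NormalForm.Regime

variable (H : F.Regime K ε)

/-- The quantity that is locally constant under deformations of the entries. -/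
noncomputable def phase (h : ∀ n, Near V₀ T₀ ε (V n) (T n)) (N : ℕ) : ℂ :=
  logDet (Complex.I • dissipative V T E (F.slope V T 0) N) + logDet (F.mobius (F.slope V T N))
    - ∑ k ∈ Finset.range N, logDet (1 + (H.traj h).X k)
    - ∑ k ∈ Finset.range N, ((Real.log (T k).det : ℝ) : ℂ)

lemma slope_pos (h : ∀ n, Near V₀ T₀ ε (V n) (T n)) (N : ℕ) : SiegelPos (F.slope V T N) :=
  siegelPos_of_form (F.rawFrame_form (fun n => (h n).V_symm) (fun n => (h n).T_posDef) N)

lemma isUnit_rawFrame (h : ∀ n, Near V₀ T₀ ε (V n) (T n)) (N : ℕ) :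
    IsUnit ((F.rawFrame V T N).toRows₁).det :=
  isUnit_det_toRows₁ (F.rawFrame_form (fun n => (h n).V_symm) (fun n => (h n).T_posDef) N)

lemma det_dissipative_ne_zero (h : ∀ n, Near V₀ T₀ ε (V n) (T n)) (N : ℕ) :
    (dissipative V T E (F.slope V T 0) N).det ≠ 0 := by
  have h1 := F.det_dissipative (fun n => (h n).V_symm) (fun n => (h n).T_posDef) N
  intro h0
  rw [h0, zero_mul] at h1
  refine mul_ne_zero (isUnit_rawFrame h N).ne_zero (Finset.prod_ne_zero_iff.mpr fun n _ => ?_)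
    h1.symm
  rw [cx_det]
  exact_mod_cast (h n).T_posDef.det_pos.ne'

lemma slitSpec_diss (h : ∀ n, Near V₀ T₀ ε (V n) (T n)) (N : ℕ) :
    SlitSpec (Complex.I • dissipative V T E (F.slope V T 0) N) :=
  slitSpec_dissipative (fun n => (h n).V_symm) (fun n => isSymm_of_posDef (h n).T_posDef)
    (slope_pos h 0) (det_dissipative_ne_zero h N)

lemma slitSpec_mob (h : ∀ n, Near V₀ T₀ ε (V n) (T n)) (N : ℕ) :
    SlitSpec (F.mobius (F.slope V T N)) :=
  slitSpec_mobius _ F.chartM_form (slope_pos h N)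

lemma x_eq (h : ∀ n, Near V₀ T₀ ε (V n) (T n)) (N : ℕ) : (H.traj h).x N
    = (F.chartM.toBlocks₁₁ + F.chartM.toBlocks₁₂ * F.slope V T N) * (F.rawFrame V T N).toRows₁ := by
  change (F.chartFrame V T N).toRows₁ = _
  have h1 : F.slope V T N * (F.rawFrame V T N).toRows₁ = (F.rawFrame V T N).toRows₂ :=
    Matrix.nonsing_inv_mul_cancel_right _ _ (isUnit_rawFrame h N)
  rw [F.chartFrame_eq, Matrix.add_mul, Matrix.mul_assoc _ (F.slope V T N), h1]
  conv_lhs => rw [← Matrix.fromBlocks_toBlocks F.chartM,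
    ← Matrix.fromRows_toRows (F.rawFrame V T N), Matrix.fromBlocks_mul_fromRows,
    Matrix.toRows₁_fromRows]

/-- Two formulas contain the determinant of the raw solution at site `N`: the one for the
dissipative determinant, with the factor `∏ det T`, and the one for `det x_N`. Eliminating it leaves
an expression in the normal form and `N` alone, free of the entries of the chain. The terms of
`phase` are arranged for this. -/
lemma exp_phase (h : ∀ n, Near V₀ T₀ ε (V n) (T n)) (N : ℕ) :
    Complex.exp (H.phase h N) = Complex.I ^ Fintype.card (Fin N × Fin L)
      * (F.splitting.Ra.det ^ N
        * (Matrix.diagonal fun i => if F.splitting.hyp i then 1 else 2 * rsqrt :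
            Matrix (Fin L) (Fin L) ℂ).det)
      * ((F.chartM.toBlocks₁₁ + F.chartM.toBlocks₁₂ * (Complex.I • 1)).det
        * (cx (1 * F.M⁻¹) * frame (Fin L)).toRows₁.det)⁻¹ := by
  have e1 : Complex.exp (∑ k ∈ Finset.range N, logDet (1 + (H.traj h).X k))
      = ∏ k ∈ Finset.range N, (1 + (H.traj h).X k).det := by
    rw [Complex.exp_sum]
    exact Finset.prod_congr rfl fun k _ => H.exp_logDet_one_add_X h k
  have e2 : Complex.exp (∑ k ∈ Finset.range N, ((Real.log (T k).det : ℝ) : ℂ))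
      = ∏ k ∈ Finset.range N, (cx (T k)).det := by
    rw [Complex.exp_sum]
    refine Finset.prod_congr rfl fun k _ => ?_
    rw [← Complex.ofReal_exp, Real.exp_log (h k).T_posDef.det_pos, cx_det]
  have h1 := F.det_dissipative (fun n => (h n).V_symm) (fun n => (h n).T_posDef) N
  have h2 := congrArg Matrix.det (H.x_eq h N)
  rw [H.det_x, H.x_zero, Matrix.det_mul] at h2
  have ha0 := (isUnit_rawFrame (F := F) h 0).ne_zero
  have haN := (isUnit_rawFrame (F := F) h N).ne_zero
  have hp : ∏ k ∈ Finset.range N, (1 + (H.traj h).X k).det ≠ 0 := by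
    rw [← e1]; exact Complex.exp_ne_zero _
  have ht : ∏ k ∈ Finset.range N, (cx (T k)).det ≠ 0 := by
    rw [← e2]; exact Complex.exp_ne_zero _
  have hD := det_mobius_ne_zero _ F.chartM_form siegelPos_I
  rw [phase, Complex.exp_sub, Complex.exp_sub, Complex.exp_add, e1, e2,
    exp_logDet (slitSpec_diss h N), exp_logDet (slitSpec_mob h N), Matrix.det_smul,
    NormalForm.mobius, Matrix.det_mul, Matrix.det_nonsing_inv, Ring.inverse_eq_inv']
  change _ = _ * ((_ : ℂ) * ((F.rawFrame V T 0).toRows₁).det)⁻¹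
  generalize (F.rawFrame V T 0).toRows₁.det = a0 at *
  generalize (F.rawFrame V T N).toRows₁.det = aN at *
  generalize (dissipative V T E (F.slope V T 0) N).det = d at *
  generalize (F.chartM.toBlocks₁₁ + F.chartM.toBlocks₁₂ * F.slope V T N).det = y at *
  generalize (F.chartM.toBlocks₁₁ + F.chartM.toBlocks₁₂ * (Complex.I • 1)).det = D at *
  generalize ∏ k ∈ Finset.range N, (1 + (H.traj h).X k).det = p at *
  generalize ∏ k ∈ Finset.range N, (cx (T k)).det = t at *
  generalize F.splitting.Ra.det ^ N = r at *
  generalize Complex.I ^ Fintype.card (Fin N × Fin L) = i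
  generalize (Matrix.diagonal fun i => if F.splitting.hyp i then 1 else 2 * rsqrt :
    Matrix (Fin L) (Fin L) ℂ).det = x0 at *
  field_simp
  have h3 : d * y * a0 * aN = t * r * x0 * p * aN := by
    linear_combination y * aN * h1 - t * aN * h2
  have h4 := mul_right_cancel₀ haN h3
  linear_combination i * h4

lemma X_eq_zero (h : ∀ n, Near V₀ T₀ ε (V n) (T n)) {k : ℕ} (hV : V k = V₀) (hT : T k = T₀) :
    (H.traj h).X k = 0 := by
  have h1 : F.pert (V k) (T k) = 0 := by
    rw [NormalForm.pert, hV, hT,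
      Matrix.nonsing_inv_mul _ (SymplecticGroup.symplectic_det H.bg.transfer_mem)]
    simp
  change (F.pert (V k) (T k)).toBlocks₁₁ + (F.pert (V k) (T k)).toBlocks₁₂ * _ = 0
  rw [h1]
  have h2 : (0 : Matrix (Fin L ⊕ Fin L) (Fin L ⊕ Fin L) ℂ).toBlocks₁₁ = 0 := rfl
  have h3 : (0 : Matrix (Fin L ⊕ Fin L) (Fin L ⊕ Fin L) ℂ).toBlocks₁₂ = 0 := rfl
  rw [h2, h3, Matrix.zero_mul, add_zero]

/-- Each determinant enters through a matrix whose spectrum stays in the slit plane: by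
dissipativity, by positivity of the slope, or by smallness of `X`. -/
lemma continuous_phase {A : Type*} [TopologicalSpace A] {V T : A → ℕ → Matrix (Fin L) (Fin L) ℝ}
    (hV : ∀ n, Continuous fun a => V a n) (hT : ∀ n, Continuous fun a => T a n)
    (h : ∀ a n, Near V₀ T₀ ε (V a n) (T a n)) (N : ℕ) : Continuous fun a => H.phase (h a) N := by
  have hTu : ∀ a n, IsUnit (T a n).det := fun a n => isUnit_det_of_posDef (h a n).T_posDef
  have hprod := continuous_transferProd hV hT hTu E
  have hraw : ∀ k, Continuous fun a => F.rawFrame (V a) (T a) k := fun k =>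
    (continuous_cx.comp ((hprod k).mul continuous_const)).matrix_mul continuous_const
  have hchart : ∀ k, Continuous fun a => F.chartFrame (V a) (T a) k := fun k =>
    continuous_const.matrix_mul ((continuous_cx.comp
      ((continuous_const.mul (hprod k)).mul continuous_const)).matrix_mul continuous_const)
  have hr1 : ∀ {G : A → Matrix (Fin L ⊕ Fin L) (Fin L) ℂ}, Continuous G →
      Continuous fun a => (G a).toRows₁ := fun hG =>
    continuous_matrix fun i j => hG.matrix_elem (Sum.inl i) j
  have hr2 : ∀ {G : A → Matrix (Fin L ⊕ Fin L) (Fin L) ℂ}, Continuous G →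
      Continuous fun a => (G a).toRows₂ := fun hG =>
    continuous_matrix fun i j => hG.matrix_elem (Sum.inr i) j
  have hslope : ∀ k, Continuous fun a => F.slope (V a) (T a) k := fun k =>
    (hr2 (hraw k)).mul (continuous_matrix_inv (hr1 (hraw k)) fun a => isUnit_rawFrame (h a) k)
  have hpert : ∀ k, Continuous fun a => F.pert (V a k) (T a k) := fun k =>
    (continuous_const.mul (continuous_cx.comp ((continuous_const.mul
      ((continuous_const.mul (continuous_transfer (hV k) (hT k) (fun a => hTu a k) E)).sub
        continuous_const)).mul continuous_const))).mul continuous_const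
  have hX : ∀ k, Continuous fun a => (H.traj (h a)).X k := by
    intro k
    have h1 : Continuous fun a => (F.pert (V a k) (T a k)).toBlocks₁₁ :=
      continuous_matrix fun i j => (hpert k).matrix_elem (Sum.inl i) (Sum.inl j)
    have h2 : Continuous fun a => (F.pert (V a k) (T a k)).toBlocks₁₂ :=
      continuous_matrix fun i j => (hpert k).matrix_elem (Sum.inl i) (Sum.inr j)
    exact h1.add (h2.mul ((hr2 (hchart k)).mul
      (continuous_matrix_inv (hr1 (hchart k)) fun a => H.isUnit_x (h a) k)))
  have hdiss : Continuous fun a => dissipative (V a) (T a) E (F.slope (V a) (T a) 0) N :=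
    (continuous_const.sub (continuous_cx.comp (continuous_hamiltonian hV hT N))).sub
      ((continuous_const.matrix_mul (((continuous_cx.comp (hT 0)).mul (hslope 0)).mul
        (continuous_cx.comp (hT 0)))).matrix_mul continuous_const)
  have c1 : Continuous fun a =>
      logDet (Complex.I • dissipative (V a) (T a) E (F.slope (V a) (T a) 0) N) :=
    continuous_logDet (hdiss.const_smul Complex.I) fun a => slitSpec_diss (h a) N
  have c2 : Continuous fun a => logDet (F.mobius (F.slope (V a) (T a) N)) :=
    continuous_logDet ((continuous_const.add (continuous_const.mul (hslope N))).mul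
      continuous_const) fun a => slitSpec_mob (h a) N
  have c3 : Continuous fun a => ∑ k ∈ Finset.range N, logDet (1 + (H.traj (h a)).X k) :=
    continuous_finsetSum _ fun k _ => continuous_logDet (continuous_const.add (hX k)) fun a =>
      slitSpec_one_add ((H.norm_X_le_sixth (h a) k).trans_lt (by norm_num))
  have c4 : Continuous fun a => ∑ k ∈ Finset.range N, ((Real.log (T a k).det : ℝ) : ℂ) :=
    continuous_finsetSum _ fun k _ => Complex.continuous_ofReal.comp
      ((hT k).matrix_det.log fun a => (hTu a k).ne_zero)
  exact ((c1.add c2).sub c3).sub c4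

/-- One `π L` comes from the boundary term of the dissipative determinant, the other from the `L ×
L` Möbius quotient; the logarithms of `det T` are real. -/
lemma abs_count_sub_phase_le (h : ∀ n, Near V₀ T₀ ε (V n) (T n)) (N : ℕ) :
    |(H.phase h N).im + (∑ k ∈ Finset.range N, logDet (1 + (H.traj h).X k)).im
      - (Real.pi * eigCount (hamiltonian V T N) E - (N * L) * (Real.pi / 2))|
      ≤ 2 * (Real.pi * L) := by
  have h1 := abs_im_logDet_dissipative_sub_le (fun n => (h n).V_symm)
    (fun n => isSymm_of_posDef (h n).T_posDef) (Z := F.slope V T 0)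
    (fun w => by
      by_cases hw : w = 0
      · simp [hw]
      · exact (slope_pos h 0 w hw).le) (det_dissipative_ne_zero h N)
  have h2 := abs_im_logDet_le (F.mobius (F.slope V T N))
  rw [Fintype.card_fin] at h2
  have h3 : (∑ k ∈ Finset.range N, ((Real.log (T k).det : ℝ) : ℂ)).im = 0 := by
    rw [Complex.im_sum]
    exact Finset.sum_eq_zero fun k _ => Complex.ofReal_im _
  rw [phase, Complex.sub_im, Complex.sub_im, Complex.add_im, h3]
  rw [abs_le] at h1 h2 ⊢
  constructor <;> linarith [h1.1, h1.2, h2.1, h2.2]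

lemma X_congr {V' T' : ℕ → Matrix (Fin L) (Fin L) ℝ} (h : ∀ n, Near V₀ T₀ ε (V n) (T n))
    (h' : ∀ n, Near V₀ T₀ ε (V' n) (T' n)) (hV : V' = V) (hT : T' = T) (k : ℕ) :
    (H.traj h').X k = (H.traj h).X k := by
  subst hV hT
  rfl

/-- Along every sequence of entries near the unperturbed ones, the number of eigenvalues is given
to first order by the traces of the growth increments. -/
theorem abs_count_sub_le (h : ∀ n, Near V₀ T₀ ε (V n) (T n)) (N : ℕ) :
    |Real.pi * eigCount (hamiltonian V T N) E
      - Real.pi * eigCount (hamiltonian (fun _ => V₀) (fun _ => T₀) N) E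
      - (∑ k ∈ Finset.range N, ((H.traj h).X k).trace).im|
      ≤ 4 * (Real.pi * L) + N * (L * (36 * (40 * K ^ 7 * ε) ^ 2)) := by
  let Vs : unitInterval → ℕ → Matrix (Fin L) (Fin L) ℝ := fun s n => V₀ + (s : ℝ) • (V n - V₀)
  let Ts : unitInterval → ℕ → Matrix (Fin L) (Fin L) ℝ := fun s n => T₀ + (s : ℝ) • (T n - T₀)
  have hs : ∀ s n, Near V₀ T₀ ε (Vs s n) (Ts s n) := fun s n =>
    (h n).segment H.bg.V_symm H.bg.T_posDef H.ε_nonneg s.2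
  have hVc : ∀ n, Continuous fun s => Vs s n := fun n =>
    continuous_const.add (continuous_subtype_val.smul continuous_const)
  have hTc : ∀ n, Continuous fun s => Ts s n := fun n =>
    continuous_const.add (continuous_subtype_val.smul continuous_const)
  -- Constancy along the homotopy determines the argument without ambiguity modulo `2π`. At the
  -- start the increments vanish, so the same value of the phase describes the unperturbed count;
  -- each end costs `2 π L`.
  have heq : H.phase (hs 1) N = H.phase (hs 0) N :=
    eq_of_exp_eq (H.continuous_phase hVc hTc hs N)
      (fun a b => by rw [H.exp_phase, H.exp_phase]) 1 0
  have hV0 : Vs 0 = fun _ => V₀ := by funext n; simp [Vs]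
  have hT0 : Ts 0 = fun _ => T₀ := by funext n; simp [Ts]
  have hV1 : Vs 1 = V := by funext n; simp [Vs]
  have hT1 : Ts 1 = T := by funext n; simp [Ts]
  have h1 := H.abs_count_sub_phase_le (hs 1) N
  have h0 := H.abs_count_sub_phase_le (hs 0) N
  have hX0 : ∑ k ∈ Finset.range N, logDet (1 + (H.traj (hs 0)).X k) = 0 :=
    Finset.sum_eq_zero fun k _ => by
      rw [H.X_eq_zero (hs 0) (congrFun hV0 k) (congrFun hT0 k), add_zero, logDet_one]
  have hX1 : ∀ k, (H.traj (hs 1)).X k = (H.traj h).X k := H.X_congr h (hs 1) hV1 hT1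
  simp only [hX1] at h1
  rw [heq] at h1
  generalize H.phase (hs 0) N = φ at h0 h1
  rw [hV1, hT1] at h1
  rw [hX0, hV0, hT0, Complex.zero_im, add_zero] at h0
  have h2 := (Complex.abs_im_le_norm _).trans (H.norm_sum_logDet_sub_trace_le h N)
  rw [Complex.sub_im] at h2
  rw [abs_le] at h0 h1 h2 ⊢
  constructor <;> linarith [h0.1, h0.2, h1.1, h1.2, h2.1, h2.2]

end NormalForm.Regime

end Counting

end BlockJacobi

namespace BlockJacobi

/-! ### Measurability of matrix-valued functions -/

section EntryMeasurable

variable {Ω : Type*} {mΩ : MeasurableSpace Ω} {𝕜 : Type*} [RCLike 𝕜] {l m n o : Type*}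

/-- Measurability of all entries of a matrix-valued function. -/
def EntryMeasurable [mΩ : MeasurableSpace Ω] (A : Ω → Matrix m n 𝕜) : Prop :=
  ∀ i j, Measurable fun ω => A ω i j

namespace EntryMeasurable

lemma const (A : Matrix m n 𝕜) : EntryMeasurable fun _ : Ω => A :=
  fun _ _ => measurable_const

lemma add {A B : Ω → Matrix m n 𝕜} (hA : EntryMeasurable A) (hB : EntryMeasurable B) :
    EntryMeasurable fun ω => A ω + B ω := fun i j => (hA i j).add (hB i j)

lemma sub {A B : Ω → Matrix m n 𝕜} (hA : EntryMeasurable A) (hB : EntryMeasurable B) :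
    EntryMeasurable fun ω => A ω - B ω := fun i j => (hA i j).sub (hB i j)

lemma neg {A : Ω → Matrix m n 𝕜} (hA : EntryMeasurable A) :
    EntryMeasurable fun ω => -A ω := fun i j => (hA i j).neg

lemma mul [Fintype n] {A : Ω → Matrix m n 𝕜} {B : Ω → Matrix n o 𝕜} (hA : EntryMeasurable A)
    (hB : EntryMeasurable B) : EntryMeasurable fun ω => A ω * B ω := by
  intro i j
  simp only [Matrix.mul_apply]
  exact Finset.measurable_sum _ fun k _ => (hA i k).mul (hB k j)

lemma det [Fintype n] [DecidableEq n] {A : Ω → Matrix n n 𝕜} (hA : EntryMeasurable A) :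
    Measurable fun ω => (A ω).det := by
  simp only [Matrix.det_apply']
  exact Finset.measurable_sum _ fun k _ =>
    (Finset.measurable_prod _ fun i _ => hA _ _).const_mul _

lemma trace [Fintype n] {A : Ω → Matrix n n 𝕜} (hA : EntryMeasurable A) :
    Measurable fun ω => (A ω).trace :=
  Finset.measurable_sum _ fun i _ => hA i i

/-- Cramer's rule; the scalar inverse is measurable everywhere, so no invertibility is needed. -/
lemma inv [Fintype n] [DecidableEq n] {A : Ω → Matrix n n 𝕜} (hA : EntryMeasurable A) :
    EntryMeasurable fun ω => (A ω)⁻¹ := by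
  intro i j
  simp only [Matrix.inv_def, Ring.inverse_eq_inv', Matrix.smul_apply, smul_eq_mul,
    Matrix.adjugate_apply]
  refine hA.det.inv.mul (EntryMeasurable.det (A := fun ω => (A ω).updateRow j (Pi.single i 1)) ?_)
  intro k k'
  simp only [Matrix.updateRow_apply]
  split_ifs
  · exact measurable_const
  · exact hA k k'

lemma fromBlocks {A : Ω → Matrix l n 𝕜} {B : Ω → Matrix l o 𝕜} {C : Ω → Matrix m n 𝕜}
    {D : Ω → Matrix m o 𝕜} (hA : EntryMeasurable A) (hB : EntryMeasurable B)
    (hC : EntryMeasurable C) (hD : EntryMeasurable D) :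
    EntryMeasurable fun ω => Matrix.fromBlocks (A ω) (B ω) (C ω) (D ω) := by
  rintro (i | i) (j | j)
  · exact hA i j
  · exact hB i j
  · exact hC i j
  · exact hD i j

lemma cx {A : Ω → Matrix m n ℝ} (hA : EntryMeasurable A) :
    EntryMeasurable fun ω => BlockJacobi.cx (A ω) :=
  fun i j => Complex.measurable_ofReal.comp (hA i j)

lemma norm [Fintype m] [Fintype n] [DecidableEq n] {A : Ω → Matrix m n 𝕜}
    (hA : EntryMeasurable A) : Measurable fun ω => ‖A ω‖ := by
  have h1 : Continuous fun f : m → n → 𝕜 => ‖Matrix.of f‖ :=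
    (continuous_norm (E := Matrix m n 𝕜)).comp continuous_id
  exact h1.measurable.comp (measurable_pi_lambda _ fun i => measurable_pi_lambda _ fun j => hA i j)

variable {L : ℕ}

lemma transfer {V T : Ω → Matrix (Fin L) (Fin L) ℝ} (hV : EntryMeasurable V)
    (hT : EntryMeasurable T) (E : ℝ) :
    EntryMeasurable fun ω => BlockJacobi.transfer (V ω) (T ω) E :=
  fromBlocks (((const _).sub hV).mul hT.inv) hT.neg hT.inv (const 0)

lemma transferProd {V T : ℕ → Ω → Matrix (Fin L) (Fin L) ℝ} (E : ℝ) :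
    ∀ N : ℕ, (∀ n < N, EntryMeasurable (V n)) → (∀ n < N, EntryMeasurable (T n)) →
      EntryMeasurable fun ω => BlockJacobi.transferProd (fun n => V n ω) (fun n => T n ω) E N
  | 0, _, _ => const 1
  | N + 1, hV, hT => ((hV N N.lt_succ_self).transfer (hT N N.lt_succ_self) E).mul
      (transferProd E N (fun n hn => hV n (hn.trans N.lt_succ_self))
        fun n hn => hT n (hn.trans N.lt_succ_self))

lemma hamiltonian {V T : ℕ → Ω → Matrix (Fin L) (Fin L) ℝ} (hV : ∀ n, EntryMeasurable (V n))
    (hT : ∀ n, EntryMeasurable (T n)) (N : ℕ) :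
    EntryMeasurable fun ω => BlockJacobi.hamiltonian (fun n => V n ω) (fun n => T n ω) N := by
  intro x y
  simp only [BlockJacobi.hamiltonian]
  split_ifs
  · exact hV _ _ _
  · exact hT _ _ _
  · exact hT _ _ _
  · exact measurable_const

lemma extPower {A : Ω → Matrix (Fin L ⊕ Fin L) (Fin L ⊕ Fin L) ℝ} (hA : EntryMeasurable A) :
    EntryMeasurable fun ω => BlockJacobi.extPower (A ω) := by
  intro s t
  simp only [extPower_eq, wedgeBlock, wedge_apply]
  exact det fun i j => hA.cx _ _

end EntryMeasurable

lemma measurable_log_norm_extPower {L : ℕ} {V T : ℕ → Ω → Matrix (Fin L) (Fin L) ℝ}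
    (hV : ∀ n, EntryMeasurable (V n)) (hT : ∀ n, EntryMeasurable (T n)) (E : ℝ) (N : ℕ) :
    Measurable fun ω =>
      Real.log ‖extPower (transferProd (fun n => V n ω) (fun n => T n ω) E N)‖ :=
  Real.measurable_log.comp
    (EntryMeasurable.transferProd E N (fun n _ => hV n) fun n _ => hT n).extPower.norm

end EntryMeasurable

/-! ### Independent sequences -/

section Independence

variable {Ω S : Type*} {mΩ : MeasurableSpace Ω} {mS : MeasurableSpace S} {P : Measure Ω}
  [IsProbabilityMeasure P] {X : ℕ → Ω → S} {ν : Measure S}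

/-- Grouping: the σ-algebra of one site is independent of the one generated jointly by the earlier
sites. -/
lemma indepFun_past (hX : ∀ n, Measurable (X n)) (hi : iIndepFun X P) {k : ℕ} {f : S → ℂ}
    (hf : Measurable f) {g : Ω → ℂ}
    (hg : Measurable[⨆ j ∈ Set.Iio k, MeasurableSpace.comap (X j) mS] g) :
    IndepFun (fun ω => f (X k ω)) g P := by
  have h1 : Indep (⨆ j ∈ ({k} : Set ℕ), MeasurableSpace.comap (X j) mS)
      (⨆ j ∈ Set.Iio k, MeasurableSpace.comap (X j) mS) P :=
    indep_iSup_of_disjoint (fun i => (hX i).comap_le) hi (by simp)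
  rw [IndepFun_iff_Indep]
  refine indep_of_indep_of_le_left (indep_of_indep_of_le_right h1 hg.comap_le) ?_
  simp only [Set.mem_singleton_iff, iSup_iSup_eq_left]
  change MeasurableSpace.comap (f ∘ X k) _ ≤ _
  rw [← MeasurableSpace.comap_comp]
  exact MeasurableSpace.comap_mono hf.comap_le

lemma measurable_past {k j : ℕ} (hj : j < k) :
    Measurable[⨆ j ∈ Set.Iio k, MeasurableSpace.comap (X j) mS] (X j) := by
  rw [measurable_iff_comap_le]
  exact le_iSup₂_of_le j hj le_rfl

/-- Both sequences have as law the infinite product of copies of `ν`. -/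
lemma map_shift (hX : ∀ n, Measurable (X n)) (hi : iIndepFun X P) (hν : ∀ n, P.map (X n) = ν)
    (m : ℕ) : P.map (fun ω n => X (m + n) ω) = P.map (fun ω n => X n ω) := by
  have h1 := (iIndepFun_iff_map_fun_eq_infinitePi_map hX).mp hi
  have h2 := (iIndepFun_iff_map_fun_eq_infinitePi_map (X := fun n => X (m + n))
    fun n => hX (m + n)).mp (hi.precomp (add_right_injective m))
  rw [h1, h2]
  simp only [hν]

lemma integral_shift (hX : ∀ n, Measurable (X n)) (hi : iIndepFun X P)
    (hν : ∀ n, P.map (X n) = ν) {f : (ℕ → S) → ℝ} (hf : Measurable f) (m : ℕ) :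
    ∫ ω, f (fun n => X (m + n) ω) ∂P = ∫ ω, f (fun n => X n ω) ∂P := by
  rw [← integral_map (φ := fun ω n => X (m + n) ω)
      (measurable_pi_lambda _ fun n => hX (m + n)).aemeasurable hf.aestronglyMeasurable,
    map_shift hX hi hν, integral_map (measurable_pi_lambda _ fun n => hX n).aemeasurable
      hf.aestronglyMeasurable]

/-- Lets a constant environment count as i.i.d. with a Dirac law, so that every result for random
chains applies to it directly. -/
lemma iIndepFun_const (P : Measure Ω) [IsProbabilityMeasure P] (c : S) :
    iIndepFun (fun (_ : ℕ) (_ : Ω) => c) P := by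
  rw [iIndepFun_iff_measure_inter_preimage_eq_mul]
  intro s A _
  by_cases h : ∀ i ∈ s, c ∈ A i
  · have h1 : ⋂ i ∈ s, (fun _ : Ω => c) ⁻¹' A i = Set.univ := by
      ext ω
      simpa using h
    rw [h1, measure_univ, Finset.prod_eq_one]
    intro i hi
    rw [Set.preimage_const_of_mem (h i hi), measure_univ]
  · push Not at h
    obtain ⟨i, hi, hc⟩ := h
    have h1 : ⋂ i ∈ s, (fun _ : Ω => c) ⁻¹' A i = ∅ := by
      ext ω
      simp only [Set.mem_iInter, Set.mem_preimage, Set.mem_empty_iff_false, iff_false]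
      exact fun h => hc (h i hi)
    rw [h1, measure_empty, Finset.prod_eq_zero hi]
    rw [Set.preimage_const_of_notMem hc, measure_empty]

end Independence

end BlockJacobi

namespace BlockJacobi

/-! ### Expectation of the growth increments -/

section Expectation

variable {Ω S : Type*} [mΩ : MeasurableSpace Ω] [mS : MeasurableSpace S] {P : Measure Ω}
  [IsProbabilityMeasure P] {X : ℕ → Ω → S} {ν : Measure S} [IsProbabilityMeasure ν]

lemma integrable_of_bounded {α G : Type*} [MeasurableSpace α] {μ : Measure α} [IsFiniteMeasure μ]
    [NormedAddCommGroup G] [MeasurableSpace G] [BorelSpace G] [SecondCountableTopology G]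
    {f : α → G} (hf : Measurable f) (c : ℝ) (h : ∀ a, ‖f a‖ ≤ c) : Integrable f μ :=
  Integrable.of_bound hf.aestronglyMeasurable c (Eventually.of_forall h)

variable {L : ℕ} {V₀ T₀ : Matrix (Fin L) (Fin L) ℝ} {E K ε : ℝ}
  {F : NormalForm (transfer V₀ T₀ E)} {Vf Tf : S → Matrix (Fin L) (Fin L) ℝ}

lemma NormalForm.entryMeasurable_pert (F : NormalForm (transfer V₀ T₀ E))
    (hV : EntryMeasurable Vf) (hT : EntryMeasurable Tf) :
    EntryMeasurable fun σ => F.pert (Vf σ) (Tf σ) :=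
  ((EntryMeasurable.const _).mul ((((EntryMeasurable.const F.M).mul
    (((EntryMeasurable.const _).mul (hV.transfer hT E)).sub (EntryMeasurable.const 1))).mul
      (EntryMeasurable.const _)).cx)).mul (EntryMeasurable.const _)

lemma NormalForm.entryMeasurable_chartSlope {Ω : Type*} [MeasurableSpace Ω]
    (F : NormalForm (transfer V₀ T₀ E)) {V T : ℕ → Ω → Matrix (Fin L) (Fin L) ℝ} {k : ℕ}
    (hV : ∀ n < k, EntryMeasurable (V n)) (hT : ∀ n < k, EntryMeasurable (T n)) :
    EntryMeasurable fun ω => (F.chartFrame (fun n => V n ω) (fun n => T n ω) k).toRows₂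
      * ((F.chartFrame (fun n => V n ω) (fun n => T n ω) k).toRows₁)⁻¹ := by
  have h : EntryMeasurable fun ω => F.chartFrame (fun n => V n ω) (fun n => T n ω) k :=
    (EntryMeasurable.const _).mul ((((EntryMeasurable.const F.M).mul
      (EntryMeasurable.transferProd E k hV hT)).mul (EntryMeasurable.const _)).cx.mul
        (EntryMeasurable.const _))
  have h1 : EntryMeasurable fun ω =>
      (F.chartFrame (fun n => V n ω) (fun n => T n ω) k).toRows₁ := fun i j => h (Sum.inl i) j
  have h2 : EntryMeasurable fun ω =>
      (F.chartFrame (fun n => V n ω) (fun n => T n ω) k).toRows₂ := fun i j => h (Sum.inr i) j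
  exact h2.mul h1.inv

lemma integral_trace_mul {B : Matrix (Fin L) (Fin L) ℂ} {W : Ω → Matrix (Fin L) (Fin L) ℂ}
    (hW : ∀ i j, Integrable (fun ω => W ω i j) P) :
    ∫ ω, (B * W ω).trace ∂P = (B * Matrix.of fun i j => ∫ ω, W ω i j ∂P).trace := by
  simp only [Matrix.trace, Matrix.diag_apply, Matrix.mul_apply, Matrix.of_apply]
  rw [integral_finsetSum]
  · refine Finset.sum_congr rfl fun i _ => ?_
    rw [integral_finsetSum]
    · exact Finset.sum_congr rfl fun j _ => integral_const_mul _ _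
    · exact fun j _ => (hW j i).const_mul _
  · exact fun i _ => integrable_finsetSum _ fun j _ => (hW j i).const_mul _

/-- Entrywise factorisation of expectations. The result keeps the integral over `σ` outside, with
`W` replaced by its mean, so that a deterministic estimate can be applied for each `σ`. -/
lemma integral_trace_indep {f : S → Matrix (Fin L) (Fin L) ℂ} {Y : Ω → S}
    {W : Ω → Matrix (Fin L) (Fin L) ℂ} (hY : Measurable Y) (hν : P.map Y = ν)
    (hf : EntryMeasurable f) (hfi : ∀ i j, Integrable (fun σ => f σ i j) ν)
    (hW : ∀ i j, Integrable (fun ω => W ω i j) P)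
    (hind : ∀ i j k l, IndepFun (fun ω => f (Y ω) i j) (fun ω => W ω k l) P) :
    ∫ ω, (f (Y ω) * W ω).trace ∂P
      = ∫ σ, (f σ * Matrix.of fun i j => ∫ ω, W ω i j ∂P).trace ∂ν := by
  have hfY : ∀ i j, Integrable (fun ω => f (Y ω) i j) P := by
    intro i j
    have := hfi i j
    rw [← hν] at this
    exact this.comp_measurable hY
  have hint : ∀ i j k l, Integrable (fun ω => f (Y ω) i j * W ω k l) P := fun i j k l =>
    (hind i j k l).integrable_mul (hfY i j) (hW k l)
  simp only [Matrix.trace, Matrix.diag_apply, Matrix.mul_apply, Matrix.of_apply]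
  rw [integral_finsetSum _ fun i _ => integrable_finsetSum _ fun j _ => hint i j j i,
    integral_finsetSum _ fun i _ => integrable_finsetSum _ fun j _ => (hfi i j).mul_const _]
  refine Finset.sum_congr rfl fun i _ => ?_
  rw [integral_finsetSum _ fun j _ => hint i j j i,
    integral_finsetSum _ fun j _ => (hfi i j).mul_const _]
  refine Finset.sum_congr rfl fun j _ => ?_
  rw [integral_mul_const]
  have h1 : ∫ σ, f σ i j ∂ν = ∫ ω, f (Y ω) i j ∂P := by
    rw [← hν, integral_map hY.aemeasurable (hf i j).aestronglyMeasurable]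
  rw [h1]
  exact (hind i j j i).integral_fun_mul_eq_mul_integral (hfY i j).aestronglyMeasurable
    (hW j i).aestronglyMeasurable

/-- An i.i.d. environment whose entries stay near the unperturbed ones. -/
structure Environment (P : Measure Ω) (X : ℕ → Ω → S) (ν : Measure S)
    (V₀ T₀ : Matrix (Fin L) (Fin L) ℝ) (ε : ℝ) (Vf Tf : S → Matrix (Fin L) (Fin L) ℝ) : Prop where
  meas : ∀ n, Measurable (X n)
  indep : iIndepFun X P
  law : ∀ n, P.map (X n) = ν
  V_meas : EntryMeasurable Vf
  T_meas : EntryMeasurable Tf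
  near : ∀ σ, Near V₀ T₀ ε (Vf σ) (Tf σ)

namespace Environment

lemma near_seq (e : Environment P X ν V₀ T₀ ε Vf Tf) (ω : Ω) (n : ℕ) :
    Near V₀ T₀ ε (Vf (X n ω)) (Tf (X n ω)) := e.near _

lemma V_meas_seq (e : Environment P X ν V₀ T₀ ε Vf Tf) (n : ℕ) :
    EntryMeasurable fun ω => Vf (X n ω) := fun i j => (e.V_meas i j).comp (e.meas n)

lemma T_meas_seq (e : Environment P X ν V₀ T₀ ε Vf Tf) (n : ℕ) :
    EntryMeasurable fun ω => Tf (X n ω) := fun i j => (e.T_meas i j).comp (e.meas n)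

variable (H : F.Regime K ε) (e : Environment P X ν V₀ T₀ ε Vf Tf)

/-- The sum of the traces of the growth increments. -/
noncomputable def growth (N : ℕ) (ω : Ω) : ℂ :=
  ∑ k ∈ Finset.range N, ((H.traj (e.near_seq ω)).X k).trace

lemma entryMeasurable_W (k : ℕ) : EntryMeasurable fun ω => (H.traj (e.near_seq ω)).W k :=
  F.entryMeasurable_chartSlope (fun n _ => e.V_meas_seq n) fun n _ => e.T_meas_seq n

/-- The slope before site `k` is computed from the product of the first `k` transfer matrices, which
involves only the indices below `k`. -/
lemma past_measurable_W (k : ℕ) (i j : Fin L) :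
    Measurable[⨆ j ∈ Set.Iio k, MeasurableSpace.comap (X j) mS]
      fun ω => (H.traj (e.near_seq ω)).W k i j := by
  have h : ∀ n < k, @EntryMeasurable Ω ℝ _ _ _ (⨆ j ∈ Set.Iio k, MeasurableSpace.comap (X j) mS)
      fun ω => Vf (X n ω) := fun n hn i j => (e.V_meas i j).comp (measurable_past hn)
  have h' : ∀ n < k, @EntryMeasurable Ω ℝ _ _ _ (⨆ j ∈ Set.Iio k, MeasurableSpace.comap (X j) mS)
      fun ω => Tf (X n ω) := fun n hn i j => (e.T_meas i j).comp (measurable_past hn)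
  exact @NormalForm.entryMeasurable_chartSlope _ _ _ _ _
    (⨆ j ∈ Set.Iio k, MeasurableSpace.comap (X j) mS) F _ _ k h h' i j

lemma X_eq (ω : Ω) (k : ℕ) : (H.traj (e.near_seq ω)).X k
    = (F.pert (Vf (X k ω)) (Tf (X k ω))).toBlocks₁₁
      + (F.pert (Vf (X k ω)) (Tf (X k ω))).toBlocks₁₂ * (H.traj (e.near_seq ω)).W k := rfl

lemma measurable_trace_X (k : ℕ) : Measurable fun ω => ((H.traj (e.near_seq ω)).X k).trace := by
  have hp := F.entryMeasurable_pert (e.V_meas_seq k) (e.T_meas_seq k)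
  have h1 : EntryMeasurable fun ω => (F.pert (Vf (X k ω)) (Tf (X k ω))).toBlocks₁₁ :=
    fun i j => hp (Sum.inl i) (Sum.inl j)
  have h2 : EntryMeasurable fun ω => (F.pert (Vf (X k ω)) (Tf (X k ω))).toBlocks₁₂ :=
    fun i j => hp (Sum.inl i) (Sum.inr j)
  exact (h1.add (h2.mul (e.entryMeasurable_W H k))).trace

lemma norm_trace_X_le (ω : Ω) (k : ℕ) :
    ‖((H.traj (e.near_seq ω)).X k).trace‖ ≤ L * (6 * (40 * K ^ 7 * ε)) := by
  refine (norm_trace_le _).trans ?_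
  rw [Fintype.card_fin]
  exact mul_le_mul_of_nonneg_left (H.norm_X_le _ k) (Nat.cast_nonneg L)

lemma measurable_growth (N : ℕ) : Measurable (e.growth H N) :=
  Finset.measurable_sum _ fun k _ => e.measurable_trace_X H k

lemma norm_growth_le (N : ℕ) (ω : Ω) : ‖e.growth H N ω‖ ≤ N * (L * (6 * (40 * K ^ 7 * ε))) := by
  refine (norm_sum_le _ _).trans ?_
  calc _ ≤ ∑ _k ∈ Finset.range N, (L * (6 * (40 * K ^ 7 * ε))) :=
        Finset.sum_le_sum fun k _ => e.norm_trace_X_le H ω k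
    _ = _ := by rw [Finset.sum_const, Finset.card_range, nsmul_eq_mul]

lemma integrable_growth (N : ℕ) : Integrable (e.growth H N) P :=
  integrable_of_bounded (e.measurable_growth H N) _ (e.norm_growth_le H N)

/-- The core of the argument. Since `D12` at site `k` is independent of `W_k`, its expectation can
be taken against the mean slope, and the sum over `k` is performed with a fixed `D12`, where
averaging makes it small. One `δ` comes from `D12`, the second from the mean slope. -/
lemma norm_integral_growth_sub_le (N : ℕ) :
    ‖∫ ω, e.growth H N ω ∂P - N * ∫ σ, (F.pert (Vf σ) (Tf σ)).toBlocks₁₁.trace ∂ν‖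
      ≤ L * (40 * K ^ 7 * ε) * (2 * ((1 + 72 * (40 * K ^ 7 * ε) * N) / F.gh)
        + (2 + 72 * (40 * K ^ 7 * ε) * N) / F.ge) := by
  have hp := F.entryMeasurable_pert e.V_meas e.T_meas
  have hδ := fun σ => F.norm_pert_le H.bg H.norm_M (e.near σ) H.ε_mul_le
  have hD11 : EntryMeasurable fun σ => (F.pert (Vf σ) (Tf σ)).toBlocks₁₁ :=
    fun i j => hp (Sum.inl i) (Sum.inl j)
  have hD12 : EntryMeasurable fun σ => (F.pert (Vf σ) (Tf σ)).toBlocks₁₂ :=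
    fun i j => hp (Sum.inl i) (Sum.inr j)
  have hn12 : ∀ σ, ‖(F.pert (Vf σ) (Tf σ)).toBlocks₁₂‖ ≤ 40 * K ^ 7 * ε :=
    fun σ => (norm_toBlocks₁₂_le _).trans (hδ σ)
  have hD12i : ∀ i j, Integrable (fun σ => (F.pert (Vf σ) (Tf σ)).toBlocks₁₂ i j) ν :=
    fun i j => integrable_of_bounded (hD12 i j) _ fun σ => (norm_entry_le _ i j).trans (hn12 σ)
  have hW := e.entryMeasurable_W H
  have hWi : ∀ k i j, Integrable (fun ω => (H.traj (e.near_seq ω)).W k i j) P :=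
    fun k i j => integrable_of_bounded (hW k i j) 5 fun ω =>
      (norm_entry_le _ i j).trans (H.norm_W_le _ k)
  set w : ℕ → Matrix (Fin L) (Fin L) ℂ :=
    fun k => Matrix.of fun i j => ∫ ω, (H.traj (e.near_seq ω)).W k i j ∂P with hw
  have h11 : ∀ k, ∫ ω, (F.pert (Vf (X k ω)) (Tf (X k ω))).toBlocks₁₁.trace ∂P
      = ∫ σ, (F.pert (Vf σ) (Tf σ)).toBlocks₁₁.trace ∂ν := by
    intro k
    rw [← e.law k, integral_map (e.meas k).aemeasurable hD11.trace.aestronglyMeasurable]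
  have h12 : ∀ k, ∫ ω, ((F.pert (Vf (X k ω)) (Tf (X k ω))).toBlocks₁₂
      * (H.traj (e.near_seq ω)).W k).trace ∂P
      = ∫ σ, ((F.pert (Vf σ) (Tf σ)).toBlocks₁₂ * w k).trace ∂ν := fun k =>
    integral_trace_indep (f := fun σ => (F.pert (Vf σ) (Tf σ)).toBlocks₁₂) (e.meas k) (e.law k)
      hD12 hD12i (hWi k) fun i j _ _ =>
        indepFun_past e.meas e.indep (hD12 i j) (e.past_measurable_W H k _ _)
  have i11 : ∀ k, Integrable (fun ω => (F.pert (Vf (X k ω)) (Tf (X k ω))).toBlocks₁₁.trace) P :=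
    fun k => integrable_of_bounded (hD11.trace.comp (e.meas k)) (L * (40 * K ^ 7 * ε)) fun ω => by
      refine (norm_trace_le _).trans ?_
      rw [Fintype.card_fin]
      exact mul_le_mul_of_nonneg_left ((norm_toBlocks₁₁_le _).trans (hδ _)) (Nat.cast_nonneg L)
  have iX : ∀ k, Integrable (fun ω => ((H.traj (e.near_seq ω)).X k).trace) P := fun k =>
    integrable_of_bounded (e.measurable_trace_X H k) _ fun ω => e.norm_trace_X_le H ω k
  have hX : ∀ k, ∫ ω, ((H.traj (e.near_seq ω)).X k).trace ∂P
      = ∫ σ, (F.pert (Vf σ) (Tf σ)).toBlocks₁₁.trace ∂ν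
        + ∫ σ, ((F.pert (Vf σ) (Tf σ)).toBlocks₁₂ * w k).trace ∂ν := by
    intro k
    have h2 : Integrable (fun ω => ((F.pert (Vf (X k ω)) (Tf (X k ω))).toBlocks₁₂
        * (H.traj (e.near_seq ω)).W k).trace) P := by
      have := (iX k).sub (i11 k)
      refine this.congr (Eventually.of_forall fun ω => ?_)
      simp [e.X_eq H ω k]
    simp only [e.X_eq H, Matrix.trace_add]
    rw [integral_add (i11 k) h2, h11, h12]
  have i12 : ∀ k, Integrable (fun σ => ((F.pert (Vf σ) (Tf σ)).toBlocks₁₂ * w k).trace) ν := by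
    intro k
    simp only [Matrix.trace, Matrix.diag_apply, Matrix.mul_apply]
    exact integrable_finsetSum _ fun i _ => integrable_finsetSum _ fun j _ =>
      (hD12i i j).mul_const _
  have hsum : ∫ ω, e.growth H N ω ∂P
      - N * ∫ σ, (F.pert (Vf σ) (Tf σ)).toBlocks₁₁.trace ∂ν
      = ∫ σ, ∑ k ∈ Finset.range N, ((F.pert (Vf σ) (Tf σ)).toBlocks₁₂ * w k).trace ∂ν := by
    simp only [growth]
    rw [integral_finsetSum _ fun k _ => iX k, integral_finsetSum _ fun k _ => i12 k]
    simp only [hX]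
    rw [Finset.sum_add_distrib, Finset.sum_const, Finset.card_range, nsmul_eq_mul]
    ring
  rw [hsum]
  -- For a fixed `B` the sum of means is the mean of the pathwise sums, and these obey the
  -- deterministic bound on every trajectory.
  have hbound : ∀ B : Matrix (Fin L) (Fin L) ℂ, ‖B‖ ≤ 40 * K ^ 7 * ε →
      ‖∑ k ∈ Finset.range N, (B * w k).trace‖
      ≤ L * (40 * K ^ 7 * ε) * (2 * ((1 + 72 * (40 * K ^ 7 * ε) * N) / F.gh)
        + (2 + 72 * (40 * K ^ 7 * ε) * N) / F.ge) := by
    intro B hB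
    have h1 : ∀ k, (B * w k).trace = ∫ ω, (B * (H.traj (e.near_seq ω)).W k).trace ∂P :=
      fun k => (integral_trace_mul (hWi k)).symm
    have h2 : ∀ k, Integrable (fun ω => (B * (H.traj (e.near_seq ω)).W k).trace) P := by
      intro k
      simp only [Matrix.trace, Matrix.diag_apply, Matrix.mul_apply]
      exact integrable_finsetSum _ fun i _ => integrable_finsetSum _ fun j _ =>
        (hWi k j i).const_mul _
    simp only [h1]
    rw [← integral_finsetSum _ fun k _ => h2 k]
    have h3 := norm_integral_le_of_norm_le_const (μ := P)
      (f := fun ω => ∑ k ∈ Finset.range N, (B * (H.traj (e.near_seq ω)).W k).trace)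
      (C := L * (40 * K ^ 7 * ε) * (2 * ((1 + 72 * (40 * K ^ 7 * ε) * N) / F.gh)
        + (2 + 72 * (40 * K ^ 7 * ε) * N) / F.ge)) (Eventually.of_forall fun ω => by
        refine ((H.traj (e.near_seq ω)).norm_sum_trace_le H.gh_pos F.gh_le_one H.δ_nonneg H.gap
          H.ge_pos B N).trans ?_
        rw [Fintype.card_fin]
        have := H.δ_nonneg
        have := H.gh_pos
        have := H.ge_pos
        refine mul_le_mul_of_nonneg_right (mul_le_mul_of_nonneg_left hB (Nat.cast_nonneg L)) ?_
        positivity)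
    simpa using h3
  have h3 := norm_integral_le_of_norm_le_const (μ := ν) (Eventually.of_forall fun σ =>
    hbound _ (hn12 σ))
  simpa using h3

end Environment

end Expectation

end BlockJacobi

namespace BlockJacobi

/-! ### Existence of the limits -/

section Limits

/-- Fekete's lemma for `u + c`, which is subadditive; the added constant disappears after division
by `n`. -/
lemma exists_tendsto_div_of_add_le {u : ℕ → ℝ} {a b c : ℝ} (hc : 0 ≤ c) (ha : 0 ≤ a) (hb : 0 ≤ b)
    (hu : ∀ m n, u (m + n) ≤ u m + u n + c) (hl : ∀ n : ℕ, -(a + n * b) ≤ u n) :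
    ∃ ℓ, Tendsto (fun n : ℕ => u n / n) atTop (𝓝 ℓ) := by
  have hs : Subadditive fun n => u n + c := fun m n => by linarith [hu m n]
  have hbdd : BddBelow (Set.range fun n : ℕ => (u n + c) / n) := by
    refine ⟨-(a + b), ?_⟩
    rintro _ ⟨n, rfl⟩
    rcases Nat.eq_zero_or_pos n with rfl | hn
    · simp; linarith
    · have hn' : (1 : ℝ) ≤ n := by exact_mod_cast hn
      change -(a + b) ≤ (u n + c) / n
      rw [le_div_iff₀ (by positivity)]
      nlinarith [hl n]
  refine ⟨hs.lim, ?_⟩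
  have h1 := hs.tendsto_lim hbdd
  have h2 : Tendsto (fun n : ℕ => c / (n : ℝ)) atTop (𝓝 0) := tendsto_const_div_atTop_nhds_zero_nat c
  have h3 := h1.sub h2
  rw [sub_zero] at h3
  refine h3.congr fun n => ?_
  ring

lemma tendsto_div_mul {u : ℕ → ℝ} {ℓ : ℝ} (h : Tendsto (fun n : ℕ => u n / n) atTop (𝓝 ℓ))
    (c : ℝ) : Tendsto (fun n : ℕ => u n / (n * c)) atTop (𝓝 (ℓ / c)) := by
  refine (h.div_const c).congr fun n => ?_
  rw [div_div]

/-- Only the error proportional to `n` survives in the limit; a boundary error `c`, however large,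
does not. -/
lemma abs_sub_le_of_tendsto {a : ℕ → ℝ} {ℓ G c r L : ℝ} (hL : 0 < L)
    (h : Tendsto (fun n : ℕ => a n / (n * L)) atTop (𝓝 ℓ))
    (hb : ∀ n : ℕ, |a n - n * G| ≤ c + n * (L * r)) : |ℓ - G / L| ≤ r := by
  have h1 : Tendsto (fun n : ℕ => |a n / (n * L) - G / L|) atTop (𝓝 |ℓ - G / L|) :=
    (h.sub_const _).abs
  have h2 : Tendsto (fun n : ℕ => c / L / (n : ℝ) + r) atTop (𝓝 (0 + r)) :=
    (tendsto_const_div_atTop_nhds_zero_nat (c / L)).add_const r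
  rw [zero_add] at h2
  refine le_of_tendsto_of_tendsto h1 h2 ?_
  filter_upwards [eventually_ge_atTop 1] with n hn
  have hn' : (0 : ℝ) < n := by exact_mod_cast hn
  have e1 : a n / (n * L) - G / L = (a n - n * G) / (n * L) := by
    field_simp
  have e2 : c / L / (n : ℝ) + r = (c + n * (L * r)) / (n * L) := by
    field_simp
  rw [e1, e2, abs_div, abs_of_pos (mul_pos hn' hL)]
  exact div_le_div_of_nonneg_right (hb n) (by positivity)

variable {L : ℕ}

lemma transferProd_add (V T : ℕ → Matrix (Fin L) (Fin L) ℝ) (E : ℝ) (m n : ℕ) :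
    transferProd V T E (m + n)
      = transferProd (fun k => V (m + k)) (fun k => T (m + k)) E n * transferProd V T E m := by
  induction n with
  | zero => simp [transferProd]
  | succ n ih =>
    rw [← add_assoc, transferProd, ih, transferProd, Matrix.mul_assoc]

variable {Ω S : Type*} [mΩ : MeasurableSpace Ω] [mS : MeasurableSpace S] {P : Measure Ω}
  [IsProbabilityMeasure P] {X : ℕ → Ω → S} {ν : Measure S}
  {E : ℝ} {Vf Tf : S → Matrix (Fin L) (Fin L) ℝ}

lemma measurable_count (hX : ∀ n, Measurable (X n)) (hV : EntryMeasurable Vf)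
    (hT : EntryMeasurable Tf) (hVs : ∀ σ, (Vf σ).IsSymm) (hTs : ∀ σ, (Tf σ).IsSymm) (E : ℝ)
    (N : ℕ) : Measurable fun ω => (eigCount
      (hamiltonian (fun n => Vf (X n ω)) (fun n => Tf (X n ω)) N) E : ℝ) :=
  measurable_eigCount (fun ω => hamiltonian_isSymm (fun n => hVs (X n ω)) (fun n => hTs (X n ω)) N)
    (EntryMeasurable.hamiltonian (V := fun n ω => Vf (X n ω)) (T := fun n ω => Tf (X n ω))
      (fun n i j => (hV i j).comp (hX n)) (fun n i j => (hT i j).comp (hX n)) N) E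

lemma integrable_count (hX : ∀ n, Measurable (X n)) (hV : EntryMeasurable Vf)
    (hT : EntryMeasurable Tf) (hVs : ∀ σ, (Vf σ).IsSymm) (hTs : ∀ σ, (Tf σ).IsSymm) (E : ℝ)
    (N : ℕ) : Integrable (fun ω => (eigCount
      (hamiltonian (fun n => Vf (X n ω)) (fun n => Tf (X n ω)) N) E : ℝ)) P :=
  integrable_of_bounded (measurable_count hX hV hT hVs hTs E N)
    (Fintype.card (Fin N × Fin L)) fun ω => by
      rw [Real.norm_eq_abs, abs_of_nonneg (Nat.cast_nonneg _)]
      exact_mod_cast eigCount_le_card (hamiltonian_isSymm (fun n => hVs (X n ω))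
        (fun n => hTs (X n ω)) N) E

/-- Stationarity replaces the expectation over the shifted second piece by the one over a chain
started at the origin, which makes the expectations almost subadditive. -/
lemma exists_tendsto_integral_div (hX : ∀ n, Measurable (X n)) (hi : iIndepFun X P)
    (hν : ∀ n, P.map (X n) = ν) {f : ℕ → (ℕ → S) → ℝ} (hf : ∀ n, Measurable (f n)) {a b c : ℝ}
    (ha : 0 ≤ a) (hb : 0 ≤ b) (hc : 0 ≤ c) (hbd : ∀ (n : ℕ) s, |f n s| ≤ a + n * b)
    (hadd : ∀ m n s, f (m + n) s ≤ f m s + f n (fun k => s (m + k)) + c) :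
    ∃ ℓ, Tendsto (fun n : ℕ => (∫ ω, f n (fun k => X k ω) ∂P) / n) atTop (𝓝 ℓ) := by
  have hint : ∀ (Y : ℕ → Ω → S), (∀ n, Measurable (Y n)) → ∀ n : ℕ,
      Integrable (fun ω => f n (fun k => Y k ω)) P := fun Y hY n =>
    integrable_of_bounded ((hf n).comp (measurable_pi_lambda _ hY)) (a + n * b) fun ω => hbd n _
  refine exists_tendsto_div_of_add_le hc ha hb (fun m n => ?_) fun n => ?_
  · rw [← integral_shift hX hi hν (hf n) m]
    have h1 := integral_mono (μ := P) (hint X hX (m + n)) (((hint X hX m).add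
      (hint (fun k => X (m + k)) (fun k => hX (m + k)) n)).add (integrable_const c))
      (fun ω => hadd m n fun k => X k ω)
    rw [integral_add' ((hint X hX m).add (hint (fun k => X (m + k)) (fun k => hX (m + k)) n))
      (integrable_const c), integral_add' (hint X hX m)
      (hint (fun k => X (m + k)) (fun k => hX (m + k)) n), integral_const] at h1
    simpa using h1
  · have h1 := norm_integral_le_of_norm_le_const (μ := P) (f := fun ω => f n fun k => X k ω)
      (C := a + n * b) (Eventually.of_forall fun ω => hbd n _)
    rw [Real.norm_eq_abs] at h1
    simp only [probReal_univ, mul_one] at h1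
    exact (abs_le.mp h1).1

lemma abs_integral_sub_sub_le {f g : Ω → ℝ} {a c : ℝ} (hf : Integrable f P) (hg : Integrable g P)
    (h : ∀ ω, |f ω - a - g ω| ≤ c) : |∫ ω, f ω ∂P - a - ∫ ω, g ω ∂P| ≤ c := by
  have h1 := norm_integral_le_of_norm_le_const (μ := P) (f := fun ω => f ω - a - g ω)
    (Eventually.of_forall h)
  have hfa : Integrable (fun ω => f ω - a) P := hf.sub (integrable_const a)
  rw [integral_sub hfa hg, integral_sub hf (integrable_const a), integral_const] at h1
  simpa using h1

/-- Cutting the chain changes the count by at most `2 L`, which is the defect in the subadditivity.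
No closeness to an unperturbed chain is needed. -/
lemma exists_hasIDS (hX : ∀ n, Measurable (X n)) (hi : iIndepFun X P)
    (hν : ∀ n, P.map (X n) = ν) (hV : EntryMeasurable Vf) (hT : EntryMeasurable Tf)
    (hVs : ∀ σ, (Vf σ).IsSymm) (hTs : ∀ σ, (Tf σ).IsSymm) (E : ℝ) :
    ∃ 𝒩, HasIDS P (fun n ω => Vf (X n ω)) (fun n ω => Tf (X n ω)) E 𝒩 := by
  have hp : ∀ n, Measurable fun s : ℕ → S => s n := fun n => measurable_pi_apply n
  set f : ℕ → (ℕ → S) → ℝ := fun N s => (eigCount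
      (hamiltonian (fun n => Vf (s n)) (fun n => Tf (s n)) N) E : ℝ) with hf
  have hm : ∀ n, Measurable (f n) :=
    measurable_count hp hV hT hVs hTs E
  have key := exists_tendsto_integral_div hX hi hν hm
      (a := 0) (b := L) (c := 2 * L) le_rfl (Nat.cast_nonneg _) (by positivity) ?_ ?_
  · obtain ⟨ℓ, hℓ⟩ := key
    exact ⟨_, tendsto_div_mul hℓ L⟩
  · intro n s
    have := eigCount_le_card (hamiltonian_isSymm (fun n => hVs (s n)) (fun n => hTs (s n)) n) E
    rw [Fintype.card_prod, Fintype.card_fin, Fintype.card_fin] at this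
    rw [abs_of_nonneg (Nat.cast_nonneg _), zero_add]
    simp only [hf]
    exact_mod_cast this
  · intro m n s
    have := (abs_le.mp (abs_eigCount_hamiltonian_add_sub_le (fun k => hVs (s k))
      (fun k => hTs (s k)) m n E)).2
    linarith

variable [IsProbabilityMeasure ν]
  {V₀ T₀ : Matrix (Fin L) (Fin L) ℝ} {K ε : ℝ} {F : NormalForm (transfer V₀ T₀ E)}

namespace Environment

/-- A linear bound in `N`, uniform over all admissible sequences; it gives integrability as well as
the lower bound required by Fekete's lemma. -/
lemma exists_bound (H : F.Regime K ε)
    : ∃ a b : ℝ, 0 ≤ a ∧ 0 ≤ b ∧ ∀ V T : ℕ → Matrix (Fin L) (Fin L) ℝ,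
    (∀ n, Near V₀ T₀ ε (V n) (T n)) → ∀ N : ℕ,
    0 < ‖extPower (transferProd V T E N)‖ ∧
    |Real.log ‖extPower (transferProd V T E N)‖| ≤ a + N * b := by
  obtain ⟨c, hc, h⟩ := F.exists_abs_log_norm_extPower_sub_le
  have hδ := H.δ_nonneg
  refine ⟨c, |Real.log ‖F.splitting.Ra.det‖| + L * (6 * (40 * K ^ 7 * ε))
    + L * (36 * (40 * K ^ 7 * ε) ^ 2), hc, by positivity, ?_⟩
  intro V T hVT N
  obtain ⟨h1, h2⟩ := h H hVT N
  refine ⟨lt_of_le_of_ne (norm_nonneg _) h1.symm, ?_⟩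
  have h3 : |(∑ k ∈ Finset.range N, ((H.traj hVT).X k).trace).re|
      ≤ N * (L * (6 * (40 * K ^ 7 * ε))) := by
    refine (Complex.abs_re_le_norm _).trans ((norm_sum_le _ _).trans ?_)
    calc _ ≤ ∑ _k ∈ Finset.range N, (L * (6 * (40 * K ^ 7 * ε))) :=
          Finset.sum_le_sum fun k _ => by
            refine (norm_trace_le _).trans ?_
            rw [Fintype.card_fin]
            exact mul_le_mul_of_nonneg_left (H.norm_X_le _ k) (Nat.cast_nonneg L)
      _ = _ := by rw [Finset.sum_const, Finset.card_range, nsmul_eq_mul]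
  have h4 : |(N : ℝ) * Real.log ‖F.splitting.Ra.det‖|
      = N * |Real.log ‖F.splitting.Ra.det‖| := by
    rw [abs_mul, Nat.abs_cast]
  generalize Real.log ‖extPower (transferProd V T E N)‖ = u at *
  generalize (∑ k ∈ Finset.range N, ((H.traj hVT).X k).trace).re = s at *
  generalize (N : ℝ) * Real.log ‖F.splitting.Ra.det‖ = r at *
  have e1 : u = (u - r - s) + r + s := by ring
  rw [e1]
  refine (abs_add_three _ _ _).trans ?_
  rw [h4]
  linarith

lemma integrable_log (H : F.Regime K ε) (e : Environment P X ν V₀ T₀ ε Vf Tf)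
    (N : ℕ) : Integrable (fun ω => Real.log ‖extPower
    (transferProd (fun n => Vf (X n ω)) (fun n => Tf (X n ω)) E N)‖) P := by
  obtain ⟨a, b, _, _, h⟩ := exists_bound H
  exact integrable_of_bounded (measurable_log_norm_extPower e.V_meas_seq e.T_meas_seq E N)
    (a + N * b) fun ω => (h _ _ (e.near_seq ω) N).2

lemma exists_tendsto_log_div (H : F.Regime K ε) (e : Environment P X ν V₀ T₀ ε Vf Tf)
    : ∃ ℓ, Tendsto (fun N : ℕ => (∫ ω, Real.log ‖extPower
    (transferProd (fun n => Vf (X n ω)) (fun n => Tf (X n ω)) E N)‖ ∂P) / N) atTop (𝓝 ℓ) := by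
  obtain ⟨a, b, ha, hb, h⟩ := exists_bound H
  have hs := fun s : ℕ → S =>
    h (fun k => Vf (s k)) (fun k => Tf (s k)) (fun k => e.near (s k))
  have hp : ∀ n, Measurable fun s : ℕ → S => s n := fun n => measurable_pi_apply n
  refine exists_tendsto_integral_div e.meas e.indep e.law (f := fun N s => Real.log ‖extPower
      (transferProd (fun n => Vf (s n)) (fun n => Tf (s n)) E N)‖) ?_ ha hb le_rfl
      (fun n s => (hs s n).2) fun m n s => ?_
  · have hV : ∀ n, EntryMeasurable fun s : ℕ → S => Vf (s n) :=
      fun n i j => (e.V_meas i j).comp (hp n)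
    have hT : ∀ n, EntryMeasurable fun s : ℕ → S => Tf (s n) :=
      fun n i j => (e.T_meas i j).comp (hp n)
    exact measurable_log_norm_extPower hV hT E
  · have p1 := (hs s m).1
    have p2 := (hs (fun k => s (m + k)) n).1
    have p3 := (hs s (m + n)).1
    have h1 : ‖extPower (transferProd (fun n => Vf (s n)) (fun n => Tf (s n)) E (m + n))‖
        ≤ ‖extPower (transferProd (fun n => Vf (s n)) (fun n => Tf (s n)) E m)‖
          * ‖extPower (transferProd (fun k => Vf (s (m + k))) (fun k => Tf (s (m + k))) E n)‖ := by
      rw [transferProd_add, extPower_mul, mul_comm ‖_‖]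
      exact Matrix.l2_opNorm_mul _ _
    have h2 := Real.log_le_log p3 h1
    rw [Real.log_mul p1.ne' p2.ne'] at h2
    rw [add_zero]
    exact h2

lemma exists_hasLyapunov (H : F.Regime K ε) (e : Environment P X ν V₀ T₀ ε Vf Tf)
    :
    ∃ γ, HasLyapunov P (fun n ω => Vf (X n ω)) (fun n ω => Tf (X n ω)) E γ := by
  obtain ⟨ℓ, hℓ⟩ := e.exists_tendsto_log_div H
  exact ⟨_, tendsto_div_mul hℓ L⟩

/-- The error of the first order approximation. -/
noncomputable def err (δ g ge : ℝ) : ℝ := 36 * δ ^ 2 + δ * (144 * δ / g + 72 * δ / ge)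

/-- The first-order formula: a constant of the normal form plus a term that is linear in the law of
a site. Only this affine dependence on the law is exploited later. -/
lemma abs_lyapunov_sub_le (H : F.Regime K ε) (e : Environment P X ν V₀ T₀ ε Vf Tf)
    (hL : 0 < L) {γ : ℝ}
    (hγ : HasLyapunov P (fun n ω => Vf (X n ω)) (fun n ω => Tf (X n ω)) E γ) :
    |γ - (Real.log ‖F.splitting.Ra.det‖
      + (∫ σ, (F.pert (Vf σ) (Tf σ)).toBlocks₁₁.trace ∂ν).re) / L|
      ≤ err (40 * K ^ 7 * ε) F.gh F.ge := by
  obtain ⟨c, hc, h⟩ := F.exists_abs_log_norm_extPower_sub_le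
  refine abs_sub_le_of_tendsto (c := c + L * (40 * K ^ 7 * ε) * (2 / F.gh + 2 / F.ge))
    (by exact_mod_cast hL) hγ fun N => ?_
  have hint := e.integrable_log H N
  have hg := (e.integrable_growth H N).re
  have h1 := abs_integral_sub_sub_le hint hg (a := N * Real.log ‖F.splitting.Ra.det‖)
    fun ω => (h H (e.near_seq ω) N).2
  have h2 := (Complex.abs_re_le_norm _).trans (e.norm_integral_growth_sub_le H N)
  have h3 : ∫ ω, (e.growth H N ω).re ∂P = (∫ ω, e.growth H N ω ∂P).re :=
    integral_re (e.integrable_growth H N)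
  rw [Complex.sub_re, ← Complex.ofReal_natCast, Complex.re_ofReal_mul] at h2
  change |_ - ∫ ω, (e.growth H N ω).re ∂P| ≤ _ at h1
  rw [h3] at h1
  -- Separates the part bounded in `N`, which goes into the boundary constant, from the part
  -- proportional to `N L`, which makes up `err`.
  have h4 : L * (40 * K ^ 7 * ε) * (2 * ((1 + 72 * (40 * K ^ 7 * ε) * N) / F.gh)
        + (2 + 72 * (40 * K ^ 7 * ε) * N) / F.ge)
      = L * (40 * K ^ 7 * ε) * (2 / F.gh + 2 / F.ge) + N * (L * ((40 * K ^ 7 * ε)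
        * (144 * (40 * K ^ 7 * ε) / F.gh + 72 * (40 * K ^ 7 * ε) / F.ge))) := by
    ring
  rw [h4] at h2
  rw [err]
  rw [abs_le] at h1 h2 ⊢
  constructor <;> linarith [h1.1, h1.2, h2.1, h2.2]

/-- The unperturbed density of states `𝒩₀` serves as the reference point, because the homotopy only
controls differences of counts. It drops out of the final comparison. -/
lemma abs_ids_sub_le (H : F.Regime K ε) (e : Environment P X ν V₀ T₀ ε Vf Tf)
    (hL : 0 < L) {𝒩 𝒩₀ : ℝ}
    (h𝒩 : HasIDS P (fun n ω => Vf (X n ω)) (fun n ω => Tf (X n ω)) E 𝒩)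
    (h𝒩₀ : HasIDS P (fun _ _ => V₀) (fun _ _ => T₀) E 𝒩₀) :
    |𝒩 - (𝒩₀ + (∫ σ, (F.pert (Vf σ) (Tf σ)).toBlocks₁₁.trace ∂ν).im / (Real.pi * L))|
      ≤ err (40 * K ^ 7 * ε) F.gh F.ge := by
  have hVs := fun σ => (e.near σ).V_symm
  have hTs := fun σ => isSymm_of_posDef (e.near σ).T_posDef
  have hπ : 1 ≤ Real.pi := by linarith [Real.pi_gt_three]
  have hlim := (h𝒩.sub h𝒩₀).const_mul Real.pi
  have hint : ∀ N : ℕ, Integrable (fun ω => (eigCount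
      (hamiltonian (fun n => Vf (X n ω)) (fun n => Tf (X n ω)) N) E : ℝ)) P := fun N =>
    integrable_count e.meas e.V_meas e.T_meas hVs hTs E N
  have key : |Real.pi * (𝒩 - 𝒩₀)
      - (∫ σ, (F.pert (Vf σ) (Tf σ)).toBlocks₁₁.trace ∂ν).im / L|
      ≤ err (40 * K ^ 7 * ε) F.gh F.ge := by
    refine abs_sub_le_of_tendsto (a := fun N => Real.pi * (∫ ω, (eigCount
      (hamiltonian (fun n => Vf (X n ω)) (fun n => Tf (X n ω)) N) E : ℝ) ∂P)
        - Real.pi * eigCount (hamiltonian (fun _ => V₀) (fun _ => T₀) N) E)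
      (c := 4 * (Real.pi * L) + L * (40 * K ^ 7 * ε) * (2 / F.gh + 2 / F.ge))
      (by exact_mod_cast hL) (hlim.congr fun N => ?_) fun N => ?_
    · rw [integral_const]
      simp only [probReal_univ, one_smul]
      ring
    have hg := (e.integrable_growth H N).im
    have h1 := abs_integral_sub_sub_le ((hint N).const_mul Real.pi) hg
      (a := Real.pi * eigCount (hamiltonian (fun _ => V₀) (fun _ => T₀) N) E)
      fun ω => H.abs_count_sub_le (e.near_seq ω) N
    rw [integral_const_mul] at h1
    have h2 := (Complex.abs_im_le_norm _).trans (e.norm_integral_growth_sub_le H N)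
    have h3 : ∫ ω, (e.growth H N ω).im ∂P = (∫ ω, e.growth H N ω ∂P).im :=
      integral_im (e.integrable_growth H N)
    rw [Complex.sub_im, ← Complex.ofReal_natCast, Complex.im_ofReal_mul] at h2
    change |_ - ∫ ω, (e.growth H N ω).im ∂P| ≤ _ at h1
    rw [h3] at h1
    have h4 : L * (40 * K ^ 7 * ε) * (2 * ((1 + 72 * (40 * K ^ 7 * ε) * N) / F.gh)
          + (2 + 72 * (40 * K ^ 7 * ε) * N) / F.ge)
        = L * (40 * K ^ 7 * ε) * (2 / F.gh + 2 / F.ge) + N * (L * ((40 * K ^ 7 * ε)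
          * (144 * (40 * K ^ 7 * ε) / F.gh + 72 * (40 * K ^ 7 * ε) / F.ge))) := by
      ring
    rw [h4] at h2
    rw [err]
    rw [abs_le] at h1 h2 ⊢
    constructor <;> linarith [h1.1, h1.2, h2.1, h2.2]
  have e1 : Real.pi * (𝒩 - 𝒩₀) - (∫ σ, (F.pert (Vf σ) (Tf σ)).toBlocks₁₁.trace ∂ν).im / L
      = Real.pi * (𝒩 - (𝒩₀
        + (∫ σ, (F.pert (Vf σ) (Tf σ)).toBlocks₁₁.trace ∂ν).im / (Real.pi * L))) := by
    have hL' : (L : ℝ) ≠ 0 := by exact_mod_cast hL.ne'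
    field_simp
    ring
  -- The estimate holds with an additional factor `1/π`, which is discarded.
  rw [e1, abs_mul, abs_of_pos Real.pi_pos] at key
  refine le_trans ?_ key
  exact le_mul_of_one_le_left (abs_nonneg _) hπ

end Environment

end Limits

end BlockJacobi

namespace BlockJacobi

/-! ### Functions of diagonalizable matrices -/

section Diagonalization

variable {k : Type*} [Field k] {n : Type*} [Fintype n] [DecidableEq n]

/-- A diagonalization `A = Q d R`, with `R = Q⁻¹`. -/
structure Diagonalization (A : Matrix n n k) where
  /-- the eigenvectors -/
  Q : Matrix n n k
  /-- the inverse of `Q` -/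
  R : Matrix n n k
  /-- the eigenvalues -/
  d : n → k
  QR : Q * R = 1
  RQ : R * Q = 1
  eq : A = Q * Matrix.diagonal d * R

namespace Diagonalization

variable {A A' : Matrix n n k}

/-- The function `g` of a diagonalized matrix. -/
def fc (D : Diagonalization A) (g : k → k) : Matrix n n k :=
  D.Q * Matrix.diagonal (fun i => g (D.d i)) * D.R

lemma fc_id (D : Diagonalization A) : D.fc (fun z => z) = A := D.eq.symm

lemma fc_congr (D : Diagonalization A) {g h : k → k} (H : ∀ i, g (D.d i) = h (D.d i)) :
    D.fc g = D.fc h := by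
  rw [fc, fc, funext H]

lemma fc_one (D : Diagonalization A) : D.fc (fun _ => 1) = 1 := by
  rw [fc, Matrix.diagonal_one, Matrix.mul_one, D.QR]

lemma fc_mul (D : Diagonalization A) (g h : k → k) :
    D.fc g * D.fc h = D.fc fun z => g z * h z := by
  rw [fc, fc, fc, ← Matrix.diagonal_mul_diagonal]
  calc _ = D.Q * Matrix.diagonal (fun i => g (D.d i)) * (D.R * D.Q)
        * Matrix.diagonal (fun i => h (D.d i)) * D.R := by simp only [Matrix.mul_assoc]
    _ = _ := by rw [D.RQ, Matrix.mul_one, Matrix.mul_assoc D.Q]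

lemma fc_mul_comm (D : Diagonalization A) (g h : k → k) : D.fc g * D.fc h = D.fc h * D.fc g := by
  rw [fc_mul, fc_mul]
  simp only [mul_comm]

/-- Written in the two eigenbases, an intertwiner has nonzero entries only between equal
eigenvalues, so it also intertwines any function of them. No continuity or polynomial approximation
is involved, hence indicator functions and conjugation are allowed. With `X = 1` it shows that the
calculus does not depend on the diagonalization. -/
lemma fc_intertwine (D : Diagonalization A) (D' : Diagonalization A') {X : Matrix n n k}
    (h : A * X = X * A') (g : k → k) : D.fc g * X = X * D'.fc g := by
  set Y := D.R * X * D'.Q with hY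
  have hX : X = D.Q * Y * D'.R := by
    calc X = (D.Q * D.R) * X * (D'.Q * D'.R) := by rw [D.QR, D'.QR, Matrix.one_mul, Matrix.mul_one]
      _ = _ := by simp only [hY, Matrix.mul_assoc]
  have h1 : Matrix.diagonal D.d * Y = Y * Matrix.diagonal D'.d := by
    calc Matrix.diagonal D.d * Y
        = (D.R * D.Q) * Matrix.diagonal D.d * Y := by rw [D.RQ, Matrix.one_mul]
      _ = D.R * (D.Q * Matrix.diagonal D.d * D.R * X) * D'.Q := by
        simp only [hY, Matrix.mul_assoc]
      _ = D.R * (X * (D'.Q * Matrix.diagonal D'.d * D'.R)) * D'.Q := by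
        rw [← D.eq, ← D'.eq, h]
      _ = Y * Matrix.diagonal D'.d * (D'.R * D'.Q) := by simp only [hY, Matrix.mul_assoc]
      _ = _ := by rw [D'.RQ, Matrix.mul_one]
  have h3 : Matrix.diagonal (fun i => g (D.d i)) * Y
      = Y * Matrix.diagonal (fun i => g (D'.d i)) := by
    ext i j
    have h4 := congrFun (congrFun h1 i) j
    rw [Matrix.diagonal_mul, Matrix.mul_diagonal] at h4 ⊢
    by_cases hz : Y i j = 0
    · rw [hz, mul_zero, zero_mul]
    · have : D.d i = D'.d j := by
        rw [mul_comm] at h4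
        exact mul_left_cancel₀ hz h4
      rw [this, mul_comm]
  calc D.fc g * X = D.Q * Matrix.diagonal (fun i => g (D.d i)) * (D.R * D.Q) * Y * D'.R := by
        rw [hX, fc]; simp only [Matrix.mul_assoc]
    _ = D.Q * (Matrix.diagonal (fun i => g (D.d i)) * Y) * D'.R := by
        rw [D.RQ, Matrix.mul_one, Matrix.mul_assoc D.Q]
    _ = D.Q * Y * (D'.R * D'.Q) * Matrix.diagonal (fun i => g (D'.d i)) * D'.R := by
        rw [h3, D'.RQ, Matrix.mul_one]; simp only [Matrix.mul_assoc]
    _ = X * D'.fc g := by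
        rw [hX, fc]; simp only [Matrix.mul_assoc]

lemma fc_eq (D : Diagonalization A) (D' : Diagonalization A) (g : k → k) : D.fc g = D'.fc g := by
  have := D.fc_intertwine D' (X := 1) (by rw [Matrix.mul_one, Matrix.one_mul]) g
  rwa [Matrix.mul_one, Matrix.one_mul] at this

/-- The diagonalization of a function of a matrix. -/
def ofFc (D : Diagonalization A) (h : k → k) : Diagonalization (D.fc h) where
  Q := D.Q
  R := D.R
  d := fun i => h (D.d i)
  QR := D.QR
  RQ := D.RQ
  eq := rfl

lemma ofFc_fc (D : Diagonalization A) (h g : k → k) : (D.ofFc h).fc g = D.fc fun z => g (h z) := rfl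

/-- The diagonalization of the transpose. -/
def transpose (D : Diagonalization A) : Diagonalization A.transpose where
  Q := D.R.transpose
  R := D.Q.transpose
  d := D.d
  QR := by rw [← Matrix.transpose_mul, D.QR, Matrix.transpose_one]
  RQ := by rw [← Matrix.transpose_mul, D.RQ, Matrix.transpose_one]
  eq := by
    conv_lhs => rw [D.eq]
    rw [Matrix.transpose_mul, Matrix.transpose_mul, Matrix.diagonal_transpose, Matrix.mul_assoc]

lemma transpose_fc (D : Diagonalization A) (g : k → k) :
    D.transpose.fc g = (D.fc g).transpose := by
  rw [fc, fc, Matrix.transpose_mul, Matrix.transpose_mul, Matrix.diagonal_transpose,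
    Matrix.mul_assoc]
  rfl

/-- Transport of a diagonalization along an equality. -/
def cast (D : Diagonalization A) (h : A = A') : Diagonalization A' where
  Q := D.Q
  R := D.R
  d := D.d
  QR := D.QR
  RQ := D.RQ
  eq := h ▸ D.eq

lemma cast_fc (D : Diagonalization A) (h : A = A') (g : k → k) : (D.cast h).fc g = D.fc g := rfl

/-- The diagonalization of a conjugate. -/
def conj (D : Diagonalization A) {M M' : Matrix n n k} (h : M * M' = 1) (h' : M' * M = 1) :
    Diagonalization (M * A * M') where
  Q := M * D.Q
  R := D.R * M'
  d := D.d
  QR := by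
    calc _ = M * (D.Q * D.R) * M' := by simp only [Matrix.mul_assoc]
      _ = 1 := by rw [D.QR, Matrix.mul_one, h]
  RQ := by
    calc _ = D.R * (M' * M) * D.Q := by simp only [Matrix.mul_assoc]
      _ = 1 := by rw [h', Matrix.mul_one, D.RQ]
  eq := by
    conv_lhs => rw [D.eq]
    simp only [Matrix.mul_assoc]

lemma conj_fc (D : Diagonalization A) {M M' : Matrix n n k} (h : M * M' = 1) (h' : M' * M = 1)
    (g : k → k) : (D.conj h h').fc g = M * D.fc g * M' := by
  rw [fc, fc]
  simp only [conj, Matrix.mul_assoc]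

lemma trace_fc (D : Diagonalization A) (g : k → k) : (D.fc g).trace = ∑ i, g (D.d i) := by
  rw [fc, Matrix.mul_assoc, Matrix.trace_mul_comm, Matrix.mul_assoc, D.RQ, Matrix.mul_one,
    Matrix.trace_diagonal]

lemma d_ne_zero (D : Diagonalization A) (hA : IsUnit A.det) (i : n) : D.d i ≠ 0 := by
  intro h
  apply hA.ne_zero
  rw [D.eq, Matrix.det_mul, Matrix.det_mul, Matrix.det_diagonal,
    Finset.prod_eq_zero (Finset.mem_univ i) h, mul_zero, zero_mul]

lemma fc_inv (D : Diagonalization A) (hA : IsUnit A.det) : D.fc (fun z => z⁻¹) = A⁻¹ := by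
  symm
  apply Matrix.inv_eq_left_inv
  calc D.fc (fun z => z⁻¹) * A = D.fc (fun z => z⁻¹) * D.fc (fun z => z) := by rw [D.fc_id]
    _ = D.fc fun _ => 1 := by
        rw [fc_mul]
        exact D.fc_congr fun i => inv_mul_cancel₀ (D.d_ne_zero hA i)
    _ = 1 := D.fc_one

end Diagonalization

/-- The diagonalization of the complex conjugate of a real matrix. -/
noncomputable def Diagonalization.star {A : Matrix n n ℝ} (D : Diagonalization (cx A)) :
    Diagonalization (cx A) where
  Q := D.Q.map (starRingEnd ℂ)
  R := D.R.map (starRingEnd ℂ)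
  d := fun i => starRingEnd ℂ (D.d i)
  QR := by rw [← Matrix.map_mul, D.QR]; simp
  RQ := by rw [← Matrix.map_mul, D.RQ]; simp
  eq := by
    have h : cx A = (cx A).map (starRingEnd ℂ) := by
      ext i j
      simp
    refine h.trans ((congrArg (fun B => B.map (starRingEnd ℂ)) D.eq).trans ?_)
    simp only [Matrix.map_mul, Matrix.diagonal_map (map_zero (starRingEnd ℂ))]

/-- Conjugating all entries of a diagonalization of a real matrix gives another one. By independence
of the choice, a function commuting with conjugation has a real matrix as value. -/
lemma Diagonalization.exists_cx_eq {A : Matrix n n ℝ} (D : Diagonalization (cx A)) {g : ℂ → ℂ}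
    (hg : ∀ z, g (starRingEnd ℂ z) = starRingEnd ℂ (g z)) : ∃ B : Matrix n n ℝ, cx B = D.fc g := by
  have h : D.star.fc g = (D.fc g).map (starRingEnd ℂ) := by
    rw [fc, fc, Matrix.map_mul, Matrix.map_mul, Matrix.diagonal_map (map_zero _)]
    simp only [Diagonalization.star, hg]
  rw [D.star.fc_eq D] at h
  refine ⟨(D.fc g).map Complex.re, ?_⟩
  ext i j
  rw [cx_apply, Matrix.map_apply]
  exact (Complex.conj_eq_iff_re.mp (congrFun (congrFun h i) j).symm)

lemma cx_injective {m : Type*} : Function.Injective (cx : Matrix m n ℝ → Matrix m n ℂ) := by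
  intro A B h
  ext i j
  have := congrFun (congrFun h i) j
  simp only [cx_apply] at this
  exact_mod_cast this

end Diagonalization

end BlockJacobi

namespace BlockJacobi

/-! ### Symplectic conjugation to a normal matrix -/

section Normalization

variable {n : Type*} [Fintype n] [DecidableEq n]

lemma exists_posDef_diagonalization {P : Matrix n n ℝ} (hP : P.PosDef) :
    ∃ D : Diagonalization P, D.R = D.Q.transpose ∧ ∀ i, 0 < D.d i := by
  have hs : P.IsSymm := by
    rw [Matrix.IsSymm, ← Matrix.conjTranspose_eq_transpose_of_trivial]
    exact hP.1
  obtain ⟨Q, μ, h1, h2, h3, _⟩ := exists_orthogonal_diagonalization hs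
  refine ⟨⟨Q, Q.transpose, μ, h2, h1, h3⟩, rfl, fun i => ?_⟩
  have hd : (Matrix.diagonal μ).PosDef := by
    have h4 : Matrix.diagonal μ = Q.transpose * P * Q := by
      rw [h3]
      calc _ = (Q.transpose * Q) * Matrix.diagonal μ * (Q.transpose * Q) := by
            rw [h1, Matrix.one_mul, Matrix.mul_one]
        _ = _ := by simp only [Matrix.mul_assoc]
    rw [h4, ← Matrix.conjTranspose_eq_transpose_of_trivial]
    refine hP.conjTranspose_mul_mul_same ?_
    refine Function.LeftInverse.injective (g := Q.transpose.mulVec) fun x => ?_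
    rw [Matrix.mulVec_mulVec, h1, Matrix.one_mulVec]
  exact Matrix.posDef_diagonal_iff.mp hd i

lemma Diagonalization.fc_transpose_of_orthogonal {P : Matrix n n ℝ} {D : Diagonalization P}
    (hD : D.R = D.Q.transpose) (g : ℝ → ℝ) : (D.fc g).transpose = D.fc g := by
  rw [fc, hD, Matrix.transpose_mul, Matrix.transpose_mul, Matrix.transpose_transpose,
    Matrix.diagonal_transpose, Matrix.mul_assoc]

lemma Diagonalization.fc_posDef {P : Matrix n n ℝ} {D : Diagonalization P}
    (hD : D.R = D.Q.transpose) {g : ℝ → ℝ} (hg : ∀ i, 0 < g (D.d i)) : (D.fc g).PosDef := by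
  have h1 : (Matrix.diagonal fun i => g (D.d i)).PosDef := Matrix.posDef_diagonal_iff.mpr hg
  have h2 := h1.mul_mul_conjTranspose_same (B := D.Q) ?_
  · rwa [Matrix.conjTranspose_eq_transpose_of_trivial, ← hD] at h2
  · refine Function.LeftInverse.injective (g := D.R.vecMul) fun x => ?_
    change Matrix.vecMul (Matrix.vecMul x D.Q) D.R = x
    rw [Matrix.vecMul_vecMul, D.QR, Matrix.vecMul_one]

lemma Diagonalization.sqrt_mul_sqrt {P : Matrix n n ℝ} {D : Diagonalization P}
    (hd : ∀ i, 0 < D.d i) : D.fc Real.sqrt * D.fc Real.sqrt = P := by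
  rw [fc_mul]
  refine (D.fc_congr fun i => ?_).trans D.fc_id
  exact Real.mul_self_sqrt (hd i).le

lemma re_cx_mul (A : Matrix n n ℝ) (M : Matrix n n ℂ) :
    (cx A * M).map Complex.re = A * M.map Complex.re := by
  ext i j
  simp [Matrix.mul_apply]

lemma re_mul_cx (A : Matrix n n ℝ) (M : Matrix n n ℂ) :
    (M * cx A).map Complex.re = M.map Complex.re * A := by
  ext i j
  simp [Matrix.mul_apply]

open scoped ComplexOrder in
/-- A real inner product for which a diagonalizable matrix is normal. -/
lemma exists_inner_product {A B : Matrix n n ℝ} (D : Diagonalization (cx A))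
    (hB : cx B = D.fc (starRingEnd ℂ)) :
    ∃ P : Matrix n n ℝ, P.PosDef ∧ A.transpose * P = P * B := by
  -- The Hermitian inner product in which the eigenvectors are orthonormal.
  set H := D.R.conjTranspose * D.R with hH
  have hHp : H.PosDef := by
    refine Matrix.PosDef.conjTranspose_mul_self _ ?_
    refine Function.LeftInverse.injective (g := D.Q.mulVec) fun x => ?_
    rw [Matrix.mulVec_mulVec, D.QR, Matrix.one_mulVec]
  have hcomm : cx A.transpose * H = H * cx B := by
    have h1 : cx A.transpose = D.R.conjTranspose
        * Matrix.diagonal (fun i => starRingEnd ℂ (D.d i)) * D.Q.conjTranspose := by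
      rw [← cx_conjTranspose]
      refine (congrArg Matrix.conjTranspose D.eq).trans ?_
      rw [Matrix.conjTranspose_mul, Matrix.conjTranspose_mul, Matrix.diagonal_conjTranspose,
        Matrix.mul_assoc]
      rfl
    have h2 : D.Q.conjTranspose * D.R.conjTranspose = 1 := by
      rw [← Matrix.conjTranspose_mul, D.RQ, Matrix.conjTranspose_one]
    rw [h1, hB, Diagonalization.fc, hH]
    calc _ = D.R.conjTranspose * Matrix.diagonal (fun i => starRingEnd ℂ (D.d i))
          * (D.Q.conjTranspose * D.R.conjTranspose) * D.R := by simp only [Matrix.mul_assoc]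
      _ = D.R.conjTranspose * (D.R * D.Q) * Matrix.diagonal (fun i => starRingEnd ℂ (D.d i))
          * D.R := by rw [h2, D.RQ, Matrix.mul_one, Matrix.mul_one]
      _ = _ := by simp only [Matrix.mul_assoc]
  -- `A` and `B` are real, so the real part of `H` satisfies the same relation, and it stays
  -- positive when tested on real vectors.
  refine ⟨H.map Complex.re, ?_, ?_⟩
  · refine Matrix.PosDef.of_dotProduct_mulVec_pos ?_ fun x hx => ?_
    · ext i j
      have := congrFun (congrFun hHp.1 i) j
      rw [Matrix.conjTranspose_apply] at this
      simp only [Matrix.conjTranspose_apply, Matrix.map_apply, star_trivial]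
      rw [← this]
      simp
    · have hx' : (fun i => (x i : ℂ)) ≠ 0 := by
        intro h
        apply hx
        ext i
        have := congrFun h i
        simpa using this
      have h1 := hHp.dotProduct_mulVec_pos hx'
      have h2 := (Complex.pos_iff.mp h1).1
      refine lt_of_lt_of_eq h2 ?_
      simp [dotProduct, Matrix.mulVec, Finset.mul_sum]
  · rw [← re_cx_mul, hcomm, re_mul_cx]

variable {l : Type*} [Fintype l] [DecidableEq l]

/-- Symplecticity says that `J` intertwines `A` with the transposed inverse of `A`. Hence it
intertwines the conjugation function of both, which is the same statement for `B`. -/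
lemma conj_mem_symplectic {A B : Matrix (l ⊕ l) (l ⊕ l) ℝ}
    (hA : A ∈ Matrix.symplecticGroup l ℝ) (D : Diagonalization (cx A))
    (hB : cx B = D.fc (starRingEnd ℂ)) : B ∈ Matrix.symplecticGroup l ℝ := by
  have hu : IsUnit A.det := SymplecticGroup.symplectic_det hA
  have huc : IsUnit (cx A).det := by
    rw [cx_det]
    exact hu.map Complex.ofRealHom
  have hJ := SymplecticGroup.mem_iff.mp hA
  have h1 : cx A * cx (Matrix.J l ℝ) = cx (Matrix.J l ℝ) * ((cx A)⁻¹).transpose := by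
    rw [← cx_inv hu, ← cx_transpose, ← cx_mul, ← cx_mul]
    congr 1
    rw [Matrix.transpose_nonsing_inv]
    have hut : IsUnit A.transpose.det := by rwa [Matrix.det_transpose]
    calc A * Matrix.J l ℝ = A * Matrix.J l ℝ * A.transpose * A.transpose⁻¹ := by
          rw [Matrix.mul_nonsing_inv_cancel_right _ _ hut]
      _ = _ := by rw [hJ]
  have h2 := D.fc_intertwine (((D.ofFc fun z => z⁻¹).cast (D.fc_inv huc)).transpose) h1
    (starRingEnd ℂ)
  rw [Diagonalization.transpose_fc, Diagonalization.cast_fc, Diagonalization.ofFc_fc, ← hB] at h2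
  have h3 : (D.fc fun z => starRingEnd ℂ z⁻¹) * cx B = 1 := by
    rw [hB, D.fc_mul, ← D.fc_one]
    refine D.fc_congr fun i => ?_
    rw [← map_mul, inv_mul_cancel₀ (D.d_ne_zero huc i), map_one]
  have h4 : cx B * (D.fc fun z => starRingEnd ℂ z⁻¹) = 1 := mul_eq_one_comm.mp h3
  rw [SymplecticGroup.mem_iff]
  apply cx_injective
  rw [cx_mul, cx_mul, h2, cx_transpose, Matrix.mul_assoc, ← Matrix.transpose_mul, h4,
    Matrix.transpose_one, Matrix.mul_one]

/-- A symplectic inner product for which a diagonalizable symplectic matrix is normal. -/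
lemma exists_symplectic_inner_product {A B : Matrix (l ⊕ l) (l ⊕ l) ℝ}
    (hA : A ∈ Matrix.symplecticGroup l ℝ) (D : Diagonalization (cx A))
    (hB : cx B = D.fc (starRingEnd ℂ)) :
    ∃ P : Matrix (l ⊕ l) (l ⊕ l) ℝ, P.PosDef ∧ P ∈ Matrix.symplecticGroup l ℝ ∧
      A.transpose * P = P * B := by
  set J := Matrix.J l ℝ with hJ
  have hJJ : J * J = -1 := Matrix.J_squared l ℝ
  have hJt : J.transpose = -J := Matrix.J_transpose l ℝ
  have hAJ := SymplecticGroup.mem_iff'.mp hA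
  have hBJ := SymplecticGroup.mem_iff'.mp (conj_mem_symplectic hA D hB)
  -- Any inner product making `A` normal is corrected to one compatible with `J`. In coordinates
  -- orthonormal for `P₀ = a²`, the matrix becomes a normal `N` and the symplectic form an
  -- antisymmetric `Ω`. Inserting the modulus `Y = (Ωᵀ Ω)^{1/2}` turns the form into an orthogonal
  -- complex structure without destroying normality, because `Y` commutes with `N` and `Nᵀ`.
  obtain ⟨P₀, hP₀, hAB⟩ := exists_inner_product D hB
  obtain ⟨D₀, hR₀, hd₀⟩ := exists_posDef_diagonalization hP₀
  set a := D₀.fc Real.sqrt with ha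
  have hat : a.transpose = a := Diagonalization.fc_transpose_of_orthogonal hR₀ _
  have haa : a * a = P₀ := Diagonalization.sqrt_mul_sqrt hd₀
  set b := D₀.fc (fun x => (Real.sqrt x)⁻¹) with hb
  have hbt : b.transpose = b := Diagonalization.fc_transpose_of_orthogonal hR₀ _
  have hba : b * a = 1 := by
    rw [hb, ha, D₀.fc_mul, ← D₀.fc_one]
    exact D₀.fc_congr fun i => inv_mul_cancel₀ (Real.sqrt_pos.mpr (hd₀ i)).ne'
  have hab : a * b = 1 := mul_eq_one_comm.mp hba
  set N := a * A * b with hN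
  have hNt : N.transpose = a * B * b := by
    have h1 : b * A.transpose * a = a * B * b := by
      calc b * A.transpose * a = b * (A.transpose * (a * a)) * b := by
            calc _ = b * A.transpose * a * (a * b) := by rw [hab, Matrix.mul_one]
              _ = _ := by simp only [Matrix.mul_assoc]
        _ = b * ((a * a) * B) * b := by rw [haa, hAB]
        _ = (b * a) * a * B * b := by simp only [Matrix.mul_assoc]
        _ = _ := by rw [hba, Matrix.one_mul]
    rw [← h1, hN, Matrix.transpose_mul, Matrix.transpose_mul, hat, hbt, Matrix.mul_assoc]
  set Ω := b * J * b with hΩ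
  have hΩt : Ω.transpose = -Ω := by
    rw [hΩ, Matrix.transpose_mul, Matrix.transpose_mul, hbt, hJt, Matrix.neg_mul, Matrix.mul_neg,
      Matrix.mul_assoc]
  have hinv : ∀ X : Matrix (l ⊕ l) (l ⊕ l) ℝ, X.transpose * J * X = J →
      (a * X * b).transpose * Ω * (a * X * b) = Ω := by
    intro X hX
    calc _ = b * X.transpose * (a * b) * J * (b * a) * X * b := by
          rw [Matrix.transpose_mul, Matrix.transpose_mul, hat, hbt, hΩ]
          simp only [Matrix.mul_assoc]
      _ = b * (X.transpose * J * X) * b := by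
          rw [hab, hba]
          simp only [Matrix.mul_assoc, Matrix.mul_one]
      _ = Ω := by rw [hX, hΩ]
  have h1 : N.transpose * Ω * N = Ω := hinv A hAJ
  have h2 : N * Ω * N.transpose = Ω := by
    have := hinv B hBJ
    rwa [← hNt, Matrix.transpose_transpose] at this
  set Ω' := -(a * J * a) with hΩ'
  have hΩΩ' : Ω * Ω' = 1 := by
    calc Ω * Ω' = -(b * J * (b * a) * J * a) := by
          rw [hΩ, hΩ', Matrix.mul_neg]
          simp only [Matrix.mul_assoc]
      _ = 1 := by
          rw [hba, Matrix.mul_one, Matrix.mul_assoc b, hJJ, Matrix.mul_neg, Matrix.mul_one,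
            Matrix.neg_mul, neg_neg, hba]
  have hΩ'Ω : Ω' * Ω = 1 := mul_eq_one_comm.mp hΩΩ'
  set W := Ω.transpose * Ω with hW
  have hWp : W.PosDef := by
    rw [hW, ← Matrix.conjTranspose_eq_transpose_of_trivial]
    refine Matrix.PosDef.conjTranspose_mul_self _ ?_
    refine Function.LeftInverse.injective (g := Ω'.mulVec) fun x => ?_
    rw [Matrix.mulVec_mulVec, hΩ'Ω, Matrix.one_mulVec]
  have hWΩ : W * Ω = Ω * W := by
    rw [hW, hΩt]
    simp only [Matrix.mul_assoc, Matrix.neg_mul, Matrix.mul_neg]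
  -- Both `N` and `Nᵀ` preserve `Ω`, the latter because the conjugate matrix `B` is symplectic too;
  -- together they make `Ω²` commute with `N`.
  have hWN : W * N = N * W := by
    have h3 : Ω * Ω * N = N * (Ω * Ω) := by
      calc Ω * Ω * N = (N * Ω * N.transpose) * Ω * N := by rw [h2]
        _ = N * Ω * (N.transpose * Ω * N) := by simp only [Matrix.mul_assoc]
        _ = _ := by rw [h1, Matrix.mul_assoc]
    rw [hW, hΩt, Matrix.neg_mul, Matrix.neg_mul, Matrix.mul_neg, h3]
  obtain ⟨DW, hRW, hdW⟩ := exists_posDef_diagonalization hWp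
  set Y := DW.fc Real.sqrt with hY
  have hYt : Y.transpose = Y := Diagonalization.fc_transpose_of_orthogonal hRW _
  have hYY : Y * Y = W := Diagonalization.sqrt_mul_sqrt hdW
  have hYΩ : Y * Ω = Ω * Y := DW.fc_intertwine DW hWΩ _
  have hYN : Y * N = N * Y := DW.fc_intertwine DW hWN _
  have hYNt : Y * N.transpose = N.transpose * Y := by
    have := congrArg Matrix.transpose hYN
    rw [Matrix.transpose_mul Y, Matrix.transpose_mul N, hYt] at this
    exact this.symm
  have hYp : Y.PosDef := Diagonalization.fc_posDef hRW fun i => Real.sqrt_pos.mpr (hdW i)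
  have hPt : (a * Y * a).transpose = a * Y * a := by
    rw [Matrix.transpose_mul, Matrix.transpose_mul, hat, hYt, Matrix.mul_assoc]
  refine ⟨a * Y * a, ?_, ?_, ?_⟩
  · have := hYp.conjTranspose_mul_mul_same (B := a) ?_
    · rwa [Matrix.conjTranspose_eq_transpose_of_trivial, hat] at this
    · refine Function.LeftInverse.injective (g := b.mulVec) fun x => ?_
      rw [Matrix.mulVec_mulVec, hba, Matrix.one_mulVec]
  · rw [SymplecticGroup.mem_iff', hPt]
    have hYΩ' : Ω' * Y = Y * Ω' := by
      calc Ω' * Y = Ω' * Y * (Ω * Ω') := by rw [hΩΩ', Matrix.mul_one]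
        _ = Ω' * (Y * Ω) * Ω' := by simp only [Matrix.mul_assoc]
        _ = (Ω' * Ω) * Y * Ω' := by rw [hYΩ]; simp only [Matrix.mul_assoc]
        _ = _ := by rw [hΩ'Ω, Matrix.one_mul]
    have h3 : Y * (a * J * a) * Y = Ω := by
      calc Y * (a * J * a) * Y = -(Y * (Ω' * Y)) := by
            rw [hΩ']
            simp only [Matrix.mul_assoc, Matrix.neg_mul, Matrix.mul_neg, neg_neg]
        _ = -(Ω.transpose * (Ω * Ω')) := by
            rw [hYΩ', ← Matrix.mul_assoc, hYY, hW, Matrix.mul_assoc]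
        _ = Ω := by rw [hΩΩ', Matrix.mul_one, hΩt, neg_neg]
    calc a * Y * a * J * (a * Y * a) = a * (Y * (a * J * a) * Y) * a := by
          simp only [Matrix.mul_assoc]
      _ = (a * b) * J * (b * a) := by
          rw [h3, hΩ]
          simp only [Matrix.mul_assoc]
      _ = J := by rw [hab, hba, Matrix.one_mul, Matrix.mul_one]
  · calc A.transpose * (a * Y * a) = (a * b) * A.transpose * a * Y * a := by
          rw [hab, Matrix.one_mul]
          simp only [Matrix.mul_assoc]
      _ = a * (N.transpose * Y) * a := by
          rw [hN, Matrix.transpose_mul, Matrix.transpose_mul, hat, hbt]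
          simp only [Matrix.mul_assoc]
      _ = a * Y * a * B * (b * a) := by
          rw [← hYNt, hNt]
          simp only [Matrix.mul_assoc]
      _ = _ := by rw [hba, Matrix.mul_one]

/-- A diagonalizable symplectic matrix is symplectically conjugate to a normal matrix. -/
lemma exists_symplectic_conj_normal {A : Matrix (l ⊕ l) (l ⊕ l) ℝ}
    (hA : A ∈ Matrix.symplecticGroup l ℝ) (D : Diagonalization (cx A)) :
    ∃ M ∈ Matrix.symplecticGroup l ℝ, ∃ D' : Diagonalization (cx (M * A * M⁻¹)),
      cx (M * A * M⁻¹).transpose = D'.fc (starRingEnd ℂ) := by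
  obtain ⟨B, hB⟩ := D.exists_cx_eq (g := starRingEnd ℂ) fun _ => rfl
  obtain ⟨P, hP, hPs, hAB⟩ := exists_symplectic_inner_product hA D hB
  obtain ⟨D₀, hR₀, hd₀⟩ := exists_posDef_diagonalization hP
  have hu : IsUnit P.det := isUnit_iff_ne_zero.mpr hP.det_pos.ne'
  have hPt : P.transpose = P := by
    rw [← Matrix.conjTranspose_eq_transpose_of_trivial]
    exact hP.1
  set a := D₀.fc Real.sqrt with ha
  have hat : a.transpose = a := Diagonalization.fc_transpose_of_orthogonal hR₀ _
  have haa : a * a = P := Diagonalization.sqrt_mul_sqrt hd₀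
  set b := D₀.fc (fun x => (Real.sqrt x)⁻¹) with hb
  have hbt : b.transpose = b := Diagonalization.fc_transpose_of_orthogonal hR₀ _
  have hba : b * a = 1 := by
    rw [hb, ha, D₀.fc_mul, ← D₀.fc_one]
    exact D₀.fc_congr fun i => inv_mul_cancel₀ (Real.sqrt_pos.mpr (hd₀ i)).ne'
  have hab : a * b = 1 := mul_eq_one_comm.mp hba
  have hinv : a⁻¹ = b := Matrix.inv_eq_left_inv hba
  -- `J` intertwines `P` with `P⁻¹`, hence also the square roots; so the root of a symplectic
  -- positive matrix is symplectic.
  have has : a ∈ Matrix.symplecticGroup l ℝ := by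
    have h1 : P * Matrix.J l ℝ = Matrix.J l ℝ * P⁻¹ := by
      have := SymplecticGroup.mem_iff.mp hPs
      rw [hPt] at this
      calc P * Matrix.J l ℝ = P * Matrix.J l ℝ * P * P⁻¹ := by
            rw [Matrix.mul_nonsing_inv_cancel_right _ _ hu]
        _ = _ := by rw [this]
    have h2 := D₀.fc_intertwine ((D₀.ofFc fun z => z⁻¹).cast (D₀.fc_inv hu)) h1 Real.sqrt
    rw [Diagonalization.cast_fc, Diagonalization.ofFc_fc] at h2
    simp only [Real.sqrt_inv] at h2
    rw [SymplecticGroup.mem_iff, hat]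
    change a * Matrix.J l ℝ = Matrix.J l ℝ * b at h2
    rw [h2, Matrix.mul_assoc, hba, Matrix.mul_one]
  refine ⟨a, has, ?_⟩
  rw [hinv]
  refine ⟨(D.conj (M := cx a) (M' := cx b) (by rw [← cx_mul, hab, cx_one])
    (by rw [← cx_mul, hba, cx_one])).cast (by rw [cx_mul, cx_mul]), ?_⟩
  rw [Diagonalization.cast_fc, Diagonalization.conj_fc, ← hB, ← cx_mul, ← cx_mul]
  congr 1
  rw [Matrix.transpose_mul, Matrix.transpose_mul, hat, hbt]
  calc b * (A.transpose * a) = b * (A.transpose * (a * a)) * b := by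
        calc _ = b * A.transpose * a * (a * b) := by
              rw [hab, Matrix.mul_one, Matrix.mul_assoc]
          _ = _ := by simp only [Matrix.mul_assoc]
    _ = b * ((a * a) * B) * b := by rw [haa, hAB]
    _ = (b * a) * a * B * b := by simp only [Matrix.mul_assoc]
    _ = _ := by rw [hba, Matrix.one_mul]

end Normalization

end BlockJacobi

namespace BlockJacobi

/-! ### Frames for normal symplectic matrices -/

section Frames

variable {l : Type*} [Fintype l] [DecidableEq l] {N : Matrix (l ⊕ l) (l ⊕ l) ℝ}

/-- The complexification of a diagonalization. -/
noncomputable def Diagonalization.toComplex {n : Type*} [Fintype n] [DecidableEq n]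
    {A : Matrix n n ℝ} (D : Diagonalization A) : Diagonalization (cx A) where
  Q := cx D.Q
  R := cx D.R
  d := fun i => (D.d i : ℂ)
  QR := by rw [← cx_mul, D.QR, cx_one]
  RQ := by rw [← cx_mul, D.RQ, cx_one]
  eq := by rw [← cx_diagonal, ← cx_mul, ← cx_mul, ← D.eq]

lemma gram_J_gram (hN : N ∈ Matrix.symplecticGroup l ℝ) :
    N.transpose * N * Matrix.J l ℝ * (N.transpose * N) = Matrix.J l ℝ := by
  calc _ = N.transpose * (N * Matrix.J l ℝ * N.transpose) * N := by simp only [Matrix.mul_assoc]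
    _ = _ := by rw [SymplecticGroup.mem_iff.mp hN, SymplecticGroup.mem_iff'.mp hN]

lemma mul_J_mul_gram (hN : N ∈ Matrix.symplecticGroup l ℝ) :
    N * Matrix.J l ℝ * (N.transpose * N) = Matrix.J l ℝ * N := by
  rw [← Matrix.mul_assoc, SymplecticGroup.mem_iff.mp hN]

/-- `J` conjugates the Gram matrix to its inverse, so Gram eigenvalues above and below `1` are
equally many. As `N` is normal, the Gram matrix is the function `|z|²` of `N`, and its eigenvalue
`1` has the multiplicity of the unit circle in the spectrum of `N`. Multiplicities are compared as
traces of indicator functions. -/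
lemma card_add_two_mul_card (hN : N ∈ Matrix.symplecticGroup l ℝ) (D : Diagonalization (cx N))
    (hD : cx N.transpose = D.fc (starRingEnd ℂ)) (D₀ : Diagonalization (N.transpose * N))
    (hd : ∀ i, 0 < D₀.d i) :
    Fintype.card {i // starRingEnd ℂ (D.d i) * D.d i = 1} + 2 * Fintype.card {i // 1 < D₀.d i}
      = 2 * Fintype.card l := by
  have hdet : IsUnit (N.transpose * N).det := by
    have := SymplecticGroup.symplectic_det hN
    rw [Matrix.det_mul, Matrix.det_transpose]
    exact this.mul this
  have h1 : Fintype.card {i // 1 < D₀.d i} = Fintype.card {i // D₀.d i < 1} := by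
    have hJ : N.transpose * N * Matrix.J l ℝ = Matrix.J l ℝ * (N.transpose * N)⁻¹ := by
      conv_rhs => rw [← gram_J_gram hN]
      rw [Matrix.mul_nonsing_inv_cancel_right _ _ hdet]
    have h2 := D₀.fc_intertwine ((D₀.ofFc fun z => z⁻¹).cast (D₀.fc_inv hdet)) hJ
      (fun x => if 1 < x then 1 else 0)
    rw [Diagonalization.cast_fc, Diagonalization.ofFc_fc] at h2
    have h3 : -(Matrix.J l ℝ * _).trace = -(Matrix.J l ℝ * _).trace :=
      congrArg (fun X => -(Matrix.J l ℝ * X).trace) h2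
    rw [← Matrix.mul_assoc, Matrix.trace_mul_comm, ← Matrix.mul_assoc, ← Matrix.mul_assoc,
      Matrix.J_squared, Matrix.neg_mul, Matrix.one_mul, Matrix.neg_mul, Matrix.one_mul,
      Matrix.trace_neg, Matrix.trace_neg, neg_neg, neg_neg, D₀.trace_fc, D₀.trace_fc] at h3
    rw [Finset.sum_boole, Finset.sum_boole] at h3
    rw [Fintype.card_subtype, Fintype.card_subtype]
    have h4 : ∀ i, 1 < (D₀.d i)⁻¹ ↔ D₀.d i < 1 := fun i => one_lt_inv₀ (hd i)
    simp only [h4] at h3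
    exact_mod_cast h3
  have h2 : Fintype.card {i // starRingEnd ℂ (D.d i) * D.d i = 1}
      = Fintype.card {i // D₀.d i = 1} := by
    have e : D.fc (fun z => starRingEnd ℂ z * z) = cx (N.transpose * N) := by
      rw [cx_mul, hD, ← D.fc_mul, D.fc_id]
    have h3 := ((D.ofFc _).cast e).fc_eq D₀.toComplex (fun z => if z = 1 then 1 else 0)
    have h4 := congrArg Matrix.trace h3
    rw [Diagonalization.trace_fc, Diagonalization.trace_fc] at h4
    change (∑ i, if starRingEnd ℂ (D.d i) * D.d i = 1 then (1 : ℂ) else 0)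
      = ∑ i, if (D₀.d i : ℂ) = 1 then (1 : ℂ) else 0 at h4
    rw [Finset.sum_boole, Finset.sum_boole] at h4
    rw [Fintype.card_subtype, Fintype.card_subtype]
    have h5 : ∀ i, ((D₀.d i : ℂ) = 1 ↔ D₀.d i = 1) := fun i => by exact_mod_cast Iff.rfl
    simp only [h5] at h4
    exact_mod_cast h4
  have h3 : Fintype.card {i // D₀.d i = 1} + Fintype.card {i // 1 < D₀.d i}
      + Fintype.card {i // D₀.d i < 1} = Fintype.card (l ⊕ l) := by
    simp only [Fintype.card_subtype, Finset.card_filter]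
    rw [← Finset.sum_add_distrib, ← Finset.sum_add_distrib, ← Finset.card_univ,
      Finset.card_eq_sum_ones]
    refine Finset.sum_congr rfl fun i _ => ?_
    rcases lt_trichotomy (D₀.d i) 1 with h | h | h
    · simp [h, h.ne, h.le]
    · simp [h]
    · simp [h, h.ne', h.le]
  rw [Fintype.card_sum] at h3
  omega

/-- The real eigenvectors spanning the expanding subspace. -/
lemma exists_hyperbolic_frame (hN : N ∈ Matrix.symplecticGroup l ℝ) (D : Diagonalization (cx N))
    (hD : cx N.transpose = D.fc (starRingEnd ℂ)) :
    ∃ (m : ℕ) (κ : Fin m → ℝ) (S : Matrix (Fin m) (Fin m) ℝ) (B : Matrix (l ⊕ l) (Fin m) ℝ),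
      (∀ i, 0 < κ i) ∧ S ∈ Matrix.orthogonalGroup (Fin m) ℝ ∧
      Commute S (Matrix.diagonal fun i => Real.exp (κ i)) ∧
      B.transpose * B = 1 ∧ B.transpose * Matrix.J l ℝ * B = 0 ∧
      N.transpose * N * B = B * Matrix.diagonal (fun i => Real.exp (κ i) * Real.exp (κ i)) ∧
      N * B = B * (S * Matrix.diagonal fun i => Real.exp (κ i)) ∧
      Fintype.card {i // starRingEnd ℂ (D.d i) * D.d i = 1} + 2 * m = 2 * Fintype.card l := by
  have hdet := SymplecticGroup.symplectic_det hN
  have hGp : (N.transpose * N).PosDef := by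
    rw [← Matrix.conjTranspose_eq_transpose_of_trivial]
    refine Matrix.PosDef.conjTranspose_mul_self _ ?_
    refine Function.LeftInverse.injective (g := N⁻¹.mulVec) fun x => ?_
    rw [Matrix.mulVec_mulVec, Matrix.nonsing_inv_mul _ hdet, Matrix.one_mulVec]
  obtain ⟨D₀, hR, hd⟩ := exists_posDef_diagonalization hGp
  have hcard := card_add_two_mul_card hN D hD D₀ hd
  obtain ⟨O, R, g, hOO', hOO, hGeq⟩ := D₀
  simp only at hR hd hcard
  subst hR
  set G := N.transpose * N with hG
  have hGN : G * N = N * G := by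
    have h : N.transpose * N = N * N.transpose := by
      apply cx_injective
      rw [cx_mul, cx_mul, hD]
      have := D.fc_mul_comm (starRingEnd ℂ) (fun z => z)
      rwa [D.fc_id] at this
    rw [hG]
    conv_lhs => rw [h]
    rw [Matrix.mul_assoc]
  set m := Fintype.card {i // 1 < g i} with hm
  set v : Fin m → l ⊕ l := fun j => ((Fintype.equivFin {i // 1 < g i}).symm j : l ⊕ l) with hv
  have hvinj : Function.Injective v :=
    Subtype.val_injective.comp (Fintype.equivFin {i // 1 < g i}).symm.injective
  have hvd : ∀ j, 1 < g (v j) := fun j => ((Fintype.equivFin {i // 1 < g i}).symm j).2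
  have hvr : ∀ i, i ∉ Set.range v → ¬ 1 < g i := by
    intro i hi h
    exact hi ⟨Fintype.equivFin {i // 1 < g i} ⟨i, h⟩, by simp [hv]⟩
  set B : Matrix (l ⊕ l) (Fin m) ℝ := O.submatrix id v with hB
  have hcol : ∀ X : Matrix (l ⊕ l) (l ⊕ l) ℝ, B.transpose * X * B
      = (O.transpose * X * O).submatrix v v := by
    intro X
    rw [Matrix.submatrix_mul _ _ v id v Function.bijective_id,
      Matrix.submatrix_mul _ _ v id id Function.bijective_id]
    rfl
  have hBB : B.transpose * B = 1 := by
    have := hcol 1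
    rw [Matrix.mul_one, Matrix.mul_one, hOO] at this
    rw [this]
    exact Matrix.submatrix_one _ hvinj
  set A := O.transpose * N * O with hA
  have hNO : N * O = O * A := by
    rw [hA, ← Matrix.mul_assoc, ← Matrix.mul_assoc, hOO', Matrix.one_mul]
  have hGO : G * O = O * Matrix.diagonal g := by
    rw [hGeq, Matrix.mul_assoc, hOO, Matrix.mul_one]
  have hAd : ∀ i j, A i j ≠ 0 → g i = g j := by
    have h : Matrix.diagonal g * A = A * Matrix.diagonal g := by
      calc Matrix.diagonal g * A = (O.transpose * O) * Matrix.diagonal g * A := by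
            rw [hOO, Matrix.one_mul]
        _ = O.transpose * (G * N) * O := by
            rw [Matrix.mul_assoc O.transpose, ← hGO, hA]
            calc _ = O.transpose * G * (O * O.transpose) * N * O := by
                  simp only [Matrix.mul_assoc]
              _ = _ := by rw [hOO', Matrix.mul_one]; simp only [Matrix.mul_assoc]
        _ = O.transpose * N * (G * O) := by rw [hGN]; simp only [Matrix.mul_assoc]
        _ = _ := by rw [hGO, hA]; simp only [Matrix.mul_assoc]
    intro i j hij
    have h1 := congrFun (congrFun h i) j
    rw [Matrix.diagonal_mul, Matrix.mul_diagonal, mul_comm] at h1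
    exact mul_left_cancel₀ hij h1
  set κ : Fin m → ℝ := fun i => Real.log (g (v i)) / 2 with hκ
  have hexp : ∀ i, Real.exp (κ i) * Real.exp (κ i) = g (v i) := by
    intro i
    rw [← Real.exp_add, hκ]
    simp only [add_halves]
    exact Real.exp_log (hd _)
  -- `N` commutes with the Gram matrix, hence preserves its eigenspaces, and no entry leads from an
  -- index with `g > 1` to one outside the range of `v`.
  have hNB : N * B = B * A.submatrix v v := by
    have h1 : N * B = (N * O).submatrix id v := by
      rw [Matrix.submatrix_mul _ _ id id v Function.bijective_id]
      rfl
    rw [h1, hNO]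
    ext i j
    rw [Matrix.submatrix_apply, Matrix.mul_apply, Matrix.mul_apply]
    refine (Fintype.sum_of_injective v hvinj _ _ (fun k hk => ?_) fun k => rfl).symm
    have : A k (v j) = 0 := by
      by_contra hne
      exact hvr k hk (by rw [hAd k (v j) hne]; exact hvd j)
    rw [this, mul_zero]
  have hGB : G * B = B * Matrix.diagonal (fun i => g (v i)) := by
    have h1 : G * B = (G * O).submatrix id v := by
      rw [Matrix.submatrix_mul _ _ id id v Function.bijective_id]
      rfl
    rw [h1, hGO]
    ext i j
    simp [Matrix.mul_diagonal, hB]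
  have hedge : Matrix.diagonal (fun i => Real.exp (-κ i)) * Matrix.diagonal
      (fun i => Real.exp (κ i)) = 1 := by
    rw [Matrix.diagonal_mul_diagonal, ← Matrix.diagonal_one]
    congr 1
    ext i
    rw [← Real.exp_add, neg_add_cancel, Real.exp_zero]
  have hedge' : Matrix.diagonal (fun i => Real.exp (κ i)) * Matrix.diagonal
      (fun i => Real.exp (-κ i)) = 1 := mul_eq_one_comm.mp hedge
  have hcomm : A.submatrix v v * Matrix.diagonal (fun i => Real.exp (κ i))
      = Matrix.diagonal (fun i => Real.exp (κ i)) * A.submatrix v v := by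
    ext i j
    rw [Matrix.mul_diagonal, Matrix.diagonal_mul, Matrix.submatrix_apply, mul_comm]
    by_cases h : A (v i) (v j) = 0
    · rw [h, mul_zero, mul_zero]
    · rw [hκ]
      simp only [hAd _ _ h]
  have hgram : (A.submatrix v v).transpose * A.submatrix v v
      = Matrix.diagonal fun i => g (v i) := by
    calc _ = (A.submatrix v v).transpose * (B.transpose * B) * A.submatrix v v := by
          rw [hBB, Matrix.mul_one]
      _ = (N * B).transpose * (N * B) := by
          rw [hNB, Matrix.transpose_mul]
          simp only [Matrix.mul_assoc]
      _ = B.transpose * (G * B) := by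
          rw [Matrix.transpose_mul, hG]
          simp only [Matrix.mul_assoc]
      _ = _ := by rw [hGB, ← Matrix.mul_assoc, hBB, Matrix.one_mul]
  -- Polar decomposition: the compressed matrix has Gram matrix `e^{2κ}` and commutes with `e^κ`, so
  -- dividing by `e^κ` leaves an orthogonal matrix. This is why `κ` is half the logarithm of a Gram
  -- eigenvalue.
  refine ⟨m, κ, A.submatrix v v * Matrix.diagonal (fun i => Real.exp (-κ i)), B, ?_, ?_, ?_, hBB,
    ?_, ?_, ?_, ?_⟩
  · intro i
    exact div_pos (Real.log_pos (hvd i)) two_pos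
  · rw [Matrix.mem_orthogonalGroup_iff', Matrix.transpose_mul, Matrix.diagonal_transpose]
    calc _ = Matrix.diagonal (fun i => Real.exp (-κ i)) * ((A.submatrix v v).transpose
          * A.submatrix v v) * Matrix.diagonal (fun i => Real.exp (-κ i)) := by
          simp only [Matrix.mul_assoc]
      _ = 1 := by
          rw [hgram, Matrix.diagonal_mul_diagonal, Matrix.diagonal_mul_diagonal,
            ← Matrix.diagonal_one]
          congr 1
          ext i
          rw [← hexp, Real.exp_neg]
          have := (Real.exp_pos (κ i)).ne'
          field_simp
  · change _ * _ = _ * _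
    rw [Matrix.mul_assoc, hedge, Matrix.mul_one, ← Matrix.mul_assoc, ← hcomm, Matrix.mul_assoc,
      hedge', Matrix.mul_one]
  · rw [hcol]
    -- The Gram matrix is symplectic, so the pairing of two of its eigenvectors is unchanged when
    -- multiplied by `g_i g_j`. Where this product exceeds `1` the pairing vanishes: the expanding
    -- subspace is isotropic.
    have h1 : Matrix.diagonal g * (O.transpose * Matrix.J l ℝ * O) * Matrix.diagonal g
        = O.transpose * Matrix.J l ℝ * O := by
      have h2 : O.transpose * G = Matrix.diagonal g * O.transpose := by
        rw [hGeq, ← Matrix.mul_assoc, ← Matrix.mul_assoc, hOO, Matrix.one_mul]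
      calc _ = (Matrix.diagonal g * O.transpose) * Matrix.J l ℝ
            * (O * Matrix.diagonal g) := by simp only [Matrix.mul_assoc]
        _ = O.transpose * (G * Matrix.J l ℝ * G) * O := by
            rw [← h2, ← hGO]
            simp only [Matrix.mul_assoc]
        _ = _ := by rw [hG, gram_J_gram hN]
    ext i j
    have h2 := congrFun (congrFun h1 (v i)) (v j)
    rw [Matrix.mul_diagonal, Matrix.diagonal_mul] at h2
    rw [Matrix.submatrix_apply, Matrix.zero_apply]
    have h3 : 1 < g (v i) * g (v j) := one_lt_mul_of_lt_of_le (hvd i) (hvd j).le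
    have h4 : (g (v i) * g (v j) - 1)
        * (O.transpose * Matrix.J l ℝ * O) (v i) (v j) = 0 := by
      linarith
    rcases mul_eq_zero.mp h4 with h5 | h5
    · linarith
    · exact h5
  · rw [hGB]
    simp only [hexp]
  · rw [Matrix.mul_assoc, hedge, Matrix.mul_one, hNB]
  · exact hcard

end Frames

end BlockJacobi

namespace BlockJacobi

/-! ### The elliptic subspace of a normal symplectic matrix. -/

section EllipticFrame

variable {n : Type*} [Fintype n] [DecidableEq n]

/-- A unitary diagonalization of a Hermitian matrix. -/
lemma exists_hermitian_diagonalization {Z : Matrix n n ℂ} (hZ : Z.IsHermitian) :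
    ∃ (D : Diagonalization Z) (z : n → ℝ), D.R = D.Q.conjTranspose ∧ ∀ i, D.d i = z i := by
  have h1 := Unitary.coe_star_mul_self hZ.eigenvectorUnitary
  have h2 := Unitary.coe_mul_star_self hZ.eigenvectorUnitary
  have h3 := hZ.spectral_theorem
  rw [Unitary.conjStarAlgAut_apply] at h3
  exact ⟨⟨hZ.eigenvectorUnitary, star (hZ.eigenvectorUnitary : Matrix n n ℂ),
    fun i => (hZ.eigenvalues i : ℂ), h2, h1, h3⟩, hZ.eigenvalues, rfl, fun _ => rfl⟩

variable {N : Matrix n n ℝ}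

/-- The adjoint of a diagonalization of `N` diagonalizes `Nᵀ`, which by normality is the conjugation
function of `N`; independence of the choice of diagonalization identifies the two calculi. -/
lemma Diagonalization.fc_conjTranspose (D : Diagonalization (cx N))
    (hD : cx N.transpose = D.fc (starRingEnd ℂ)) (g : ℂ → ℂ) :
    (D.fc g).conjTranspose = D.fc fun z => starRingEnd ℂ (g z) := by
  have hD' : (cx N).transpose = D.fc (starRingEnd ℂ) := hD
  have h := (D.star.transpose.cast hD').fc_eq (D.ofFc (starRingEnd ℂ))
    (fun z => starRingEnd ℂ (g (starRingEnd ℂ z)))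
  rw [D.ofFc_fc, cast_fc, transpose_fc] at h
  simp only [Complex.conj_conj] at h
  rw [← h, fc, fc]
  simp only [Diagonalization.star, Complex.conj_conj, Matrix.transpose_mul,
    Matrix.conjTranspose_mul, Matrix.diagonal_transpose, Matrix.diagonal_conjTranspose]
  rfl

lemma Diagonalization.fc_transpose (D : Diagonalization (cx N))
    (hD : cx N.transpose = D.fc (starRingEnd ℂ)) (g : ℂ → ℂ) :
    (D.fc g).transpose = D.fc fun z => g (starRingEnd ℂ z) := by
  have hD' : (cx N).transpose = D.fc (starRingEnd ℂ) := hD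
  have h := (D.transpose.cast hD').fc_eq (D.ofFc (starRingEnd ℂ)) g
  rwa [D.ofFc_fc, cast_fc, transpose_fc] at h

variable {l : Type*} [Fintype l] [DecidableEq l] {N : Matrix (l ⊕ l) (l ⊕ l) ℝ}

/-- The indicator function of the unit circle. -/
noncomputable def circleIndicator (z : ℂ) : ℂ := if starRingEnd ℂ z * z = 1 then 1 else 0

/-- An injective function from the unit circle to the positive numbers. -/
noncomputable def phase (z : ℂ) : ℝ := z.arg + 4

lemma phase_pos (z : ℂ) : 0 < phase z := by
  have := Complex.neg_pi_lt_arg z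
  have := Real.pi_lt_four
  rw [phase]
  linarith

lemma exp_phase {z : ℂ} (hz : starRingEnd ℂ z * z = 1) :
    Complex.exp (((phase z - 4 : ℝ) : ℂ) * Complex.I) = z := by
  have h1 : ‖z‖ = 1 := by
    have h2 : ‖z‖ * ‖z‖ = 1 := by
      have := congrArg norm hz
      rwa [norm_mul, Complex.norm_conj, norm_one] at this
    nlinarith [norm_nonneg z]
  have h := Complex.norm_mul_exp_arg_mul_I z
  rw [h1, Complex.ofReal_one, one_mul] at h
  rwa [phase, add_sub_cancel_right]

/-- The unitary frame of the elliptic subspace. -/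
lemma exists_unitary_frame (hN : N ∈ Matrix.symplecticGroup l ℝ) (D : Diagonalization (cx N))
    (hD : cx N.transpose = D.fc (starRingEnd ℂ)) :
    ∃ (m : ℕ) (η : Fin m → ℝ) (F : Matrix (l ⊕ l) (Fin m) ℂ),
      F.conjTranspose * F = 1 ∧ cx (Matrix.J l ℝ) * F = -(Complex.I • F) ∧
      cx N * F = F * Matrix.diagonal (fun i => Complex.exp ((η i : ℂ) * Complex.I)) ∧
      cx (N.transpose * N) * F = F ∧
      2 * m = Fintype.card {i // starRingEnd ℂ (D.d i) * D.d i = 1} := by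
  set J := cx (Matrix.J l ℝ) with hJ
  have hu : IsUnit N.det := SymplecticGroup.symplectic_det hN
  have huc : IsUnit (cx N).det := by
    rw [cx_det]
    exact hu.map Complex.ofRealHom
  have hJJ : J * J = -1 := by rw [hJ, ← cx_mul, Matrix.J_squared, cx_neg, cx_one]
  have hJt : J.transpose = -J := by rw [hJ, ← cx_transpose, Matrix.J_transpose, cx_neg]
  have hJh : J.conjTranspose = -J := by rw [hJ, cx_conjTranspose, Matrix.J_transpose, cx_neg]
  -- The spectral projection onto the elliptic subspace. It commutes with `J` because on the unit
  -- circle conjugation is inversion.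
  set Φ := D.fc circleIndicator with hΦ
  have hp0 : ∀ z, circleIndicator z * circleIndicator z = circleIndicator z := by
    intro z
    rw [circleIndicator]
    split_ifs <;> simp
  have hΦΦ : Φ * Φ = Φ := by
    rw [hΦ, D.fc_mul]
    exact D.fc_congr fun i => hp0 _
  have hNJ : cx N * (J * Φ) = J * Φ * cx N := by
    have h1 : cx N * J * cx N.transpose = J := by
      rw [hJ, ← cx_mul, ← cx_mul, SymplecticGroup.mem_iff.mp hN]
    have h2 : D.fc (starRingEnd ℂ) * D.fc (fun z => z * circleIndicator z) = Φ := by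
      rw [D.fc_mul]
      refine D.fc_congr fun i => ?_
      rw [circleIndicator]
      split_ifs with h
      · rw [mul_one, h]
      · simp
    calc cx N * (J * Φ) = cx N * J * (D.fc (starRingEnd ℂ)
          * D.fc (fun z => z * circleIndicator z)) := by rw [h2, Matrix.mul_assoc]
      _ = J * D.fc (fun z => circleIndicator z * z) := by
          rw [← hD, ← Matrix.mul_assoc, h1]
          simp only [mul_comm]
      _ = J * Φ * cx N := by
          rw [← D.fc_mul, D.fc_id, Matrix.mul_assoc]
  have hfJ : ∀ g, D.fc g * (J * Φ) = J * Φ * D.fc g := fun g => D.fc_intertwine D hNJ g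
  have hΦJΦ : Φ * (J * Φ) = J * Φ := by rw [hfJ, Matrix.mul_assoc, hΦΦ]
  have hΦh : Φ.conjTranspose = Φ := by
    rw [hΦ, D.fc_conjTranspose hD]
    refine D.fc_congr fun i => ?_
    rw [circleIndicator]
    split_ifs <;> simp
  have hΦt : Φ.transpose = Φ := by
    rw [hΦ, D.fc_transpose hD]
    refine D.fc_congr fun i => ?_
    rw [circleIndicator, circleIndicator, Complex.conj_conj, mul_comm]
  have hΦJ : Φ * J = J * Φ := by
    have h1 := congrArg Matrix.conjTranspose hΦJΦ
    rw [Matrix.conjTranspose_mul, Matrix.conjTranspose_mul, hΦh, hJh, Matrix.mul_neg,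
      Matrix.neg_mul, neg_inj, Matrix.mul_assoc, hΦJΦ] at h1
    exact h1.symm
  -- A Hermitian involution of the elliptic subspace that commutes with `N`; its eigenvalues `±1`
  -- are the Krein signs.
  set σ := Complex.I • (J * Φ) with hσ
  have hσh : σ.conjTranspose = σ := by
    rw [hσ, Matrix.conjTranspose_smul, Matrix.conjTranspose_mul, hΦh, hJh, Matrix.mul_neg, hΦJ]
    simp
  have hσσ : σ * σ = Φ := by
    rw [hσ, Matrix.smul_mul, Matrix.mul_smul, smul_smul, Complex.I_mul_I, Matrix.mul_assoc, hΦJΦ,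
      ← Matrix.mul_assoc, hJJ, Matrix.neg_mul, Matrix.one_mul, neg_smul, one_smul, neg_neg]
  have hfσ : ∀ g, D.fc g * σ = σ * D.fc g := by
    intro g
    rw [hσ, Matrix.mul_smul, hfJ, Matrix.smul_mul]
  set Θ := D.fc (fun z => (phase z : ℂ)) with hΘ
  have hΘh : Θ.conjTranspose = Θ := by
    rw [hΘ, D.fc_conjTranspose hD]
    exact D.fc_congr fun i => Complex.conj_ofReal _
  -- One Hermitian matrix replaces the simultaneous diagonalization of `σ` and `N`: the sign of an
  -- eigenvalue of `Z` is the Krein sign and its modulus is the phase. This is why `phase` is made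
  -- positive by the shift `4 > π`.
  set Z := σ * Θ with hZ
  have hZh : Z.IsHermitian := by
    rw [Matrix.IsHermitian, hZ, Matrix.conjTranspose_mul, hσh, hΘh]
    exact hfσ _
  obtain ⟨DZ, z, hR, hz⟩ := exists_hermitian_diagonalization hZh
  have hsq : DZ.fc (fun w => w * w) = D.fc fun w => phase w * phase w * circleIndicator w := by
    rw [← DZ.fc_mul, DZ.fc_id]
    calc Z * Z = σ * (Θ * σ) * Θ := by rw [hZ]; simp only [Matrix.mul_assoc]
      _ = (σ * σ) * (Θ * Θ) := by rw [hΘ, hfσ]; simp only [Matrix.mul_assoc]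
      _ = _ := by
        rw [hσσ, hΦ, hΘ, D.fc_mul, D.fc_mul]
        exact D.fc_congr fun i => mul_comm _ _
  have htr : ∀ h : ℂ → ℂ, DZ.fc (fun w => h (w * w))
      = D.fc fun w => h (phase w * phase w * circleIndicator w) := by
    intro h
    have := ((DZ.ofFc fun w => w * w).cast hsq).fc_eq
      (D.ofFc fun w => phase w * phase w * circleIndicator w) h
    exact this
  have hsqrt : ∀ w : ℂ, Real.sqrt ((phase w : ℂ) * phase w * 1).re = phase w := by
    intro w
    rw [mul_one, ← Complex.ofReal_mul, Complex.ofReal_re, Real.sqrt_mul_self (phase_pos w).le]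
  have hne : ∀ w : ℂ, (phase w : ℂ) * phase w * 1 ≠ 0 := by
    intro w
    have : (phase w : ℂ) ≠ 0 := by exact_mod_cast (phase_pos w).ne'
    rw [mul_one]
    exact mul_ne_zero this this
  have hfun : ∀ (h : ℂ → ℂ) (w : ℂ),
      (if (phase w : ℂ) * phase w * circleIndicator w = 0 then 0 else
        h (Real.sqrt ((phase w : ℂ) * phase w * circleIndicator w).re))
      = h (phase w) * circleIndicator w := by
    intro h w
    by_cases hw : starRingEnd ℂ w * w = 1
    · rw [circleIndicator, if_pos hw, if_neg (hne w), hsqrt, mul_one]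
    · rw [circleIndicator, if_neg hw]
      simp
  -- Since `Z² = Θ² Φ`, the phase is recovered as `√(Z²)`, and functions of the phase of `N` cut off
  -- to the elliptic subspace become functions of `Z`.
  have htr' : ∀ h : ℂ → ℂ, D.fc (fun w => h (phase w) * circleIndicator w)
      = DZ.fc fun w => if w * w = 0 then 0 else h (Real.sqrt (w * w).re) := by
    intro h
    rw [htr (fun w => if w = 0 then 0 else h (Real.sqrt w.re))]
    exact D.fc_congr fun i => (hfun h _).symm
  have hΦZ : Φ = DZ.fc fun w => if w * w = 0 then 0 else 1 := by
    rw [← htr' fun _ => 1, hΦ]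
    exact D.fc_congr fun i => (one_mul _).symm
  have hNZ : cx N * Φ = DZ.fc fun w => if w * w = 0 then 0 else
      Complex.exp ((((Real.sqrt (w * w).re : ℂ).re - 4 : ℝ) : ℂ) * Complex.I) := by
    rw [← htr' fun w => Complex.exp (((w.re - 4 : ℝ) : ℂ) * Complex.I)]
    conv_lhs => rw [← D.fc_id, hΦ, D.fc_mul]
    refine D.fc_congr fun i => ?_
    rw [Complex.ofReal_re, circleIndicator]
    split_ifs with h
    · rw [exp_phase h]
    · simp
  have hσZ : σ = DZ.fc fun w => w * (if w * w = 0 then 0 else (Real.sqrt (w * w).re : ℂ)⁻¹) := by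
    rw [← DZ.fc_mul, DZ.fc_id, ← htr' fun w => w⁻¹, hZ, Matrix.mul_assoc, hΘ, D.fc_mul]
    calc σ = σ * Φ := by
          rw [hσ, Matrix.smul_mul, Matrix.mul_assoc, hΦΦ]
      _ = _ := by
          congr 1
          refine D.fc_congr fun i => ?_
          have : (phase (D.d i) : ℂ) ≠ 0 := by exact_mod_cast (phase_pos _).ne'
          rw [← mul_assoc, mul_inv_cancel₀ this, one_mul]
  set m := Fintype.card {i // 0 < z i} with hm
  set v : Fin m → l ⊕ l := fun j => ((Fintype.equivFin {i // 0 < z i}).symm j : l ⊕ l) with hv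
  have hvinj : Function.Injective v :=
    Subtype.val_injective.comp (Fintype.equivFin {i // 0 < z i}).symm.injective
  have hvz : ∀ j, 0 < z (v j) := fun j => ((Fintype.equivFin {i // 0 < z i}).symm j).2
  -- The eigenvectors with `z > 0` are those with `σ = 1`, that is `J F = -i F`; the angle is `z -
  -- 4`.
  set F : Matrix (l ⊕ l) (Fin m) ℂ := DZ.Q.submatrix id v with hF
  have hcol : ∀ g, DZ.fc g * F = F * Matrix.diagonal fun j => g (z (v j)) := by
    intro g
    have h1 : DZ.fc g * F = (DZ.fc g * DZ.Q).submatrix id v := by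
      rw [Matrix.submatrix_mul _ _ id id v Function.bijective_id]
      rfl
    rw [h1, Diagonalization.fc, Matrix.mul_assoc, DZ.RQ, Matrix.mul_one]
    ext i j
    simp [Matrix.mul_diagonal, hF, hz]
  have hzz : ∀ j, ((z (v j) : ℂ) * z (v j) ≠ 0) := by
    intro j
    have : (z (v j) : ℂ) ≠ 0 := by exact_mod_cast (hvz j).ne'
    exact mul_ne_zero this this
  have hzs : ∀ j, Real.sqrt ((z (v j) : ℂ) * z (v j)).re = z (v j) := by
    intro j
    rw [← Complex.ofReal_mul, Complex.ofReal_re, Real.sqrt_mul_self (hvz j).le]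
  have hΦF : Φ * F = F := by
    rw [hΦZ, hcol]
    simp only [hzz, if_false, Matrix.diagonal_one, Matrix.mul_one]
  have hσF : σ * F = F := by
    rw [hσZ, hcol]
    have : ∀ j, (z (v j) : ℂ) * (z (v j) : ℂ)⁻¹ = 1 := fun j =>
      mul_inv_cancel₀ (by exact_mod_cast (hvz j).ne')
    simp only [hzz, if_false, hzs, this, Matrix.diagonal_one, Matrix.mul_one]
  refine ⟨m, fun j => z (v j) - 4, F, ?_, ?_, ?_, ?_, ?_⟩
  · have h1 : F.conjTranspose * F = (DZ.R * DZ.Q).submatrix v v := by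
      rw [Matrix.submatrix_mul _ _ v id v Function.bijective_id, hR]
      rfl
    rw [h1, DZ.RQ]
    exact Matrix.submatrix_one _ hvinj
  · have h1 : Complex.I • (J * F) = F := by
      conv_rhs => rw [← hσF]
      rw [hσ, Matrix.smul_mul, Matrix.mul_assoc, hΦF]
    conv_rhs => rw [← h1]
    rw [smul_smul, Complex.I_mul_I, neg_smul, one_smul, neg_neg]
  · conv_lhs => rw [← hΦF]
    rw [← Matrix.mul_assoc, hNZ, hcol]
    simp only [hzz, if_false, hzs, Complex.ofReal_re]
  · have h1 : cx (N.transpose * N) * Φ = Φ := by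
      have e : D.fc (fun z => starRingEnd ℂ z * z) = cx (N.transpose * N) := by
        rw [cx_mul, hD, ← D.fc_mul, D.fc_id]
      rw [← e, hΦ, D.fc_mul]
      refine D.fc_congr fun i => ?_
      rw [circleIndicator]
      split_ifs with h
      · rw [mul_one, h]
      · simp
    conv_lhs => rw [← hΦF]
    rw [← Matrix.mul_assoc, h1, hΦF]
  -- `J Φ` is antisymmetric, so `σ` has trace zero and both signs occur equally often; hence `m` is
  -- half the rank of `Φ`. Below, `z / |z| + 1` is twice the indicator of `z > 0` off the kernel.
  · have h1 : σ.trace = 0 := by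
      have h2 : (J * Φ).trace = -(J * Φ).trace := by
        conv_lhs => rw [← Matrix.trace_transpose, Matrix.transpose_mul, hΦt, hJt, Matrix.mul_neg,
          Matrix.trace_neg, hΦJ]
      have h3 : (J * Φ).trace = 0 := self_eq_neg.mp h2
      rw [hσ, Matrix.trace_smul, h3, smul_zero]
    have h2 := congrArg Matrix.trace hσZ
    have h3 := congrArg Matrix.trace hΦZ
    rw [h1, DZ.trace_fc] at h2
    rw [hΦ, D.trace_fc, DZ.trace_fc] at h3
    have h4 : (∑ i, (circleIndicator (D.d i)))
        = (Fintype.card {i // starRingEnd ℂ (D.d i) * D.d i = 1} : ℂ) := by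
      simp only [circleIndicator]
      rw [Finset.sum_boole, Fintype.card_subtype]
    have h5 : ∀ i, (DZ.d i * (if DZ.d i * DZ.d i = 0 then 0 else
        (Real.sqrt (DZ.d i * DZ.d i).re : ℂ)⁻¹)) + (if DZ.d i * DZ.d i = 0 then 0 else 1)
        = 2 * if 0 < z i then 1 else 0 := by
      intro i
      rw [hz]
      rcases lt_trichotomy (z i) 0 with h | h | h
      · have h6 : (z i : ℂ) ≠ 0 := by exact_mod_cast h.ne
        rw [if_neg (mul_ne_zero h6 h6), if_neg (mul_ne_zero h6 h6), if_neg h.le.not_gt,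
          ← Complex.ofReal_mul, Complex.ofReal_re, Real.sqrt_mul_self_eq_abs, abs_of_neg h,
          Complex.ofReal_neg]
        field_simp
        ring
      · simp [h]
      · have h6 : (z i : ℂ) ≠ 0 := by exact_mod_cast h.ne'
        rw [if_neg (mul_ne_zero h6 h6), if_neg (mul_ne_zero h6 h6), if_pos h,
          ← Complex.ofReal_mul, Complex.ofReal_re, Real.sqrt_mul_self h.le, mul_inv_cancel₀ h6]
        norm_num
    have h6 := Finset.sum_congr (s₁ := Finset.univ) rfl fun i _ => h5 i
    rw [Finset.sum_add_distrib, ← h2, ← h3, h4, zero_add, ← Finset.mul_sum, Finset.sum_boole] at h6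
    rw [hm, Fintype.card_subtype (fun i => 0 < z i)]
    exact_mod_cast h6.symm

/-- The real frame of the elliptic subspace. -/
lemma exists_elliptic_frame (hN : N ∈ Matrix.symplecticGroup l ℝ) (D : Diagonalization (cx N))
    (hD : cx N.transpose = D.fc (starRingEnd ℂ)) :
    ∃ (m : ℕ) (η : Fin m → ℝ) (B : Matrix (l ⊕ l) (Fin m) ℝ),
      B.transpose * B = 1 ∧ B.transpose * Matrix.J l ℝ * B = 0 ∧
      N * B = B * Matrix.diagonal (fun i => Real.cos (η i))
        - Matrix.J l ℝ * B * Matrix.diagonal (fun i => Real.sin (η i)) ∧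
      N.transpose * N * B = B ∧
      2 * m = Fintype.card {i // starRingEnd ℂ (D.d i) * D.d i = 1} := by
  obtain ⟨m, η, F, hFF, hJF, hNF, hGF, hcard⟩ := exists_unitary_frame hN D hD
  set a := F.map Complex.re with ha
  set b := F.map Complex.im with hb
  have hF : F = cx a + Complex.I • cx b := by
    ext i j
    simp [ha, hb, mul_comm Complex.I]
  have hre : ∀ X : Matrix (l ⊕ l) (l ⊕ l) ℝ, (cx X * F).map Complex.re = X * a := by
    intro X
    ext i j
    simp [ha, Matrix.mul_apply]
  -- The real part of `J F = -i F`: the imaginary part of the frame is determined by the real part,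
  -- so the latter alone spans a Lagrangian half.
  have hb' : Matrix.J l ℝ * a = b := by
    rw [← hre, hJF]
    ext i j
    simp [hb]
  have hGa : N.transpose * N * a = a := by
    rw [← hre, hGF]
  have hNa : N * a = a * Matrix.diagonal (fun i => Real.cos (η i))
      - b * Matrix.diagonal (fun i => Real.sin (η i)) := by
    rw [← hre, hNF]
    ext i j
    simp [Matrix.mul_diagonal, ha, hb, Complex.exp_ofReal_mul_I_re, Complex.exp_ofReal_mul_I_im]
  have hJJ : (Matrix.J l ℝ).transpose * Matrix.J l ℝ = 1 := by
    rw [Matrix.J_transpose, Matrix.neg_mul, Matrix.J_squared, neg_neg]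
  have hbb : b.transpose * b = a.transpose * a := by
    rw [← hb', Matrix.transpose_mul, Matrix.mul_assoc, ← Matrix.mul_assoc _ _ a, hJJ,
      Matrix.one_mul]
  have hgram : F.conjTranspose * F = cx (a.transpose * a + b.transpose * b)
      + Complex.I • cx (a.transpose * b - b.transpose * a) := by
    ext i j
    simp only [hF, Matrix.mul_apply, Matrix.conjTranspose_apply, Matrix.add_apply,
      Matrix.smul_apply, Matrix.sub_apply, cx_apply, Matrix.transpose_apply, smul_eq_mul,
      Complex.star_def, map_add, map_mul, Complex.conj_ofReal, Complex.conj_I,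
      Complex.ofReal_add, Complex.ofReal_sub, Complex.ofReal_sum, Complex.ofReal_mul]
    rw [← Finset.sum_add_distrib, ← Finset.sum_sub_distrib, Finset.mul_sum,
      ← Finset.sum_add_distrib]
    refine Finset.sum_congr rfl fun k _ => ?_
    linear_combination (-(b k i : ℂ) * b k j) * Complex.I_sq
  rw [hFF] at hgram
  have h1 : a.transpose * a + b.transpose * b = 1 := by
    ext i j
    have := congrArg Complex.re (congrFun (congrFun hgram i) j)
    by_cases hij : i = j <;> simpa [hij, Matrix.one_apply] using this.symm
  have h2 : a.transpose * b - b.transpose * a = 0 := by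
    ext i j
    have := congrArg Complex.im (congrFun (congrFun hgram i) j)
    by_cases hij : i = j <;> simpa [hij, Matrix.one_apply] using this.symm
  have hs : Real.sqrt 2 * Real.sqrt 2 = 2 := Real.mul_self_sqrt (by norm_num)
  -- Orthonormality of `F` splits equally between `a` and `b = J a`, giving `aᵀ a = 1/2`; hence the
  -- factor `√2`.
  refine ⟨m, η, Real.sqrt 2 • a, ?_, ?_, ?_, ?_, hcard⟩
  · rw [Matrix.transpose_smul, Matrix.smul_mul, Matrix.mul_smul, smul_smul, hs, two_smul]
    rw [hbb] at h1
    exact h1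
  · have h3 : a.transpose * b = 0 := by
      have h4 : b.transpose * a = -(a.transpose * b) := by
        rw [← hb', Matrix.transpose_mul, Matrix.J_transpose]
        simp only [Matrix.mul_neg, Matrix.neg_mul, Matrix.mul_assoc]
      rw [h4, sub_neg_eq_add, ← two_smul ℝ] at h2
      exact (smul_eq_zero.mp h2).resolve_left two_ne_zero
    rw [Matrix.transpose_smul, Matrix.smul_mul, Matrix.smul_mul, Matrix.mul_smul, Matrix.mul_assoc,
      hb', h3, smul_zero, smul_zero]
  · rw [Matrix.mul_smul, hNa, Matrix.mul_smul, hb', smul_sub, Matrix.smul_mul, Matrix.smul_mul]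
  · rw [Matrix.mul_smul, hGa]

end EllipticFrame

/-! ### Assembly of the normal form from the two frames. -/

section NormalFormExistence

variable {L : ℕ}

/-- Orthogonality of eigenvectors of a symmetric matrix. It separates the hyperbolic frame, where
the Gram eigenvalues exceed `1`, from the elliptic one, where the Gram matrix acts as the identity.
-/
lemma eq_zero_of_gram {n p q : Type*} [Fintype n] [Fintype p] [DecidableEq p] {G : Matrix n n ℝ}
    (hG : G.transpose = G) {B : Matrix n p ℝ} {C : Matrix n q ℝ} {g : p → ℝ} (hg : ∀ i, g i ≠ 1)
    (hB : G * B = B * Matrix.diagonal g) (hC : G * C = C) : B.transpose * C = 0 := by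
  have h1 : Matrix.diagonal g * (B.transpose * C) = B.transpose * C := by
    have h2 := congrArg Matrix.transpose hB
    rw [Matrix.transpose_mul, Matrix.transpose_mul, Matrix.diagonal_transpose, hG] at h2
    rw [← Matrix.mul_assoc, ← h2, Matrix.mul_assoc, hC]
  ext i j
  have h2 := congrFun (congrFun h1 i) j
  rw [Matrix.diagonal_mul] at h2
  have h3 : (g i - 1) * (B.transpose * C) i j = 0 := by linarith
  exact (mul_eq_zero.mp h3).resolve_left (sub_ne_zero.mpr (hg i))

/-- A normal symplectic matrix has a normal form. -/
lemma exists_frame_of_normal {N : Matrix (Fin L ⊕ Fin L) (Fin L ⊕ Fin L) ℝ}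
    (hN : N ∈ Matrix.symplecticGroup (Fin L) ℝ) (D : Diagonalization (cx N))
    (hD : cx N.transpose = D.fc (starRingEnd ℂ)) :
    ∃ (p q : ℕ) (chan : Fin p ⊕ Fin q ≃ Fin L) (κ : Fin p → ℝ) (η : Fin q → ℝ)
      (S : Matrix (Fin p) (Fin p) ℝ) (W : Matrix (Fin L ⊕ Fin L) (Fin L ⊕ Fin L) ℝ),
      (∀ i, 0 < κ i) ∧ S ∈ Matrix.orthogonalGroup (Fin p) ℝ ∧
      Commute S (Matrix.diagonal fun i => Real.exp (κ i)) ∧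
      W ∈ Matrix.symplecticGroup (Fin L) ℝ ∧
      N * W = W * Matrix.reindex (Equiv.sumCongr chan chan) (Equiv.sumCongr chan chan)
        (normalMatrix κ η S) := by
  obtain ⟨p, κ, S, A, hκ, hS, hSc, hAA, hAJA, hGA, hNA, hc1⟩ := exists_hyperbolic_frame hN D hD
  obtain ⟨q, η, B, hBB, hBJB, hNB, hGB, hc2⟩ := exists_elliptic_frame hN D hD
  rw [Fintype.card_fin] at hc1
  set J := Matrix.J (Fin L) ℝ with hJ
  have hJJ : J * J = -1 := Matrix.J_squared _ _
  have hJt : J.transpose = -J := Matrix.J_transpose _ _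
  have hJtJ : J.transpose * J = 1 := by rw [hJt, Matrix.neg_mul, hJJ, neg_neg]
  have hpq : p + q = L := by omega
  have chan : Fin p ⊕ Fin q ≃ Fin L := finSumFinEquiv.trans (finCongr hpq)
  have hGt : (N.transpose * N).transpose = N.transpose * N := by
    rw [Matrix.transpose_mul, Matrix.transpose_transpose]
  have hg : ∀ i, Real.exp (κ i) * Real.exp (κ i) ≠ 1 := by
    intro i
    have : 1 < Real.exp (κ i) := Real.one_lt_exp_iff.mpr (hκ i)
    nlinarith
  have hGJB : N.transpose * N * (J * B) = J * B := by
    calc N.transpose * N * (J * B) = N.transpose * N * J * (N.transpose * N) * B := by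
          conv_lhs => rw [← hGB]
          simp only [Matrix.mul_assoc]
      _ = J * B := by rw [gram_J_gram hN]
  have hAB : A.transpose * B = 0 := eq_zero_of_gram hGt hg hGA hGB
  have hAJB : A.transpose * (J * B) = 0 := eq_zero_of_gram hGt hg hGA hGJB
  have hBA : B.transpose * A = 0 := by
    have := congrArg Matrix.transpose hAB
    rwa [Matrix.transpose_mul, Matrix.transpose_transpose, Matrix.transpose_zero] at this
  have hBJA : B.transpose * (J * A) = 0 := by
    have := congrArg Matrix.transpose hAJB
    rw [Matrix.transpose_mul, Matrix.transpose_mul, Matrix.transpose_transpose,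
      Matrix.transpose_zero, hJt, Matrix.mul_assoc, Matrix.neg_mul, Matrix.mul_neg,
      neg_eq_zero] at this
    exact this
  -- `J` carries the expanding subspace to the contracting one. The relation `N J Nᵀ N = J N`
  -- transports the action of `N` there, and dividing by the Gram eigenvalue `e^{2κ}` turns `e^κ`
  -- into `e^{-κ}` with the same orthogonal part.
  have hNJA : N * (J * A) = J * A * (S * Matrix.diagonal fun i => Real.exp (-κ i)) := by
    have h1 : N * (J * A) * Matrix.diagonal (fun i => Real.exp (κ i) * Real.exp (κ i))
        = J * A * (S * Matrix.diagonal fun i => Real.exp (κ i)) := by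
      calc _ = N * J * (A * Matrix.diagonal (fun i => Real.exp (κ i) * Real.exp (κ i))) := by
            simp only [Matrix.mul_assoc]
        _ = (N * J * (N.transpose * N)) * A := by rw [← hGA]; simp only [Matrix.mul_assoc]
        _ = _ := by rw [mul_J_mul_gram hN, Matrix.mul_assoc, hNA, Matrix.mul_assoc]
    have h2 : Matrix.diagonal (fun i => Real.exp (κ i) * Real.exp (κ i))
        * Matrix.diagonal (fun i => Real.exp (-κ i) * Real.exp (-κ i)) = 1 := by
      rw [Matrix.diagonal_mul_diagonal, ← Matrix.diagonal_one]
      congr 1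
      ext i
      rw [Real.exp_neg]
      have := (Real.exp_pos (κ i)).ne'
      field_simp
    have h3 : Matrix.diagonal (fun i => Real.exp (κ i))
        * Matrix.diagonal (fun i => Real.exp (-κ i) * Real.exp (-κ i))
        = Matrix.diagonal fun i => Real.exp (-κ i) := by
      rw [Matrix.diagonal_mul_diagonal]
      congr 1
      ext i
      rw [Real.exp_neg]
      have := (Real.exp_pos (κ i)).ne'
      field_simp
    calc N * (J * A) = N * (J * A) * Matrix.diagonal (fun i => Real.exp (κ i) * Real.exp (κ i))
          * Matrix.diagonal (fun i => Real.exp (-κ i) * Real.exp (-κ i)) := by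
          rw [Matrix.mul_assoc (N * (J * A)), h2, Matrix.mul_one]
      _ = _ := by
          rw [h1]
          simp only [Matrix.mul_assoc]
          rw [h3]
  have hNJB : N * (J * B) = B * Matrix.diagonal (fun i => Real.sin (η i))
      + J * B * Matrix.diagonal (fun i => Real.cos (η i)) := by
    calc N * (J * B) = N * J * (N.transpose * N) * B := by
          conv_lhs => rw [← hGB]
          simp only [Matrix.mul_assoc]
      _ = J * (N * B) := by rw [mul_J_mul_gram hN, Matrix.mul_assoc]
      _ = J * B * Matrix.diagonal (fun i => Real.cos (η i))
          - (J * J) * B * Matrix.diagonal (fun i => Real.sin (η i)) := by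
          rw [hNB, Matrix.mul_sub]
          simp only [Matrix.mul_assoc]
      _ = _ := by
          rw [hJJ, Matrix.neg_mul, Matrix.one_mul, Matrix.neg_mul, sub_neg_eq_add, add_comm]
  set U := Matrix.fromCols A B with hU
  have hUU : U.transpose * U = 1 := by
    rw [hU, Matrix.transpose_fromCols, Matrix.fromRows_mul_fromCols, hAA, hAB, hBA, hBB,
      Matrix.fromBlocks_one]
  have hUJU : U.transpose * (J * U) = 0 := by
    rw [hU, Matrix.transpose_fromCols, Matrix.mul_fromCols, Matrix.fromRows_mul_fromCols,
      ← Matrix.mul_assoc A.transpose, hAJA, hAJB, hBJA, ← Matrix.mul_assoc B.transpose, hBJB,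
      Matrix.fromBlocks_zero]
  set U' := U.submatrix id chan.symm with hU'
  have hUU' : U'.transpose * U' = 1 := by
    have : U'.transpose * U' = (U.transpose * U).submatrix chan.symm chan.symm := by
      rw [Matrix.submatrix_mul _ _ chan.symm id chan.symm Function.bijective_id]
      rfl
    rw [this, hUU]
    exact Matrix.submatrix_one _ chan.symm.injective
  have hUJU' : U'.transpose * (J * U') = 0 := by
    have : U'.transpose * (J * U') = (U.transpose * (J * U)).submatrix chan.symm chan.symm := by
      rw [Matrix.submatrix_mul _ _ chan.symm id chan.symm Function.bijective_id,
        Matrix.submatrix_mul _ _ id id chan.symm Function.bijective_id]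
      rfl
    rw [this, hUJU]
    rfl
  -- The columns of `U'` are orthonormal and span a Lagrangian subspace, so completing them by their
  -- images under `J` gives a symplectic matrix.
  refine ⟨p, q, chan, κ, η, S, Matrix.fromCols U' (J * U'), hκ, hS, hSc, ?_, ?_⟩
  · rw [SymplecticGroup.mem_iff', Matrix.transpose_fromCols, Matrix.mul_assoc,
      Matrix.mul_fromCols, Matrix.fromRows_mul_fromCols, ← hJ, ← Matrix.mul_assoc J J, hJJ,
      Matrix.transpose_mul, hUJU', Matrix.neg_mul, Matrix.one_mul, Matrix.mul_neg, hUU',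
      Matrix.mul_assoc, ← Matrix.mul_assoc _ J, hJtJ, Matrix.one_mul, hUU', Matrix.mul_neg,
      Matrix.mul_assoc, hJt, Matrix.neg_mul, Matrix.mul_neg, hUJU', neg_neg, hJ, Matrix.J]
  · have hfr : Matrix.fromCols U' (J * U')
        = (Matrix.fromCols U (J * U)).submatrix id (Equiv.sumCongr chan chan).symm := by
      ext i j
      rcases j with j | j
      · rfl
      · rw [Matrix.fromCols_apply_inr]
        rfl
    have hmain : N * Matrix.fromCols U (J * U) = Matrix.fromCols U (J * U) * normalMatrix κ η S := by
      rw [normalMatrix, Matrix.fromCols_mul_fromBlocks, Matrix.mul_fromCols, hU,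
        Matrix.mul_fromCols, Matrix.mul_fromCols, Matrix.mul_fromCols,
        Matrix.fromCols_mul_fromBlocks, Matrix.fromCols_mul_fromBlocks,
        Matrix.fromCols_mul_fromBlocks, Matrix.fromCols_mul_fromBlocks, hNA, hNB, hNJA, hNJB]
      ext i j
      rcases j with (j | j) | (j | j) <;> simp [sub_eq_add_neg]
    rw [hfr, Matrix.reindex_apply]
    have h1 : N * (Matrix.fromCols U (J * U)).submatrix id (Equiv.sumCongr chan chan).symm
        = (N * Matrix.fromCols U (J * U)).submatrix id (Equiv.sumCongr chan chan).symm := by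
      rw [Matrix.submatrix_mul _ _ id id _ Function.bijective_id]
      rfl
    rw [h1, hmain, Matrix.submatrix_mul _ _ id (Equiv.sumCongr chan chan).symm _
      (Equiv.bijective _)]

/-- A diagonalizable symplectic matrix has a normal form. -/
lemma nonempty_normalForm {𝒯 : Matrix (Fin L ⊕ Fin L) (Fin L ⊕ Fin L) ℝ}
    (h𝒯 : 𝒯 ∈ Matrix.symplecticGroup (Fin L) ℝ) (hd : IsDiagonalizable 𝒯) :
    Nonempty (NormalForm 𝒯) := by
  obtain ⟨Q, d, hQ, hQd⟩ := hd
  have hQu : IsUnit Q.det := (Matrix.isUnit_iff_isUnit_det _).mp hQ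
  have D : Diagonalization (cx 𝒯) :=
    ⟨Q, Q⁻¹, d, Matrix.mul_nonsing_inv _ hQu, Matrix.nonsing_inv_mul _ hQu, hQd⟩
  obtain ⟨M, hM, D', hD'⟩ := exists_symplectic_conj_normal h𝒯 D
  have hN : M * 𝒯 * M⁻¹ ∈ Matrix.symplecticGroup (Fin L) ℝ :=
    mul_mem (mul_mem hM h𝒯) (inv_mem_symplectic hM)
  obtain ⟨p, q, chan, κ, η, S, W, hκ, hS, hSc, hW, hNW⟩ := exists_frame_of_normal hN D' hD'
  have hWu : IsUnit W.det := SymplecticGroup.symplectic_det hW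
  refine ⟨⟨p, q, chan, κ, η, S, W⁻¹ * M, hκ, hS, hSc, mul_mem (inv_mem_symplectic hW) hM, ?_⟩⟩
  rw [Matrix.mul_inv_rev, Matrix.nonsing_inv_nonsing_inv _ hWu]
  calc _ = W⁻¹ * (M * 𝒯 * M⁻¹ * W) := by simp only [Matrix.mul_assoc]
    _ = _ := by rw [hNW, ← Matrix.mul_assoc, Matrix.nonsing_inv_mul _ hWu, Matrix.one_mul]

end NormalFormExistence

end BlockJacobi

namespace BlockJacobi

/-! ### Comparison of the random and the averaged constant environments -/

section Comparison

/-- Comparison through a common first-order term `h`: `x` is near the integral of `h`, and each `g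
σ` is near `h σ`. Integrability of `g` follows since it differs from an integrable function by a
bounded one. -/
lemma integrable_and_abs_sub_integral_le {S : Type*} [MeasurableSpace S] {ν : Measure S}
    [IsProbabilityMeasure ν] {g h : S → ℝ} {x r : ℝ} (hg : Measurable g) (hh : Measurable h)
    (hi : Integrable h ν) (hx : |x - ∫ σ, h σ ∂ν| ≤ r) (hgh : ∀ σ, |g σ - h σ| ≤ r) :
    Integrable g ν ∧ |x - ∫ σ, g σ ∂ν| ≤ 2 * r := by
  have h1 : Integrable (fun σ => g σ - h σ) ν := integrable_of_bounded (hg.sub hh) r hgh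
  have h2 : Integrable g ν := (h1.add hi).congr (Eventually.of_forall fun σ => by simp)
  refine ⟨h2, ?_⟩
  have h3 := norm_integral_le_of_norm_le_const (μ := ν) (f := fun σ => g σ - h σ)
    (Eventually.of_forall hgh)
  rw [integral_sub h2 hi, Real.norm_eq_abs, probReal_univ, mul_one] at h3
  rw [abs_le] at *
  constructor <;> linarith [hx.1, hx.2, h3.1, h3.2]

variable {Ω S : Type*} [mΩ : MeasurableSpace Ω] [mS : MeasurableSpace S] {P : Measure Ω}
  [IsProbabilityMeasure P] {X : ℕ → Ω → S} {ν : Measure S} [IsProbabilityMeasure ν] {L : ℕ}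
  {E K ε : ℝ} {V₀ T₀ : Matrix (Fin L) (Fin L) ℝ} {F : NormalForm (transfer V₀ T₀ E)}
  {Vf Tf : S → Matrix (Fin L) (Fin L) ℝ}

namespace Environment

/-- The constant environment. -/
lemma const (e : Environment P X ν V₀ T₀ ε Vf Tf) (σ : S) :
    Environment P (fun _ _ => σ) (Measure.dirac σ) V₀ T₀ ε Vf Tf where
  meas := fun _ => measurable_const
  indep := iIndepFun_const P σ
  law := fun _ => by rw [Measure.map_const, measure_univ, one_smul]
  V_meas := e.V_meas
  T_meas := e.T_meas
  near := e.near

lemma measurable_pert_trace (e : Environment P X ν V₀ T₀ ε Vf Tf)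
    :
    Measurable fun σ => (F.pert (Vf σ) (Tf σ)).toBlocks₁₁.trace := by
  have hp := F.entryMeasurable_pert e.V_meas e.T_meas
  have h11 : EntryMeasurable fun σ => (F.pert (Vf σ) (Tf σ)).toBlocks₁₁ :=
    fun i j => hp (Sum.inl i) (Sum.inl j)
  exact h11.trace

lemma integrable_pert_trace (H : F.Regime K ε) (e : Environment P X ν V₀ T₀ ε Vf Tf)
    :
    Integrable (fun σ => (F.pert (Vf σ) (Tf σ)).toBlocks₁₁.trace) ν :=
  integrable_of_bounded e.measurable_pert_trace (L * (40 * K ^ 7 * ε)) fun σ => by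
    refine (norm_trace_le _).trans ?_
    rw [Fintype.card_fin]
    exact mul_le_mul_of_nonneg_left ((norm_toBlocks₁₁_le _).trans
      (F.norm_pert_le H.bg H.norm_M (e.near σ) H.ε_mul_le)) (Nat.cast_nonneg L)

lemma integral_dirac_pert_trace (e : Environment P X ν V₀ T₀ ε Vf Tf)
    (σ : S) :
    ∫ τ, (F.pert (Vf τ) (Tf τ)).toBlocks₁₁.trace ∂(Measure.dirac σ)
      = (F.pert (Vf σ) (Tf σ)).toBlocks₁₁.trace :=
  integral_dirac' _ _ e.measurable_pert_trace.stronglyMeasurable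

/-- The first-order formula is used twice: for the random chain, and for each `σ` with the Dirac
law, where the mean of `tr D11` is its value at `σ`. The first-order terms agree after integration
over `ν`, leaving twice the error. -/
lemma exists_lyapunov_comparison (H : F.Regime K ε) (e : Environment P X ν V₀ T₀ ε Vf Tf)
    (hL : 0 < L) : ∃ (γ : ℝ) (γσ : S → ℝ),
    HasLyapunov P (fun n ω => Vf (X n ω)) (fun n ω => Tf (X n ω)) E γ ∧
    (∀ σ, HasLyapunov P (fun _ _ => Vf σ) (fun _ _ => Tf σ) E (γσ σ)) ∧
    Integrable γσ ν ∧ |γ - ∫ σ, γσ σ ∂ν| ≤ 2 * err (40 * K ^ 7 * ε) F.gh F.ge := by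
  obtain ⟨γ, hγ⟩ := e.exists_hasLyapunov H
  choose γσ hγσ using fun σ => (e.const σ).exists_hasLyapunov H
  have hf := e.integrable_pert_trace H
  have hfm := e.measurable_pert_trace (F := F)
  -- The exponents were chosen for each `σ` separately, but as pointwise limits of measurable
  -- functions they depend measurably on `σ`.
  have hmeas : Measurable γσ := by
    refine measurable_of_tendsto_metrizable (f := fun (N : ℕ) σ => Real.log ‖extPower
      (transferProd (fun _ => Vf σ) (fun _ => Tf σ) E N)‖ / (N * L)) (fun N => ?_)
      (tendsto_pi_nhds.mpr fun σ => ?_)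
    · exact (measurable_log_norm_extPower (fun _ => e.V_meas) (fun _ => e.T_meas) E N).div_const _
    · refine (hγσ σ).congr fun N => ?_
      rw [integral_const, probReal_univ, one_smul]
  have hre : Integrable (fun σ => (F.pert (Vf σ) (Tf σ)).toBlocks₁₁.trace.re) ν := hf.re
  have hint : ∫ σ, (F.pert (Vf σ) (Tf σ)).toBlocks₁₁.trace.re ∂ν
      = (∫ σ, (F.pert (Vf σ) (Tf σ)).toBlocks₁₁.trace ∂ν).re := integral_re hf
  have key := integrable_and_abs_sub_integral_le (ν := ν) (g := γσ) (x := γ)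
    (h := fun σ => (Real.log ‖F.splitting.Ra.det‖
      + (F.pert (Vf σ) (Tf σ)).toBlocks₁₁.trace.re) / L)
    (r := err (40 * K ^ 7 * ε) F.gh F.ge) hmeas
    (((Complex.measurable_re.comp hfm).const_add _).div_const _)
    (((integrable_const _).add hre).div_const _) ?_ ?_
  · exact ⟨γ, γσ, hγ, hγσ, key⟩
  · rw [integral_div, integral_add (integrable_const _) hre, integral_const, probReal_univ,
      one_smul, hint]
    exact e.abs_lyapunov_sub_le H hL hγ
  · intro σ
    have := (e.const σ).abs_lyapunov_sub_le H hL (hγσ σ)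
    rwa [e.integral_dirac_pert_trace] at this

lemma exists_ids_comparison (H : F.Regime K ε) (e : Environment P X ν V₀ T₀ ε Vf Tf)
    (hL : 0 < L) : ∃ (𝒩 : ℝ) (𝒩σ : S → ℝ),
    HasIDS P (fun n ω => Vf (X n ω)) (fun n ω => Tf (X n ω)) E 𝒩 ∧
    (∀ σ, HasIDS P (fun _ _ => Vf σ) (fun _ _ => Tf σ) E (𝒩σ σ)) ∧
    Integrable 𝒩σ ν ∧ |𝒩 - ∫ σ, 𝒩σ σ ∂ν| ≤ 2 * err (40 * K ^ 7 * ε) F.gh F.ge := by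
  have hVs := fun σ => (e.near σ).V_symm
  have hTs := fun σ => isSymm_of_posDef (e.near σ).T_posDef
  obtain ⟨𝒩, h𝒩⟩ := exists_hasIDS e.meas e.indep e.law e.V_meas e.T_meas hVs hTs E
  obtain ⟨𝒩₀, h𝒩₀⟩ := exists_hasIDS e.meas e.indep e.law (EntryMeasurable.const V₀)
    (EntryMeasurable.const T₀) (fun _ => H.bg.V_symm) (fun _ => isSymm_of_posDef H.bg.T_posDef) E
  choose 𝒩σ h𝒩σ using fun σ => exists_hasIDS (e.const σ).meas (e.const σ).indep (e.const σ).law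
    e.V_meas e.T_meas hVs hTs E
  have hf := e.integrable_pert_trace H
  have hfm := e.measurable_pert_trace (F := F)
  have hmeas : Measurable 𝒩σ := by
    refine measurable_of_tendsto_metrizable (f := fun (N : ℕ) σ => (eigCount
      (hamiltonian (fun _ => Vf σ) (fun _ => Tf σ) N) E : ℝ) / (N * L)) (fun N => ?_)
      (tendsto_pi_nhds.mpr fun σ => ?_)
    · exact (measurable_count (fun _ => measurable_id) e.V_meas e.T_meas hVs hTs E N).div_const _
    · refine (h𝒩σ σ).congr fun N => ?_
      rw [integral_const, probReal_univ, one_smul]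
  have him : Integrable (fun σ => (F.pert (Vf σ) (Tf σ)).toBlocks₁₁.trace.im) ν := hf.im
  have hint : ∫ σ, (F.pert (Vf σ) (Tf σ)).toBlocks₁₁.trace.im ∂ν
      = (∫ σ, (F.pert (Vf σ) (Tf σ)).toBlocks₁₁.trace ∂ν).im := integral_im hf
  have key := integrable_and_abs_sub_integral_le (ν := ν) (g := 𝒩σ) (x := 𝒩)
    (h := fun σ => 𝒩₀ + (F.pert (Vf σ) (Tf σ)).toBlocks₁₁.trace.im / (Real.pi * L))
    (r := err (40 * K ^ 7 * ε) F.gh F.ge) hmeas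
    (((Complex.measurable_im.comp hfm).div_const _).const_add _)
    ((integrable_const _).add (him.div_const _)) ?_ ?_
  · exact ⟨𝒩, 𝒩σ, h𝒩, h𝒩σ, key⟩
  · rw [integral_add (integrable_const _) (him.div_const _), integral_div, integral_const,
      probReal_univ, one_smul, hint]
    exact e.abs_ids_sub_le H hL h𝒩 h𝒩₀
  · intro σ
    have := (e.const σ).abs_ids_sub_le H hL (h𝒩σ σ) h𝒩₀
    rwa [e.integral_dirac_pert_trace] at this

end Environment

end Comparison

/-! ### Tracking of constants. -/

section Constants

/-- Twice the error is `δ² (72 + 288/g + 144/ge)`. The first two terms are absorbed into `360/g³`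
because `g ≤ 1`; the cubic power is generous, as the argument loses only `1/g`. -/
lemma err_le {δ g ge : ℝ} (hg : 0 < g) (hg1 : g ≤ 1) (hge : 0 < ge) :
    2 * Environment.err δ g ge ≤ 360 * δ ^ 2 * (1 / ge + 1 / g ^ 3) := by
  have h1 : 1 / g ≤ 1 / g ^ 3 := by
    apply one_div_le_one_div_of_le (by positivity)
    nlinarith [mul_nonneg hg.le (sub_nonneg.mpr hg1), sq_nonneg g]
  have h2 : 1 ≤ 1 / g ^ 3 := by
    rw [le_div_iff₀ (by positivity), one_mul]
    exact pow_le_one₀ hg.le hg1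
  have h3 : Environment.err δ g ge = δ ^ 2 * (36 + 144 * (1 / g) + 72 * (1 / ge)) := by
    rw [Environment.err]
    ring
  have h4 : 0 < 1 / ge := by positivity
  rw [h3]
  nlinarith [sq_nonneg δ, mul_nonneg (sq_nonneg δ) h4.le,
    mul_nonneg (sq_nonneg δ) (sub_nonneg.mpr h1), mul_nonneg (sq_nonneg δ) (sub_nonneg.mpr h2)]

variable {L : ℕ} {S : Type*} [MeasurableSpace S] {K : ℝ}

/-- For `lam ≤ 1` the quadratic remainder is dominated by `K lam`, like the linear term; together
they give the factor `2`. -/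
lemma norm_sub_le_of_expansion {V V₀ v : Matrix (Fin L) (Fin L) ℝ} {lam K' : ℝ} (hK : K ≤ K')
    (h0 : 0 ≤ lam) (h1 : lam ≤ 1) (hv : ‖v‖ ≤ K) (hV : ‖V - (V₀ + lam • v)‖ ≤ K * lam ^ 2) :
    ‖V - V₀‖ ≤ 2 * K' * lam := by
  have hK0 : 0 ≤ K := (norm_nonneg _).trans hv
  have h2 : V - V₀ = (V - (V₀ + lam • v)) + lam • v := by abel
  have h3 : ‖lam • v‖ ≤ lam * K := by
    rw [norm_smul, Real.norm_eq_abs, abs_of_nonneg h0]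
    exact mul_le_mul_of_nonneg_left hv h0
  rw [h2]
  refine (norm_add_le _ _).trans ((add_le_add hV h3).trans ?_)
  nlinarith [mul_nonneg hK0 h0, mul_nonneg (mul_nonneg hK0 h0) (sub_nonneg.mpr h1),
    mul_nonneg (sub_nonneg.mpr hK) h0]

lemma Ensemble.near (A : Ensemble L S K) {lam K' : ℝ} (hK : K ≤ K') (h0 : 0 ≤ lam) (h1 : lam ≤ 1)
    (h : lam ≤ A.lam0) (σ : S) : Near A.V₀ A.T₀ (2 * K' * lam) (A.V lam σ) (A.T lam σ) where
  V_symm := A.V_symm lam ⟨h0, h⟩ σ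
  T_posDef := A.T_posDef lam ⟨h0, h⟩ σ
  norm_V := norm_sub_le_of_expansion hK h0 h1 (A.v_bound σ) (A.V_expansion lam ⟨h0, h⟩ σ)
  norm_T := norm_sub_le_of_expansion hK h0 h1 (A.t_bound σ) (A.T_expansion lam ⟨h0, h⟩ σ)

/-- With `ε = 2 K' lam`, the gap condition reads `2880 K'^8 lam ≤ g_h`, where `2880 = 36 · 40 · 2`.
It follows from the hypothesis with `g_h²` since `g_h ≤ 1`. -/
lemma Ensemble.regime (A : Ensemble L S K) {E lam K' : ℝ} (hK : K ≤ K') (hK' : 1 ≤ K')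
    (hE : |E| ≤ K) (F : NormalForm (transfer A.V₀ A.T₀ E)) (hM : ‖F.M‖ ≤ K) (hh : 0 < F.gh)
    (he : 0 < F.ge) (h0 : 0 ≤ lam) (h1 : lam ≤ 1 / (2880 * K' ^ 8) * F.gh ^ 2) :
    F.Regime K' (2 * K' * lam) := by
  have hp : 0 < K' ^ 8 := by positivity
  have h2 : 2880 * K' ^ 8 * lam ≤ F.gh ^ 2 := by
    rw [div_mul_eq_mul_div, one_mul, le_div_iff₀ (by positivity)] at h1
    linarith
  have h3 : F.gh ^ 2 ≤ F.gh := by nlinarith [F.gh_le_one]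
  refine ⟨⟨hK', A.V₀_symm, A.T₀_posDef, A.V₀_bound.trans hK, A.T₀_bound.trans hK,
    A.T₀_inv_bound.trans hK, hE.trans hK⟩, hM.trans hK, hh, he, by positivity, ?_, ?_⟩
  · have h4 : K' ^ 2 ≤ K' ^ 8 := pow_le_pow_right₀ hK' (by norm_num)
    have h5 := mul_le_mul_of_nonneg_right h4 h0
    nlinarith [F.gh_le_one]
  · calc 36 * (40 * K' ^ 7 * (2 * K' * lam)) = 2880 * K' ^ 8 * lam := by ring
      _ ≤ F.gh := h2.trans h3

end Constants

end BlockJacobi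

/-! ### The main theorem. -/

theorem theorem2 (K : ℝ) :
    ∃ C : ℝ, 0 < C ∧ ∃ c : ℝ, 0 < c ∧
      ∀ (L : ℕ) (_ : 0 < L)
        (S : Type*) [MeasurableSpace S] (ν : Measure S) [IsProbabilityMeasure ν]
        (Ω : Type*) [MeasurableSpace Ω] (P : Measure Ω) [IsProbabilityMeasure P]
        (X : ℕ → Ω → S) (_ : ∀ n, Measurable (X n)) (_ : iIndepFun X P)
        (_ : ∀ n, P.map (X n) = ν)
        (A : BlockJacobi.Ensemble L S K) (E : ℝ) (_ : |E| ≤ K)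
        (_ : BlockJacobi.IsDiagonalizable (BlockJacobi.transfer A.V₀ A.T₀ E)),
        Nonempty (BlockJacobi.NormalForm (BlockJacobi.transfer A.V₀ A.T₀ E)) ∧
        ∀ F : BlockJacobi.NormalForm (BlockJacobi.transfer A.V₀ A.T₀ E),
          ‖F.M‖ ≤ K → 0 < F.gh → 0 < F.ge →
          ∀ lam : ℝ, 0 ≤ lam → lam ≤ A.lam0 → lam ≤ c * F.gh ^ 2 →
            ∃ (𝒩 γ : ℝ) (𝒩σ γσ : S → ℝ),
              BlockJacobi.HasIDS P (fun n ω => A.V lam (X n ω)) (fun n ω => A.T lam (X n ω)) E 𝒩 ∧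
              BlockJacobi.HasLyapunov P
                (fun n ω => A.V lam (X n ω)) (fun n ω => A.T lam (X n ω)) E γ ∧
              (∀ σ, BlockJacobi.HasIDS P (fun _ _ => A.V lam σ) (fun _ _ => A.T lam σ) E (𝒩σ σ)) ∧
              (∀ σ, BlockJacobi.HasLyapunov P
                (fun _ _ => A.V lam σ) (fun _ _ => A.T lam σ) E (γσ σ)) ∧
              Integrable 𝒩σ ν ∧ Integrable γσ ν ∧
              |𝒩 - ∫ σ, 𝒩σ σ ∂ν| ≤ C * (lam ^ 2 / F.ge + lam ^ 2 / F.gh ^ 3) ∧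
              |γ - ∫ σ, γσ σ ∂ν| ≤ C * (lam ^ 2 / F.ge + lam ^ 2 / F.gh ^ 3) := by
  have hK' : 1 ≤ max K 1 := le_max_right _ _
  have hp : 0 < max K 1 ^ 8 := by positivity
  -- The size of the perturbation blocks is `δ = 40 K^7 · 2 K lam = 80 K^8 lam`, and `360 δ²` is the
  -- bound on twice the error. `K` is replaced by `max K 1` so that powers of `K` are monotone.
  refine ⟨360 * (80 * max K 1 ^ 8) ^ 2, by positivity, 1 / (2880 * max K 1 ^ 8), by positivity, ?_⟩
  intro L hL S _ ν _ Ω _ P _ X hX hi hν A E hE hd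
  refine ⟨BlockJacobi.nonempty_normalForm
    (BlockJacobi.transfer_mem_symplectic E A.V₀_symm A.T₀_posDef) hd, ?_⟩
  intro F hM hh he lam h0 hlam0 hlam
  have H := A.regime (le_max_left K 1) hK' hE F hM hh he h0 hlam
  -- Smallness relative to the gap already forces `lam ≤ 1`, as needed to absorb the quadratic
  -- remainders of the ensemble.
  have hlam1 : lam ≤ 1 := by
    refine hlam.trans (mul_le_one₀ ?_ (by positivity) (pow_le_one₀ hh.le F.gh_le_one))
    rw [div_le_one (by positivity)]
    nlinarith [one_le_pow₀ hK' (n := 8)]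
  have e : BlockJacobi.Environment P X ν A.V₀ A.T₀ (2 * max K 1 * lam) (A.V lam) (A.T lam) :=
    ⟨hX, hi, hν, A.V_meas lam ⟨h0, hlam0⟩, A.T_meas lam ⟨h0, hlam0⟩,
      A.near (le_max_left K 1) h0 hlam1 hlam0⟩
  obtain ⟨γ, γσ, hγ, hγσ, hγi, hγb⟩ := e.exists_lyapunov_comparison H hL
  obtain ⟨𝒩, 𝒩σ, h𝒩, h𝒩σ, h𝒩i, h𝒩b⟩ := e.exists_ids_comparison H hL
  have herr : 2 * BlockJacobi.Environment.err (40 * max K 1 ^ 7 * (2 * max K 1 * lam)) F.gh F.ge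
      ≤ 360 * (80 * max K 1 ^ 8) ^ 2 * (lam ^ 2 / F.ge + lam ^ 2 / F.gh ^ 3) :=
    (BlockJacobi.err_le hh F.gh_le_one he).trans (le_of_eq (by ring))
  exact ⟨𝒩, γ, 𝒩σ, γσ, h𝒩, hγ, h𝒩σ, hγσ, h𝒩i, hγi, h𝒩b.trans herr, hγb.trans herr⟩
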